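/- Let $M$ be a compact smooth $3$-manifold with an oriented atlas, $L\to M$ a smooth complex line bundle with a smooth hermitian metric, and $K\in H^2(M\times S^1,\mathbb Z)$. Let $\mathcal A(L)$ be the space of smooth hermitian connections on $L$, and let $\mathcal M^K_M$ be the space of smooth triples $(g,J,\omega)$ on $M\times S^1$, where $g$ is a Riemannian metric, $J$ is an almost complex structure with $g(J\cdot,J\cdot)=g$, and $\omega=g(J\cdot,\cdot)$, that are invariant under all rotations of the factor $S^1$ and for which the canonical bundle $\Lambda^{2,0}_J$ has first Chern class $K$. Put $Y=\mathcal A(L)\times\mathcal M^K_M$, $V=\Omega^1(M)$ and $V^*=\Omega^2(M)$ (real smooth forms), the two being in duality by $\langle\alpha,\beta\rangle=\int_M\alpha\wedge\beta$. Smoothness on these spaces of sections and connections, and on $Y$, is tested on finite-dimensional families: a family over $\mathbb R^n$ is smooth if it is jointly smooth in the parameter and the base point, a map is smooth if it preserves smooth families, and a set is open if its preimages under smooth families are open (on the Fréchet spaces of sections these are the usual notions). Then $Y$ is a Poisson manifold with a constant Poisson structure, in the following sense. (1) There is an atlas $\mathfrak A$ of $Y$ whose charts $\varphi$ are diffeomorphisms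 of open subsets of $Y$ onto open subsets of $V\oplus V^*\oplus V$. The first component of each chart is the affine coordinate of the connection, so that $a'=a+i\,(\varphi_1(a',t')-\varphi_1(a,t))$; the second and third components depend only on the triple. Any two charts differ locally by a constant. Hence the differentials of the charts give an identification $T_{y}Y\cong V\oplus V^*\oplus V$ at each point, independent of the chart and locally trivial. (2) Let $\mathcal C$ be the set of smooth functions $F:Y\to\mathbb R$ for which, in each chart of $\mathfrak A$, the partial differentials of $F$ along the first two summands are represented, via $\langle\cdot,\cdot\rangle$, by $dF_1\in V^*$ and $dF_2\in V$ depending smoothly on the point. Then $\mathcal C$ is a subalgebra of the algebra of functions on $Y$, and for each $y\in Y$ every element of $V^*\oplus V\oplus V^*$ is the differential at $y$ of some $F\in\mathcal C$. (3) There is a Poisson bracket on $\mathcal C$ (bilinear over $\mathbb R$, skew-symmetric, satisfying the Leibniz rule and the Jacobi identity) such that at each point and in each chart of $\mathfrak A$ $$\{F,G\}=dF_1(dG_2)-dG_1(dF_2)=\langle dG_2,dF_1\rangle-\langle dF_2,dG_1\rangle .$$ (4) A function $F\in\mathcal C$ satisfies $\{F,G\}=0$ for all $G\in\mathcal C$ if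 and only if near each point of $Y$ it depends only on the third component of a chart of $\mathfrak A$. -/

import Mathlib

open scoped Manifold ContDiff Topology Bundle
open Bundle Diffeology

noncomputable section

set_option synthInstance.maxHeartbeats 200000

/-! ### Smooth structures on spaces of sections

Spaces of smooth sections over a compact manifold are Fréchet spaces. Smoothness of maps between
them is expressed through smooth finite-dimensional families (plots): a family of sections
parametrised by `ℝⁿ` is smooth if it is jointly smooth in the parameter and the base point, a map
is smooth if it preserves smooth families, and a set is open if its preimage under each smooth
family is open. On Fréchet spaces this is the usual notion of smooth map and the usual topology. -/

namespace DiffeologicalSpace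

/-- The diffeology on `A` whose plots are the maps with `f i ∘ p` a plot for all `i`. -/
@[reducible]
def initial {A ι : Type*} {B : ι → Type*} [∀ i, DiffeologicalSpace (B i)]
    (f : ∀ i, A → B i) : DiffeologicalSpace A where
  plots _ := {p | ∀ i, IsPlot (fun u => f i (p u))}
  constant_plots _ _ := isPlot_const
  plot_reparam hp hf i := isPlot_reparam (hp i) hf
  locality {n p} h i := by
    refine DiffeologicalSpace.locality fun x => ?_
    obtain ⟨u, hu, hx, h'⟩ := h x
    exact ⟨u, hu, hx, fun hf hf' => h' hf hf' i⟩

end DiffeologicalSpace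

instance instDiffeologicalSpaceProd {A B : Type*} [DiffeologicalSpace A] [DiffeologicalSpace B] :
    DiffeologicalSpace (A × B) where
  plots _ := {p | IsPlot (fun u => (p u).1) ∧ IsPlot (fun u => (p u).2)}
  constant_plots _ := ⟨isPlot_const, isPlot_const⟩
  plot_reparam hp hf := ⟨isPlot_reparam hp.1 hf, isPlot_reparam hp.2 hf⟩
  locality {n p} h := by
    constructor
    · refine DiffeologicalSpace.locality fun x => ?_
      obtain ⟨u, hu, hx, h'⟩ := h x
      exact ⟨u, hu, hx, fun hf hf' => (h' hf hf').1⟩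
    · refine DiffeologicalSpace.locality fun x => ?_
      obtain ⟨u, hu, hx, h'⟩ := h x
      exact ⟨u, hu, hx, fun hf hf' => (h' hf hf').2⟩

instance instDiffeologicalSpaceSubtype {A : Type*} [DiffeologicalSpace A] (P : A → Prop) :
    DiffeologicalSpace (Subtype P) :=
  DiffeologicalSpace.initial (fun (_ : Unit) (a : Subtype P) => a.1)

/-- Smoothness of a map on a subset (used for open subsets only). -/
def DSmoothOn {A B : Type*} [DiffeologicalSpace A] [DiffeologicalSpace B] (f : A → B)
    (s : Set A) : Prop :=
  ∀ (n : ℕ) (p : EuclideanSpace ℝ (Fin n) → A), IsPlot p → (∀ u, p u ∈ s) →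
    IsPlot (fun u => f (p u))

section Sections

variable {E : Type*} [NormedAddCommGroup E] [NormedSpace ℝ E] {H : Type*} [TopologicalSpace H]
  {I : ModelWithCorners ℝ E H} {N : Type*} [TopologicalSpace N] [ChartedSpace H N]
  {F : Type*} [NormedAddCommGroup F] [NormedSpace ℝ F]
  {W : N → Type*} [TopologicalSpace (TotalSpace F W)] [∀ x, TopologicalSpace (W x)]
  [FiberBundle F W]

/-- Smooth families of smooth sections are the jointly smooth ones. -/
instance instDiffeologicalSpaceSection : DiffeologicalSpace Cₛ^∞⟮I; F, W⟯ :=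
  .ofCorePlotsOn {
    isPlotOn := fun {n u} _ p =>
      ContMDiffOn (𝓘(ℝ, EuclideanSpace ℝ (Fin n)).prod I) (I.prod 𝓘(ℝ, F)) ∞
        (fun z : EuclideanSpace ℝ (Fin n) × N => TotalSpace.mk' F z.2 (p z.1 z.2))
        (u ×ˢ Set.univ)
    isPlotOn_congr := fun _ p q h =>
      contMDiffOn_congr fun z hz => by rw [h hz.1]
    isPlot := fun {n} p =>
      ContMDiff (𝓘(ℝ, EuclideanSpace ℝ (Fin n)).prod I) (I.prod 𝓘(ℝ, F)) ∞
        (fun z : EuclideanSpace ℝ (Fin n) × N => TotalSpace.mk' F z.2 (p z.1 z.2))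
    isPlotOn_univ := by
      intro n p
      rw [Set.univ_prod_univ, contMDiffOn_univ]
    isPlot_const := fun s => s.contMDiff.comp contMDiff_snd
    isPlotOn_reparam := by
      intro n m u v hu hv p f h hp hf
      have hg : ContMDiffOn (𝓘(ℝ, EuclideanSpace ℝ (Fin m)).prod I)
          (𝓘(ℝ, EuclideanSpace ℝ (Fin n)).prod I) ∞
          (fun z : EuclideanSpace ℝ (Fin m) × N => (f z.1, z.2)) (v ×ˢ Set.univ) :=
        ContMDiffOn.prodMk (hf.contMDiffOn.comp contMDiff_fst.contMDiffOn fun z hz => hz.1)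
          contMDiff_snd.contMDiffOn
      exact hp.comp hg fun z hz => ⟨h hz.1, trivial⟩
    locality := by
      intro n u hu p h
      refine contMDiffOn_of_locally_contMDiffOn fun z hz => ?_
      obtain ⟨v, hv, hx, h'⟩ := h z.1 hz.1
      exact ⟨v ×ˢ Set.univ, hv.prod isOpen_univ, ⟨hx, trivial⟩, h'.mono Set.inter_subset_right⟩ }

end Sections

/-! ### Differential forms on a 3-manifold, and the duality of 1-forms and 2-forms -/

/-- The model space `ℝ³`. -/
abbrev R3 : Type := EuclideanSpace ℝ (Fin 3)

section Forms

variable (M : Type*) [TopologicalSpace M] [ChartedSpace R3 M]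

/-- The charts of `M` form an oriented atlas; this is the orientation of `M`. -/
class OrientedAtlas : Prop where
  det_pos : ∀ e ∈ atlas R3 M, ∀ e' ∈ atlas R3 M, ∀ y ∈ (e.symm ≫ₕ e').source,
    0 < (fderiv ℝ (e.symm ≫ₕ e') y).det

variable [IsManifold (𝓡 3) ∞ M]

/-- The space of smooth real 1-forms on `M`. -/
abbrev Form1 : Type _ :=
  Cₛ^∞⟮𝓡 3; R3 →L[ℝ] ℝ, fun x : M => TangentSpace (𝓡 3) x →L[ℝ] ℝ⟯

instance : AddCommGroup (Form1 M) := inferInstance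

instance : Module ℝ (Form1 M) := inferInstance

/-- The space of smooth bilinear forms on the tangent spaces of `M`. -/
abbrev Bilin : Type _ :=
  Cₛ^∞⟮𝓡 3; R3 →L[ℝ] R3 →L[ℝ] ℝ,
    fun x : M => TangentSpace (𝓡 3) x →L[ℝ] TangentSpace (𝓡 3) x →L[ℝ] ℝ⟯

instance : AddCommGroup (Bilin M) := inferInstance

instance : Module ℝ (Bilin M) := inferInstance

/-- The space of smooth real 2-forms on `M`. -/
def Form2 : Submodule ℝ (Bilin M) where
  carrier := {β | ∀ x u, β x u u = 0}
  zero_mem' _ _ := rfl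
  add_mem' {a b} ha hb x u := by
    have h : (a + b) x u u = a x u u + b x u u := rfl
    rw [h, ha, hb, add_zero]
  smul_mem' c a ha x u := by
    have h : (c • a) x u u = c * a x u u := rfl
    rw [h, ha, mul_zero]

variable {M}

/-- The value of the 3-form `α ∧ β` on three tangent vectors. -/
def wedge (α : Form1 M) (β : Form2 M) (x : M) (u v w : TangentSpace (𝓡 3) x) : ℝ :=
  α x u * β.1 x v w - α x v * β.1 x u w + α x w * β.1 x u v

variable [T2Space M] [CompactSpace M]

/-- The integral of a 3-form over the compact manifold `M`, oriented by its atlas: a partition of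
unity subordinate to the charts, and Lebesgue integration in the charts. -/
def integral3 (η : ∀ x : M, TangentSpace (𝓡 3) x → TangentSpace (𝓡 3) x →
    TangentSpace (𝓡 3) x → ℝ) : ℝ :=
  let ρ := (SmoothPartitionOfUnity.exists_isSubordinate_chartAt_source (𝓡 3) M).choose
  ∑ᶠ i : M, ∫ y in (chartAt R3 i).target,
    let e : Fin 3 → TangentSpace (𝓡 3) ((chartAt R3 i).symm y) := fun j =>
      mfderiv (𝓡 3) (𝓡 3) (chartAt R3 i).symm y (EuclideanSpace.single j (1 : ℝ))
    ρ i ((chartAt R3 i).symm y) * η ((chartAt R3 i).symm y) (e 0) (e 1) (e 2)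

/-- The duality `∫_M α ∧ β` between 1-forms and 2-forms. -/
def pairing (α : Form1 M) (β : Form2 M) : ℝ := integral3 (wedge α β)

end Forms

/-! ### Hermitian connections on a hermitian line bundle -/

section Connections

variable {M : Type*} [TopologicalSpace M] [ChartedSpace R3 M] [IsManifold (𝓡 3) ∞ M]
  (L : M → Type*) [TopologicalSpace (TotalSpace ℂ L)] [∀ x, NormedAddCommGroup (L x)]
  [∀ x, InnerProductSpace ℂ (L x)] [FiberBundle ℂ L] [VectorBundle ℝ ℂ L]
  [ContMDiffVectorBundle ∞ ℂ L (𝓡 3)]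

/-- The hermitian metric of `L` is smooth. -/
class IsSmoothHermitian : Prop where
  contMDiff_inner : ∀ σ τ : Cₛ^∞⟮𝓡 3; ℂ, L⟯,
    ContMDiff (𝓡 3) 𝓘(ℝ, ℂ) ∞ (fun x => (inner ℂ (σ x) (τ x) : ℂ))

/-- The space `𝒜(L)` of hermitian connections on `L`, as covariant derivatives. -/
@[ext]
structure HermitianConnection where
  /-- The covariant derivative `σ ↦ ∇ σ`. -/
  cov : Cₛ^∞⟮𝓡 3; ℂ, L⟯ →
    Cₛ^∞⟮𝓡 3; R3 →L[ℝ] ℂ, fun x : M => TangentSpace (𝓡 3) x →L[ℝ] L x⟯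
  add : ∀ σ τ, cov (σ + τ) = cov σ + cov τ
  leibniz : ∀ (f : M → ℂ) (σ τ : Cₛ^∞⟮𝓡 3; ℂ, L⟯), ContMDiff (𝓡 3) 𝓘(ℝ, ℂ) ∞ f →
    (∀ x, τ x = f x • σ x) → ∀ (x : M) (v : TangentSpace (𝓡 3) x),
      cov τ x v = f x • cov σ x v + mvfderiv (𝓡 3) f x v • σ x
  hermitian : ∀ (σ τ : Cₛ^∞⟮𝓡 3; ℂ, L⟯) (x : M) (v : TangentSpace (𝓡 3) x),
    mvfderiv (𝓡 3) (fun y => (inner ℂ (σ y) (τ y) : ℂ)) x v =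
      inner ℂ (cov σ x v) (τ x) + inner ℂ (σ x) (cov τ x v)

/-- Smooth families of connections: `∇ᵘ σ` is a smooth family for each section `σ`. -/
instance : DiffeologicalSpace (HermitianConnection L) :=
  DiffeologicalSpace.initial (fun σ (a : HermitianConnection L) => a.cov σ)

variable {L}

/-- `a' = a + i α` for a real 1-form `α`. -/
def IsTranslate (a : HermitianConnection L) (α : Form1 M) (a' : HermitianConnection L) : Prop :=
  ∀ (σ : Cₛ^∞⟮𝓡 3; ℂ, L⟯) (x : M) (v : TangentSpace (𝓡 3) x),
    a'.cov σ x v = a.cov σ x v + (Complex.I * (α x v : ℂ)) • σ x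

end Connections

/-! ### The second cohomology with integer coefficients, after Čech -/

section Cech

/-- A Čech 2-cocycle of the constant sheaf `ℤ`, on an open cover. The covers are indexed by the
points of the space, `x ∈ U x`; every open cover has a refinement of this form. -/
structure CechCocycle (X : Type*) [TopologicalSpace X] where
  U : X → Set X
  isOpen_U : ∀ i, IsOpen (U i)
  mem_U : ∀ i, i ∈ U i
  c : X → X → X → X → ℤ
  continuousOn_c : ∀ i j k, ContinuousOn (c i j k) (U i ∩ U j ∩ U k)
  cocycle : ∀ i j k l, ∀ x ∈ U i ∩ U j ∩ U k ∩ U l,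
    c j k l x - c i k l x + c i j l x - c i j k x = 0

/-- Two cocycles agree up to a coboundary on a common refinement of their covers. -/
def CechCohomologous {X : Type*} [TopologicalSpace X] (z z' : CechCocycle X) : Prop :=
  ∃ (W : X → Set X) (r r' : X → X) (b : X → X → X → ℤ),
    (∀ i, IsOpen (W i) ∧ i ∈ W i ∧ W i ⊆ z.U (r i) ∧ W i ⊆ z'.U (r' i)) ∧
    (∀ i j, ContinuousOn (b i j) (W i ∩ W j)) ∧
    ∀ i j k, ∀ x ∈ W i ∩ W j ∩ W k,
      z.c (r i) (r j) (r k) x - z'.c (r' i) (r' j) (r' k) x = b j k x - b i k x + b i j x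

/-- `H²(X, ℤ)`, the direct limit of the Čech cohomologies of the open covers. -/
def CechH2 (X : Type*) [TopologicalSpace X] : Type _ :=
  Quot (CechCohomologous (X := X))

end Cech

/-! ### Rotation-invariant hermitian triples on `M × S¹` -/

section Triples

/-- The model of `M × S¹`. -/
abbrev IX : ModelWithCorners ℝ (R3 × EuclideanSpace ℝ (Fin 1))
    (ModelProd R3 (EuclideanSpace ℝ (Fin 1))) :=
  (𝓡 3).prod (𝓡 1)

/-- The model vector space of `M × S¹`. -/
abbrev EX : Type := R3 × EuclideanSpace ℝ (Fin 1)

variable (M : Type*) [TopologicalSpace M] [ChartedSpace R3 M]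

/-- The tangent space of `M × S¹`. -/
abbrev TX (x : M × Circle) : Type := TangentSpace IX x

variable [IsManifold (𝓡 3) ∞ M]

/-- Hermitian triples `(g, J, ω)` on `M × S¹`: a Riemannian metric, a compatible almost complex
structure, and the corresponding 2-form `om`. -/
structure HermitianTriple where
  g : ContMDiffRiemannianMetric IX ∞ EX (fun x : M × Circle => TX M x)
  J : Cₛ^∞⟮IX; EX →L[ℝ] EX, fun x : M × Circle => TX M x →L[ℝ] TX M x⟯
  om : Cₛ^∞⟮IX; EX →L[ℝ] EX →L[ℝ] ℝ, fun x : M × Circle => TX M x →L[ℝ] TX M x →L[ℝ] ℝ⟯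
  J_sq : ∀ x u, J x (J x u) = -u
  compatible : ∀ x u v, g.inner x (J x u) (J x v) = g.inner x u v
  om_eq : ∀ x u v, om x u v = g.inner x (J x u) v

variable {M}

/-- The metric of a triple, as a section. -/
def HermitianTriple.metric (t : HermitianTriple M) :
    Cₛ^∞⟮IX; EX →L[ℝ] EX →L[ℝ] ℝ, fun x : M × Circle => TX M x →L[ℝ] TX M x →L[ℝ] ℝ⟯ :=
  ⟨t.g.inner, t.g.contMDiff⟩

/-- Smooth families of triples: `g`, `J` and `ω` are smooth families of sections. -/
instance : DiffeologicalSpace (HermitianTriple M) :=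
  DiffeologicalSpace.initial (fun (_ : Unit) (t : HermitianTriple M) => (t.metric, t.J, t.om))

/-- The rotation of the circle factor of `M × S¹` by `c`. -/
def rotate (c : Circle) (x : M × Circle) : M × Circle := (x.1, c * x.2)

/-- Invariance of a triple under all rotations of the circle factor. -/
def HermitianTriple.IsInvariant (t : HermitianTriple M) : Prop :=
  ∀ (c : Circle) (x : M × Circle) (u v : TX M x),
    t.g.inner (rotate c x) (mfderiv IX IX (rotate c) x u) (mfderiv IX IX (rotate c) x v) =
      t.g.inner x u v ∧
    t.J (rotate c x) (mfderiv IX IX (rotate c) x u) = mfderiv IX IX (rotate c) x (t.J x u) ∧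
    t.om (rotate c x) (mfderiv IX IX (rotate c) x u) (mfderiv IX IX (rotate c) x v) = t.om x u v

/-- `z` represents the first Chern class of the canonical bundle `Λ^{2,0}` of `J`: there are
nowhere zero `(2,0)`-forms `σ i` on `U i` with `σ j = exp (2πi f i j) σ i` on overlaps, and `z` is
the coboundary of `f`. -/
def HermitianTriple.IsCanonicalCocycle (t : HermitianTriple M)
    (z : CechCocycle (M × Circle)) : Prop :=
  ∃ (σ : M × Circle → ∀ x : M × Circle, TX M x →L[ℝ] TX M x →L[ℝ] ℂ)
    (f : M × Circle → M × Circle → M × Circle → ℂ),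
    (∀ i, ContinuousOn
      (fun x => TotalSpace.mk' (EX →L[ℝ] EX →L[ℝ] ℂ)
        (E := fun x : M × Circle => TX M x →L[ℝ] TX M x →L[ℝ] ℂ) x (σ i x)) (z.U i)) ∧
    (∀ i, ∀ x ∈ z.U i, σ i x ≠ 0 ∧ (∀ u, σ i x u u = 0) ∧
      ∀ u v, σ i x (t.J x u) v = Complex.I * σ i x u v) ∧
    (∀ i j, ContinuousOn (f i j) (z.U i ∩ z.U j)) ∧
    (∀ i j, ∀ x ∈ z.U i ∩ z.U j, ∀ u v,
      σ j x u v = Complex.exp (2 * Real.pi * Complex.I * f i j x) * σ i x u v) ∧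
    ∀ i j k, ∀ x ∈ z.U i ∩ z.U j ∩ z.U k, f j k x - f i k x + f i j x = (z.c i j k x : ℂ)

/-- The canonical class of `J` is `K ∈ H²(M × S¹, ℤ)`. -/
def HermitianTriple.HasCanonicalClass (t : HermitianTriple M) (K : CechH2 (M × Circle)) : Prop :=
  ∃ z : CechCocycle (M × Circle), t.IsCanonicalCocycle z ∧ Quot.mk _ z = K

/-- The space `ℳ^K_M` of rotation-invariant hermitian triples on `M × S¹` with canonical class
`K`. -/
abbrev InvariantTriples (K : CechH2 (M × Circle)) : Type _ :=
  {t : HermitianTriple M // t.IsInvariant ∧ t.HasCanonicalClass K}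

end Triples

/-! ### Charts on `Y` and the Poisson bracket -/

/-- A Poisson bracket on a commutative real algebra. -/
structure PoissonBracket (A : Type*) [CommRing A] [Algebra ℝ A] where
  bracket : A →ₗ[ℝ] A →ₗ[ℝ] A
  skew : ∀ F G, bracket F G = -bracket G F
  leibniz : ∀ F G H, bracket F (G * H) = bracket F G * H + G * bracket F H
  jacobi : ∀ F G H,
    bracket F (bracket G H) + bracket G (bracket H F) + bracket H (bracket F G) = 0

section Charts

variable {M : Type*} [TopologicalSpace M] [ChartedSpace R3 M] [IsManifold (𝓡 3) ∞ M]

/-- The model space `V ⊕ V* ⊕ V` with `V = Ω¹(M)` and `V* = Ω²(M)`. -/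
abbrev ModelY (M : Type*) [TopologicalSpace M] [ChartedSpace R3 M] [IsManifold (𝓡 3) ∞ M] :
    Type _ :=
  Form1 M × Form2 M × Form1 M

instance : AddCommGroup (Form2 M) := inferInstance

instance : Module ℝ (Form2 M) := inferInstance

instance : AddCommGroup (ModelY M) := inferInstance

instance : Module ℝ (ModelY M) := inferInstance

/-- The space `Y = 𝒜(L) × ℳ^K_M`. -/
abbrev SpaceY (L : M → Type*) [TopologicalSpace (TotalSpace ℂ L)] [∀ x, NormedAddCommGroup (L x)]
    [∀ x, InnerProductSpace ℂ (L x)] [FiberBundle ℂ L] [VectorBundle ℝ ℂ L]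
    [ContMDiffVectorBundle ∞ ℂ L (𝓡 3)] (K : CechH2 (M × Circle)) : Type _ :=
  HermitianConnection L × InvariantTriples K

/-- A chart: a diffeomorphism between open subsets. -/
structure IsChart {A B : Type*} [DiffeologicalSpace A] [DiffeologicalSpace B]
    (φ : PartialEquiv A B) : Prop where
  open_source : IsOpen[dTopology] φ.source
  open_target : IsOpen[dTopology] φ.target
  smooth : DSmoothOn φ φ.source
  smooth_symm : DSmoothOn φ.symm φ.target

variable {L : M → Type*} [TopologicalSpace (TotalSpace ℂ L)] [∀ x, NormedAddCommGroup (L x)]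
    [∀ x, InnerProductSpace ℂ (L x)] [FiberBundle ℂ L] [VectorBundle ℝ ℂ L]
    [ContMDiffVectorBundle ∞ ℂ L (𝓡 3)] {K : CechH2 (M × Circle)}

/-- The chart respects the product `Y = 𝒜(L) × ℳ^K_M`: its first component is the affine
coordinate of the connection (after division by `i`), the other two components depend on the
triple only. -/
def IsSplit (φ : PartialEquiv (SpaceY L K) (ModelY M)) : Prop :=
  ∀ y ∈ φ.source, ∀ y' ∈ φ.source,
    IsTranslate y.1 ((φ y').1 - (φ y).1) y'.1 ∧ (y.2 = y'.2 → (φ y).2 = (φ y').2)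

/-- An atlas of split charts of `Y` with values in `V ⊕ V* ⊕ V`, any two of which differ locally by
a constant. So the identification of the tangent space of `Y` at `y` with `V ⊕ V* ⊕ V` by the
differential of a chart does not depend on the chart, and is constant in the charts. -/
structure IsConstantAtlas (𝔸 : Set (PartialEquiv (SpaceY L K) (ModelY M))) : Prop where
  isChart : ∀ φ ∈ 𝔸, IsChart φ
  isSplit : ∀ φ ∈ 𝔸, IsSplit φ
  cover : ∀ y, ∃ φ ∈ 𝔸, y ∈ φ.source
  locally_translation : ∀ φ ∈ 𝔸, ∀ φ' ∈ 𝔸, ∀ y ∈ φ.source ∩ φ'.source,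
    ∃ W : Set (SpaceY L K), IsOpen[dTopology] W ∧ y ∈ W ∧ W ⊆ φ.source ∩ φ'.source ∧
      ∀ z ∈ W, φ' z - φ z = φ' y - φ y

/-- The function `F` has at `y` the derivative `d` in the direction `v ∈ V ⊕ V* ⊕ V`. -/
def HasDirDeriv (φ : PartialEquiv (SpaceY L K) (ModelY M)) (F : SpaceY L K → ℝ) (y : SpaceY L K)
    (v : ModelY M) (d : ℝ) : Prop :=
  HasDerivAt (fun s : ℝ => F (φ.symm (φ y + s • v))) d 0

variable [T2Space M] [CompactSpace M]

/-- `dF₁ = α ∈ V*` and `dF₂ = β ∈ V` at `y`: the first two components of the differential of `F`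
in the dual decomposition `V* ⊕ V ⊕ V*`. -/
def HasComponents (φ : PartialEquiv (SpaceY L K) (ModelY M)) (F : SpaceY L K → ℝ)
    (y : SpaceY L K) (α : Form2 M) (β : Form1 M) : Prop :=
  (∀ v : Form1 M, HasDirDeriv φ F y (v, 0, 0) (pairing v α)) ∧
  ∀ w : Form2 M, HasDirDeriv φ F y (0, w, 0) (pairing β w)

/-- Smooth functions on `Y` whose differential has first component `dF₁` in `V* = Ω²` and second
component `dF₂` in `V = Ω¹`, both depending smoothly on the point. -/
def IsRegularFunction (𝔸 : Set (PartialEquiv (SpaceY L K) (ModelY M))) (F : SpaceY L K → ℝ) : Prop :=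
  DSmooth F ∧ ∀ φ ∈ 𝔸, ∃ (F₁ : SpaceY L K → Form2 M) (F₂ : SpaceY L K → Form1 M),
    DSmoothOn F₁ φ.source ∧ DSmoothOn F₂ φ.source ∧
      ∀ y ∈ φ.source, HasComponents φ F y (F₁ y) (F₂ y)

/-- Near each point, `F` depends on the third component of a chart only. -/
def DependsOnThird (𝔸 : Set (PartialEquiv (SpaceY L K) (ModelY M))) (F : SpaceY L K → ℝ) :
    Prop :=
  ∀ y, ∃ φ ∈ 𝔸, ∃ W : Set (SpaceY L K), IsOpen[dTopology] W ∧ y ∈ W ∧ W ⊆ φ.source ∧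
    ∀ z ∈ W, ∀ z' ∈ W, (φ z).2.2 = (φ z').2.2 → F z = F z'

end Charts

end

noncomputable section

local notation "𝔼" n:max => EuclideanSpace ℝ (Fin n)

set_option synthInstance.maxHeartbeats 200000
set_option linter.unusedSectionVars false
set_option linter.unusedSimpArgs false
set_option linter.unusedVariables false

/-! ### Families of rapidly decreasing sequences -/

/-- A countable index set with a weight of polynomial growth. -/
class RapidIndex (I : Type*) where
  wt : I → ℝ
  one_le : ∀ i, 1 ≤ wt i
  exists_summable : ∃ m : ℕ, Summable fun i => (wt i ^ m)⁻¹

namespace RapidIndex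

variable {I J : Type*} [RapidIndex I] [RapidIndex J]

lemma wt_pos (i : I) : 0 < wt i := zero_lt_one.trans_le (one_le i)

lemma one_le_pow (i : I) (m : ℕ) : 1 ≤ wt i ^ m := one_le_pow₀ (one_le i)

lemma pow_pos' (i : I) (m : ℕ) : 0 < wt i ^ m := pow_pos (wt_pos i) m

instance : RapidIndex Unit where
  wt _ := 1
  one_le _ := le_rfl
  exists_summable := ⟨0, (hasSum_fintype _).summable⟩

instance : RapidIndex ℕ where
  wt n := n + 1
  one_le n := by simp
  exists_summable := ⟨2, by
    have := (summable_nat_add_iff 1).2 (Real.summable_nat_pow_inv (p := 2) |>.2 one_lt_two)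
    simpa using this⟩

instance : RapidIndex (I × J) where
  wt i := wt i.1 * wt i.2
  one_le i := one_le_mul_of_one_le_of_one_le (one_le _) (one_le _)
  exists_summable := by
    obtain ⟨m, hm⟩ := exists_summable (I := I)
    obtain ⟨m', hm'⟩ := exists_summable (I := J)
    refine ⟨m + m', Summable.of_nonneg_of_le (fun i => ?_) (fun i => ?_)
      (hm.mul_of_nonneg hm' (fun i => ?_) fun i => ?_)⟩
    · exact inv_nonneg.2 (pow_nonneg (mul_pos (wt_pos _) (wt_pos _)).le _)
    · rw [← mul_inv]
      refine inv_anti₀ (mul_pos (pow_pos' _ _) (pow_pos' _ _)) ?_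
      rw [mul_pow]
      exact mul_le_mul (pow_le_pow_right₀ (one_le _) (Nat.le_add_right _ _))
        (pow_le_pow_right₀ (one_le _) (Nat.le_add_left _ _)) (pow_pos' _ _).le (pow_pos' _ _).le
    · exact inv_nonneg.2 (pow_pos' _ _).le
    · exact inv_nonneg.2 (pow_pos' _ _).le

instance : RapidIndex (I ⊕ J) where
  wt := Sum.elim wt wt
  one_le := by rintro (i | j) <;> simp [one_le]
  exists_summable := by
    obtain ⟨m, hm⟩ := exists_summable (I := I)
    obtain ⟨m', hm'⟩ := exists_summable (I := J)
    refine ⟨m + m', ?_⟩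
    refine HasSum.summable (HasSum.sum (Summable.hasSum ?_) (Summable.hasSum ?_))
    · refine Summable.of_nonneg_of_le (fun i => inv_nonneg.2 (pow_pos' _ _).le) (fun i => ?_) hm
      exact inv_anti₀ (pow_pos' _ _) (pow_le_pow_right₀ (one_le _) (Nat.le_add_right _ _))
    · refine Summable.of_nonneg_of_le (fun i => inv_nonneg.2 (pow_pos' _ _).le) (fun i => ?_) hm'
      exact inv_anti₀ (pow_pos' _ _) (pow_le_pow_right₀ (one_le _) (Nat.le_add_left _ _))

end RapidIndex

open RapidIndex

section Families

variable {E E' : Type*} [NormedAddCommGroup E] [NormedSpace ℝ E] [NormedAddCommGroup E']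
  [NormedSpace ℝ E'] {I J : Type*} [RapidIndex I] [RapidIndex J]

/-- A family of sequences all of whose derivatives are rapidly decreasing, locally uniformly. -/
def RapidFamily (c : E → I → ℝ) : Prop :=
  (∀ i, ContDiff ℝ ∞ fun u => c u i) ∧ ∀ (j m : ℕ) (K : Set E), IsCompact K →
    ∃ C, ∀ u ∈ K, ∀ i, wt i ^ m * ‖iteratedFDeriv ℝ j (fun u => c u i) u‖ ≤ C

/-- A family of sequences all of whose derivatives are of polynomial growth, locally uniformly. -/
def PolyFamily (c : E → I → ℝ) : Prop :=
  (∀ i, ContDiff ℝ ∞ fun u => c u i) ∧ ∀ (j : ℕ) (K : Set E), IsCompact K →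
    ∃ (m : ℕ) (C : ℝ), ∀ u ∈ K, ∀ i, ‖iteratedFDeriv ℝ j (fun u => c u i) u‖ ≤ C * wt i ^ m

lemma exists_forall_of_forall_exists_bound {P : ℕ → ℝ → Prop}
    (hP : ∀ k a b, a ≤ b → P k a → P k b) (h : ∀ k, ∃ C, P k C) (j : ℕ) :
    ∃ C, 0 ≤ C ∧ ∀ k ≤ j, P k C := by
  induction j with
  | zero =>
    obtain ⟨C, hC⟩ := h 0
    refine ⟨max C 0, le_max_right _ _, fun k hk => ?_⟩
    rw [Nat.le_zero.1 hk]
    exact hP _ _ _ (le_max_left _ _) hC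
  | succ j ih =>
    obtain ⟨C, h0, hC⟩ := ih
    obtain ⟨C', hC'⟩ := h (j + 1)
    refine ⟨max C C', h0.trans (le_max_left _ _), fun k hk => ?_⟩
    rcases Nat.le_succ_iff.1 hk with hk | rfl
    · exact hP _ _ _ (le_max_left _ _) (hC k hk)
    · exact hP _ _ _ (le_max_right _ _) hC'

lemma RapidFamily.bound_le {c : E → I → ℝ} (hc : RapidFamily c) (j m : ℕ) {K : Set E}
    (hK : IsCompact K) : ∃ C, 0 ≤ C ∧ ∀ k ≤ j, ∀ u ∈ K, ∀ i,
      wt i ^ m * ‖iteratedFDeriv ℝ k (fun u => c u i) u‖ ≤ C :=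
  exists_forall_of_forall_exists_bound
    (P := fun k C => ∀ u ∈ K, ∀ i, wt i ^ m * ‖iteratedFDeriv ℝ k (fun u => c u i) u‖ ≤ C)
    (fun _ _ _ hab h u hu i => (h u hu i).trans hab) (fun k => hc.2 k m K hK) j

lemma PolyFamily.bound_le {c : E → I → ℝ} (hc : PolyFamily c) (j : ℕ) {K : Set E}
    (hK : IsCompact K) : ∃ (m : ℕ) (C : ℝ), 0 ≤ C ∧ ∀ k ≤ j, ∀ u ∈ K, ∀ i,
      ‖iteratedFDeriv ℝ k (fun u => c u i) u‖ ≤ C * wt i ^ m := by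
  choose m C hC using fun k => hc.2 k K hK
  obtain ⟨D, hD0, hD⟩ := exists_forall_of_forall_exists_bound (P := fun k a => C k ≤ a)
    (fun _ _ _ hab h => h.trans hab) (fun k => ⟨_, le_rfl⟩) j
  refine ⟨∑ k ∈ Finset.range (j + 1), m k, D, hD0, fun k hk u hu i => (hC k u hu i).trans ?_⟩
  have hm : m k ≤ ∑ k ∈ Finset.range (j + 1), m k :=
    Finset.single_le_sum (f := m) (fun _ _ => Nat.zero_le _)
      (Finset.mem_range.2 (Nat.lt_succ_of_le hk))
  exact mul_le_mul (hD k hk) (pow_le_pow_right₀ (one_le i) hm) (pow_pos' _ _).le hD0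

lemma iteratedFDeriv_bound_of_compact {F : Type*} [NormedAddCommGroup F] [NormedSpace ℝ F]
    {f : E → F} (hf : ContDiff ℝ ∞ f) (j : ℕ) {K : Set E} (hK : IsCompact K) :
    ∃ C, ∀ u ∈ K, ‖iteratedFDeriv ℝ j f u‖ ≤ C :=
  (hK.bddAbove_image (hf.continuous_iteratedFDeriv (m := j)
    (by exact_mod_cast le_top)).norm.continuousOn).imp fun C hC u hu => hC ⟨u, hu, rfl⟩

lemma iteratedFDeriv_comp_bound {c : E' → ℝ} {f : E → E'} (hc : ContDiff ℝ ∞ c)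
    (hf : ContDiff ℝ ∞ f) {j : ℕ} {C D : ℝ} {u : E}
    (hC : ∀ k ≤ j, ‖iteratedFDeriv ℝ k c (f u)‖ ≤ C) (hD1 : 1 ≤ D)
    (hD : ∀ k ≤ j, ‖iteratedFDeriv ℝ k f u‖ ≤ D) :
    ‖iteratedFDeriv ℝ j (fun u => c (f u)) u‖ ≤ j.factorial * C * D ^ j :=
  norm_iteratedFDeriv_comp_le (g := c) (f := f) (N := ∞) hc hf (by exact_mod_cast le_top) u hC
    fun k hk hk' => (hD k hk').trans (le_self_pow₀ hD1 (Nat.one_le_iff_ne_zero.1 hk))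

lemma RapidFamily.comp {c : E' → I → ℝ} (hc : RapidFamily c) {f : E → E'} (hf : ContDiff ℝ ∞ f) :
    RapidFamily fun u => c (f u) := by
  refine ⟨fun i => (hc.1 i).comp hf, fun j m K hK => ?_⟩
  obtain ⟨C, hC0, hC⟩ := hc.bound_le j m (hK.image hf.continuous)
  obtain ⟨D, hD0, hD⟩ := exists_forall_of_forall_exists_bound
    (P := fun k a => ∀ u ∈ K, ‖iteratedFDeriv ℝ k f u‖ ≤ a)
    (fun _ _ _ hab h u hu => (h u hu).trans hab)
    (fun k => iteratedFDeriv_bound_of_compact hf k hK) j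
  refine ⟨j.factorial * C * (max D 1) ^ j, fun u hu i => ?_⟩
  have h := iteratedFDeriv_comp_bound (C := (wt i ^ m)⁻¹ * C) (D := max D 1) (u := u) (hc.1 i) hf
    (j := j) (fun k hk => by
      have := hC k hk (f u) ⟨u, hu, rfl⟩ i
      rwa [← div_eq_inv_mul, le_div_iff₀' (pow_pos' _ _)]) (le_max_right _ _)
      (fun k hk => (hD k hk u hu).trans (le_max_left _ _))
  calc _ ≤ wt i ^ m * (j.factorial * ((wt i ^ m)⁻¹ * C) * (max D 1) ^ j) :=
        mul_le_mul_of_nonneg_left h (pow_pos' _ _).le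
    _ = _ := by field_simp [(pow_pos' i m).ne']

lemma RapidFamily.add {c d : E → I → ℝ} (hc : RapidFamily c) (hd : RapidFamily d) :
    RapidFamily fun u i => c u i + d u i := by
  refine ⟨fun i => (hc.1 i).add (hd.1 i), fun j m K hK => ?_⟩
  obtain ⟨C, hC⟩ := hc.2 j m K hK
  obtain ⟨D, hD⟩ := hd.2 j m K hK
  refine ⟨C + D, fun u hu i => ?_⟩
  have h : iteratedFDeriv ℝ j (fun u => c u i + d u i) u =
      iteratedFDeriv ℝ j (fun u => c u i) u + iteratedFDeriv ℝ j (fun u => d u i) u :=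
    iteratedFDeriv_add_apply ((hc.1 i).of_le (by exact_mod_cast le_top)).contDiffAt
      ((hd.1 i).of_le (by exact_mod_cast le_top)).contDiffAt
  rw [h]
  calc _ ≤ wt i ^ m * (‖iteratedFDeriv ℝ j (fun u => c u i) u‖ +
        ‖iteratedFDeriv ℝ j (fun u => d u i) u‖) :=
        mul_le_mul_of_nonneg_left (norm_add_le _ _) (pow_pos' _ _).le
    _ ≤ _ := by rw [mul_add]; exact add_le_add (hC u hu i) (hD u hu i)

/-- The product of a rapidly decreasing family and a family of polynomial growth. -/
lemma RapidFamily.mul_poly {c d : E → I → ℝ} (hc : RapidFamily c) (hd : PolyFamily d) :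
    RapidFamily fun u i => d u i * c u i := by
  refine ⟨fun i => (hd.1 i).mul (hc.1 i), fun j m K hK => ?_⟩
  obtain ⟨r, D, hD0, hD⟩ := hd.bound_le j hK
  obtain ⟨C, hC0, hC⟩ := hc.bound_le j (m + r) hK
  refine ⟨∑ k ∈ Finset.range (j + 1), (j.choose k : ℝ) * D * C, fun u hu i => ?_⟩
  have h := norm_iteratedFDeriv_mul_le (hd.1 i) (hc.1 i) u (n := j) (by exact_mod_cast le_top)
  refine (mul_le_mul_of_nonneg_left h (pow_pos' _ _).le).trans ?_
  rw [Finset.mul_sum]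
  refine Finset.sum_le_sum fun k hk => ?_
  have h1 := hD k (Nat.lt_succ_iff.1 (Finset.mem_range.1 hk)) u hu i
  have h2 := hC (j - k) (Nat.sub_le _ _) u hu i
  rw [pow_add] at h2
  have h0 : (0 : ℝ) ≤ j.choose k := Nat.cast_nonneg _
  calc wt i ^ m * ((j.choose k : ℝ) * ‖iteratedFDeriv ℝ k (fun u => d u i) u‖ *
        ‖iteratedFDeriv ℝ (j - k) (fun u => c u i) u‖)
      ≤ wt i ^ m * ((j.choose k : ℝ) * (D * wt i ^ r) *
        ‖iteratedFDeriv ℝ (j - k) (fun u => c u i) u‖) := by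
        gcongr
        exact (pow_pos' _ _).le
    _ = (j.choose k : ℝ) * D * (wt i ^ m * wt i ^ r *
        ‖iteratedFDeriv ℝ (j - k) (fun u => c u i) u‖) := by ring
    _ ≤ (j.choose k : ℝ) * D * C := by gcongr

lemma polyFamily_const {f : E → ℝ} (hf : ContDiff ℝ ∞ f) : PolyFamily fun u (_ : I) => f u :=
  ⟨fun _ => hf, fun j K hK => ⟨0, (iteratedFDeriv_bound_of_compact hf j hK).imp
    fun C hC u hu i => by simpa using hC u hu⟩⟩

lemma RapidFamily.smul {c : E → I → ℝ} (hc : RapidFamily c) {f : E → ℝ} (hf : ContDiff ℝ ∞ f) :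
    RapidFamily fun u i => f u * c u i :=
  hc.mul_poly (polyFamily_const hf)

lemma PolyFamily.reindex {c : E → I → ℝ} (hc : PolyFamily c) (f : J → I) {r : ℕ} {D : ℝ}
    (hf : ∀ i, wt (f i) ≤ D * wt i ^ r) : PolyFamily fun u i => c u (f i) := by
  refine ⟨fun i => hc.1 _, fun j K hK => ?_⟩
  obtain ⟨m, C, hC⟩ := hc.2 j K hK
  refine ⟨r * m, |C| * D ^ m, fun u hu i => (hC u hu (f i)).trans ?_⟩
  calc C * wt (f i) ^ m ≤ |C| * (D * wt i ^ r) ^ m := by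
        gcongr
        · exact (pow_pos' _ _).le
        · exact le_abs_self C
        · exact (wt_pos _).le
        · exact hf i
    _ = _ := by rw [mul_pow, pow_mul]; ring

/-- Change of the index set, with polynomially bounded weights. -/
lemma RapidFamily.reindex {c : E → I → ℝ} (hc : RapidFamily c) (f : J → I) {r : ℕ} {D : ℝ}
    (hf : ∀ i, wt i ≤ D * wt (f i) ^ r) : RapidFamily fun u i => c u (f i) := by
  refine ⟨fun i => hc.1 _, fun j m K hK => ?_⟩
  obtain ⟨C, hC⟩ := hc.2 j (r * m) K hK
  refine ⟨|D| ^ m * C, fun u hu i => ?_⟩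
  calc wt i ^ m * ‖iteratedFDeriv ℝ j (fun u => c u (f i)) u‖
      ≤ (|D| * wt (f i) ^ r) ^ m * ‖iteratedFDeriv ℝ j (fun u => c u (f i)) u‖ := by
        gcongr
        · exact (wt_pos _).le
        · refine (hf i).trans ?_
          gcongr
          · exact (pow_pos' _ _).le
          · exact le_abs_self D
    _ = |D| ^ m * (wt (f i) ^ (r * m) * ‖iteratedFDeriv ℝ j (fun u => c u (f i)) u‖) := by
        rw [mul_pow, pow_mul]; ring
    _ ≤ _ := by gcongr; exact hC u hu (f i)

/-- Extension by zero along an injection, with polynomially bounded weights. -/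
lemma RapidFamily.extend {c : E → I → ℝ} (hc : RapidFamily c) {f : I → J}
    (hinj : Function.Injective f) {r : ℕ} {D : ℝ} (hf : ∀ i, wt (f i) ≤ D * wt i ^ r) :
    RapidFamily fun u => Function.extend f (c u) 0 := by
  have key : ∀ j, (∃ i, f i = j ∧ (fun u => Function.extend f (c u) 0 j) = fun u => c u i) ∨
      (fun u => Function.extend f (c u) 0 j) = fun _ : E => (0 : ℝ) := by
    intro j
    by_cases h : ∃ i, f i = j
    · obtain ⟨i, rfl⟩ := h
      exact Or.inl ⟨i, rfl, funext fun u => hinj.extend_apply _ _ _⟩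
    · exact Or.inr (funext fun u => Function.extend_apply' _ _ _ h)
  refine ⟨fun j => ?_, fun j m K hK => ?_⟩
  · rcases key j with ⟨i, -, h⟩ | h
    · exact h ▸ hc.1 i
    · exact h ▸ contDiff_const
  obtain ⟨C, hC⟩ := hc.2 j (r * m) K hK
  refine ⟨max (|D| ^ m * C) 0, fun u hu i' => ?_⟩
  rcases key i' with ⟨i, rfl, h⟩ | h
  · rw [h]
    refine le_trans ?_ (le_max_left _ _)
    calc wt (f i) ^ m * ‖iteratedFDeriv ℝ j (fun u => c u i) u‖
        ≤ (|D| * wt i ^ r) ^ m * ‖iteratedFDeriv ℝ j (fun u => c u i) u‖ := by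
          gcongr
          · exact (wt_pos _).le
          · refine (hf i).trans ?_
            gcongr
            · exact (pow_pos' _ _).le
            · exact le_abs_self D
      _ = |D| ^ m * (wt i ^ (r * m) * ‖iteratedFDeriv ℝ j (fun u => c u i) u‖) := by
          rw [mul_pow, pow_mul]; ring
      _ ≤ _ := by gcongr; exact hC u hu i
  · rw [h]
    refine le_trans (le_of_eq ?_) (le_max_right _ _)
    have : (fun _ : E => (0 : ℝ)) = 0 := rfl
    rw [this, iteratedFDeriv_zero]
    simp

/-- Partial sums of rapidly decreasing families. -/
lemma RapidFamily.tsum [FiniteDimensional ℝ E] {c : E → I × J → ℝ} (hc : RapidFamily c) :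
    RapidFamily fun u j => ∑' i, c u (i, j) := by
  obtain ⟨r, hr⟩ := exists_summable (I := I)
  -- a cutoff that is one near a given compact set
  have main : ∀ K : Set E, IsCompact K → ∃ χ : E → ℝ, ContDiff ℝ ∞ χ ∧ HasCompactSupport χ ∧
      ∀ u ∈ K, χ =ᶠ[𝓝 u] fun _ => 1 := by
    intro K hK
    obtain ⟨R, hR0, hR⟩ := hK.isBounded.subset_ball_lt 0 0
    let φ : ContDiffBump (0 : E) := ⟨R, R + 1, hR0, lt_add_one R⟩
    refine ⟨φ, φ.contDiff, φ.hasCompactSupport, fun u hu => ?_⟩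
    filter_upwards [Metric.isOpen_ball.mem_nhds (hR hu)] with v hv
    exact φ.one_of_mem_closedBall (Metric.ball_subset_closedBall hv)
  have bd : ∀ (χ : E → ℝ), ContDiff ℝ ∞ χ → HasCompactSupport χ → ∀ (j m : ℕ), ∃ C, 0 ≤ C ∧
      ∀ u i i', wt i' ^ m * ‖iteratedFDeriv ℝ j (fun u => χ u * c u (i, i')) u‖ ≤
        C * (wt i ^ r)⁻¹ := by
    intro χ hχ hχc j m
    obtain ⟨C, hC⟩ := (hc.smul hχ).2 j (m + r) (tsupport χ) hχc
    refine ⟨max C 0, le_max_right _ _, fun u i i' => ?_⟩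
    by_cases hu : u ∈ tsupport χ
    · rw [← div_eq_mul_inv, le_div_iff₀ (pow_pos' _ _)]
      refine le_trans ?_ ((hC u hu (i, i')).trans (le_max_left _ _))
      have : wt i' ^ m * wt i ^ r ≤ wt (i, i') ^ (m + r) := by
        have h : wt (i, i') = wt i * wt i' := rfl
        rw [h, mul_pow, mul_comm]
        exact mul_le_mul (pow_le_pow_right₀ (one_le _) (Nat.le_add_left _ _))
          (pow_le_pow_right₀ (one_le _) (Nat.le_add_right _ _)) (pow_pos' _ _).le (pow_pos' _ _).le
      calc _ = wt i' ^ m * wt i ^ r *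
            ‖iteratedFDeriv ℝ j (fun u => χ u * c u (i, i')) u‖ := by ring
        _ ≤ _ := by gcongr
    · have h0 : (fun u => χ u * c u (i, i')) =ᶠ[𝓝 u] fun _ => 0 := by
        filter_upwards [(isClosed_tsupport χ).isOpen_compl.mem_nhds hu] with v hv
        rw [image_eq_zero_of_notMem_tsupport hv, zero_mul]
      rw [(h0.iteratedFDeriv ℝ j).eq_of_nhds]
      have : (fun _ : E => (0 : ℝ)) = 0 := rfl
      rw [this, iteratedFDeriv_zero]
      simp only [Pi.zero_apply, norm_zero, mul_zero]
      exact mul_nonneg (le_max_right _ _) (inv_nonneg.2 (pow_pos' _ _).le)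
  have bd' : ∀ (χ : E → ℝ), ContDiff ℝ ∞ χ → HasCompactSupport χ → ∀ (j : ℕ), ∃ C, 0 ≤ C ∧
      ∀ u i i', ‖iteratedFDeriv ℝ j (fun u => χ u * c u (i, i')) u‖ ≤ C * (wt i ^ r)⁻¹ := by
    intro χ hχ hχc j
    obtain ⟨C, h0, hC⟩ := bd χ hχ hχc j 0
    exact ⟨C, h0, fun u i i' => by simpa using hC u i i'⟩
  have loc : ∀ (χ : E → ℝ) (u : E), χ =ᶠ[𝓝 u] (fun _ => 1) → ∀ i',
      (fun u => ∑' i, χ u * c u (i, i')) =ᶠ[𝓝 u] fun u => ∑' i, c u (i, i') := by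
    intro χ u hu i'
    filter_upwards [hu] with v hv
    rw [hv]
    simp
  refine ⟨fun i' => contDiff_iff_contDiffAt.2 fun u => ?_, fun j m K hK => ?_⟩
  · obtain ⟨χ, hχ, hχc, h1⟩ := main {u} isCompact_singleton
    refine ContDiffAt.congr_of_eventuallyEq ?_ (loc χ u (h1 u rfl) i').symm
    choose C hC0 hC using bd' χ hχ hχc
    exact (contDiff_tsum (v := fun j i => C j * (wt i ^ r)⁻¹) (N := ⊤)
      (fun i => hχ.mul (hc.1 (i, i'))) (fun k _ => hr.mul_left _)
      fun k i u _ => hC k u i i').contDiffAt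
  · obtain ⟨χ, hχ, hχc, h1⟩ := main K hK
    choose C hC0 hC using bd' χ hχ hχc
    obtain ⟨D, hD0, hD⟩ := bd χ hχ hχc j m
    refine ⟨D * ∑' i : I, (wt i ^ r)⁻¹, fun u hu i' => ?_⟩
    rw [← ((loc χ u (h1 u hu) i').iteratedFDeriv ℝ j).eq_of_nhds,
      iteratedFDeriv_tsum_apply (v := fun j i => C j * (wt i ^ r)⁻¹) (N := ⊤)
        (fun i => hχ.mul (hc.1 (i, i'))) (fun k _ => hr.mul_left _)
        (fun k i u _ => hC k u i i') le_top u, ← tsum_mul_left]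
    have hs : Summable fun i => D * (wt i ^ r)⁻¹ := hr.mul_left _
    have hle : ∀ i, ‖wt i' ^ m • iteratedFDeriv ℝ j (fun u => χ u * c u (i, i')) u‖ ≤
        D * (wt i ^ r)⁻¹ := fun i => by
      rw [norm_smul, Real.norm_of_nonneg (pow_pos' _ _).le]
      exact hD u i i'
    have := tsum_of_norm_bounded hs.hasSum hle
    rwa [tsum_const_smul'', norm_smul, Real.norm_of_nonneg (pow_pos' _ _).le] at this

lemma RapidFamily.contDiff_tsum [FiniteDimensional ℝ E] {c : E → I → ℝ} (hc : RapidFamily c) :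
    ContDiff ℝ ∞ fun u => ∑' i, c u i :=
  (RapidFamily.tsum (J := Unit) (hc.reindex Prod.fst (r := 1) (D := 1)
    fun i => by simp [wt])).1 ()

end Families

section Poly

variable {E E' : Type*} [NormedAddCommGroup E] [NormedSpace ℝ E] [NormedAddCommGroup E']
  [NormedSpace ℝ E'] {I J : Type*} [RapidIndex I] [RapidIndex J]

lemma PolyFamily.add {c d : E → I → ℝ} (hc : PolyFamily c) (hd : PolyFamily d) :
    PolyFamily fun u i => c u i + d u i := by
  refine ⟨fun i => (hc.1 i).add (hd.1 i), fun j K hK => ?_⟩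
  obtain ⟨m, C, hC0, hC⟩ := hc.bound_le j hK
  obtain ⟨r, D, hD0, hD⟩ := hd.bound_le j hK
  refine ⟨m + r, C + D, fun u hu i => ?_⟩
  have h : iteratedFDeriv ℝ j (fun u => c u i + d u i) u =
      iteratedFDeriv ℝ j (fun u => c u i) u + iteratedFDeriv ℝ j (fun u => d u i) u :=
    iteratedFDeriv_add_apply ((hc.1 i).of_le (by exact_mod_cast le_top)).contDiffAt
      ((hd.1 i).of_le (by exact_mod_cast le_top)).contDiffAt
  rw [h, add_mul]
  refine (norm_add_le _ _).trans (add_le_add ?_ ?_)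
  · exact (hC j le_rfl u hu i).trans (mul_le_mul_of_nonneg_left
      (pow_le_pow_right₀ (one_le _) (Nat.le_add_right _ _)) hC0)
  · exact (hD j le_rfl u hu i).trans (mul_le_mul_of_nonneg_left
      (pow_le_pow_right₀ (one_le _) (Nat.le_add_left _ _)) hD0)

lemma PolyFamily.mul {c d : E → I → ℝ} (hc : PolyFamily c) (hd : PolyFamily d) :
    PolyFamily fun u i => c u i * d u i := by
  refine ⟨fun i => (hc.1 i).mul (hd.1 i), fun j K hK => ?_⟩
  obtain ⟨m, C, hC0, hC⟩ := hc.bound_le j hK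
  obtain ⟨r, D, hD0, hD⟩ := hd.bound_le j hK
  refine ⟨m + r, ∑ k ∈ Finset.range (j + 1), (j.choose k : ℝ) * C * D, fun u hu i => ?_⟩
  refine (norm_iteratedFDeriv_mul_le (hc.1 i) (hd.1 i) u (n := j)
    (by exact_mod_cast le_top)).trans ?_
  rw [Finset.sum_mul]
  refine Finset.sum_le_sum fun k hk => ?_
  have h1 := hC k (Nat.lt_succ_iff.1 (Finset.mem_range.1 hk)) u hu i
  have h2 := hD (j - k) (Nat.sub_le _ _) u hu i
  calc (j.choose k : ℝ) * ‖iteratedFDeriv ℝ k (fun u => c u i) u‖ *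
        ‖iteratedFDeriv ℝ (j - k) (fun u => d u i) u‖
      ≤ (j.choose k : ℝ) * (C * wt i ^ m) * (D * wt i ^ r) := by
        have := (pow_pos' i m).le
        gcongr
    _ = _ := by rw [pow_add]; ring

lemma polyFamily_const_seq {c : I → ℝ} {m : ℕ} {C : ℝ} (hc : ∀ i, |c i| ≤ C * wt i ^ m) :
    PolyFamily fun (_ : E) i => c i := by
  refine ⟨fun i => contDiff_const, fun j K _ => ⟨m, C, fun u _ i => ?_⟩⟩
  rcases j with - | j
  · simpa using hc i
  · rw [iteratedFDeriv_succ_const]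
    simpa using (abs_nonneg _).trans (hc i)

/-- Composition with a function all of whose derivatives are bounded. -/
lemma PolyFamily.bounded_comp {c : E → I → ℝ} (hc : PolyFamily c) {φ : ℝ → ℝ}
    (hφ : ContDiff ℝ ∞ φ) (hb : ∀ j, ∃ C, ∀ x, ‖iteratedFDeriv ℝ j φ x‖ ≤ C) :
    PolyFamily fun u i => φ (c u i) := by
  refine ⟨fun i => hφ.comp (hc.1 i), fun j K hK => ?_⟩
  obtain ⟨m, D, hD0, hD⟩ := hc.bound_le j hK
  obtain ⟨C, hC0, hC⟩ := exists_forall_of_forall_exists_bound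
    (P := fun k a => ∀ x, ‖iteratedFDeriv ℝ k φ x‖ ≤ a)
    (fun _ _ _ hab h u => (h u).trans hab) hb j
  refine ⟨m * j, j.factorial * C * (D + 1) ^ j, fun u hu i => ?_⟩
  have hw := one_le_pow i m
  have := iteratedFDeriv_comp_bound (u := u) (D := (D + 1) * wt i ^ m) hφ (hc.1 i)
    (fun k hk => hC k hk _) (by nlinarith)
    (fun k (hk : k ≤ j) => (hD k hk u hu i).trans (by nlinarith))
  refine this.trans (le_of_eq ?_)
  rw [mul_pow, pow_mul]
  ring

lemma PolyFamily.comp {c : E' → I → ℝ} (hc : PolyFamily c) {f : E → E'} (hf : ContDiff ℝ ∞ f) :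
    PolyFamily fun u => c (f u) := by
  refine ⟨fun i => (hc.1 i).comp hf, fun j K hK => ?_⟩
  obtain ⟨m, C, hC0, hC⟩ := hc.bound_le j (hK.image hf.continuous)
  obtain ⟨D, hD0, hD⟩ := exists_forall_of_forall_exists_bound
    (P := fun k a => ∀ u ∈ K, ‖iteratedFDeriv ℝ k f u‖ ≤ a)
    (fun _ _ _ hab h u hu => (h u hu).trans hab)
    (fun k => iteratedFDeriv_bound_of_compact hf k hK) j
  refine ⟨m, j.factorial * C * (max D 1) ^ j, fun u hu i => ?_⟩
  have h := iteratedFDeriv_comp_bound (D := max D 1) (u := u) (hc.1 i) hf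
    (j := j) (fun k hk => hC k hk (f u) ⟨u, hu, rfl⟩ i) (le_max_right _ _)
      (fun k hk => (hD k hk u hu).trans (le_max_left _ _))
  exact h.trans (le_of_eq (by ring))

lemma bounded_iteratedFDeriv_of_hasCompactSupport {φ : E → ℝ} (hφ : ContDiff ℝ ∞ φ)
    (hc : HasCompactSupport φ) (j : ℕ) : ∃ C, ∀ x, ‖iteratedFDeriv ℝ j φ x‖ ≤ C :=
  (hφ.continuous_iteratedFDeriv (m := j) (by exact_mod_cast le_top)).bounded_above_of_compact_support
    (hc.iteratedFDeriv j)

end Poly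

/-! ### The space of rapidly decreasing sequences -/

/-- The space of rapidly decreasing sequences on an index set. -/
def Rapid (I : Type*) [RapidIndex I] : Submodule ℝ (I → ℝ) where
  carrier := {c | ∀ m : ℕ, ∃ C, ∀ i, wt i ^ m * |c i| ≤ C}
  zero_mem' m := ⟨0, fun i => by simp⟩
  add_mem' {a b} ha hb m := by
    obtain ⟨C, hC⟩ := ha m
    obtain ⟨D, hD⟩ := hb m
    refine ⟨C + D, fun i => ?_⟩
    have := mul_le_mul_of_nonneg_left (abs_add_le (a i) (b i)) (pow_pos' i m).le
    have h1 := hC i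
    have h2 := hD i
    simp only [Pi.add_apply]
    linarith
  smul_mem' r a ha m := by
    obtain ⟨C, hC⟩ := ha m
    refine ⟨|r| * C, fun i => ?_⟩
    have := mul_le_mul_of_nonneg_left (hC i) (abs_nonneg r)
    simp only [Pi.smul_apply, smul_eq_mul, abs_mul]
    linarith

section

variable {E : Type*} [NormedAddCommGroup E] [NormedSpace ℝ E] {I J : Type*} [RapidIndex I]
  [RapidIndex J]

lemma RapidFamily.mem {c : E → I → ℝ} (hc : RapidFamily c) (u : E) : c u ∈ Rapid I := fun m => by
  obtain ⟨C, hC⟩ := hc.2 0 m {u} isCompact_singleton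
  exact ⟨C, fun i => by simpa using hC u rfl i⟩

lemma rapidFamily_const (c : Rapid I) : RapidFamily fun _ : E => c.1 := by
  refine ⟨fun i => contDiff_const, fun j m K _ => ?_⟩
  obtain ⟨C, hC⟩ := c.2 m
  refine ⟨max C 0, fun u _ i => ?_⟩
  rcases j with - | j
  · simpa using Or.inl (hC i)
  · rw [iteratedFDeriv_succ_const]
    simp

/-- A smooth map into a neighbourhood of a point that is the identity near the point. -/
lemma exists_contDiff_eventuallyEq_id [FiniteDimensional ℝ E] {s : Set E} {x : E}
    (hs : s ∈ 𝓝 x) : ∃ ψ : E → E, ContDiff ℝ ∞ ψ ∧ (∀ y, ψ y ∈ s) ∧ ψ =ᶠ[𝓝 x] id := by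
  obtain ⟨ε, hε, hb⟩ := Metric.mem_nhds_iff.1 hs
  let φ : ContDiffBump x := ⟨ε / 2, ε, half_pos hε, half_lt_self hε⟩
  refine ⟨fun y => x + φ y • (y - x), contDiff_const.add (φ.contDiff.smul
    (contDiff_id.sub contDiff_const)), fun y => hb ?_, ?_⟩
  · rw [mem_ball_iff_norm, add_sub_cancel_left, norm_smul, Real.norm_of_nonneg φ.nonneg]
    by_cases hy : y ∈ Metric.ball x ε
    · exact (mul_le_of_le_one_left (norm_nonneg _) φ.le_one).trans_lt (mem_ball_iff_norm.1 hy)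
    · rw [φ.zero_of_le_dist (by simpa using hy)]
      simpa using hε
  · filter_upwards [φ.eventuallyEq_one] with y hy
    simp [hy]

lemma RapidFamily.of_locally [FiniteDimensional ℝ E] {c : E → I → ℝ}
    (h : ∀ x, ∃ d : E → I → ℝ, RapidFamily d ∧ ∀ᶠ y in 𝓝 x, c y = d y) : RapidFamily c := by
  have hloc : ∀ (x : E) (d : E → I → ℝ), (∀ᶠ y in 𝓝 x, c y = d y) → ∀ i,
      (fun u => c u i) =ᶠ[𝓝 x] fun u => d u i := fun x d hd i => by
    filter_upwards [hd] with y hy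
    rw [hy]
  refine ⟨fun i => contDiff_iff_contDiffAt.2 fun x => ?_, fun j m K hK => ?_⟩
  · obtain ⟨d, hd, hx⟩ := h x
    exact (hd.1 i).contDiffAt.congr_of_eventuallyEq (hloc x d hx i)
  refine hK.induction_on (p := fun K => ∃ C, ∀ u ∈ K, ∀ i,
    wt i ^ m * ‖iteratedFDeriv ℝ j (fun u => c u i) u‖ ≤ C) ⟨0, by simp⟩ ?_ ?_ ?_
  · rintro s t hst ⟨C, hC⟩
    exact ⟨C, fun u hu => hC u (hst hu)⟩
  · rintro s t ⟨C, hC⟩ ⟨D, hD⟩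
    refine ⟨max C D, fun u hu i => ?_⟩
    rcases hu with hu | hu
    · exact (hC u hu i).trans (le_max_left _ _)
    · exact (hD u hu i).trans (le_max_right _ _)
  · intro x _
    obtain ⟨d, hd, hx⟩ := h x
    obtain ⟨ε, hε, hb⟩ := Metric.eventually_nhds_iff_ball.1 hx
    obtain ⟨C, hC⟩ := hd.2 j m _ (isCompact_closedBall x (ε / 2))
    refine ⟨Metric.closedBall x (ε / 2), mem_nhdsWithin_of_mem_nhds
      (Metric.closedBall_mem_nhds x (half_pos hε)), C, fun u hu i => ?_⟩
    have hu' : u ∈ Metric.ball x ε := Metric.closedBall_subset_ball (half_lt_self hε) hu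
    have : (fun u => c u i) =ᶠ[𝓝 u] fun u => d u i := by
      filter_upwards [Metric.isOpen_ball.mem_nhds hu'] with y hy
      rw [hb y hy]
    rw [(this.iteratedFDeriv ℝ j).eq_of_nhds]
    exact hC u hu i

end

instance instDiffeologicalSpaceRapid {I : Type*} [RapidIndex I] :
    DiffeologicalSpace (Rapid I) where
  plots _ := {p | RapidFamily fun u => (p u).1}
  constant_plots c := rapidFamily_const c
  plot_reparam hp hf := RapidFamily.comp hp hf
  locality {n p} h := by
    refine RapidFamily.of_locally fun x => ?_
    obtain ⟨u, hu, hx, h'⟩ := h x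
    obtain ⟨ψ, hψ, hψu, hψx⟩ := exists_contDiff_eventuallyEq_id (hu.mem_nhds hx)
    refine ⟨fun y => (p (ψ y)).1, h' hψu hψ, ?_⟩
    filter_upwards [hψx] with y hy
    rw [hy, id]

lemma isPlot_rapid_iff {I : Type*} [RapidIndex I] {n : ℕ} {p : 𝔼 n → Rapid I} :
    IsPlot p ↔ RapidFamily fun u => (p u).1 := Iff.rfl

/-- A real vector space with a diffeology for which the operations are smooth. -/
class DiffeologicalModule (X : Type*) [AddCommGroup X] [Module ℝ X] [DiffeologicalSpace X] :
    Prop where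
  isPlot_add : ∀ {n : ℕ} {p q : 𝔼 n → X}, IsPlot p → IsPlot q →
    IsPlot fun u => p u + q u
  isPlot_smul : ∀ {n : ℕ} {f : 𝔼 n → ℝ} {p : 𝔼 n → X},
    ContDiff ℝ ∞ f → IsPlot p → IsPlot fun u => f u • p u

open DiffeologicalModule

section Modules

variable {X Y Z W : Type*} [AddCommGroup X] [Module ℝ X] [DiffeologicalSpace X]
  [AddCommGroup Y] [Module ℝ Y] [DiffeologicalSpace Y]
  [AddCommGroup Z] [Module ℝ Z] [DiffeologicalSpace Z]
  [AddCommGroup W] [Module ℝ W] [DiffeologicalSpace W]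

lemma isPlot_neg [DiffeologicalModule X] {n : ℕ} {p : 𝔼 n → X}
    (hp : IsPlot p) : IsPlot fun u => -p u := by
  simpa using isPlot_smul (f := fun _ => (-1 : ℝ)) contDiff_const hp

lemma isPlot_sub [DiffeologicalModule X] {n : ℕ} {p q : 𝔼 n → X}
    (hp : IsPlot p) (hq : IsPlot q) : IsPlot fun u => p u - q u := by
  simpa only [sub_eq_add_neg] using isPlot_add hp (isPlot_neg hq)

lemma isPlot_sum [DiffeologicalModule X] {ι : Type*} (s : Finset ι) {n : ℕ}
    {p : ι → 𝔼 n → X} (hp : ∀ i ∈ s, IsPlot (p i)) :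
    IsPlot fun u => ∑ i ∈ s, p i u := by
  classical
  induction s using Finset.induction_on with
  | empty => simpa using isPlot_const
  | insert a s ha ih =>
    simp only [Finset.sum_insert ha]
    exact isPlot_add (hp a (Finset.mem_insert_self _ _))
      (ih fun i hi => hp i (Finset.mem_insert_of_mem hi))

lemma isPlot_subtype_iff {A : Type*} [DiffeologicalSpace A] {P : A → Prop} {n : ℕ}
    {p : 𝔼 n → Subtype P} : IsPlot p ↔ IsPlot fun u => (p u).1 :=
  ⟨fun h => h (), fun h _ => h⟩

instance [DiffeologicalModule X] [DiffeologicalModule Y] : DiffeologicalModule (X × Y) where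
  isPlot_add hp hq := ⟨isPlot_add hp.1 hq.1, isPlot_add hp.2 hq.2⟩
  isPlot_smul hf hp := ⟨isPlot_smul hf hp.1, isPlot_smul hf hp.2⟩

instance [DiffeologicalModule X] (S : Submodule ℝ X) : DiffeologicalModule S where
  isPlot_add hp hq := isPlot_subtype_iff.2
    (isPlot_add (isPlot_subtype_iff.1 hp) (isPlot_subtype_iff.1 hq))
  isPlot_smul hf hp := isPlot_subtype_iff.2 (isPlot_smul hf (isPlot_subtype_iff.1 hp))

instance {I : Type*} [RapidIndex I] : DiffeologicalModule (Rapid I) where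
  isPlot_add hp hq := RapidFamily.add hp hq
  isPlot_smul hf hp := RapidFamily.smul hp hf

variable (X Y) in
/-- Two spaces are linearly diffeomorphic. -/
def LinearlyDiffeomorphic : Prop := ∃ e : X ≃ₗ[ℝ] Y, DSmooth e ∧ DSmooth e.symm

lemma LinearlyDiffeomorphic.symm (h : LinearlyDiffeomorphic X Y) : LinearlyDiffeomorphic Y X := by
  obtain ⟨e, h1, h2⟩ := h
  exact ⟨e.symm, h2, by simpa using h1⟩

lemma LinearlyDiffeomorphic.trans (h : LinearlyDiffeomorphic X Y)
    (h' : LinearlyDiffeomorphic Y Z) : LinearlyDiffeomorphic X Z := by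
  obtain ⟨e, h1, h2⟩ := h
  obtain ⟨e', h1', h2'⟩ := h'
  exact ⟨e.trans e', h1'.comp h1, h2.comp h2'⟩

lemma LinearlyDiffeomorphic.prodMap (h : LinearlyDiffeomorphic X Y)
    (h' : LinearlyDiffeomorphic Z W) : LinearlyDiffeomorphic (X × Z) (Y × W) := by
  obtain ⟨e, h1, h2⟩ := h
  obtain ⟨e', h1', h2'⟩ := h'
  exact ⟨e.prodCongr e', fun n p hp => ⟨h1 n _ hp.1, h1' n _ hp.2⟩,
    fun n p hp => ⟨h2 n _ hp.1, h2' n _ hp.2⟩⟩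

variable (X Y) in
/-- `X` is a direct summand of `Y`, with smooth inclusion and projection. -/
def SmoothSummand : Prop :=
  ∃ (a : X →ₗ[ℝ] Y) (b : Y →ₗ[ℝ] X), DSmooth a ∧ DSmooth b ∧ ∀ x, b (a x) = x

lemma SmoothSummand.trans (h : SmoothSummand X Y) (h' : SmoothSummand Y Z) :
    SmoothSummand X Z := by
  obtain ⟨a, b, ha, hb, hab⟩ := h
  obtain ⟨a', b', ha', hb', hab'⟩ := h'
  exact ⟨a' ∘ₗ a, b ∘ₗ b', ha'.comp ha, hb.comp hb', fun x => by simp [hab', hab]⟩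

end Modules

/-! ### Linear maps between spaces of rapidly decreasing sequences -/

section Reindex

variable {I J : Type*} [RapidIndex I] [RapidIndex J]

lemma smoothSummand_of_injective {f : I → J} (hf : Function.Injective f) {r r' : ℕ} {D D' : ℝ}
    (h : ∀ i, wt (f i) ≤ D * wt i ^ r) (h' : ∀ i, wt i ≤ D' * wt (f i) ^ r') :
    SmoothSummand (Rapid I) (Rapid J) := by
  refine ⟨⟨⟨fun c => ⟨Function.extend f c.1 0, ?_⟩, fun c d => ?_⟩, fun a c => ?_⟩,
    ⟨⟨fun c => ⟨fun i => c.1 (f i), ?_⟩, fun c d => ?_⟩, fun a c => ?_⟩, ?_, ?_, fun c => ?_⟩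
  · exact ((rapidFamily_const (E := ℝ) c).extend hf h).mem 0
  · ext j
    by_cases hj : ∃ i, f i = j
    · obtain ⟨i, rfl⟩ := hj
      simp [hf.extend_apply]
    · simp [Function.extend_apply' _ _ _ hj]
  · ext j
    by_cases hj : ∃ i, f i = j
    · obtain ⟨i, rfl⟩ := hj
      simp [hf.extend_apply]
    · simp [Function.extend_apply' _ _ _ hj]
  · exact ((rapidFamily_const (E := ℝ) c).reindex f h').mem 0
  · rfl
  · rfl
  · exact fun n p hp => RapidFamily.extend hp hf h
  · exact fun n p hp => RapidFamily.reindex hp f h'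
  · ext i
    exact hf.extend_apply _ _ _

lemma linearlyDiffeomorphic_of_equiv (f : I ≃ J) {r r' : ℕ} {D D' : ℝ}
    (h : ∀ i, wt (f i) ≤ D * wt i ^ r) (h' : ∀ i, wt i ≤ D' * wt (f i) ^ r') :
    LinearlyDiffeomorphic (Rapid I) (Rapid J) := by
  have h2 : ∀ j, wt j ≤ D * wt (f.symm j) ^ r := fun j => by simpa using h (f.symm j)
  refine ⟨⟨⟨⟨fun c => ⟨fun j => c.1 (f.symm j), ?_⟩, fun c d => rfl⟩, fun a c => rfl⟩,
    fun c => ⟨fun i => c.1 (f i), ?_⟩, fun c => ?_, fun c => ?_⟩, ?_, ?_⟩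
  · exact ((rapidFamily_const (E := ℝ) c).reindex f.symm h2).mem 0
  · exact ((rapidFamily_const (E := ℝ) c).reindex f h').mem 0
  · ext i
    simp
  · ext i
    simp
  · exact fun n p hp => RapidFamily.reindex hp f.symm h2
  · exact fun n p hp => RapidFamily.reindex hp f h'

lemma linearlyDiffeomorphic_rapid_sum :
    LinearlyDiffeomorphic (Rapid (I ⊕ J)) (Rapid I × Rapid J) := by
  have h1 : ∀ i : I, wt i ≤ 1 * wt (Sum.inl i : I ⊕ J) ^ 1 := fun i => by simp [wt]
  have h2 : ∀ i : J, wt i ≤ 1 * wt (Sum.inr i : I ⊕ J) ^ 1 := fun i => by simp [wt]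
  have h3 : ∀ {E : Type} [NormedAddCommGroup E] [NormedSpace ℝ E] {c : E → I → ℝ}
      {d : E → J → ℝ}, RapidFamily c → RapidFamily d →
        RapidFamily fun u => (Sum.elim (c u) (d u) : I ⊕ J → ℝ) := by
    intro E _ _ c d hc hd
    refine ⟨?_, fun j m K hK => ?_⟩
    · rintro (i | i)
      · exact hc.1 i
      · exact hd.1 i
    · obtain ⟨C, hC⟩ := hc.2 j m K hK
      obtain ⟨D, hD⟩ := hd.2 j m K hK
      refine ⟨max C D, ?_⟩
      rintro u hu (i | i)
      · exact (hC u hu i).trans (le_max_left _ _)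
      · exact (hD u hu i).trans (le_max_right _ _)
  refine ⟨⟨⟨⟨fun c => (⟨fun i => c.1 (.inl i), ?_⟩, ⟨fun i => c.1 (.inr i), ?_⟩),
    fun c d => rfl⟩, fun a c => rfl⟩,
    fun c => ⟨Sum.elim c.1.1 c.2.1, ?_⟩, fun c => ?_, fun c => ?_⟩, ?_, ?_⟩
  · exact ((rapidFamily_const (E := ℝ) c).reindex _ h1).mem 0
  · exact ((rapidFamily_const (E := ℝ) c).reindex _ h2).mem 0
  · exact (h3 (rapidFamily_const (E := ℝ) c.1) (rapidFamily_const c.2)).mem 0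
  · ext (i | i) <;> rfl
  · rfl
  · exact fun n p hp => ⟨RapidFamily.reindex hp _ h1, RapidFamily.reindex hp _ h2⟩
  · exact fun n p hp => h3 hp.1 hp.2

lemma linearlyDiffeomorphic_rapid_nat_prod :
    LinearlyDiffeomorphic (Rapid (ℕ × ℕ)) (Rapid ℕ) := by
  refine linearlyDiffeomorphic_of_equiv Nat.pairEquiv (r := 2) (D := 1) (r' := 2) (D' := 1) ?_ ?_
  · rintro ⟨a, b⟩
    have h := Nat.pair_lt_max_add_one_sq a b
    have h1 : max a b + 1 ≤ (a + 1) * (b + 1) := by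
      rcases max_cases a b with ⟨h, -⟩ | ⟨h, -⟩ <;> rw [h] <;> nlinarith
    have h2 : Nat.pair a b + 1 ≤ ((a + 1) * (b + 1)) ^ 2 :=
      (Nat.succ_le_of_lt h).trans (Nat.pow_le_pow_left h1 2)
    have h3 : ((Nat.pair a b : ℕ) : ℝ) + 1 ≤ (((a : ℝ) + 1) * (b + 1)) ^ 2 := by exact_mod_cast h2
    simpa [wt] using h3
  · rintro ⟨a, b⟩
    have h1 := Nat.left_le_pair a b
    have h2 := Nat.right_le_pair a b
    have h3 : (a + 1) * (b + 1) ≤ (Nat.pair a b + 1) ^ 2 := by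
      rw [sq]
      exact Nat.mul_le_mul (by lia) (by lia)
    have h4 : ((a : ℝ) + 1) * (b + 1) ≤ ((Nat.pair a b : ℕ) + 1 : ℝ) ^ 2 := by exact_mod_cast h3
    simpa [wt] using h4

lemma linearlyDiffeomorphic_rapid_nat_sum :
    LinearlyDiffeomorphic (Rapid (ℕ ⊕ ℕ)) (Rapid ℕ) := by
  refine linearlyDiffeomorphic_of_equiv Equiv.natSumNatEquivNat (r := 1) (D := 2) (r' := 1)
    (D' := 1) ?_ ?_
  · rintro (a | a) <;> simp [wt] <;> linarith
  · rintro (a | a) <;> simp [wt] <;> linarith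

end Reindex

/-! ### The action of a smooth linear map on rows -/

section Rows

variable {E : Type*} [NormedAddCommGroup E] [NormedSpace ℝ E]
  {J J' : Type*} [RapidIndex J] [RapidIndex J']

lemma RapidFamily.row {c : E → ℕ × J → ℝ} (hc : RapidFamily c) (l : ℕ) :
    RapidFamily fun u j => c u (l, j) :=
  hc.reindex (fun j => (l, j)) (r := 1) (D := 1) fun j => by
    have h : wt (l, j) = wt l * wt j := rfl
    rw [h]
    nlinarith [one_le l, wt_pos j]

lemma RapidFamily.map_smooth [FiniteDimensional ℝ E] {T : Rapid J →ₗ[ℝ] Rapid J'} (hT : DSmooth T)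
    {c : E → J → ℝ}
    (hc : RapidFamily c) : RapidFamily fun u => (T ⟨c u, hc.mem u⟩).1 := by
  let e : E ≃L[ℝ] EuclideanSpace ℝ (Fin (Module.finrank ℝ E)) := toEuclidean
  have h : IsPlot fun v => (⟨c (e.symm v), hc.mem _⟩ : Rapid J) := hc.comp e.symm.contDiff
  have h' : RapidFamily fun v => (T ⟨c (e.symm v), hc.mem _⟩).1 := hT _ _ h
  simpa using h'.comp e.contDiff

/-- A smooth function vanishing on a half space is flat on its boundary. -/
lemma norm_iteratedFDeriv_le_of_eq_zero {f : ℝ × E → ℝ} (hf : ContDiff ℝ ∞ f)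
    (h0 : ∀ z : ℝ × E, z.1 ≤ 0 → f z = 0) (r : ℕ) {u : E} {C : ℝ} : ∀ {j : ℕ},
    (∀ s ∈ Set.Icc (0 : ℝ) 1, ‖iteratedFDeriv ℝ (j + r) f (s, u)‖ ≤ C) →
      ∀ t ∈ Set.Icc (0 : ℝ) 1, ‖iteratedFDeriv ℝ j f (t, u)‖ ≤ C * t ^ r := by
  induction r with
  | zero =>
    intro j h t ht
    simpa using h t ht
  | succ r ih =>
    intro j h t ht
    have ih' := ih (j := j + 1) (by rwa [add_right_comm, add_assoc])
    have hC : 0 ≤ C := (norm_nonneg _).trans (h 0 (by simp))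
    have hd : Differentiable ℝ (iteratedFDeriv ℝ j f) :=
      hf.differentiable_iteratedFDeriv (by exact_mod_cast ENat.natCast_lt_top j)
    have hz : iteratedFDeriv ℝ j f (0, u) = 0 := by
      have hcont : Filter.Tendsto (fun s : ℝ => iteratedFDeriv ℝ j f (s, u)) (𝓝[<] 0)
          (𝓝 (iteratedFDeriv ℝ j f (0, u))) :=
        ((hd.continuous.comp (by fun_prop : Continuous fun s : ℝ => (s, u))).tendsto 0).mono_left
          nhdsWithin_le_nhds
      refine tendsto_nhds_unique hcont (tendsto_const_nhds.congr' ?_)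
      filter_upwards [self_mem_nhdsWithin] with s hs
      have : f =ᶠ[𝓝 (s, u)] fun _ => 0 := by
        filter_upwards [(isOpen_Iio.preimage continuous_fst).mem_nhds (x := (s, u)) hs] with z hz
        exact h0 z (le_of_lt hz)
      rw [(this.iteratedFDeriv ℝ j).eq_of_nhds]
      have : (fun _ : ℝ × E => (0 : ℝ)) = 0 := rfl
      rw [this, iteratedFDeriv_zero]
      rfl
    have hseg : ∀ z ∈ segment ℝ ((0 : ℝ), u) (t, u),
        ‖fderiv ℝ (iteratedFDeriv ℝ j f) z‖ ≤ C * t ^ r := by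
      intro z hz
      obtain ⟨a, ha, rfl⟩ := (segment_eq_image ℝ ((0 : ℝ), u) (t, u)) ▸ hz
      have h1 : (1 - a) • ((0 : ℝ), u) + a • (t, u) = (a * t, u) := by
        ext <;> simp [← add_smul]
      have h2 : a * t ≤ t := mul_le_of_le_one_left ht.1 ha.2
      simp only [h1]
      rw [norm_fderiv_iteratedFDeriv]
      refine (ih' (a * t) ⟨mul_nonneg ha.1 ht.1, h2.trans ht.2⟩).trans ?_
      exact mul_le_mul_of_nonneg_left (pow_le_pow_left₀ (mul_nonneg ha.1 ht.1) h2 r) hC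
    have := (convex_segment ((0 : ℝ), u) (t, u)).norm_image_sub_le_of_norm_fderiv_le
      (fun z _ => hd z) hseg (left_mem_segment _ _ _) (right_mem_segment _ _ _)
    have hn : ‖((t, u) : ℝ × E) - (0, u)‖ = t := by
      simpa [Prod.norm_def, abs_of_nonneg ht.1] using ht.1
    rw [hz, sub_zero, hn] at this
    rwa [pow_succ, ← mul_assoc]

lemma norm_iteratedFDeriv_slice_le {f : ℝ × E → ℝ} (hf : ContDiff ℝ ∞ f) (j : ℕ) (t : ℝ) (u : E) :
    ‖iteratedFDeriv ℝ j (fun u => f (t, u)) u‖ ≤ ‖iteratedFDeriv ℝ j f (t, u)‖ := by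
  have h1 : (fun u : E => f (t, u)) =
      (fun z : ℝ × E => f ((t, (0 : E)) + z)) ∘ ContinuousLinearMap.inr ℝ ℝ E := by
    ext u
    simp
  have hs : ContDiff ℝ ∞ (fun z : ℝ × E => f ((t, (0 : E)) + z)) :=
    hf.comp (contDiff_const.add contDiff_id)
  rw [h1, (ContinuousLinearMap.inr ℝ ℝ E).iteratedFDeriv_comp_right hs u
    (i := j) (by exact_mod_cast le_top), iteratedFDeriv_comp_add_left]
  refine (ContinuousMultilinearMap.norm_compContinuousLinearMap_le _ _).trans ?_
  have h2 : ((t, (0 : E)) + ContinuousLinearMap.inr ℝ ℝ E u) = (t, u) := by simp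
  rw [h2]
  refine mul_le_of_le_one_right (norm_nonneg _) ?_
  rw [Finset.prod_const]
  exact pow_le_one₀ (norm_nonneg _) (ContinuousLinearMap.norm_inr_le_one ℝ ℝ E)

/-- Bump functions separating the points `1 / (l + 1)`. -/
lemma exists_separating_bumps : ∃ β : ℝ → ℕ → ℝ, PolyFamily β ∧
    (∀ l l' : ℕ, β (1 / (l' + 1)) l = if l = l' then 1 else 0) ∧ ∀ t ≤ 0, ∀ l, β t l = 0 := by
  let φ : ContDiffBump (0 : ℝ) := ⟨1 / 2, 1, by norm_num, by norm_num⟩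
  have hzero : ∀ x : ℝ, 1 ≤ |x| → φ x = 0 := fun x hx =>
    φ.zero_of_le_dist (by simpa [Real.dist_eq] using hx)
  refine ⟨fun t l => φ ((l + 1) * (l + 2) * t + -(l + 2)), ?_, fun l l' => ?_, fun t ht l => ?_⟩
  · have h1 : PolyFamily fun (t : ℝ) (l : ℕ) => ((l : ℝ) + 1) * (l + 2) := by
      refine polyFamily_const_seq (m := 2) (C := 2) fun l => ?_
      have : (0 : ℝ) ≤ l := Nat.cast_nonneg l
      rw [abs_of_nonneg (by positivity)]
      simp only [wt]
      nlinarith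
    have h2 : PolyFamily fun (t : ℝ) (l : ℕ) => -((l : ℝ) + 2) := by
      refine polyFamily_const_seq (m := 1) (C := 2) fun l => ?_
      have : (0 : ℝ) ≤ l := Nat.cast_nonneg l
      rw [abs_neg, abs_of_nonneg (by positivity)]
      simp only [wt]
      nlinarith
    have h3 : PolyFamily fun (t : ℝ) (_ : ℕ) => t := polyFamily_const contDiff_id
    exact ((h1.mul h3).add h2).bounded_comp φ.contDiff
      (bounded_iteratedFDeriv_of_hasCompactSupport φ.contDiff φ.hasCompactSupport)
  · have hl : (0 : ℝ) ≤ l := Nat.cast_nonneg l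
    have hl' : (0 : ℝ) ≤ l' := Nat.cast_nonneg l'
    split_ifs with h
    · subst h
      have : ((l : ℝ) + 1) * (l + 2) * (1 / (l + 1)) + -(l + 2) = 0 := by field_simp; ring
      simp only [this]
      exact φ.one_of_mem_closedBall (Metric.mem_closedBall_self φ.rIn_pos.le)
    · refine hzero _ ?_
      have : ((l : ℝ) + 1) * (l + 2) * (1 / (l' + 1)) + -(l + 2) =
          ((l : ℝ) + 2) * (l - l') / (l' + 1) := by field_simp; ring
      rw [this, abs_div, abs_mul, abs_of_nonneg (by positivity : (0 : ℝ) ≤ (l : ℝ) + 2),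
        abs_of_nonneg (by positivity : (0 : ℝ) ≤ (l' : ℝ) + 1), le_div_iff₀ (by positivity), one_mul]
      rcases lt_or_gt_of_ne h with h | h
      · have h1 : (l : ℝ) + 1 ≤ l' := by exact_mod_cast h
        rw [abs_of_nonpos (by linarith)]
        nlinarith
      · have h1 : (l' : ℝ) + 1 ≤ l := by exact_mod_cast h
        rw [abs_of_nonneg (by linarith)]
        nlinarith
  · refine hzero _ ?_
    have hl : (0 : ℝ) ≤ l := Nat.cast_nonneg l
    have h : ((l : ℝ) + 1) * (l + 2) * t ≤ 0 := mul_nonpos_of_nonneg_of_nonpos (by positivity) ht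
    rw [abs_of_nonpos (by linarith)]
    linarith

/-- A smooth linear map acts smoothly on sequences of rapidly decreasing sequences. -/
lemma RapidFamily.map_rows [FiniteDimensional ℝ E] {T : Rapid J →ₗ[ℝ] Rapid J'} (hT : DSmooth T)
    {c : E → ℕ × J → ℝ}
    (hc : RapidFamily c) :
    RapidFamily fun u (i : ℕ × J') => (T ⟨fun j => c u (i.1, j), (hc.row i.1).mem u⟩).1 i.2 := by
  obtain ⟨β, hβ, hβ1, hβ0⟩ := exists_separating_bumps
  have hβ' : PolyFamily fun (z : ℝ × E) (i : ℕ × J) => β z.1 i.1 := by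
    have : PolyFamily fun (z : ℝ × E) l => β z.1 l := hβ.comp contDiff_fst
    exact this.reindex Prod.fst (r := 1) (D := 1) fun i => by
      have h : wt i = wt i.1 * wt i.2 := rfl
      rw [h]
      nlinarith [one_le i.2, wt_pos i.1]
  have hA : RapidFamily fun (z : ℝ × E) (j : J) => ∑' l, β z.1 l * c z.2 (l, j) :=
    RapidFamily.tsum ((hc.comp contDiff_snd).mul_poly hβ')
  have hq := hA.map_smooth hT
  set q : ℝ × E → J' → ℝ := fun z => (T ⟨_, hA.mem z⟩).1 with hq_def
  have hq0 : ∀ z : ℝ × E, z.1 ≤ 0 → ∀ k, q z k = 0 := by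
    intro z hz k
    have : (⟨_, hA.mem z⟩ : Rapid J) = 0 := by
      ext j
      simp [hβ0 _ hz]
    simp only [hq_def, this, map_zero]
    rfl
  have hq1 : ∀ (l : ℕ) (u : E) (k : J'),
      (T ⟨fun j => c u (l, j), (hc.row l).mem u⟩).1 k = q (1 / (l + 1), u) k := by
    intro l u k
    have : (⟨_, hA.mem (1 / ((l : ℝ) + 1), u)⟩ : Rapid J) =
        ⟨fun j => c u (l, j), (hc.row l).mem u⟩ := by
      ext j
      simp only [hβ1]
      rw [tsum_eq_single l fun l' hl' => by simp [hl']]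
      simp
    simp only [hq_def, this]
  have hsl : ∀ t : ℝ, ContDiff ℝ ∞ fun u : E => ((t, u) : ℝ × E) := fun t =>
    contDiff_const.prodMk contDiff_id
  refine ⟨fun i => ?_, fun j m K hK => ?_⟩
  · simp only [hq1]
    exact (hq.1 i.2).comp (hsl _)
  · obtain ⟨C, hC0, hC⟩ := hq.bound_le (j + m) m ((isCompact_Icc (a := (0 : ℝ)) (b := 1)).prod hK)
    refine ⟨C, fun u hu i => ?_⟩
    simp only [hq1]
    have hl : (0 : ℝ) < (i.1 : ℝ) + 1 := by positivity
    have ht : (1 / ((i.1 : ℝ) + 1)) ∈ Set.Icc (0 : ℝ) 1 :=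
      ⟨by positivity, by rw [div_le_one hl]; linarith [(Nat.cast_nonneg i.1 : (0 : ℝ) ≤ i.1)]⟩
    have h := norm_iteratedFDeriv_le_of_eq_zero (j := j) (u := u) (C := (wt i.2 ^ m)⁻¹ * C)
      (hq.1 i.2) (fun z hz => hq0 z hz _) m (fun s hs => by
        rw [← div_eq_inv_mul, le_div_iff₀' (pow_pos' _ _)]
        exact hC (j + m) le_rfl (s, u) ⟨hs, hu⟩ i.2) _ ht
    have hw : wt i = ((i.1 : ℝ) + 1) * wt i.2 := rfl
    refine (mul_le_mul_of_nonneg_left ((norm_iteratedFDeriv_slice_le (hq.1 i.2) _ _ _).trans h)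
      (pow_pos' _ _).le).trans (le_of_eq ?_)
    have h1 := pow_ne_zero m (wt_pos i.2).ne'
    rw [hw, mul_pow, one_div, inv_pow]
    field_simp

/-- The action of a smooth linear map on sequences of rapidly decreasing sequences. -/
def mapRows (T : Rapid J →ₗ[ℝ] Rapid J') (hT : DSmooth T) :
    Rapid (ℕ × J) →ₗ[ℝ] Rapid (ℕ × J') where
  toFun c := ⟨fun i => (T ⟨fun j => c.1 (i.1, j),
    ((rapidFamily_const (E := ℝ) c).row i.1).mem 0⟩).1 i.2,
    ((rapidFamily_const (E := ℝ) c).map_rows hT).mem 0⟩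
  map_add' c d := by
    ext i
    exact congrFun (congrArg Subtype.val (T.map_add
      ⟨fun j => c.1 (i.1, j), ((rapidFamily_const (E := ℝ) c).row i.1).mem 0⟩
      ⟨fun j => d.1 (i.1, j), ((rapidFamily_const (E := ℝ) d).row i.1).mem 0⟩)) i.2
  map_smul' a c := by
    ext i
    exact congrFun (congrArg Subtype.val (T.map_smul a
      ⟨fun j => c.1 (i.1, j), ((rapidFamily_const (E := ℝ) c).row i.1).mem 0⟩)) i.2

lemma dSmooth_mapRows {T : Rapid J →ₗ[ℝ] Rapid J'} (hT : DSmooth T) : DSmooth (mapRows T hT) :=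
  fun _ _ hp => RapidFamily.map_rows hT hp

end Rows

/-! ### The decomposition method -/

section Decomposition

variable {J : Type*} [RapidIndex J]

/-- The row of index `l`. -/
def rapidRow (l : ℕ) : Rapid (ℕ × J) →ₗ[ℝ] Rapid J where
  toFun c := ⟨fun j => c.1 (l, j), ((rapidFamily_const (E := ℝ) c).row l).mem 0⟩
  map_add' _ _ := rfl
  map_smul' _ _ := rfl

lemma dSmooth_rapidRow (l : ℕ) : DSmooth (rapidRow (J := J) l) :=
  fun _ _ hp => RapidFamily.row hp l

lemma wt_le_wt_succ (i : ℕ × J) : wt i ≤ 1 * wt (i.1 + 1, i.2) ^ 1 := by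
  have h1 : wt i = ((i.1 : ℝ) + 1) * wt i.2 := rfl
  have h2 : wt (i.1 + 1, i.2) = (((i.1 + 1 : ℕ) : ℝ) + 1) * wt i.2 := rfl
  rw [h1, h2]
  push_cast
  nlinarith [wt_pos i.2]

/-- Removal of the first row. -/
def rapidTail : Rapid (ℕ × J) →ₗ[ℝ] Rapid (ℕ × J) where
  toFun c := ⟨fun i => c.1 (i.1 + 1, i.2),
    ((rapidFamily_const (E := ℝ) c).reindex _ wt_le_wt_succ).mem 0⟩
  map_add' _ _ := rfl
  map_smul' _ _ := rfl

lemma dSmooth_rapidTail : DSmooth (rapidTail (J := J)) :=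
  fun _ _ hp => RapidFamily.reindex hp _ wt_le_wt_succ

lemma RapidFamily.cons {E : Type*} [NormedAddCommGroup E] [NormedSpace ℝ E] {a : E → J → ℝ}
    {c : E → ℕ × J → ℝ} (ha : RapidFamily a) (hc : RapidFamily c) :
    RapidFamily fun u (i : ℕ × J) => Nat.casesOn (motive := fun _ => ℝ) i.1 (a u i.2)
      fun l => c u (l, i.2) := by
  refine ⟨?_, fun j m K hK => ?_⟩
  · rintro ⟨- | l, k⟩
    · exact ha.1 k
    · exact hc.1 (l, k)
  obtain ⟨C, hC⟩ := ha.2 j m K hK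
  obtain ⟨D, hD⟩ := hc.2 j m K hK
  refine ⟨max C (2 ^ m * D), ?_⟩
  rintro u hu ⟨- | l, k⟩
  · refine le_trans (le_of_eq ?_) ((hC u hu k).trans (le_max_left _ _))
    have : wt ((0, k) : ℕ × J) = wt k := by
      change (((0 : ℕ) : ℝ) + 1) * wt k = wt k
      simp
    simp only [this]
    rfl
  · refine le_trans ?_ ((mul_le_mul_of_nonneg_left (hD u hu (l, k)) (by positivity)).trans
      (le_max_right _ _))
    have h1 : wt (l + 1, k) = (((l + 1 : ℕ) : ℝ) + 1) * wt k := rfl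
    have h2 : wt (l, k) = ((l : ℝ) + 1) * wt k := rfl
    have h3 : wt (l + 1, k) ≤ 2 * wt (l, k) := by
      rw [h1, h2]
      push_cast
      nlinarith [wt_pos k, (Nat.cast_nonneg l : (0 : ℝ) ≤ l)]
    rw [← mul_assoc, ← mul_pow]
    exact mul_le_mul_of_nonneg_right (pow_le_pow_left₀ (wt_pos _).le h3 m) (norm_nonneg _)

/-- Adding a first row. -/
def rapidCons (a : Rapid J) (c : Rapid (ℕ × J)) : Rapid (ℕ × J) :=
  ⟨fun i => Nat.casesOn (motive := fun _ => ℝ) i.1 (a.1 i.2) fun l => c.1 (l, i.2),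
    ((rapidFamily_const (E := ℝ) a).cons (rapidFamily_const c)).mem 0⟩

lemma rapid_ext_rows {c d : Rapid (ℕ × J)} (h : ∀ l, rapidRow l c = rapidRow l d) : c = d := by
  ext ⟨l, k⟩
  exact congrFun (congrArg Subtype.val (h l)) k

lemma rapidRow_mapRows {T : Rapid J →ₗ[ℝ] Rapid J} (hT : DSmooth T) (l : ℕ)
    (c : Rapid (ℕ × J)) : rapidRow l (mapRows T hT c) = T (rapidRow l c) := rfl

lemma rapidRow_rapidTail (l : ℕ) (c : Rapid (ℕ × J)) :
    rapidRow l (rapidTail c) = rapidRow (l + 1) c := rfl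

lemma rapidRow_zero_rapidCons (a : Rapid J) (c : Rapid (ℕ × J)) :
    rapidRow 0 (rapidCons a c) = a := rfl

lemma rapidRow_succ_rapidCons (l : ℕ) (a : Rapid J) (c : Rapid (ℕ × J)) :
    rapidRow (l + 1) (rapidCons a c) = rapidRow l c := rfl

variable {X : Type*} [AddCommGroup X] [Module ℝ X] [DiffeologicalSpace X]

lemma linearlyDiffeomorphic_rapid_absorb (h : SmoothSummand X (Rapid J)) :
    LinearlyDiffeomorphic (Rapid (ℕ × J)) (X × Rapid (ℕ × J)) := by
  obtain ⟨a, b, ha, hb, hab⟩ := h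
  have hP : DSmooth (a ∘ₗ b) := ha.comp hb
  set P := mapRows (a ∘ₗ b) hP
  refine ⟨⟨⟨⟨fun c => (b (rapidRow 0 c), c - P c + P (rapidTail c)), fun c d => ?_⟩,
    fun r c => ?_⟩, fun z => z.2 - P z.2 + rapidCons (a z.1) (P z.2), fun c => ?_,
    fun z => ?_⟩, fun n p hp => ⟨?_, ?_⟩, fun n p hp => ?_⟩
  · ext1
    · simp
    · simp only [map_add, Prod.mk_add_mk]
      abel
  · ext1
    · simp
    · simp [smul_sub, smul_add]
  · refine rapid_ext_rows fun l => ?_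
    rcases l with - | l
    · simp [map_add, map_sub, rapidRow_mapRows, rapidRow_zero_rapidCons, rapidRow_rapidTail, P, hab]
    · simp [map_add, map_sub, rapidRow_mapRows, rapidRow_succ_rapidCons, rapidRow_rapidTail, P, hab]
  · ext1
    · simp [map_add, map_sub, rapidRow_mapRows, rapidRow_zero_rapidCons, P, hab]
    · refine rapid_ext_rows fun l => ?_
      rcases l with - | l
      · simp [map_add, map_sub, rapidRow_mapRows, rapidRow_zero_rapidCons,
          rapidRow_succ_rapidCons, rapidRow_rapidTail, P, hab]
      · simp [map_add, map_sub, rapidRow_mapRows,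
          rapidRow_succ_rapidCons, rapidRow_rapidTail, P, hab]
  · exact hb _ _ (dSmooth_rapidRow 0 _ _ hp)
  · exact isPlot_add (isPlot_sub hp (dSmooth_mapRows hP _ _ hp))
      (dSmooth_mapRows hP _ _ (dSmooth_rapidTail _ _ hp))
  · refine isPlot_add (isPlot_sub hp.2 (dSmooth_mapRows hP _ _ hp.2)) ?_
    exact RapidFamily.cons (ha _ _ hp.1) (dSmooth_mapRows hP _ _ hp.2)

lemma linearlyDiffeomorphic_prod_rapid_nat [DiffeologicalModule X] (h : SmoothSummand (Rapid ℕ) X) :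
    LinearlyDiffeomorphic X (X × Rapid ℕ) := by
  obtain ⟨c, d, hc, hd, hcd⟩ := h
  obtain ⟨e, he, he'⟩ := linearlyDiffeomorphic_rapid_nat_sum.symm.trans
    (linearlyDiffeomorphic_rapid_sum (I := ℕ) (J := ℕ))
  refine ⟨⟨⟨⟨fun f => (f - c (d f) + c (e (d f)).1, (e (d f)).2), fun f g => ?_⟩,
    fun r f => ?_⟩, fun z => z.1 - c (d z.1) + c (e.symm (d z.1, z.2)), fun f => ?_,
    fun z => ?_⟩, fun n p hp => ⟨?_, ?_⟩, fun n p hp => ?_⟩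
  · ext1
    · simp only [map_add, Prod.fst_add, Prod.mk_add_mk]
      abel
    · simp
  · ext1
    · simp [smul_sub, smul_add]
    · simp
  · simp [hcd]
  · ext1
    · simp [hcd]
    · simp [hcd]
  · exact isPlot_add (isPlot_sub hp (hc _ _ (hd _ _ hp))) (hc _ _ (he _ _ (hd _ _ hp)).1)
  · exact (he _ _ (hd _ _ hp)).2
  · exact isPlot_add (isPlot_sub hp.1 (hc _ _ (hd _ _ hp.1)))
      (hc _ _ (he' _ (fun u => (d (p u).1, (p u).2)) ⟨hd _ _ hp.1, hp.2⟩))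

lemma LinearlyDiffeomorphic.refl (X : Type*) [AddCommGroup X] [Module ℝ X]
    [DiffeologicalSpace X] : LinearlyDiffeomorphic X X :=
  ⟨LinearEquiv.refl ℝ X, dSmooth_id, dSmooth_id⟩

/-- A space that is a summand of the space of rapidly decreasing sequences, and of which this space
is a summand, is linearly diffeomorphic to it. -/
theorem linearlyDiffeomorphic_rapid_nat [DiffeologicalModule X] (h : SmoothSummand X (Rapid ℕ))
    (h' : SmoothSummand (Rapid ℕ) X) : LinearlyDiffeomorphic X (Rapid ℕ) :=
  (linearlyDiffeomorphic_prod_rapid_nat h').trans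
    (((LinearlyDiffeomorphic.refl X).prodMap linearlyDiffeomorphic_rapid_nat_prod.symm).trans
      ((linearlyDiffeomorphic_rapid_absorb h).symm.trans linearlyDiffeomorphic_rapid_nat_prod))

end Decomposition

open MeasureTheory

/-! ### Integrals depending on parameters -/

section ParametricIntegral

variable {E : Type} [NormedAddCommGroup E] [NormedSpace ℝ E]
  {V : Type*} [NormedAddCommGroup V] [NormedSpace ℝ V] [MeasurableSpace V] [BorelSpace V]
  [SecondCountableTopology V] {μ : Measure V} [IsFiniteMeasureOnCompacts μ] {K : Set V}

/-- The partial derivative in the first variable. -/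
def partialFDeriv {F : Type} [NormedAddCommGroup F] [NormedSpace ℝ F] (f : E × V → F) (z : E × V) :
    E →L[ℝ] F :=
  (fderiv ℝ f z).comp (ContinuousLinearMap.inl ℝ E V)

lemma contDiff_partialFDeriv {F : Type} [NormedAddCommGroup F] [NormedSpace ℝ F] {f : E × V → F}
    (hf : ContDiff ℝ ∞ f) : ContDiff ℝ ∞ (partialFDeriv f) :=
  (hf.fderiv_right (m := ∞) (by simp)).clm_comp contDiff_const

lemma integrableOn_smul_of_bounded {F : Type} [NormedAddCommGroup F] [NormedSpace ℝ F]
    {f : E × V → F} (hf : Continuous f) (hK : IsCompact K) {g : V → ℝ}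
    (hg : AEStronglyMeasurable g (μ.restrict K)) (hg1 : ∀ y, |g y| ≤ 1) (u : E) :
    IntegrableOn (fun y => g y • f (u, y)) K μ := by
  have h : IntegrableOn (fun y => f (u, y)) K μ :=
    (hf.comp (by fun_prop : Continuous fun y : V => (u, y))).continuousOn.integrableOn_compact hK
  exact h.bdd_smul 1 hg (Filter.Eventually.of_forall fun y => by simpa using hg1 y)

lemma hasFDerivAt_integral_param [FiniteDimensional ℝ E]
    {F : Type} [NormedAddCommGroup F] [NormedSpace ℝ F] {f : E × V → F}
    (hf : ContDiff ℝ ∞ f) (hK : IsCompact K) {g : V → ℝ}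
    (hg : AEStronglyMeasurable g (μ.restrict K)) (hg1 : ∀ y, |g y| ≤ 1) (u : E) :
    HasFDerivAt (fun u => ∫ y in K, g y • f (u, y) ∂μ)
      (∫ y in K, g y • partialFDeriv f (u, y) ∂μ) u := by
  have hc := (contDiff_partialFDeriv hf).continuous
  obtain ⟨C, hC⟩ := ((isCompact_closedBall u 1).prod hK).bddAbove_image
    (f := fun z => ‖partialFDeriv f z‖) hc.norm.continuousOn
  have hC' : ∀ x ∈ Metric.closedBall u 1, ∀ y ∈ K, ‖partialFDeriv f (x, y)‖ ≤ C :=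
    fun x hx y hy => hC ⟨(x, y), ⟨hx, hy⟩, rfl⟩
  have hmeas : ∀ᵐ y ∂μ.restrict K, y ∈ K := ae_restrict_mem hK.measurableSet
  refine hasFDerivAt_integral_of_dominated_of_fderiv_le (𝕜 := ℝ) (bound := fun _ => C)
    (s := Metric.closedBall u 1) (Metric.closedBall_mem_nhds u one_pos)
    (F := fun u y => g y • f (u, y)) (F' := fun u y => g y • partialFDeriv f (u, y))
    (Filter.Eventually.of_forall fun x =>
      (integrableOn_smul_of_bounded hf.continuous hK hg hg1 x).aestronglyMeasurable)
    (integrableOn_smul_of_bounded hf.continuous hK hg hg1 u)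
    (integrableOn_smul_of_bounded hc hK hg hg1 u).aestronglyMeasurable ?_ ?_ ?_
  · filter_upwards [hmeas] with y hy x hx
    rw [norm_smul]
    have h1 : ‖g y‖ ≤ 1 := hg1 y
    calc ‖g y‖ * ‖partialFDeriv f (x, y)‖ ≤ 1 * C :=
          mul_le_mul h1 (hC' x hx y hy) (norm_nonneg _) zero_le_one
      _ = C := one_mul C
  · exact integrableOn_const hK.measure_lt_top.ne
  · filter_upwards with y x _
    have h1 : HasFDerivAt f (fderiv ℝ f (x, y)) (x, y) :=
      (hf.differentiable (by simp)).differentiableAt.hasFDerivAt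
    have h2 : HasFDerivAt (fun x : E => ((x, y) : E × V)) (ContinuousLinearMap.inl ℝ E V) x :=
      hasFDerivAt_prodMk_left x y
    exact (h1.comp x h2).const_smul (g y)

lemma contDiff_integral_param [FiniteDimensional ℝ E] (n : ℕ) :
    ∀ {F : Type} [NormedAddCommGroup F] [NormedSpace ℝ F] {f : E × V → F}
    (_ : ContDiff ℝ ∞ f) (_ : IsCompact K) {g : V → ℝ}
    (_ : AEStronglyMeasurable g (μ.restrict K)) (_ : ∀ y, |g y| ≤ 1),
    ContDiff ℝ n fun u => ∫ y in K, g y • f (u, y) ∂μ := by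
  induction n with
  | zero =>
    intro F _ _ f hf hK g hg hg1
    rw [Nat.cast_zero, contDiff_zero]
    exact continuous_iff_continuousAt.2 fun u =>
      (hasFDerivAt_integral_param hf hK hg hg1 u).continuousAt
  | succ n ih =>
    intro F _ _ f hf hK g hg hg1
    have hd := hasFDerivAt_integral_param (μ := μ) hf hK hg hg1
    rw [Nat.cast_succ, contDiff_succ_iff_fderiv]
    refine ⟨fun u => (hd u).differentiableAt, by simp, ?_⟩
    have : (fderiv ℝ fun u => ∫ y in K, g y • f (u, y) ∂μ) =
        fun u => ∫ y in K, g y • partialFDeriv f (u, y) ∂μ := funext fun u => (hd u).fderiv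
    rw [this]
    exact ih (contDiff_partialFDeriv hf) hK hg hg1

/-- Smoothness of integrals depending on parameters. -/
lemma contDiff_infty_integral_param [FiniteDimensional ℝ E] {f : E × V → ℝ}
    (hf : ContDiff ℝ ∞ f) (hK : IsCompact K) {g : V → ℝ}
    (hg : AEStronglyMeasurable g (μ.restrict K)) (hg1 : ∀ y, |g y| ≤ 1) :
    ContDiff ℝ ∞ fun u => ∫ y in K, g y • f (u, y) ∂μ :=
  contDiff_infty.2 fun n => contDiff_integral_param n hf hK hg hg1

lemma bound_iteratedFDeriv_integral_param [FiniteDimensional ℝ E] (n : ℕ) :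
    ∀ {F : Type} [NormedAddCommGroup F] [NormedSpace ℝ F] {f : E × V → F}
    (_ : ContDiff ℝ ∞ f) (_ : IsCompact K) {C : Set E} (_ : IsCompact C),
    ∃ B, ∀ g : V → ℝ, AEStronglyMeasurable g (μ.restrict K) → (∀ y, |g y| ≤ 1) → ∀ u ∈ C,
      ‖iteratedFDeriv ℝ n (fun u => ∫ y in K, g y • f (u, y) ∂μ) u‖ ≤ B := by
  induction n with
  | zero =>
    intro F _ _ f hf hK C hC
    obtain ⟨B, hB⟩ := (hC.prod hK).bddAbove_image (f := fun z => ‖f z‖)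
      hf.continuous.norm.continuousOn
    refine ⟨B * μ.real K, fun g hg hg1 u hu => ?_⟩
    rw [norm_iteratedFDeriv_zero]
    refine norm_setIntegral_le_of_norm_le_const hK.measure_lt_top fun y hy => ?_
    rw [norm_smul]
    calc ‖g y‖ * ‖f (u, y)‖ ≤ 1 * B :=
          mul_le_mul (hg1 y) (hB ⟨(u, y), ⟨hu, hy⟩, rfl⟩) (norm_nonneg _) zero_le_one
      _ = B := one_mul B
  | succ n ih =>
    intro F _ _ f hf hK C hC
    obtain ⟨B, hB⟩ := ih (contDiff_partialFDeriv hf) hK hC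
    refine ⟨B, fun g hg hg1 u hu => ?_⟩
    rw [← norm_iteratedFDeriv_fderiv]
    have : (fderiv ℝ fun u => ∫ y in K, g y • f (u, y) ∂μ) =
        fun u => ∫ y in K, g y • partialFDeriv f (u, y) ∂μ :=
      funext fun u => (hasFDerivAt_integral_param hf hK hg hg1 u).fderiv
    rw [this]
    exact hB g hg hg1 u hu

end ParametricIntegral

/-! ### Fourier coefficients with parameters -/

section Coefficients

variable {E : Type} [NormedAddCommGroup E] [NormedSpace ℝ E] [FiniteDimensional ℝ E]
  {V : Type*} [NormedAddCommGroup V] [NormedSpace ℝ V] [FiniteDimensional ℝ V]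
  [MeasurableSpace V] [BorelSpace V] {μ : Measure V} [μ.IsAddHaarMeasure] {K : Set V}

/-- The operator `1 - ∑ ∂²` in the directions `b`. -/
def bessel {ι : Type*} [Fintype ι] (b : ι → V) (f : E × V → ℝ) (z : E × V) : ℝ :=
  f z - ∑ a, fderiv ℝ (fun z => fderiv ℝ f z (0, b a)) z (0, b a)

lemma contDiff_fderiv_apply_const {W : Type*} [NormedAddCommGroup W] [NormedSpace ℝ W]
    {f : W → ℝ} (hf : ContDiff ℝ ∞ f) (w : W) : ContDiff ℝ ∞ fun z => fderiv ℝ f z w :=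
  (hf.fderiv_right (m := ∞) (by simp)).clm_apply contDiff_const

lemma contDiff_bessel {ι : Type*} [Fintype ι] (b : ι → V) {f : E × V → ℝ} (hf : ContDiff ℝ ∞ f) :
    ContDiff ℝ ∞ (bessel b f) :=
  hf.sub (ContDiff.sum fun _ _ => contDiff_fderiv_apply_const (contDiff_fderiv_apply_const hf _) _)

lemma fderiv_apply_eq_zero_of_notMem {f : E × V → ℝ} (hK : IsCompact K)
    (h0 : ∀ z : E × V, z.2 ∉ K → f z = 0) (w : E × V) (z : E × V) (hz : z.2 ∉ K) :
    fderiv ℝ f z w = 0 := by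
  have : f =ᶠ[𝓝 z] fun _ => 0 := by
    filter_upwards [(hK.isClosed.isOpen_compl.preimage continuous_snd).mem_nhds hz] with x hx
    exact h0 x hx
  rw [this.fderiv_eq]
  simp

lemma bessel_eq_zero_of_notMem {ι : Type*} [Fintype ι] (b : ι → V) {f : E × V → ℝ}
    (hK : IsCompact K) (h0 : ∀ z : E × V, z.2 ∉ K → f z = 0) (z : E × V) (hz : z.2 ∉ K) :
    bessel b f z = 0 := by
  have h1 : ∀ a, fderiv ℝ (fun z => fderiv ℝ f z (0, b a)) z (0, b a) = 0 := fun a =>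
    fderiv_apply_eq_zero_of_notMem hK
      (fun z hz => fderiv_apply_eq_zero_of_notMem hK h0 _ z hz) _ z hz
  simp [bessel, h0 z hz, h1]

lemma hasCompactSupport_slice {f : E × V → ℝ} (hK : IsCompact K)
    (h0 : ∀ z : E × V, z.2 ∉ K → f z = 0) (u : E) : HasCompactSupport fun y => f (u, y) :=
  HasCompactSupport.intro hK fun y hy => h0 (u, y) hy

lemma fderiv_slice {f : E × V → ℝ} (hf : ContDiff ℝ ∞ f) (u : E) (y b : V) :
    fderiv ℝ (fun y => f (u, y)) y b = fderiv ℝ f (u, y) (0, b) := by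
  have h1 : HasFDerivAt f (fderiv ℝ f (u, y)) (u, y) :=
    (hf.differentiable (by simp)).differentiableAt.hasFDerivAt
  have h2 : HasFDerivAt (fun y : V => ((u, y) : E × V)) (ContinuousLinearMap.inr ℝ E V) y :=
    hasFDerivAt_prodMk_right u y
  have h3 : HasFDerivAt (fun y => f (u, y)) _ y := h1.comp y h2
  rw [h3.fderiv]
  simp

lemma integral_mul_fderiv_slice {f : E × V → ℝ} (hf : ContDiff ℝ ∞ f) (hK : IsCompact K)
    (h0 : ∀ z : E × V, z.2 ∉ K → f z = 0) {g : V → ℝ} (hg : ContDiff ℝ ∞ g) (u : E) (b : V) :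
    ∫ y, g y * fderiv ℝ f (u, y) (0, b) ∂μ = -∫ y, fderiv ℝ g y b * f (u, y) ∂μ := by
  have hs : Continuous fun y : V => (u, y) := by fun_prop
  have hfs : ContDiff ℝ ∞ fun y => f (u, y) := hf.comp (contDiff_const.prodMk contDiff_id)
  have hc := hasCompactSupport_slice hK h0 u
  have hc' := hasCompactSupport_slice (f := fun z => fderiv ℝ f z (0, b)) hK
    (fun z hz => fderiv_apply_eq_zero_of_notMem hK h0 (0, b) z hz) u
  have hgb : Continuous fun y => fderiv ℝ g y b := (contDiff_fderiv_apply_const hg b).continuous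
  have hfb : Continuous fun y => fderiv ℝ f (u, y) (0, b) :=
    (contDiff_fderiv_apply_const hf (0, b)).continuous.comp hs
  have := integral_mul_fderiv_eq_neg_fderiv_mul_of_integrable (μ := μ) (f := g)
    (g := fun y => f (u, y)) (v := b)
    ((hgb.mul hfs.continuous).integrable_of_hasCompactSupport hc.mul_left)
    (by
      simp only [fderiv_slice hf]
      exact (hg.continuous.mul hfb).integrable_of_hasCompactSupport hc'.mul_left)
    ((hg.continuous.mul hfs.continuous).integrable_of_hasCompactSupport hc.mul_left)
    (fun y _ => (hg.differentiable (by simp)) y) (fun y _ => (hfs.differentiable (by simp)) y)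
  simpa only [fderiv_slice hf] using this

variable (μ) in
/-- The Fourier coefficient of `f(u, ·)` with frequency `ℓ` and phase `φ`. -/
def cosCoeff (ℓ : V →L[ℝ] ℝ) (φ : ℝ) (f : E × V → ℝ) (u : E) : ℝ :=
  ∫ y, Real.cos (ℓ y + φ) * f (u, y) ∂μ

lemma contDiff_cos_linear (ℓ : V →L[ℝ] ℝ) (φ : ℝ) : ContDiff ℝ ∞ fun y => Real.cos (ℓ y + φ) :=
  Real.contDiff_cos.comp (ℓ.contDiff.add contDiff_const)

lemma cosCoeff_fderiv_fderiv {f : E × V → ℝ} (hf : ContDiff ℝ ∞ f) (hK : IsCompact K)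
    (h0 : ∀ z : E × V, z.2 ∉ K → f z = 0) (ℓ : V →L[ℝ] ℝ) (φ : ℝ) (u : E) (b : V) :
    cosCoeff μ ℓ φ (fun z => fderiv ℝ (fun z => fderiv ℝ f z (0, b)) z (0, b)) u =
      -(ℓ b ^ 2 * cosCoeff μ ℓ φ f u) := by
  have hf' := contDiff_fderiv_apply_const hf ((0, b) : E × V)
  have h0' : ∀ z : E × V, z.2 ∉ K → fderiv ℝ f z (0, b) = 0 := fun z hz =>
    fderiv_apply_eq_zero_of_notMem hK h0 _ z hz
  have hc := contDiff_cos_linear ℓ φ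
  have hl : ∀ y, HasFDerivAt (fun y => ℓ y + φ) ℓ y := fun y =>
    ℓ.hasFDerivAt.add_const φ
  have h1 : ∀ y, fderiv ℝ (fun y => Real.cos (ℓ y + φ)) y b = -Real.sin (ℓ y + φ) * ℓ b := fun y => by
    rw [(hl y).cos.fderiv]
    simp
  have h2 : ∀ y, fderiv ℝ (fun y => -Real.sin (ℓ y + φ) * ℓ b) y b =
      -(ℓ b ^ 2 * Real.cos (ℓ y + φ)) := fun y => by
    have : HasFDerivAt (fun y => -Real.sin (ℓ y + φ) * ℓ b) _ y :=
      (hl y).sin.neg.mul_const (ℓ b)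
    rw [this.fderiv]
    simp
    ring
  have hs : ContDiff ℝ ∞ fun y => -Real.sin (ℓ y + φ) * ℓ b :=
    ((Real.contDiff_sin.comp (ℓ.contDiff.add contDiff_const)).neg).mul contDiff_const
  unfold cosCoeff
  rw [integral_mul_fderiv_slice hf' hK h0' hc u b]
  simp only [h1]
  rw [integral_mul_fderiv_slice hf hK h0 hs u b]
  simp only [h2]
  simp only [neg_mul, mul_assoc]
  rw [integral_neg, integral_const_mul, neg_neg]

lemma integrable_cos_mul_slice {f : E × V → ℝ} (hf : Continuous f) (hK : IsCompact K)
    (h0 : ∀ z : E × V, z.2 ∉ K → f z = 0) (ℓ : V →L[ℝ] ℝ) (φ : ℝ) (u : E) :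
    Integrable (fun y => Real.cos (ℓ y + φ) * f (u, y)) μ :=
  ((contDiff_cos_linear ℓ φ).continuous.mul
    (hf.comp (by fun_prop : Continuous fun y : V => (u, y)))).integrable_of_hasCompactSupport
      (hasCompactSupport_slice hK h0 u).mul_left

lemma cosCoeff_bessel {ι : Type*} [Fintype ι] (b : ι → V) {f : E × V → ℝ} (hf : ContDiff ℝ ∞ f)
    (hK : IsCompact K) (h0 : ∀ z : E × V, z.2 ∉ K → f z = 0) (ℓ : V →L[ℝ] ℝ) (φ : ℝ) (u : E) :
    cosCoeff μ ℓ φ (bessel b f) u = (1 + ∑ a, ℓ (b a) ^ 2) * cosCoeff μ ℓ φ f u := by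
  have hI : ∀ a ∈ Finset.univ, Integrable (fun y => Real.cos (ℓ y + φ) *
      fderiv ℝ (fun z => fderiv ℝ f z (0, b a)) (u, y) (0, b a)) μ := fun a _ =>
    integrable_cos_mul_slice (f := fun z => fderiv ℝ (fun z => fderiv ℝ f z (0, b a)) z (0, b a))
      (contDiff_fderiv_apply_const (contDiff_fderiv_apply_const hf _) _).continuous hK
      (fun z hz => fderiv_apply_eq_zero_of_notMem hK
        (fun z hz => fderiv_apply_eq_zero_of_notMem hK h0 _ z hz) _ z hz) ℓ φ u
  have h1 : cosCoeff μ ℓ φ (bessel b f) u = cosCoeff μ ℓ φ f u - ∑ a,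
      cosCoeff μ ℓ φ (fun z => fderiv ℝ (fun z => fderiv ℝ f z (0, b a)) z (0, b a)) u := by
    unfold cosCoeff bessel
    rw [← integral_finsetSum _ hI, ← integral_sub
      (integrable_cos_mul_slice hf.continuous hK h0 ℓ φ u) (integrable_finsetSum _ hI)]
    simp only [mul_sub, Finset.mul_sum]
  rw [h1]
  simp only [cosCoeff_fderiv_fderiv hf hK h0, Finset.sum_neg_distrib, ← Finset.sum_mul]
  ring

lemma contDiff_iterate_bessel {ι : Type*} [Fintype ι] (b : ι → V) {f : E × V → ℝ}
    (hf : ContDiff ℝ ∞ f) (hK : IsCompact K) (h0 : ∀ z : E × V, z.2 ∉ K → f z = 0) (m : ℕ) :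
    ContDiff ℝ ∞ ((bessel b)^[m] f) ∧ (∀ z : E × V, z.2 ∉ K → (bessel b)^[m] f z = 0) ∧
      ∀ (ℓ : V →L[ℝ] ℝ) (φ : ℝ) (u : E), cosCoeff μ ℓ φ ((bessel b)^[m] f) u =
        (1 + ∑ a, ℓ (b a) ^ 2) ^ m * cosCoeff μ ℓ φ f u := by
  induction m with
  | zero => exact ⟨hf, h0, fun ℓ φ u => by simp⟩
  | succ m ih =>
    obtain ⟨h1, h2, h3⟩ := ih
    rw [Function.iterate_succ_apply']
    refine ⟨contDiff_bessel b h1, bessel_eq_zero_of_notMem b hK h2, fun ℓ φ u => ?_⟩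
    rw [cosCoeff_bessel b h1 hK h2, h3, pow_succ]
    ring

lemma cosCoeff_eq_setIntegral {f : E × V → ℝ}
    (h0 : ∀ z : E × V, z.2 ∉ K → f z = 0) (ℓ : V →L[ℝ] ℝ) (φ : ℝ) :
    cosCoeff μ ℓ φ f = fun u => ∫ y in K, Real.cos (ℓ y + φ) • f (u, y) ∂μ := by
  funext u
  refine (setIntegral_eq_integral_of_forall_compl_eq_zero fun y hy => ?_).symm
  rw [h0 (u, y) hy, mul_zero]

/-- The Fourier coefficients of a smooth family of functions with support in a compact set form a
rapidly decreasing family. -/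
lemma rapidFamily_cosCoeff {I : Type*} [RapidIndex I] {ι : Type*} [Fintype ι] (b : ι → V)
    {f : E × V → ℝ} (hf : ContDiff ℝ ∞ f) (hK : IsCompact K)
    (h0 : ∀ z : E × V, z.2 ∉ K → f z = 0) (ℓ : I → V →L[ℝ] ℝ) (φ : I → ℝ) {D : ℝ} {r : ℕ}
    (hℓ : ∀ i, wt i ≤ D * (1 + ∑ a, ℓ i (b a) ^ 2) ^ r) :
    RapidFamily fun u i => cosCoeff μ (ℓ i) (φ i) f u := by
  have hcm : ∀ i, AEStronglyMeasurable (fun y => Real.cos (ℓ i y + φ i)) (μ.restrict K) := fun i =>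
    (contDiff_cos_linear (ℓ i) (φ i)).continuous.aestronglyMeasurable
  refine ⟨fun i => ?_, fun j m C hC => ?_⟩
  · change ContDiff ℝ ∞ (cosCoeff μ (ℓ i) (φ i) f)
    rw [cosCoeff_eq_setIntegral h0]
    exact contDiff_infty_integral_param hf hK (hcm i) fun y => Real.abs_cos_le_one _
  obtain ⟨h1, h2, h3⟩ := contDiff_iterate_bessel (μ := μ) b hf hK h0 (r * m)
  obtain ⟨B, hB⟩ := bound_iteratedFDeriv_integral_param (μ := μ) j h1 hK hC
  refine ⟨|D| ^ m * B, fun u hu i => ?_⟩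
  have hq : 0 ≤ 1 + ∑ a, ℓ i (b a) ^ 2 := by positivity
  have h4 := hB _ (hcm i) (fun y => Real.abs_cos_le_one _) u hu
  rw [← cosCoeff_eq_setIntegral h2, funext (h3 (ℓ i) (φ i))] at h4
  have h5 : ContDiff ℝ ∞ fun u => cosCoeff μ (ℓ i) (φ i) f u := by
    change ContDiff ℝ ∞ (cosCoeff μ (ℓ i) (φ i) f)
    rw [cosCoeff_eq_setIntegral h0]
    exact contDiff_infty_integral_param hf hK (hcm i) fun y => Real.abs_cos_le_one _
  have h6 := iteratedFDeriv_const_smul_apply (𝕜 := ℝ) (i := j) (x := u)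
    (a := (1 + ∑ a, ℓ i (b a) ^ 2) ^ (r * m))
    (h5.of_le (by exact_mod_cast le_top)).contDiffAt
  have h7 : ((1 + ∑ a, ℓ i (b a) ^ 2) ^ (r * m) • fun u => cosCoeff μ (ℓ i) (φ i) f u) =
      fun u => (1 + ∑ a, ℓ i (b a) ^ 2) ^ (r * m) * cosCoeff μ (ℓ i) (φ i) f u := rfl
  rw [h7] at h6
  rw [h6, norm_smul, Real.norm_of_nonneg (pow_nonneg hq _)] at h4
  calc wt i ^ m * ‖iteratedFDeriv ℝ j (fun u => cosCoeff μ (ℓ i) (φ i) f u) u‖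
      ≤ (|D| * (1 + ∑ a, ℓ i (b a) ^ 2) ^ r) ^ m *
        ‖iteratedFDeriv ℝ j (fun u => cosCoeff μ (ℓ i) (φ i) f u) u‖ := by
        gcongr
        · exact (wt_pos _).le
        · refine (hℓ i).trans ?_
          gcongr
          exact le_abs_self D
    _ = |D| ^ m * ((1 + ∑ a, ℓ i (b a) ^ 2) ^ (r * m) *
        ‖iteratedFDeriv ℝ j (fun u => cosCoeff μ (ℓ i) (φ i) f u) u‖) := by
        rw [mul_pow, pow_mul]; ring
    _ ≤ _ := by gcongr

end Coefficients

namespace RapidIndex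

/-- Transport of weights along a bijection. -/
@[reducible]
def ofEquiv {I J : Type*} [RapidIndex J] (e : I ≃ J) : RapidIndex I where
  wt i := wt (e i)
  one_le i := one_le (e i)
  exists_summable := (exists_summable (I := J)).imp fun _ hm => hm.comp_injective e.injective

instance : RapidIndex ℤ where
  wt k := 1 + |(k : ℝ)|
  one_le k := by simp
  exists_summable := by
    refine ⟨2, Summable.of_norm_bounded_eventually
      (g := fun k : ℤ => 1 / (k : ℝ) ^ 2) (Real.summable_one_div_int_pow.2 one_lt_two) ?_⟩
    filter_upwards [(Set.finite_singleton (0 : ℤ)).compl_mem_cofinite] with k hk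
    have hk : (k : ℝ) ≠ 0 := by simpa using hk
    rw [Real.norm_of_nonneg (by positivity), one_div]
    refine inv_anti₀ (by positivity) ?_
    rw [← sq_abs (k : ℝ)]
    gcongr
    linarith

instance {N : ℕ} : RapidIndex (Fin N) where
  wt _ := 1
  one_le _ := le_rfl
  exists_summable := ⟨0, (hasSum_fintype _).summable⟩

/-- Triples of integers. -/
def tripleEquiv : (Fin 3 → ℤ) ≃ ℤ × ℤ × ℤ where
  toFun n := (n 0, n 1, n 2)
  invFun a := ![a.1, a.2.1, a.2.2]
  left_inv n := by
    ext i
    fin_cases i <;> rfl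
  right_inv _ := rfl

instance : RapidIndex (Fin 3 → ℤ) := ofEquiv tripleEquiv

/-- The index set embeds into `ℕ` with polynomially comparable weights. -/
def Tame (I : Type*) [RapidIndex I] : Prop :=
  ∃ (f : I → ℕ) (r r' : ℕ) (D D' : ℝ), Function.Injective f ∧
    (∀ i, wt (f i) ≤ D * wt i ^ r) ∧ ∀ i, wt i ≤ D' * wt (f i) ^ r'

lemma Tame.prod {I J : Type*} [RapidIndex I] [RapidIndex J] (hI : Tame I) (hJ : Tame J) :
    Tame (I × J) := by
  obtain ⟨f, r, r', D, D', hf, h1, h2⟩ := hI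
  obtain ⟨g, s, s', B, B', hg, h3, h4⟩ := hJ
  have hD : ∀ i, wt (f i) ≤ |D| * wt i ^ r := fun i => (h1 i).trans
    (mul_le_mul_of_nonneg_right (le_abs_self D) (pow_pos' _ _).le)
  have hB : ∀ i, wt (g i) ≤ |B| * wt i ^ s := fun i => (h3 i).trans
    (mul_le_mul_of_nonneg_right (le_abs_self B) (pow_pos' _ _).le)
  have hD' : ∀ i, wt i ≤ |D'| * wt (f i) ^ r' := fun i => (h2 i).trans
    (mul_le_mul_of_nonneg_right (le_abs_self D') (pow_pos' _ _).le)
  have hB' : ∀ i, wt i ≤ |B'| * wt (g i) ^ s' := fun i => (h4 i).trans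
    (mul_le_mul_of_nonneg_right (le_abs_self B') (pow_pos' _ _).le)
  refine ⟨fun i => Nat.pair (f i.1) (g i.2), (r + s) * 2, r' + s', (|D| * |B|) ^ 2, |D'| * |B'|,
    fun i j h => ?_, fun i => ?_, fun i => ?_⟩
  · have := Nat.pair_eq_pair.1 h
    exact Prod.ext (hf this.1) (hg this.2)
  · have h := Nat.pair_lt_max_add_one_sq (f i.1) (g i.2)
    have h5 : max (f i.1) (g i.2) + 1 ≤ (f i.1 + 1) * (g i.2 + 1) := by
      rcases max_cases (f i.1) (g i.2) with ⟨h, -⟩ | ⟨h, -⟩ <;> rw [h] <;> nlinarith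
    have h6 : Nat.pair (f i.1) (g i.2) + 1 ≤ ((f i.1 + 1) * (g i.2 + 1)) ^ 2 :=
      (Nat.succ_le_of_lt h).trans (Nat.pow_le_pow_left h5 2)
    have h7 : wt (Nat.pair (f i.1) (g i.2)) ≤ (wt (f i.1) * wt (g i.2)) ^ 2 := by
      change ((Nat.pair (f i.1) (g i.2) : ℕ) : ℝ) + 1 ≤ (((f i.1 : ℝ) + 1) * (g i.2 + 1)) ^ 2
      exact_mod_cast h6
    have h8 : wt (f i.1) * wt (g i.2) ≤ |D| * |B| * wt i ^ (r + s) := by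
      have hw : wt i = wt i.1 * wt i.2 := rfl
      calc wt (f i.1) * wt (g i.2) ≤ (|D| * wt i.1 ^ r) * (|B| * wt i.2 ^ s) :=
            mul_le_mul (hD _) (hB _) (wt_pos _).le (mul_nonneg (abs_nonneg _) (pow_pos' _ _).le)
        _ = |D| * |B| * (wt i.1 ^ r * wt i.2 ^ s) := by ring
        _ ≤ |D| * |B| * wt i ^ (r + s) := by
          rw [hw, mul_pow]
          have a1 := pow_le_pow_right₀ (one_le i.1) (Nat.le_add_right r s)
          have a2 := pow_le_pow_right₀ (one_le i.2) (Nat.le_add_left s r)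
          have a3 := (pow_pos' i.1 r).le
          have a4 := (pow_pos' i.2 s).le
          have a5 := (pow_pos' i.1 (r + s)).le
          gcongr
    calc _ ≤ (wt (f i.1) * wt (g i.2)) ^ 2 := h7
      _ ≤ (|D| * |B| * wt i ^ (r + s)) ^ 2 :=
        pow_le_pow_left₀ (mul_pos (wt_pos _) (wt_pos _)).le h8 2
      _ = _ := by rw [mul_pow, pow_mul]
  · have h5 : wt (f i.1) ≤ wt (Nat.pair (f i.1) (g i.2)) := by
      change ((f i.1 : ℕ) : ℝ) + 1 ≤ ((Nat.pair (f i.1) (g i.2) : ℕ) : ℝ) + 1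
      exact_mod_cast Nat.succ_le_succ (Nat.left_le_pair _ _)
    have h6 : wt (g i.2) ≤ wt (Nat.pair (f i.1) (g i.2)) := by
      change ((g i.2 : ℕ) : ℝ) + 1 ≤ ((Nat.pair (f i.1) (g i.2) : ℕ) : ℝ) + 1
      exact_mod_cast Nat.succ_le_succ (Nat.right_le_pair _ _)
    have a1 := pow_le_pow_left₀ (wt_pos _).le h5 r'
    have a2 := pow_le_pow_left₀ (wt_pos _).le h6 s'
    have a3 := (pow_pos' (f i.1) r').le
    have a4 := (pow_pos' (g i.2) s').le
    have a5 := (pow_pos' (Nat.pair (f i.1) (g i.2)) r').le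
    calc wt i = wt i.1 * wt i.2 := rfl
      _ ≤ (|D'| * wt (f i.1) ^ r') * (|B'| * wt (g i.2) ^ s') :=
        mul_le_mul (hD' _) (hB' _) (wt_pos _).le (mul_nonneg (abs_nonneg _) (pow_pos' _ _).le)
      _ = |D'| * |B'| * (wt (f i.1) ^ r' * wt (g i.2) ^ s') := by ring
      _ ≤ _ := by
        rw [pow_add]
        gcongr

lemma tame_int : Tame ℤ := by
  refine ⟨Equiv.intEquivNat, 1, 1, 2, 1, Equiv.intEquivNat.injective, fun k => ?_, fun k => ?_⟩ <;>
  · simp only [wt]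
    rcases k with k | k
    · have h : ((Int.ofNat k : ℤ) : ℝ) = k := by simp
      have hk : (0 : ℝ) ≤ k := Nat.cast_nonneg k
      have he : Equiv.intEquivNat (Int.ofNat k) = 2 * k := rfl
      rw [h, he, abs_of_nonneg hk]
      push_cast
      linarith
    · have h : ((Int.negSucc k : ℤ) : ℝ) = -(k + 1) := by simp [Int.cast_negSucc]
      have hk : (0 : ℝ) ≤ k := Nat.cast_nonneg k
      have he : Equiv.intEquivNat (Int.negSucc k) = 2 * k + 1 := rfl
      rw [h, he, abs_neg, abs_of_nonneg (by positivity)]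
      push_cast
      linarith

lemma tame_fin {N : ℕ} : Tame (Fin N) := by
  refine ⟨Fin.val, 1, 0, N, 1, Fin.val_injective, fun i => ?_, fun i => ?_⟩
  · have : ((i : ℕ) : ℝ) + 1 ≤ N := by exact_mod_cast i.2
    simpa [wt] using this
  · simp [wt]

lemma tame_triple : Tame (Fin 3 → ℤ) := by
  obtain ⟨f, r, r', D, D', hf, h⟩ := tame_int.prod (tame_int.prod tame_int)
  exact ⟨f ∘ tripleEquiv, r, r', D, D', hf.comp tripleEquiv.injective,
    fun i => h.1 _, fun i => h.2 _⟩

lemma Tame.smoothSummand {I : Type*} [RapidIndex I] (h : Tame I) :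
    SmoothSummand (Rapid I) (Rapid ℕ) := by
  obtain ⟨f, r, r', D, D', hf, h1, h2⟩ := h
  exact smoothSummand_of_injective hf h1 h2

end RapidIndex

/-! ### Fourier expansion of functions supported in a cube -/

section Expansion

/-- The frequencies of Fourier series in three variables. -/
def freq (n : Fin 3 → ℤ) : (Fin 3 → ℝ) →L[ℝ] ℝ :=
  ∑ j, (2 * Real.pi * n j) • ContinuousLinearMap.proj (R := ℝ) (φ := fun _ : Fin 3 => ℝ) j

lemma freq_apply (n : Fin 3 → ℤ) (x : Fin 3 → ℝ) : freq n x = ∑ j, 2 * Real.pi * n j * x j := by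
  simp [freq]

/-- The phases for cosines and sines. -/
def phase (ε : Fin 2) : ℝ := if ε = 0 then 0 else -(Real.pi / 2)

lemma wt_triple_le (i : (Fin 3 → ℤ) × Fin 2) :
    wt i ≤ 8 * (1 + ∑ a : Fin 3, freq i.1 (Pi.single a 1) ^ 2) ^ 3 := by
  obtain ⟨n, ε⟩ := i
  have h1 : wt ((n, ε) : (Fin 3 → ℤ) × Fin 2) =
      (1 + |(n 0 : ℝ)|) * ((1 + |(n 1 : ℝ)|) * (1 + |(n 2 : ℝ)|)) * 1 := rfl
  have h2 : ∀ a, freq n (Pi.single a 1) = 2 * Real.pi * n a := fun a => by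
    rw [freq_apply]
    simp [Pi.single_apply]
  set q := 1 + ∑ a : Fin 3, freq n (Pi.single a 1) ^ 2 with hq
  have h3 : ∀ a, 1 + |(n a : ℝ)| ≤ 2 * q := fun a => by
    have h4 : freq n (Pi.single a 1) ^ 2 ≤ ∑ a : Fin 3, freq n (Pi.single a 1) ^ 2 :=
      Finset.single_le_sum (f := fun a => freq n (Pi.single a 1) ^ 2)
        (fun _ _ => sq_nonneg _) (Finset.mem_univ a)
    have h5 : |(n a : ℝ)| ^ 2 ≤ freq n (Pi.single a 1) ^ 2 := by
      rw [h2, mul_pow, sq_abs]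
      have : 1 ≤ (2 * Real.pi) ^ 2 := by nlinarith [Real.pi_gt_three]
      nlinarith [sq_nonneg (n a : ℝ)]
    nlinarith [sq_nonneg (|(n a : ℝ)| - 1)]
  have hq0 : 0 ≤ q := by positivity
  rw [h1, mul_one]
  calc _ ≤ (2 * q) * ((2 * q) * (2 * q)) := by
        have := h3 0
        have := h3 1
        have := h3 2
        gcongr
    _ = 8 * q ^ 3 := by ring

/-- A compactly supported function in the unit cube as a function on the torus. -/
lemma exists_torus_function {h : (Fin 3 → ℝ) → ℝ} (hh : Continuous h) {K : Set (Fin 3 → ℝ)}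
    (hK : IsCompact K) (h0 : ∀ x ∉ K, h x = 0) (hKc : ∀ x ∈ K, ∀ i, |x i| < 1 / 2) :
    ∃ H : C(UnitAddTorus (Fin 3), ℂ), ∀ x : Fin 3 → ℝ,
      (∀ i, x i ∈ Set.Ioc (-(1 / 2) : ℝ) (-(1 / 2) + 1)) → H (fun i => x i) = (h x : ℂ) := by
  let pr : (Fin 3 → ℝ) → UnitAddTorus (Fin 3) := fun x i => x i
  let rep : UnitAddTorus (Fin 3) → (Fin 3 → ℝ) := fun t i =>
    (AddCircle.equivIoc (1 : ℝ) (-(1 / 2)) (t i)).1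
  have hrep : ∀ t, pr (rep t) = t := fun t => funext fun i =>
    (AddCircle.equivIoc (1 : ℝ) (-(1 / 2))).symm_apply_apply (t i)
  have hrep' : ∀ x : Fin 3 → ℝ, (∀ i, x i ∈ Set.Ioc (-(1 / 2) : ℝ) (-(1 / 2) + 1)) →
      rep (pr x) = x := fun x hx => funext fun i =>
    congrArg Subtype.val ((AddCircle.equivIoc (1 : ℝ) (-(1 / 2))).apply_symm_apply ⟨x i, hx i⟩)
  have hprc : Continuous pr := continuous_pi fun i =>
    (AddCircle.continuous_mk' (1 : ℝ)).comp (continuous_apply i)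
  have hpro : IsOpenMap pr := IsOpenMap.piMap (fun _ => QuotientAddGroup.isOpenMap_coe)
    (Filter.Eventually.of_forall fun _ => QuotientAddGroup.mk_surjective)
  have hcube : IsOpen {x : Fin 3 → ℝ | ∀ i, |x i| < 1 / 2} := by
    simp only [Set.ofPred_forall]
    exact isOpen_iInter_of_finite fun i => isOpen_lt (by fun_prop) continuous_const
  have hIoc : ∀ x : Fin 3 → ℝ, (∀ i, |x i| < 1 / 2) →
      ∀ i, x i ∈ Set.Ioc (-(1 / 2) : ℝ) (-(1 / 2) + 1) := fun x hx i =>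
    ⟨(abs_lt.1 (hx i)).1, by linarith [(abs_lt.1 (hx i)).2]⟩
  have hcont : Continuous fun t => (h (rep t) : ℂ) := by
    refine continuous_iff_continuousAt.2 fun t => ?_
    by_cases ht : t ∈ pr '' K
    · obtain ⟨x, hx, rfl⟩ := ht
      have hm : Filter.map pr (𝓝 x) = 𝓝 (pr x) :=
        le_antisymm hprc.continuousAt (hpro.nhds_le x)
      unfold ContinuousAt
      rw [← hm, Filter.tendsto_map'_iff]
      have he : ((fun t => (h (rep t) : ℂ)) ∘ pr) =ᶠ[𝓝 x] fun x => (h x : ℂ) := by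
        filter_upwards [hcube.mem_nhds (hKc x hx)] with y hy
        simp only [Function.comp_apply, hrep' y (hIoc y hy)]
      change Filter.Tendsto _ _ (𝓝 (h (rep (pr x)) : ℂ))
      rw [hrep' x (hIoc x (hKc x hx))]
      exact ((Complex.continuous_ofReal.comp hh).tendsto x).congr' he.symm
    · have he : (fun t => (h (rep t) : ℂ)) =ᶠ[𝓝 t] fun _ => 0 := by
        filter_upwards [(hK.image hprc).isClosed.isOpen_compl.mem_nhds ht] with s hs
        rw [h0 (rep s) fun hr => hs ⟨rep s, hr, hrep s⟩, Complex.ofReal_zero]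
      exact continuousAt_const.congr he.symm
  exact ⟨⟨_, hcont⟩, fun x hx => by
    change (h (rep (pr x)) : ℂ) = h x
    rw [hrep' x hx]⟩

lemma mFourier_coe (n : Fin 3 → ℤ) (x : Fin 3 → ℝ) :
    UnitAddTorus.mFourier n (fun i => (x i : UnitAddCircle)) =
      Complex.exp ((freq n x : ℝ) * Complex.I) := by
  have : UnitAddTorus.mFourier n (fun i => (x i : UnitAddCircle)) =
      ∏ i, fourier (n i) (x i : UnitAddCircle) := rfl
  rw [this]
  simp only [fourier_coe_apply]
  rw [← Complex.exp_sum, freq_apply]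
  congr 1
  push_cast
  rw [Finset.sum_mul]
  refine Finset.sum_congr rfl fun i _ => ?_
  ring

variable {E : Type} [NormedAddCommGroup E] [NormedSpace ℝ E] [FiniteDimensional ℝ E]
  {K : Set (Fin 3 → ℝ)}

/-- The real Fourier coefficients of `f(u, ·)`. -/
def cubeCoeff (f : E × (Fin 3 → ℝ) → ℝ) (u : E) (i : (Fin 3 → ℤ) × Fin 2) : ℝ :=
  cosCoeff volume (freq i.1) (phase i.2) f u

/-- The real Fourier basis. -/
def cubeBasis (x : Fin 3 → ℝ) (i : (Fin 3 → ℤ) × Fin 2) : ℝ := Real.cos (freq i.1 x + phase i.2)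

lemma rapidFamily_cubeCoeff {f : E × (Fin 3 → ℝ) → ℝ} (hf : ContDiff ℝ ∞ f) (hK : IsCompact K)
    (h0 : ∀ z : E × (Fin 3 → ℝ), z.2 ∉ K → f z = 0) : RapidFamily (cubeCoeff f) :=
  rapidFamily_cosCoeff (μ := volume) (fun a : Fin 3 => (Pi.single a 1 : Fin 3 → ℝ)) hf hK h0
    (fun i : (Fin 3 → ℤ) × Fin 2 => freq i.1) (fun i => phase i.2) wt_triple_le

lemma summable_rapid {I : Type*} [RapidIndex I] (c : Rapid I) : Summable fun i => |c.1 i| := by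
  obtain ⟨m, hm⟩ := exists_summable (I := I)
  obtain ⟨C, hC⟩ := c.2 m
  refine Summable.of_nonneg_of_le (fun i => abs_nonneg _) (fun i => ?_) (hm.mul_left C)
  rw [← div_eq_mul_inv, le_div_iff₀' (pow_pos' _ _)]
  exact hC i

lemma tsum_cubeCoeff_mul_cubeBasis {f : E × (Fin 3 → ℝ) → ℝ} (hf : ContDiff ℝ ∞ f)
    (hK : IsCompact K) (h0 : ∀ z : E × (Fin 3 → ℝ), z.2 ∉ K → f z = 0)
    (hKc : ∀ x ∈ K, ∀ i, |x i| < 1 / 2) (u : E) (x : Fin 3 → ℝ) (hx : ∀ i, |x i| < 1 / 2) :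
    ∑' i, cubeBasis x i * cubeCoeff f u i = f (u, x) := by
  have hfu : Continuous fun y => f (u, y) := hf.continuous.comp (by fun_prop)
  obtain ⟨H, hH⟩ := exists_torus_function hfu hK (fun x hx => h0 (u, x) hx) hKc
  have hIoc : ∀ i, x i ∈ Set.Ioc (-(1 / 2) : ℝ) (-(1 / 2) + 1) := fun i =>
    ⟨(abs_lt.1 (hx i)).1, by linarith [(abs_lt.1 (hx i)).2]⟩
  have hrap := summable_rapid ⟨_, (rapidFamily_cubeCoeff hf hK h0).mem u⟩
  have hb : ∀ i, |cubeBasis x i| ≤ 1 := fun i => Real.abs_cos_le_one _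
  have hsum : Summable fun i => cubeBasis x i * cubeCoeff f u i :=
    Summable.of_norm_bounded hrap fun i => by
      rw [Real.norm_eq_abs, abs_mul]
      exact mul_le_of_le_one_left (abs_nonneg _) (hb i)
  have hcoeff : ∀ n, UnitAddTorus.mFourierCoeff H n =
      (cubeCoeff f u (n, 0) : ℂ) - cubeCoeff f u (n, 1) * Complex.I := by
    intro n
    rw [UnitAddTorus.mFourierCoeff_eq_integral H n (fun _ => -(1 / 2))]
    have hmeas : MeasurableSet {x : Fin 3 → ℝ | ∀ i, x i ∈ Set.Ioc (-(1 / 2) : ℝ) (-(1 / 2) + 1)} :=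
      MeasurableSet.univ_pi' fun i => measurableSet_Ioc
    rw [setIntegral_congr_fun hmeas (g := fun y => ((Real.cos (freq n y + phase 0) * f (u, y) : ℝ) : ℂ)
      - ((Real.cos (freq n y + phase 1) * f (u, y) : ℝ) : ℂ) * Complex.I) fun y hy => ?_,
      setIntegral_eq_integral_of_forall_compl_eq_zero fun y hy => ?_, integral_sub,
      integral_mul_const, integral_complex_ofReal, integral_complex_ofReal]
    · rfl
    · exact (integrable_cos_mul_slice hf.continuous hK h0 (freq n) (phase 0) u).ofReal
    · exact (integrable_cos_mul_slice hf.continuous hK h0 (freq n) (phase 1) u).ofReal.mul_const _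
    · have : y ∉ K := fun hyK => hy fun i => ⟨(abs_lt.1 (hKc y hyK i)).1, by
        linarith [(abs_lt.1 (hKc y hyK i)).2]⟩
      simp [h0 (u, y) this]
    · simp only [hH y hy]
      rw [UnitAddTorus.mFourier_neg, mFourier_coe, ← Complex.exp_conj]
      simp only [map_mul, Complex.conj_ofReal, Complex.conj_I, mul_neg, smul_eq_mul]
      rw [← neg_mul, Complex.exp_mul_I, Complex.cos_neg, Complex.sin_neg]
      simp only [phase, if_true, add_zero, if_neg (one_ne_zero : (1 : Fin 2) ≠ 0),
        ← sub_eq_add_neg, Real.cos_sub_pi_div_two]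
      push_cast
      ring
  have hs : Summable (UnitAddTorus.mFourierCoeff H) := by
    have h1 : Summable fun n => |cubeCoeff f u (n, 0)| :=
      hrap.comp_injective (i := fun n => (n, 0)) fun a b h => (Prod.ext_iff.1 h).1
    have h2 : Summable fun n => |cubeCoeff f u (n, 1)| :=
      hrap.comp_injective (i := fun n => (n, 1)) fun a b h => (Prod.ext_iff.1 h).1
    refine Summable.of_norm_bounded (h1.add h2) fun n => ?_
    rw [hcoeff]
    refine (norm_sub_le _ _).trans ?_
    simp
  have key := UnitAddTorus.hasSum_mFourier_series_apply_of_summable hs (fun i => (x i : UnitAddCircle))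
  rw [hH x hIoc] at key
  have key2 := Complex.hasSum_re key
  rw [Complex.ofReal_re] at key2
  rw [hsum.tsum_prod, ← key2.tsum_eq]
  refine tsum_congr fun n => ?_
  rw [tsum_fintype, Fin.sum_univ_two, hcoeff, mFourier_coe]
  simp only [cubeBasis, phase, if_true, add_zero, if_neg (one_ne_zero : (1 : Fin 2) ≠ 0),
    ← sub_eq_add_neg, Real.cos_sub_pi_div_two, smul_eq_mul, Complex.exp_mul_I]
  simp [← Complex.ofReal_cos, ← Complex.ofReal_sin]
  ring

/-- Sines and cosines form a family of polynomial growth. -/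
lemma bounded_iteratedFDeriv_cos (j : ℕ) : ∃ C, ∀ x, ‖iteratedFDeriv ℝ j Real.cos x‖ ≤ C := by
  refine ⟨1, fun x => ?_⟩
  rw [norm_iteratedFDeriv_eq_norm_iteratedDeriv]
  rcases Nat.even_or_odd' j with ⟨k, rfl | rfl⟩
  · rw [Real.iteratedDeriv_even_cos]
    simp [Real.abs_cos_le_one]
  · rw [Real.iteratedDeriv_odd_cos]
    simp [Real.abs_sin_le_one]

lemma polyFamily_cubeBasis : PolyFamily cubeBasis := by
  have h1 : ∀ j : Fin 3, PolyFamily fun (x : Fin 3 → ℝ) (i : (Fin 3 → ℤ) × Fin 2) =>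
      2 * Real.pi * i.1 j * x j := by
    intro j
    refine PolyFamily.mul (polyFamily_const_seq (m := 1) (C := 2 * Real.pi) fun i => ?_)
      (polyFamily_const (contDiff_apply ℝ ℝ j))
    have h2 : wt i = (1 + |(i.1 0 : ℝ)|) * ((1 + |(i.1 1 : ℝ)|) * (1 + |(i.1 2 : ℝ)|)) * 1 := rfl
    rw [abs_mul, abs_of_nonneg (by positivity : 0 ≤ 2 * Real.pi), pow_one, h2]
    refine mul_le_mul_of_nonneg_left ?_ (by positivity)
    have a0 := abs_nonneg (i.1 0 : ℝ)
    have a1 := abs_nonneg (i.1 1 : ℝ)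
    have a2 := abs_nonneg (i.1 2 : ℝ)
    have b0 := mul_nonneg a0 a1
    have b1 := mul_nonneg a1 a2
    have b2 := mul_nonneg a0 a2
    have b3 := mul_nonneg b0 a2
    fin_cases j <;> simp only [Fin.zero_eta, Fin.mk_one, Fin.reduceFinMk] <;> nlinarith
  have h3 : PolyFamily fun (x : Fin 3 → ℝ) (i : (Fin 3 → ℤ) × Fin 2) => phase i.2 :=
    polyFamily_const_seq (m := 0) (C := Real.pi / 2) fun i => by
      have := Real.pi_pos
      simp only [phase]
      split_ifs
      · simp; positivity
      · rw [abs_neg, abs_of_pos (by positivity)]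
        simp
  have h4 := (((h1 0).add (h1 1)).add (h1 2)).add h3
  have h5 := h4.bounded_comp Real.contDiff_cos bounded_iteratedFDeriv_cos
  convert h5 using 3 with x i
  simp only [cubeBasis, freq_apply, Fin.sum_univ_three]

end Expansion

/-! ### Smooth functions -/

section SmoothFn

variable (M : Type*) [TopologicalSpace M] [ChartedSpace R3 M]

/-- Smooth real functions on `M`. -/
abbrev SmoothFn : Type _ := C^∞⟮𝓡 3, M; 𝓘(ℝ, ℝ), ℝ⟯

variable {M}

instance instDiffeologicalSpaceSmoothFn : DiffeologicalSpace (SmoothFn M) :=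
  .ofCorePlotsOn {
    isPlotOn := fun {n u} _ p =>
      ContMDiffOn (𝓘(ℝ, 𝔼 n).prod (𝓡 3)) 𝓘(ℝ, ℝ) ∞
        (fun z : 𝔼 n × M => p z.1 z.2) (u ×ˢ Set.univ)
    isPlotOn_congr := fun _ p q h =>
      contMDiffOn_congr fun z hz => by rw [h hz.1]
    isPlot := fun {n} p =>
      ContMDiff (𝓘(ℝ, 𝔼 n).prod (𝓡 3)) 𝓘(ℝ, ℝ) ∞
        (fun z : 𝔼 n × M => p z.1 z.2)
    isPlotOn_univ := by
      intro n p
      rw [Set.univ_prod_univ, contMDiffOn_univ]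
    isPlot_const := fun s => s.contMDiff.comp contMDiff_snd
    isPlotOn_reparam := by
      intro n m u v hu hv p f h hp hf
      have hg : ContMDiffOn (𝓘(ℝ, 𝔼 m).prod (𝓡 3))
          (𝓘(ℝ, 𝔼 n).prod (𝓡 3)) ∞
          (fun z : 𝔼 m × M => (f z.1, z.2)) (v ×ˢ Set.univ) :=
        ContMDiffOn.prodMk (hf.contMDiffOn.comp contMDiff_fst.contMDiffOn fun z hz => hz.1)
          contMDiff_snd.contMDiffOn
      exact hp.comp hg fun z hz => ⟨h hz.1, trivial⟩
    locality := by
      intro n u hu p h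
      refine contMDiffOn_of_locally_contMDiffOn fun z hz => ?_
      obtain ⟨v, hv, hx, h'⟩ := h z.1 hz.1
      exact ⟨v ×ˢ Set.univ, hv.prod isOpen_univ, ⟨hx, trivial⟩, h'.mono Set.inter_subset_right⟩ }

lemma isPlot_smoothFn_iff {n : ℕ} {p : 𝔼 n → SmoothFn M} :
    IsPlot p ↔ ContMDiff (𝓘(ℝ, 𝔼 n).prod (𝓡 3)) 𝓘(ℝ, ℝ) ∞
      (fun z : 𝔼 n × M => p z.1 z.2) := Iff.rfl

instance : DiffeologicalModule (SmoothFn M) where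
  isPlot_add hp hq := ContMDiff.add hp hq
  isPlot_smul hf hp := (hf.contMDiff.comp contMDiff_fst).smul hp

/-- Evaluation of a smooth family of functions along a smooth map. -/
lemma isPlot_smoothFn_comp {n : ℕ} {p : 𝔼 n → SmoothFn M} (hp : IsPlot p)
    {V : Type*} [NormedAddCommGroup V] [NormedSpace ℝ V] {Γ : V → M}
    (hΓ : ContMDiff 𝓘(ℝ, V) (𝓡 3) ∞ Γ) :
    ContDiff ℝ ∞ fun z : 𝔼 n × V => p z.1 (Γ z.2) := by
  rw [← contMDiff_iff_contDiff]
  exact (isPlot_smoothFn_iff.1 hp).comp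
    (contDiff_fst.contMDiff.prodMk (hΓ.comp contDiff_snd.contMDiff))

lemma contMDiff_comp_prodMk {E V F : Type*} [NormedAddCommGroup E] [NormedSpace ℝ E]
    [NormedAddCommGroup V] [NormedSpace ℝ V] [NormedAddCommGroup F] [NormedSpace ℝ F]
    {f : E × V → F} (hf : ContDiff ℝ ∞ f) {Θ : M → V} (hΘ : ContMDiff (𝓡 3) 𝓘(ℝ, V) ∞ Θ) :
    ContMDiff (𝓘(ℝ, E).prod (𝓡 3)) 𝓘(ℝ, F) ∞ fun z : E × M => f (z.1, Θ z.2) := by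
  have h2 : ContMDiff (𝓘(ℝ, E).prod (𝓡 3)) 𝓘(ℝ, E × V) ∞ fun z : E × M => (z.1, Θ z.2) :=
    contMDiff_fst.prodMk_space (hΘ.comp contMDiff_snd)
  exact ContMDiff.comp (g := f) hf.contMDiff h2

lemma contMDiff_slice {E F : Type*} [NormedAddCommGroup E] [NormedSpace ℝ E]
    [NormedAddCommGroup F] [NormedSpace ℝ F] {f : E × M → F}
    (hf : ContMDiff (𝓘(ℝ, E).prod (𝓡 3)) 𝓘(ℝ, F) ∞ f) (u : E) :
    ContMDiff (𝓡 3) 𝓘(ℝ, F) ∞ fun x => f (u, x) :=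
  hf.comp (contMDiff_const.prodMk contMDiff_id)

variable [IsManifold (𝓡 3) ∞ M] [T2Space M]

/-- Globally defined smooth maps that are inverse to each other near a point, and cutoffs. -/
lemma exists_patch (x₀ : M) {s : Set M} (hs : s ∈ 𝓝 x₀) :
    ∃ (Γ : R3 → M) (Θ : M → R3) (b : R3 → ℝ) (β : M → ℝ),
      ContMDiff (𝓡 3) (𝓡 3) ∞ Γ ∧ ContMDiff (𝓡 3) (𝓡 3) ∞ Θ ∧ ContDiff ℝ ∞ b ∧
      ContMDiff (𝓡 3) 𝓘(ℝ, ℝ) ∞ β ∧ (∀ y, Γ y ∈ s) ∧ (∀ y, ‖y‖ ≤ 2 → Θ (Γ y) = y) ∧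
      (∀ y, b y ≠ 0 → ‖y‖ ≤ 1 / 4) ∧
      (∀ x, β x ≠ 0 → Γ (Θ x) = x ∧ b (Θ x) = β x ∧ ‖Θ x‖ ≤ 1 / 4) ∧ β x₀ = 1 := by
  set φ := chartAt R3 x₀ with hφ
  have hx : x₀ ∈ φ.source := mem_chart_source R3 x₀
  have hnhds : φ.target ∩ φ.symm ⁻¹' s ∈ 𝓝 (φ x₀) := by
    refine Filter.inter_mem (φ.open_target.mem_nhds (φ.map_source hx)) ?_
    refine (φ.continuousAt_symm (φ.map_source hx)).preimage_mem_nhds ?_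
    rwa [φ.left_inv hx]
  obtain ⟨R, hR, hball⟩ := Metric.nhds_basis_closedBall.mem_iff.1 hnhds
  have hext : extChartAt (𝓡 3) x₀ x₀ = φ x₀ := rfl
  have hsub : Metric.closedBall (extChartAt (𝓡 3) x₀ x₀) R ∩ Set.range (𝓡 3) ⊆
      (extChartAt (𝓡 3) x₀).target := by
    rintro y ⟨hy, -⟩
    simpa [extChartAt] using (hball hy).1
  let B : SmoothBumpFunction (𝓡 3) x₀ := ⟨⟨R / 2, R, half_pos hR, half_lt_self hR⟩, hsub⟩
  let β : SmoothBumpFunction (𝓡 3) x₀ := ⟨⟨R / 64, R / 32, by positivity, by linarith⟩,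
    (Set.inter_subset_inter_left _ (Metric.closedBall_subset_closedBall (by linarith))).trans hsub⟩
  let h : ContDiffBump (0 : R3) := ⟨3, 4, by norm_num, by norm_num⟩
  have hh : ∀ y, ‖(R / 8) • h y • y‖ ≤ R / 2 := fun y => by
    rw [norm_smul, Real.norm_of_nonneg (by positivity)]
    have : ‖h y • y‖ ≤ 4 := by
      by_cases hy : ‖y‖ ≤ 4
      · rw [norm_smul, Real.norm_of_nonneg h.nonneg]
        have := h.le_one (x := y)
        have h0 := h.nonneg (x := y)
        nlinarith [norm_nonneg y]
      · rw [h.zero_of_le_dist (by simpa using (not_le.1 hy).le)]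
        simp
    nlinarith
  have hmem : ∀ y, φ x₀ + (R / 8) • h y • y ∈ Metric.closedBall (φ x₀) (R / 2) := fun y => by
    simpa using hh y
  have hmem' : ∀ y, φ x₀ + (R / 8) • h y • y ∈ Metric.closedBall (φ x₀) R := fun y =>
    Metric.closedBall_subset_closedBall (by linarith) (hmem y)
  have hB : ∀ x ∈ φ.source, φ x ∈ Metric.closedBall (φ x₀) (R / 2) → B x = 1 := fun x hx1 hx2 =>
    B.one_of_dist_le hx1 hx2
  have hβ : ∀ x, β x ≠ 0 → x ∈ φ.source ∧ dist (φ x) (φ x₀) < R / 32 := fun x hx1 => by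
    have : x ∈ Function.support β := hx1
    rw [β.support_eq_inter_preimage] at this
    exact this
  have hchart : ContMDiffOn (𝓡 3) (𝓡 3) ∞ φ φ.source := contMDiffOn_chart
  refine ⟨fun y => φ.symm (φ x₀ + (R / 8) • h y • y), fun x => B x • (8 / R) • (φ x - φ x₀),
    fun y => β.toContDiffBump (φ x₀ + (R / 8) • y), β, ?_, ?_, ?_, β.contMDiff,
    fun y => (hball (hmem' y)).2, fun y hy => ?_, fun y hy => ?_, fun x hx1 => ?_, ?_⟩
  · refine (contMDiffOn_chart_symm (I := 𝓡 3) (x := x₀)).comp_contMDiff (ContDiff.contMDiff ?_)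
      fun y => (hball (hmem' y)).1
    have := h.contDiff (n := ⊤)
    exact contDiff_const.add (ContDiff.const_smul _ (this.fun_smul contDiff_id))
  · refine B.contMDiff_smul (ContMDiffOn.comp (t := Set.univ) (g := fun y => (8 / R) • (y - φ x₀))
      (ContDiff.contMDiff ?_).contMDiffOn hchart fun _ _ => trivial)
    fun_prop
  · exact β.toContDiffBump.contDiff.comp (by fun_prop)
  · have h1 : h y = 1 := h.one_of_mem_closedBall (by simpa using hy.trans (by norm_num))
    have h2 := φ.right_inv (hball (hmem' y)).1
    have h3 : B (φ.symm (φ x₀ + (R / 8) • h y • y)) = 1 :=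
      hB _ (φ.map_target (hball (hmem' y)).1) (by rw [h2]; exact hmem y)
    simp only [h3, h2]
    rw [h1, one_smul, one_smul, add_sub_cancel_left, smul_smul, show 8 / R * (R / 8) = 1 by field_simp, one_smul]
  · have h1 : φ x₀ + (R / 8) • y ∈ Function.support β.toContDiffBump := hy
    rw [β.toContDiffBump.support_eq] at h1
    have h2 : ‖(R / 8) • y‖ < R / 32 := by
      have h3 : dist (φ x₀ + (R / 8) • y) (φ x₀) < R / 32 := h1
      simpa using h3
    rw [norm_smul, Real.norm_of_nonneg (by positivity)] at h2
    nlinarith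
  · obtain ⟨h1, h2⟩ := hβ x hx1
    have h3 : B x = 1 := hB x h1 (by rw [Metric.mem_closedBall]; linarith)
    have h4 : ‖(8 / R) • (φ x - φ x₀)‖ ≤ 1 / 4 := by
      rw [norm_smul, Real.norm_of_nonneg (by positivity), ← dist_eq_norm]
      calc 8 / R * dist (φ x) (φ x₀) ≤ 8 / R * (R / 32) := by gcongr
        _ = 1 / 4 := by field_simp; norm_num
    have h5 : φ x₀ + (R / 8) • (8 / R) • (φ x - φ x₀) = φ x := by
      rw [smul_smul, div_mul_div_cancel₀ (by norm_num), div_self hR.ne', one_smul, add_sub_cancel]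
    have h6 : h ((8 / R) • (φ x - φ x₀)) = 1 :=
      h.one_of_mem_closedBall (by simpa using h4.trans (by norm_num))
    simp only [h3, one_smul, h6, h5]
    refine ⟨φ.left_inv h1, ?_, h4⟩
    exact (β.eqOn_source h1).symm
  · exact β.eq_one

/-- The map from coordinates to `R3`. -/
def toR3 : (Fin 3 → ℝ) ≃L[ℝ] R3 := (EuclideanSpace.equiv (Fin 3) ℝ).symm

lemma abs_le_norm_toR3 (y : Fin 3 → ℝ) (i : Fin 3) : |y i| ≤ ‖toR3 y‖ := by
  have := PiLp.norm_apply_le (toR3 y) i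
  rwa [Real.norm_eq_abs] at this

lemma rapidFamily_fin_prod {E : Type*} [NormedAddCommGroup E] [NormedSpace ℝ E] {I : Type*}
    [RapidIndex I] {N : ℕ} {c : E → Fin N × I → ℝ} (h : ∀ a, RapidFamily fun u i => c u (a, i)) :
    RapidFamily c := by
  refine ⟨fun i => (h i.1).1 i.2, fun j m K hK => ?_⟩
  choose C hC using fun a => (h a).2 j m K hK
  refine ⟨∑ a, |C a|, fun u hu i => ?_⟩
  have h1 : wt i = wt i.2 := by
    have : wt i = 1 * wt i.2 := rfl
    rw [this, one_mul]
  rw [h1]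
  exact (hC i.1 u hu i.2).trans ((le_abs_self _).trans
    (Finset.single_le_sum (f := fun a => |C a|) (fun _ _ => abs_nonneg _) (Finset.mem_univ i.1)))

lemma RapidFamily.fin_row {E : Type*} [NormedAddCommGroup E] [NormedSpace ℝ E] {I : Type*}
    [RapidIndex I] {N : ℕ} {c : E → Fin N × I → ℝ} (h : RapidFamily c) (a : Fin N) :
    RapidFamily fun u i => c u (a, i) :=
  h.reindex (fun i => (a, i)) (r := 1) (D := 1) fun i => by
    have : wt (a, i) = 1 * wt i := rfl
    rw [this]
    simp

lemma summable_basis_mul (c : Rapid ((Fin 3 → ℤ) × Fin 2)) (y : Fin 3 → ℝ) :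
    Summable fun i => cubeBasis y i * c.1 i :=
  Summable.of_norm_bounded (summable_rapid c) fun i => by
    rw [Real.norm_eq_abs, abs_mul]
    exact mul_le_of_le_one_left (abs_nonneg _) (Real.abs_cos_le_one _)

lemma contMDiff_cubeSeries {E : Type} [NormedAddCommGroup E] [NormedSpace ℝ E]
    [FiniteDimensional ℝ E] {c : E → (Fin 3 → ℤ) × Fin 2 → ℝ} (hc : RapidFamily c) {Θ : M → R3}
    (hΘ : ContMDiff (𝓡 3) (𝓡 3) ∞ Θ) :
    ContMDiff (𝓘(ℝ, E).prod (𝓡 3)) 𝓘(ℝ, ℝ) ∞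
      fun z : E × M => ∑' i, cubeBasis (toR3.symm (Θ z.2)) i * c z.1 i := by
  have h3 : RapidFamily fun (z : E × (Fin 3 → ℝ)) => c z.1 := hc.comp contDiff_fst
  have h4 : PolyFamily fun (z : E × (Fin 3 → ℝ)) => cubeBasis z.2 :=
    polyFamily_cubeBasis.comp contDiff_snd
  have h1 : RapidFamily fun (z : E × (Fin 3 → ℝ)) i => cubeBasis z.2 i * c z.1 i :=
    h3.mul_poly h4
  have h5 := h1.contDiff_tsum
  have h2 : ContMDiff (𝓡 3) 𝓘(ℝ, Fin 3 → ℝ) ∞ fun x => toR3.symm (Θ x) :=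
    toR3.symm.contDiff.contMDiff.comp hΘ
  have h6 := contMDiff_comp_prodMk h5 h2
  exact h6.congr fun z => rfl

set_option maxHeartbeats 400000 in
/-- Smooth functions on a compact manifold are a complemented subspace of the rapidly decreasing
sequences. -/
theorem smoothSummand_smoothFn [CompactSpace M] : SmoothSummand (SmoothFn M) (Rapid ℕ) := by
  choose Γ Θ b β hΓ hΘ hb hβ _ _ hb4 hβ4 hβ1 using fun x : M => exists_patch x (s := Set.univ)
    Filter.univ_mem
  obtain ⟨t, ht⟩ := CompactSpace.elim_nhds_subcover (fun x => {y | β x y ≠ 0}) fun x =>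
    (isOpen_ne_fun (hβ x).continuous continuous_const).mem_nhds (by simp [hβ1])
  let N := t.card
  let e : Fin N → M := fun a => (t.equivFin.symm a).1
  let q : M → ℝ := fun x => ∑ a, β (e a) x ^ 2
  have hq : ∀ x, q x ≠ 0 := fun x => by
    obtain ⟨c, hc, hx⟩ : ∃ c ∈ t, β c x ≠ 0 := by
      have : x ∈ ⋃ c ∈ t, {y | β c y ≠ 0} := by rw [ht]; trivial
      simpa using this
    refine (Finset.sum_pos' (fun a _ => sq_nonneg _) ⟨t.equivFin ⟨c, hc⟩, Finset.mem_univ _, ?_⟩).ne'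
    simpa [e] using sq_pos_of_ne_zero hx
  have hqs : ContMDiff (𝓡 3) 𝓘(ℝ, ℝ) ∞ q :=
    contMDiff_finsetSum fun a _ => (hβ (e a)).pow 2
  have hΓ' : ∀ a, ContMDiff 𝓘(ℝ, Fin 3 → ℝ) (𝓡 3) ∞ fun y => Γ (e a) (toR3 y) := fun a =>
    (hΓ (e a)).comp toR3.contDiff.contMDiff
  -- the local representatives
  let G : Fin N → SmoothFn M → (Fin 3 → ℝ) → ℝ := fun a f y =>
    b (e a) (toR3 y) * (f (Γ (e a) (toR3 y)) / q (Γ (e a) (toR3 y)))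
  have hG : ∀ a {n : ℕ} {p : 𝔼 n → SmoothFn M}, IsPlot p →
      ContDiff ℝ ∞ fun z : 𝔼 n × (Fin 3 → ℝ) => G a (p z.1) z.2 := by
    intro a n p hp
    refine ((hb (e a)).comp (toR3.contDiff.comp contDiff_snd)).mul
      ((isPlot_smoothFn_comp hp (hΓ' a)).div ?_ fun z => hq _)
    exact (hqs.comp (hΓ' a)).contDiff.comp contDiff_snd
  let S : Set (Fin 3 → ℝ) := toR3 ⁻¹' Metric.closedBall 0 (1 / 4)
  have hS : IsCompact S := toR3.toHomeomorph.isClosedEmbedding.isCompact_preimage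
    (isCompact_closedBall _ _)
  have hS2 : ∀ x ∈ S, ∀ i, |x i| < 1 / 2 := fun x hx i => by
    have h1 := abs_le_norm_toR3 x i
    have h2 : ‖toR3 x‖ ≤ 1 / 4 := by simpa [S] using hx
    linarith
  have hG0 : ∀ a f, ∀ y ∉ S, G a f y = 0 := fun a f y hy => by
    have : b (e a) (toR3 y) = 0 := by
      by_contra h
      exact hy (by simpa [S] using hb4 _ _ h)
    simp only [G, this, zero_mul]
  let coeff : SmoothFn M → Fin N × ((Fin 3 → ℤ) × Fin 2) → ℝ := fun f i =>
    cubeCoeff (E := ℝ) (fun z => G i.1 f z.2) 0 i.2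
  have hcoeff : ∀ {n : ℕ} {p : 𝔼 n → SmoothFn M}, IsPlot p →
      RapidFamily fun u => coeff (p u) := by
    intro n p hp
    refine rapidFamily_fin_prod fun a => ?_
    exact rapidFamily_cubeCoeff (hG a hp) hS fun z hz => hG0 a _ _ hz
  have hcoeffm : ∀ f, coeff f ∈ Rapid _ := fun f =>
    (hcoeff (p := fun _ : EuclideanSpace ℝ (Fin 0) => f) isPlot_const).mem 0
  have hI : ∀ f a (i : (Fin 3 → ℤ) × Fin 2),
      Integrable fun y => Real.cos (freq i.1 y + phase i.2) * G a f y := by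
    intro f a i
    have := hG a (p := fun _ : EuclideanSpace ℝ (Fin 0) => f) isPlot_const
    exact integrable_cos_mul_slice this.continuous hS (fun z hz => hG0 a _ _ hz) (freq i.1)
      (phase i.2) 0
  let A : SmoothFn M →ₗ[ℝ] Rapid (Fin N × ((Fin 3 → ℤ) × Fin 2)) :=
    { toFun := fun f => ⟨coeff f, hcoeffm f⟩
      map_add' := fun f g => Subtype.ext <| funext fun i => by
        change ∫ y, _ * G i.1 (f + g) y = (∫ y, _ * G i.1 f y) + ∫ y, _ * G i.1 g y
        rw [← integral_add (hI f i.1 i.2) (hI g i.1 i.2)]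
        congr 1
        funext y
        simp only [G, ContMDiffMap.coe_add, Pi.add_apply]
        ring
      map_smul' := fun r f => Subtype.ext <| funext fun i => by
        change ∫ y, _ * G i.1 (r • f) y = r * ∫ y, _ * G i.1 f y
        rw [← integral_const_mul]
        congr 1
        funext y
        simp only [G, ContMDiffMap.coe_smul, Pi.smul_apply, smul_eq_mul]
        ring }
  have hsyn : ∀ {n : ℕ} {p : 𝔼 n → Rapid (Fin N × ((Fin 3 → ℤ) × Fin 2))},
      IsPlot p → ContMDiff (𝓘(ℝ, 𝔼 n).prod (𝓡 3)) 𝓘(ℝ, ℝ) ∞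
        fun z : 𝔼 n × M => ∑ a, β (e a) z.2 *
          ∑' i, cubeBasis (toR3.symm (Θ (e a) z.2)) i * (p z.1).1 (a, i) := by
    intro n p hp
    refine contMDiff_finsetSum fun a _ => ((hβ (e a)).comp contMDiff_snd).mul ?_
    exact contMDiff_cubeSeries ((isPlot_rapid_iff.1 hp).fin_row a) (hΘ (e a))
  have hrow : ∀ (c : Rapid (Fin N × ((Fin 3 → ℤ) × Fin 2))) a, (fun i => c.1 (a, i)) ∈ Rapid _ :=
    fun c a => ((rapidFamily_const (E := ℝ) c).fin_row a).mem 0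
  let Bm : Rapid (Fin N × ((Fin 3 → ℤ) × Fin 2)) →ₗ[ℝ] SmoothFn M :=
    { toFun := fun c => ⟨fun x => ∑ a, β (e a) x *
          ∑' i, cubeBasis (toR3.symm (Θ (e a) x)) i * c.1 (a, i),
        contMDiff_slice (hsyn (p := fun _ : EuclideanSpace ℝ (Fin 0) => c) isPlot_const) 0⟩
      map_add' := fun c d => ContMDiffMap.ext fun x => by
        change (∑ a : Fin N, _ : ℝ) = (∑ a : Fin N, _ : ℝ) + (∑ a : Fin N, _ : ℝ)
        rw [← Finset.sum_add_distrib]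
        refine Finset.sum_congr rfl fun a _ => ?_
        rw [← mul_add, ← (summable_basis_mul ⟨_, hrow c a⟩ _).tsum_add
          (summable_basis_mul ⟨_, hrow d a⟩ _)]
        congr 2
        funext i
        exact mul_add _ _ _
      map_smul' := fun r c => ContMDiffMap.ext fun x => by
        change ∑ a : Fin N, _ = r * ∑ a : Fin N, _
        rw [Finset.mul_sum]
        refine Finset.sum_congr rfl fun a _ => ?_
        rw [mul_left_comm, ← tsum_mul_left (a := r)]
        congr 2
        funext i
        exact mul_left_comm _ _ _ }
  refine SmoothSummand.trans (Y := Rapid (Fin N × ((Fin 3 → ℤ) × Fin 2)))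
    ⟨A, Bm, fun n p hp => hcoeff hp, fun n p hp => hsyn hp, fun f => ContMDiffMap.ext fun x => ?_⟩
    (tame_fin.prod (tame_triple.prod tame_fin)).smoothSummand
  change ∑ a, β (e a) x * ∑' i, cubeBasis (toR3.symm (Θ (e a) x)) i * coeff f (a, i) = f x
  have key : ∀ a, β (e a) x * ∑' i, cubeBasis (toR3.symm (Θ (e a) x)) i * coeff f (a, i) =
      β (e a) x ^ 2 * (f x / q x) := by
    intro a
    by_cases h : β (e a) x = 0
    · simp [h]
    obtain ⟨h1, h2, h3⟩ := hβ4 _ _ h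
    have h4 := tsum_cubeCoeff_mul_cubeBasis (E := EuclideanSpace ℝ (Fin 0))
      (hG a (p := fun _ : EuclideanSpace ℝ (Fin 0) => f) isPlot_const) hS
      (fun z hz => hG0 a _ _ hz) hS2 0 (toR3.symm (Θ (e a) x)) (hS2 _ (by simpa [S] using h3))
    have h5 : G a f (toR3.symm (Θ (e a) x)) = β (e a) x * (f x / q x) := by
      simp only [G, ContinuousLinearEquiv.apply_symm_apply, h1, h2]
    rw [h5] at h4
    rw [sq, mul_assoc, ← h4]
    rfl
  rw [Finset.sum_congr rfl fun a _ => key a, ← Finset.sum_mul]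
  exact mul_div_cancel₀ _ (hq x)

end SmoothFn

/-! ### Cosine series along a curve -/

section Cosine

/-- A partition of unity weight for the translations of the line by integers. -/
def unitWeight (t : ℝ) : ℝ := Real.smoothTransition t - Real.smoothTransition (t - 1)

lemma contDiff_unitWeight : ContDiff ℝ ∞ unitWeight :=
  Real.smoothTransition.contDiff.sub
    (Real.smoothTransition.contDiff.comp (contDiff_id.sub contDiff_const))

lemma unitWeight_of_nonpos {t : ℝ} (ht : t ≤ 0) : unitWeight t = 0 := by
  rw [unitWeight, Real.smoothTransition.zero_of_nonpos ht,
    Real.smoothTransition.zero_of_nonpos (by linarith), sub_zero]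

lemma unitWeight_of_two_le {t : ℝ} (ht : 2 ≤ t) : unitWeight t = 0 := by
  rw [unitWeight, Real.smoothTransition.one_of_one_le (by linarith),
    Real.smoothTransition.one_of_one_le (by linarith), sub_self]

lemma unitWeight_eq_zero {t : ℝ} (ht : t ∉ Set.Icc (0 : ℝ) 2) : unitWeight t = 0 := by
  rcases le_or_gt t 0 with h | h
  · exact unitWeight_of_nonpos h
  · exact unitWeight_of_two_le (by
      by_contra h2
      exact ht ⟨h.le, (not_le.1 h2).le⟩)

lemma integral_unitWeight_mul {g : ℝ → ℝ} (hg : Continuous g) (hper : ∀ t, g (t + 1) = g t) :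
    ∫ t, unitWeight t * g t = ∫ t in (0 : ℝ)..1, g t := by
  have hcont : Continuous fun t => unitWeight t * g t := contDiff_unitWeight.continuous.mul hg
  have h1 : ∫ t, unitWeight t * g t = ∫ t in (0 : ℝ)..2, unitWeight t * g t := by
    rw [intervalIntegral.integral_of_le (by norm_num), ← integral_Icc_eq_integral_Ioc]
    refine (setIntegral_eq_integral_of_forall_compl_eq_zero fun t ht => ?_).symm
    rw [unitWeight_eq_zero ht, zero_mul]
  have h2 : ∫ t in (1 : ℝ)..2, unitWeight t * g t =
      ∫ t in (0 : ℝ)..1, unitWeight (t + 1) * g (t + 1) := by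
    rw [intervalIntegral.integral_comp_add_right (fun t => unitWeight t * g t)]
    norm_num
  have hcont' : Continuous fun t => unitWeight (t + 1) * g (t + 1) :=
    hcont.comp (continuous_add_const 1)
  rw [h1, ← intervalIntegral.integral_add_adjacent_intervals (b := 1)
    (hcont.intervalIntegrable _ _) (hcont.intervalIntegrable _ _), h2,
    ← intervalIntegral.integral_add (hcont.intervalIntegrable _ _)
      (hcont'.intervalIntegrable _ _)]
  refine intervalIntegral.integral_congr fun t ht => ?_
  rw [Set.uIcc_of_le zero_le_one] at ht
  simp only [hper, unitWeight, add_sub_cancel_right]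
  rw [Real.smoothTransition.zero_of_nonpos (x := t - 1) (by linarith [ht.2]),
    Real.smoothTransition.one_of_one_le (x := t + 1) (by linarith [ht.1])]
  ring

lemma integral_cos_two_pi_mul {k : ℤ} (hk : k ≠ 0) :
    ∫ t in (0 : ℝ)..1, Real.cos (2 * Real.pi * k * t) = 0 := by
  have hk' : (2 * Real.pi * k : ℝ) ≠ 0 := by positivity
  rw [intervalIntegral.integral_comp_mul_left (fun t => Real.cos t) hk', integral_cos]
  have : Real.sin (2 * Real.pi * k * 1) = 0 := by
    rw [mul_one, show 2 * Real.pi * (k : ℝ) = ((2 * k : ℤ) : ℝ) * Real.pi by push_cast; ring]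
    exact Real.sin_int_mul_pi _
  rw [this]
  simp

lemma cos_two_pi_mul_add_one (k : ℕ) (t : ℝ) :
    Real.cos (2 * Real.pi * (k + 1) * (t + 1)) = Real.cos (2 * Real.pi * (k + 1) * t) := by
  rw [show 2 * Real.pi * ((k : ℝ) + 1) * (t + 1) =
    2 * Real.pi * (k + 1) * t + ((k + 1 : ℕ) : ℝ) * (2 * Real.pi) by push_cast; ring]
  exact Real.cos_add_nat_mul_two_pi _ _

lemma integral_cos_mul_cos (k l : ℕ) :
    ∫ t, unitWeight t * (2 * Real.cos (2 * Real.pi * (k + 1) * t) *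
      Real.cos (2 * Real.pi * (l + 1) * t)) = if k = l then 1 else 0 := by
  rw [integral_unitWeight_mul (by fun_prop) fun t => by
    rw [cos_two_pi_mul_add_one, cos_two_pi_mul_add_one]]
  have h : ∀ t : ℝ, 2 * Real.cos (2 * Real.pi * (k + 1) * t) *
      Real.cos (2 * Real.pi * (l + 1) * t) =
      Real.cos (2 * Real.pi * ((k - l : ℤ) : ℝ) * t) +
        Real.cos (2 * Real.pi * ((k + l + 2 : ℤ) : ℝ) * t) := fun t => by
    rw [show 2 * Real.pi * (((k : ℤ) - l : ℤ) : ℝ) * t =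
        2 * Real.pi * (k + 1) * t - 2 * Real.pi * (l + 1) * t by push_cast; ring,
      show 2 * Real.pi * (((k : ℤ) + l + 2 : ℤ) : ℝ) * t =
        2 * Real.pi * (k + 1) * t + 2 * Real.pi * (l + 1) * t by push_cast; ring,
      Real.cos_sub, Real.cos_add]
    ring
  simp only [h]
  rw [intervalIntegral.integral_add (Continuous.intervalIntegrable (by fun_prop) _ _)
    (Continuous.intervalIntegrable (by fun_prop) _ _),
    integral_cos_two_pi_mul (k := (k : ℤ) + l + 2) (by positivity), add_zero]
  split_ifs with hkl
  · subst hkl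
    simp
  · exact integral_cos_two_pi_mul (sub_ne_zero.2 (by exact_mod_cast hkl))

lemma polyFamily_cos : PolyFamily fun (t : ℝ) (k : ℕ) => Real.cos (2 * Real.pi * (k + 1) * t) := by
  refine PolyFamily.bounded_comp ?_ Real.contDiff_cos bounded_iteratedFDeriv_cos
  refine PolyFamily.mul (polyFamily_const_seq (m := 1) (C := 2 * Real.pi) fun k => ?_)
    (polyFamily_const contDiff_id)
  rw [abs_of_nonneg (by positivity), pow_one]
  exact le_rfl

lemma summable_cos_mul (c : Rapid ℕ) (t : ℝ) :
    Summable fun k : ℕ => Real.cos (2 * Real.pi * (k + 1) * t) * c.1 k :=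
  Summable.of_norm_bounded (summable_rapid c) fun i => by
    rw [Real.norm_eq_abs, abs_mul]
    exact mul_le_of_le_one_left (abs_nonneg _) (Real.abs_cos_le_one _)

/-- The coefficients of a cosine series are recovered by integration. -/
lemma integral_cosSeries (c : Rapid ℕ) (l : ℕ) :
    ∫ t, unitWeight t * (2 * Real.cos (2 * Real.pi * (l + 1) * t) *
      ∑' k : ℕ, Real.cos (2 * Real.pi * (k + 1) * t) * c.1 k) = c.1 l := by
  let f : ℕ → ℝ → ℝ := fun k t => (unitWeight t * (2 * Real.cos (2 * Real.pi * (l + 1) * t) *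
    Real.cos (2 * Real.pi * (k + 1) * t))) * c.1 k
  have hcs : ∀ k, HasCompactSupport (f k) := fun k =>
    HasCompactSupport.intro (K := Set.Icc 0 2) isCompact_Icc fun t ht => by
      simp only [f, unitWeight_eq_zero ht, zero_mul]
  have hw := contDiff_unitWeight.continuous
  have hi : ∀ k, Integrable (f k) := fun k =>
    Continuous.integrable_of_hasCompactSupport (by fun_prop) (hcs k)
  have hwi : Integrable fun t => |unitWeight t| * 2 :=
    Continuous.integrable_of_hasCompactSupport (by fun_prop)
      (HasCompactSupport.intro (K := Set.Icc 0 2) isCompact_Icc fun t ht => by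
        simp [unitWeight_eq_zero ht])
  have hsum : Summable fun k => ∫ t, ‖f k t‖ := by
    refine Summable.of_nonneg_of_le (fun k => integral_nonneg fun t => norm_nonneg _) (fun k => ?_)
      ((summable_rapid c).mul_left (∫ t, |unitWeight t| * 2))
    rw [← integral_mul_const]
    refine integral_mono (hi k).norm (hwi.mul_const _) fun t => ?_
    simp only [f, norm_mul, Real.norm_eq_abs, abs_two]
    have h1 := Real.abs_cos_le_one (2 * Real.pi * (l + 1) * t)
    have h2 := Real.abs_cos_le_one (2 * Real.pi * (k + 1) * t)
    have h3 := mul_le_one₀ h1 (abs_nonneg _) h2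
    have h4 := abs_nonneg (unitWeight t)
    have h5 := abs_nonneg (c.1 k)
    refine mul_le_mul_of_nonneg_right (mul_le_mul_of_nonneg_left ?_ h4) h5
    nlinarith
  have key := hasSum_integral_of_summable_integral_norm hi hsum
  have h1 : ∀ k, ∫ t, f k t = if k = l then c.1 l else 0 := fun k => by
    simp only [f]
    rw [integral_mul_const, integral_cos_mul_cos]
    by_cases h : k = l
    · simp [h]
    · rw [if_neg h, if_neg (Ne.symm h), zero_mul]
  simp only [h1] at key
  rw [(hasSum_ite_eq l (c.1 l)).unique key]
  congr 1
  funext t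
  simp only [f]
  rw [← tsum_mul_left, ← tsum_mul_left]
  congr 1
  funext k
  ring

variable {M : Type*} [TopologicalSpace M] [ChartedSpace R3 M] [IsManifold (𝓡 3) ∞ M] [T2Space M]

lemma contMDiff_cosSeries {E : Type} [NormedAddCommGroup E] [NormedSpace ℝ E]
    [FiniteDimensional ℝ E] {c : E → ℕ → ℝ} (hc : RapidFamily c) {θ : M → ℝ}
    (hθ : ContMDiff (𝓡 3) 𝓘(ℝ, ℝ) ∞ θ) :
    ContMDiff (𝓘(ℝ, E).prod (𝓡 3)) 𝓘(ℝ, ℝ) ∞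
      fun z : E × M => ∑' k : ℕ, Real.cos (2 * Real.pi * (k + 1) * θ z.2) * c z.1 k := by
  have h1 : RapidFamily fun (z : E × ℝ) => c z.1 := hc.comp contDiff_fst
  have h2 : PolyFamily fun (z : E × ℝ) (k : ℕ) =>
      Real.cos (2 * Real.pi * (k + 1) * z.2) := polyFamily_cos.comp contDiff_snd
  have h3 := (h1.mul_poly h2).contDiff_tsum
  have h4 := contMDiff_comp_prodMk h3 hθ
  exact h4.congr fun z => rfl

/-- A space into which the smooth functions map, with an inverse up to a factor that does not vanish
identically, has the rapidly decreasing sequences as a complemented subspace. -/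
theorem smoothSummand_rapid_of_smoothFn {X : Type*} [AddCommGroup X] [Module ℝ X]
    [DiffeologicalSpace X] {J : SmoothFn M →ₗ[ℝ] X} {R : X →ₗ[ℝ] SmoothFn M} (hJ : DSmooth J)
    (hR : DSmooth R) {ζ : M → ℝ} (hζ : ContMDiff (𝓡 3) 𝓘(ℝ, ℝ) ∞ ζ)
    (hRJ : ∀ f x, R (J f) x = ζ x * f x) {x₀ : M} (hx₀ : ζ x₀ ≠ 0) :
    SmoothSummand (Rapid ℕ) X := by
  obtain ⟨Γ, Θ, -, -, hΓ, hΘ, -, -, hΓs, hΘΓ, -⟩ := exists_patch x₀ (s := {x | ζ x ≠ 0})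
    ((isOpen_ne_fun hζ.continuous continuous_const).mem_nhds hx₀)
  let e₀ : R3 := EuclideanSpace.single 0 1
  let γ : ℝ → M := fun t => Γ ((t - 1) • e₀)
  let θ : M → ℝ := fun x => Θ x 0
  have hγ : ContMDiff 𝓘(ℝ, ℝ) (𝓡 3) ∞ γ := hΓ.comp (ContDiff.contMDiff (by fun_prop))
  have hθ : ContMDiff (𝓡 3) 𝓘(ℝ, ℝ) ∞ θ :=
    (EuclideanSpace.proj (𝕜 := ℝ) (0 : Fin 3)).contDiff.contMDiff.comp hΘ
  have hθγ : ∀ t ∈ Set.Icc (0 : ℝ) 2, θ (γ t) = t - 1 := fun t ht => by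
    have : ‖(t - 1) • e₀‖ ≤ 2 := by
      rw [norm_smul, PiLp.norm_single]
      simp only [norm_one, mul_one, Real.norm_eq_abs]
      exact (abs_le.2 ⟨by linarith [ht.1], by linarith [ht.2]⟩).trans one_le_two
    simp [θ, γ, hΘΓ _ this, e₀]
  -- synthesis
  have hsyn : ∀ {n : ℕ} {p : 𝔼 n → Rapid ℕ}, IsPlot p →
      ContMDiff (𝓘(ℝ, 𝔼 n).prod (𝓡 3)) 𝓘(ℝ, ℝ) ∞
        fun z : 𝔼 n × M =>
          ∑' k : ℕ, Real.cos (2 * Real.pi * (k + 1) * θ z.2) * (p z.1).1 k := by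
    intro n p hp
    exact contMDiff_cosSeries (isPlot_rapid_iff.1 hp) hθ
  let C : Rapid ℕ →ₗ[ℝ] SmoothFn M :=
    { toFun := fun c => ⟨fun x => ∑' k : ℕ, Real.cos (2 * Real.pi * (k + 1) * θ x) * c.1 k,
        contMDiff_slice (hsyn (p := fun _ : EuclideanSpace ℝ (Fin 0) => c) isPlot_const) 0⟩
      map_add' := fun c d => ContMDiffMap.ext fun x => by
        change (∑' k : ℕ, _ : ℝ) = (∑' k : ℕ, _ : ℝ) + (∑' k : ℕ, _ : ℝ)
        rw [← (summable_cos_mul c _).tsum_add (summable_cos_mul d _)]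
        congr 1
        funext i
        exact mul_add _ _ _
      map_smul' := fun r c => ContMDiffMap.ext fun x => by
        change (∑' k : ℕ, _ : ℝ) = r * (∑' k : ℕ, _ : ℝ)
        rw [← tsum_mul_left]
        congr 1
        funext i
        exact mul_left_comm _ _ _ }
  -- analysis
  let G : SmoothFn M → ℝ → ℝ := fun f t => unitWeight t * (2 * (f (γ t) / ζ (γ t)))
  have hG : ∀ {n : ℕ} {p : 𝔼 n → SmoothFn M}, IsPlot p →
      ContDiff ℝ ∞ fun z : 𝔼 n × ℝ => G (p z.1) z.2 := by
    intro n p hp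
    have h1 := isPlot_smoothFn_comp hp hγ
    have h2 : ContDiff ℝ ∞ fun z : 𝔼 n × ℝ => ζ (γ z.2) :=
      (hζ.comp hγ).contDiff.comp contDiff_snd
    have h3 : ContDiff ℝ ∞ fun z : 𝔼 n × ℝ => unitWeight z.2 :=
      contDiff_unitWeight.comp contDiff_snd
    exact h3.mul (contDiff_const.mul (h1.div h2 fun z => hΓs _))
  have hG0 : ∀ f, ∀ t ∉ Set.Icc (0 : ℝ) 2, G f t = 0 := fun f t ht => by
    simp only [G, unitWeight_eq_zero ht, zero_mul]
  let ℓ : ℕ → ℝ →L[ℝ] ℝ := fun l => (2 * Real.pi * (l + 1)) • ContinuousLinearMap.id ℝ ℝ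
  let coeff : SmoothFn M → ℕ → ℝ := fun f l =>
    cosCoeff (E := ℝ) volume (ℓ l) 0 (fun z => G f z.2) 0
  have hcoeff : ∀ {n : ℕ} {p : 𝔼 n → SmoothFn M}, IsPlot p →
      RapidFamily fun u => coeff (p u) := by
    intro n p hp
    have hw : ∀ l, wt l ≤ 1 * (1 + ∑ _a : Unit, ℓ l 1 ^ 2) ^ 1 := by
      intro l
      have h1 : wt l = (l : ℝ) + 1 := rfl
      simp only [ℓ, h1, one_mul, pow_one, Finset.univ_unique, Finset.sum_singleton,
        smul_apply, ContinuousLinearMap.id_apply, smul_eq_mul, mul_one]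
      have h2 : (l : ℝ) + 1 ≤ (2 * Real.pi * (l + 1)) ^ 2 := by
        have := Real.pi_gt_three
        have h0 : (0 : ℝ) ≤ l := Nat.cast_nonneg l
        have h3 : (l : ℝ) + 1 ≤ 2 * Real.pi * (l + 1) := by nlinarith
        nlinarith
      linarith
    have h := rapidFamily_cosCoeff (μ := volume) (fun _ : Unit => (1 : ℝ)) (hG hp)
        (isCompact_Icc (a := (0 : ℝ)) (b := 2)) (fun z hz => hG0 _ _ hz) ℓ (fun _ => 0) hw
    exact h
  have hI : ∀ f l, Integrable fun t => Real.cos (ℓ l t + 0) * G f t := by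
    intro f l
    have := hG (p := fun _ : EuclideanSpace ℝ (Fin 0) => f) isPlot_const
    exact integrable_cos_mul_slice this.continuous (isCompact_Icc (a := (0 : ℝ)) (b := 2))
      (fun z hz => hG0 _ _ hz) (ℓ l) 0 0
  let D : SmoothFn M →ₗ[ℝ] Rapid ℕ :=
    { toFun := fun f => ⟨coeff f,
        (hcoeff (p := fun _ : EuclideanSpace ℝ (Fin 0) => f) isPlot_const).mem 0⟩
      map_add' := fun f g => Subtype.ext <| funext fun l => by
        change ∫ y, _ * G (f + g) y = (∫ y, _ * G f y) + ∫ y, _ * G g y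
        rw [← integral_add (hI f l) (hI g l)]
        congr 1
        funext y
        simp only [G, ContMDiffMap.coe_add, Pi.add_apply]
        ring
      map_smul' := fun r f => Subtype.ext <| funext fun l => by
        change ∫ y, _ * G (r • f) y = r * ∫ y, _ * G f y
        rw [← integral_const_mul]
        congr 1
        funext y
        simp only [G, ContMDiffMap.coe_smul, Pi.smul_apply, smul_eq_mul]
        ring }
  have hC : DSmooth C := fun n p hp => isPlot_smoothFn_iff.2 ((hsyn hp).congr fun z => rfl)
  have hD : DSmooth D := fun n p hp => isPlot_rapid_iff.2 (hcoeff hp)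
  have hJC : DSmooth (J ∘ₗ C) := hJ.comp hC
  have hDR : DSmooth (D ∘ₗ R) := hD.comp hR
  suffices h : ∀ c l, (D (R (J (C c)))).1 l = c.1 l from
    ⟨J ∘ₗ C, D ∘ₗ R, hJC, hDR, fun c => Subtype.ext (funext (h c))⟩
  intro c l
  change ∫ t, Real.cos (ℓ l t + 0) * G (R (J (C c))) t = c.1 l
  rw [← integral_cosSeries c l]
  congr 1
  funext t
  by_cases ht : t ∈ Set.Icc (0 : ℝ) 2
  · have h1 : C c (γ t) = ∑' k : ℕ, Real.cos (2 * Real.pi * (k + 1) * t) * c.1 k := by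
      change ∑' k : ℕ, Real.cos (2 * Real.pi * (k + 1) * θ (γ t)) * c.1 k = _
      rw [hθγ t ht]
      congr 1
      funext k
      rw [← cos_two_pi_mul_add_one k (t - 1), sub_add_cancel]
    simp only [G, hRJ, h1]
    rw [mul_div_cancel_left₀ _ (hΓs _)]
    simp only [ℓ, smul_apply, ContinuousLinearMap.id_apply, smul_eq_mul,
      add_zero]
    ring
  · rw [hG0 _ _ ht, unitWeight_eq_zero ht, mul_zero, zero_mul]

/-- A space built from finitely many copies of the smooth functions is a complemented subspace of
the rapidly decreasing sequences. -/
theorem smoothSummand_of_smoothFn [CompactSpace M] {X : Type*} [AddCommGroup X] [Module ℝ X]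
    [DiffeologicalSpace X] [DiffeologicalModule X] {ι : Type*} [Fintype ι]
    {J : ι → SmoothFn M →ₗ[ℝ] X} {R : ι → X →ₗ[ℝ] SmoothFn M} (hJ : ∀ i, DSmooth (J i))
    (hR : ∀ i, DSmooth (R i)) (h : ∀ x, ∑ i, J i (R i x) = x) : SmoothSummand X (Rapid ℕ) := by
  obtain ⟨a, b, ha, hb, hab⟩ := smoothSummand_smoothFn (M := M)
  let N := Fintype.card ι
  let e : Fin N ≃ ι := (Fintype.equivFin ι).symm
  have hc : ∀ {n : ℕ} {p : 𝔼 n → X}, IsPlot p →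
      RapidFamily fun u (i : Fin N × ℕ) => (a (R (e i.1) (p u))).1 i.2 := fun hp =>
    rapidFamily_fin_prod fun i => ha _ _ (hR (e i) _ _ hp)
  let A : X →ₗ[ℝ] Rapid (Fin N × ℕ) :=
    { toFun := fun x => ⟨fun i => (a (R (e i.1) x)).1 i.2,
        (hc (p := fun _ : EuclideanSpace ℝ (Fin 0) => x) isPlot_const).mem 0⟩
      map_add' := fun x y => Subtype.ext <| funext fun i => by simp
      map_smul' := fun r x => Subtype.ext <| funext fun i => by simp }
  let row : Fin N → Rapid (Fin N × ℕ) →ₗ[ℝ] Rapid ℕ := fun i =>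
    { toFun := fun c => ⟨fun k => c.1 (i, k), ((rapidFamily_const (E := ℝ) c).fin_row i).mem 0⟩
      map_add' := fun _ _ => rfl
      map_smul' := fun _ _ => rfl }
  have hrow : ∀ i, DSmooth (row i) := fun i n p hp => RapidFamily.fin_row hp i
  refine SmoothSummand.trans (Y := Rapid (Fin N × ℕ)) ⟨A, ∑ i, J (e i) ∘ₗ b ∘ₗ row i,
    fun n p hp => hc hp, fun n p hp => ?_, fun x => ?_⟩
    (tame_fin.prod ⟨id, 1, 1, 1, 1, Function.injective_id, fun i => by simp,
      fun i => by simp⟩).smoothSummand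
  · simp only [Function.comp_def, LinearMap.sum_apply]
    exact isPlot_sum _ fun i _ => hJ _ _ _ (hb _ _ (hrow i _ _ hp))
  · have h1 : ∀ i, row i (A x) = a (R (e i) x) := fun i => rfl
    simp only [LinearMap.sum_apply, LinearMap.comp_apply, h1, hab]
    exact (e.sum_comp fun i => J i (R i x)).trans (h x)

end Cosine

/-! ### Smooth maps into vector bundles -/

section Along

variable {EP : Type*} [NormedAddCommGroup EP] [NormedSpace ℝ EP] {HP : Type*} [TopologicalSpace HP]
  {IP : ModelWithCorners ℝ EP HP} {P : Type*} [TopologicalSpace P] [ChartedSpace HP P]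
  {EB : Type*} [NormedAddCommGroup EB] [NormedSpace ℝ EB] {HB : Type*} [TopologicalSpace HB]
  {IB : ModelWithCorners ℝ EB HB} {N : Type*} [TopologicalSpace N] [ChartedSpace HB N]
  {F : Type*} [NormedAddCommGroup F] [NormedSpace ℝ F]
  {W : N → Type*} [TopologicalSpace (TotalSpace F W)] [∀ x, TopologicalSpace (W x)]
  [FiberBundle F W] [∀ x, AddCommGroup (W x)] [∀ x, Module ℝ (W x)] [VectorBundle ℝ F W]
  {F' : Type*} [NormedAddCommGroup F'] [NormedSpace ℝ F']
  {W' : N → Type*} [TopologicalSpace (TotalSpace F' W')] [∀ x, TopologicalSpace (W' x)]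
  [FiberBundle F' W'] [∀ x, AddCommGroup (W' x)] [∀ x, Module ℝ (W' x)] [VectorBundle ℝ F' W']
  {b : P → N} {p₀ : P}

lemma eventually_mem_baseSet (hb : ContinuousAt b p₀) :
    ∀ᶠ p in 𝓝 p₀, b p ∈ (trivializationAt F W (b p₀)).baseSet :=
  hb.preimage_mem_nhds ((trivializationAt F W (b p₀)).open_baseSet.mem_nhds
    (FiberBundle.mem_baseSet_trivializationAt' (b p₀)))

lemma contMDiffAt_along_smul {f : P → ℝ} {s : ∀ p, W (b p)} (hf : ContMDiffAt IP 𝓘(ℝ, ℝ) ∞ f p₀)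
    (hs : ContMDiffAt IP (IB.prod 𝓘(ℝ, F)) ∞ (fun p => TotalSpace.mk' F (b p) (s p)) p₀) :
    ContMDiffAt IP (IB.prod 𝓘(ℝ, F)) ∞ (fun p => TotalSpace.mk' F (b p) (f p • s p)) p₀ := by
  rw [contMDiffAt_totalSpace] at hs ⊢
  refine ⟨hs.1, (hf.smul hs.2).congr_of_eventuallyEq ?_⟩
  filter_upwards [eventually_mem_baseSet (F := F) (W := W) hs.1.continuousAt] with p hp
  exact ((trivializationAt F W (b p₀)).linear ℝ hp).map_smul _ _

lemma contMDiffAt_along_add {s t : ∀ p, W (b p)}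
    (hs : ContMDiffAt IP (IB.prod 𝓘(ℝ, F)) ∞ (fun p => TotalSpace.mk' F (b p) (s p)) p₀)
    (ht : ContMDiffAt IP (IB.prod 𝓘(ℝ, F)) ∞ (fun p => TotalSpace.mk' F (b p) (t p)) p₀) :
    ContMDiffAt IP (IB.prod 𝓘(ℝ, F)) ∞ (fun p => TotalSpace.mk' F (b p) (s p + t p)) p₀ := by
  rw [contMDiffAt_totalSpace] at hs ht ⊢
  refine ⟨hs.1, (hs.2.add ht.2).congr_of_eventuallyEq ?_⟩
  filter_upwards [eventually_mem_baseSet (F := F) (W := W) hs.1.continuousAt] with p hp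
  exact ((trivializationAt F W (b p₀)).linear ℝ hp).map_add _ _

lemma contMDiffAt_along_zero (hb : ContMDiffAt IP IB ∞ b p₀) :
    ContMDiffAt IP (IB.prod 𝓘(ℝ, F)) ∞ (fun p => TotalSpace.mk' F (b p) (0 : W (b p))) p₀ :=
  (contMDiff_zeroSection ℝ W).contMDiffAt.comp p₀ hb

lemma contMDiffAt_along_sum {ι : Type*} {A : Finset ι} {s : ι → ∀ p, W (b p)}
    (hb : ContMDiffAt IP IB ∞ b p₀) (hs : ∀ i ∈ A, ContMDiffAt IP (IB.prod 𝓘(ℝ, F)) ∞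
      (fun p => TotalSpace.mk' F (b p) (s i p)) p₀) :
    ContMDiffAt IP (IB.prod 𝓘(ℝ, F)) ∞
      (fun p => TotalSpace.mk' F (b p) (∑ i ∈ A, s i p)) p₀ := by
  classical
  induction A using Finset.induction_on with
  | empty => simpa using contMDiffAt_along_zero hb
  | insert i A hi ih =>
    simp only [Finset.sum_insert hi]
    exact contMDiffAt_along_add (hs i (Finset.mem_insert_self _ _))
      (ih fun j hj => hs j (Finset.mem_insert_of_mem hj))

variable (IP IB F) in
/-- A smooth family of vectors over a smooth map to the base. -/
def SmoothAlong (b : P → N) (s : ∀ p, W (b p)) : Prop :=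
  ContMDiff IP (IB.prod 𝓘(ℝ, F)) ∞ fun p => TotalSpace.mk' F (b p) (s p)

namespace SmoothAlong

lemma base {s : ∀ p, W (b p)} (hs : SmoothAlong IP IB F b s) : ContMDiff IP IB ∞ b := fun p =>
  (contMDiffAt_totalSpace.1 (hs p)).1

lemma smul {f : P → ℝ} {s : ∀ p, W (b p)} (hs : SmoothAlong IP IB F b s)
    (hf : ContMDiff IP 𝓘(ℝ, ℝ) ∞ f) : SmoothAlong IP IB F b fun p => f p • s p := fun p =>
  contMDiffAt_along_smul (hf p) (hs p)

lemma add {s t : ∀ p, W (b p)} (hs : SmoothAlong IP IB F b s) (ht : SmoothAlong IP IB F b t) :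
    SmoothAlong IP IB F b fun p => s p + t p := fun p =>
  contMDiffAt_along_add (hs p) (ht p)

lemma neg {s : ∀ p, W (b p)} (hs : SmoothAlong IP IB F b s) :
    SmoothAlong IP IB F b fun p => -s p := by
  simpa using hs.smul (f := fun _ => -1) contMDiff_const

lemma sub {s t : ∀ p, W (b p)} (hs : SmoothAlong IP IB F b s) (ht : SmoothAlong IP IB F b t) :
    SmoothAlong IP IB F b fun p => s p - t p := by
  simpa only [sub_eq_add_neg] using hs.add ht.neg

lemma zero (hb : ContMDiff IP IB ∞ b) : SmoothAlong IP IB F b fun p => (0 : W (b p)) := fun p =>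
  contMDiffAt_along_zero (hb p)

lemma comp {EQ : Type*} [NormedAddCommGroup EQ] [NormedSpace ℝ EQ] {HQ : Type*}
    [TopologicalSpace HQ] {IQ : ModelWithCorners ℝ EQ HQ} {Q : Type*} [TopologicalSpace Q]
    [ChartedSpace HQ Q] {s : ∀ p, W (b p)} (hs : SmoothAlong IP IB F b s) {f : Q → P}
    (hf : ContMDiff IQ IP ∞ f) : SmoothAlong IQ IB F (fun q => b (f q)) fun q => s (f q) :=
  ContMDiff.comp (g := fun p => TotalSpace.mk' F (b p) (s p)) hs hf

lemma congr {s t : ∀ p, W (b p)} (hs : SmoothAlong IP IB F b s) (h : ∀ p, t p = s p) :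
    SmoothAlong IP IB F b t := by
  have : t = s := funext h
  rwa [this]

lemma clm_apply [∀ x, IsTopologicalAddGroup (W' x)] [∀ x, ContinuousSMul ℝ (W' x)]
    {Φ : ∀ p, W (b p) →L[ℝ] W' (b p)} {s : ∀ p, W (b p)}
    (hΦ : SmoothAlong (W := fun x => W x →L[ℝ] W' x) IP IB (F →L[ℝ] F') b Φ)
    (hs : SmoothAlong IP IB F b s) : SmoothAlong IP IB F' b fun p => Φ p (s p) :=
  ContMDiff.clm_bundle_apply hΦ hs

end SmoothAlong

lemma smoothAlong_section (σ : Cₛ^∞⟮IB; F, W⟯) {b : P → N} (hb : ContMDiff IP IB ∞ b) :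
    SmoothAlong IP IB F b fun p => σ (b p) :=
  σ.contMDiff.comp hb

lemma isPlot_section_iff {n : ℕ} {p : 𝔼 n → Cₛ^∞⟮IB; F, W⟯} :
    IsPlot p ↔ SmoothAlong (𝓘(ℝ, 𝔼 n).prod IB) IB F
      (fun z : 𝔼 n × N => z.2) fun z => p z.1 z.2 := Iff.rfl

instance [IsManifold IB ∞ N] [ContMDiffVectorBundle ∞ F W IB] :
    DiffeologicalModule Cₛ^∞⟮IB; F, W⟯ where
  isPlot_add hp hq := isPlot_section_iff.2
    ((isPlot_section_iff.1 hp).add (isPlot_section_iff.1 hq))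
  isPlot_smul hf hp := isPlot_section_iff.2
    ((isPlot_section_iff.1 hp).smul (hf.contMDiff.comp contMDiff_fst))

/-- Smooth families of vectors in a trivial bundle. -/
lemma smoothAlong_trivial_iff {b : P → N} {f : P → F} :
    SmoothAlong (W := Bundle.Trivial N F) IP IB F b f ↔
      ContMDiff IP IB ∞ b ∧ ContMDiff IP 𝓘(ℝ, F) ∞ f :=
  ⟨fun h => ⟨h.base, fun p => (contMDiffAt_totalSpace.1 (h p)).2⟩,
    fun h p => contMDiffAt_totalSpace.2 ⟨h.1 p, h.2 p⟩⟩

lemma SmoothAlong.clm_apply_real {Φ : ∀ p, W (b p) →L[ℝ] ℝ} {s : ∀ p, W (b p)}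
    (hΦ : SmoothAlong (W := fun x => W x →L[ℝ] ℝ) IP IB (F →L[ℝ] ℝ) b Φ)
    (hs : SmoothAlong IP IB F b s) : ContMDiff IP 𝓘(ℝ, ℝ) ∞ fun p => Φ p (s p) :=
  (smoothAlong_trivial_iff.1
    (SmoothAlong.clm_apply (W' := Bundle.Trivial N ℝ) hΦ hs)).2

/-- A solution of a smooth family of uniquely solvable linear equations is smooth. -/
lemma SmoothAlong.solve [FiniteDimensional ℝ F] [∀ x, IsTopologicalAddGroup (W' x)]
    [∀ x, ContinuousSMul ℝ (W' x)] [CompleteSpace F]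
    {Φ : ∀ p, W (b p) →L[ℝ] W' (b p)} {s : ∀ p, W (b p)} {w : ∀ p, W' (b p)}
    (hΦ : SmoothAlong (W := fun x => W x →L[ℝ] W' x) IP IB (F →L[ℝ] F') b Φ)
    (hw : SmoothAlong IP IB F' b w) (h : ∀ p, Φ p (s p) = w p)
    (hbij : ∀ p, Function.Bijective (Φ p)) : SmoothAlong IP IB F b s := by
  intro p₀
  have hb := hw.base
  have h1 := (contMDiffAt_hom_bundle _).1 (hΦ p₀)
  have h2 := (contMDiffAt_totalSpace.1 (hw p₀)).2
  refine contMDiffAt_totalSpace.2 ⟨hb p₀, ?_⟩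
  set e := trivializationAt F W (b p₀) with he
  set e' := trivializationAt F' W' (b p₀) with he'
  set T : P → F →L[ℝ] F' := fun p =>
    ContinuousLinearMap.inCoordinates F W F' W' (b p₀) (b p) (b p₀) (b p) (Φ p) with hT
  have hT1 : ContMDiffAt IP 𝓘(ℝ, F →L[ℝ] F') ∞ T p₀ := h1.2
  have hm : b p₀ ∈ e.baseSet := FiberBundle.mem_baseSet_trivializationAt' _
  have hm' : b p₀ ∈ e'.baseSet := FiberBundle.mem_baseSet_trivializationAt' _
  have hTeq : ∀ p, b p ∈ e.baseSet → b p ∈ e'.baseSet → ∀ v : W (b p),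
      T p (e ⟨b p, v⟩).2 = (e' ⟨b p, Φ p v⟩).2 := by
    intro p hp hp' v
    rw [hT]
    simp only
    rw [ContinuousLinearMap.inCoordinates_eq hp hp']
    simp only [ContinuousLinearMap.comp_apply, ContinuousLinearEquiv.coe_coe]
    change (e' ⟨b p, Φ p (e.symm (b p) (e ⟨b p, v⟩).2)⟩).2 = _
    rw [e.symm_apply_apply_mk hp]
  have hTbij : Function.Bijective (T p₀) := by
    have hs : ∀ y : F, ∃ v : W (b p₀), (e ⟨b p₀, v⟩).2 = y := fun y =>
      ⟨e.symm (b p₀) y, by rw [e.apply_mk_symm hm]⟩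
    constructor
    · intro y y' hy
      obtain ⟨v, rfl⟩ := hs y
      obtain ⟨v', rfl⟩ := hs y'
      rw [hTeq p₀ hm hm', hTeq p₀ hm hm'] at hy
      have h4 : Φ p₀ v = Φ p₀ v' := (e'.linearEquivAt ℝ (b p₀) hm').injective hy
      rw [(hbij p₀).1 h4]
    · intro y
      obtain ⟨v, hv⟩ := (hbij p₀).2 (e'.symm (b p₀) y)
      exact ⟨_, by rw [hTeq p₀ hm hm' v, hv, e'.apply_mk_symm hm']⟩
  have : FiniteDimensional ℝ F' := Module.Finite.of_surjective (T p₀ : F →ₗ[ℝ] F') hTbij.2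
  let Teq : F ≃L[ℝ] F' := (LinearEquiv.ofBijective (T p₀ : F →ₗ[ℝ] F') hTbij).toContinuousLinearEquiv
  have hTe : (Teq : F →L[ℝ] F') = T p₀ := by ext; rfl
  have hinv : ContMDiffAt IP 𝓘(ℝ, F' →L[ℝ] F) ∞ (fun p => (T p).inverse) p₀ := by
    have h3 : ContDiffAt ℝ ∞ ContinuousLinearMap.inverse (T p₀) := hTe ▸ contDiffAt_map_inverse Teq
    exact h3.contMDiffAt.comp p₀ hT1
  have hunit : ∀ᶠ p in 𝓝 p₀, ∃ L : F ≃L[ℝ] F', (L : F →L[ℝ] F') = T p :=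
    hT1.continuousAt.preimage_mem_nhds
      (t := Set.range ((↑) : (F ≃L[ℝ] F') → F →L[ℝ] F')) (by rw [← hTe]; exact Teq.nhds)
  refine (hinv.clm_apply h2).congr_of_eventuallyEq ?_
  filter_upwards [hunit, eventually_mem_baseSet (F := F) (W := W) (hb p₀).continuousAt,
    eventually_mem_baseSet (F := F') (W := W') (hb p₀).continuousAt] with p ⟨L, hL⟩ hp hp'
  have h5 := hTeq p hp hp' (s p)
  rw [h p] at h5
  rw [← hL, ContinuousLinearMap.inverse_equiv]
  rw [← hL] at h5
  exact (L.eq_symm_apply).2 h5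

/-! ### Global frames -/

variable (IB F W) in
/-- A finite family of sections that span the fibres, with smooth coefficients. -/
structure BundleFrame (ι : Type*) [Fintype ι] where
  /-- The sections of the frame. -/
  sec : ι → Cₛ^∞⟮IB; F, W⟯
  /-- The coefficients. -/
  coeff : ι → ∀ x, W x →L[ℝ] ℝ
  contMDiff_coeff : ∀ i, ContMDiff (IB.prod 𝓘(ℝ, F)) 𝓘(ℝ, ℝ) ∞
    fun v : TotalSpace F W => coeff i v.1 v.2
  sum_coeff : ∀ x v, ∑ i, coeff i x v • sec i x = v

lemma BundleFrame.contMDiffAt_coeff {ι : Type*} [Fintype ι] (fr : BundleFrame IB F W ι) (i : ι)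
    {s : ∀ p, W (b p)}
    (hs : ContMDiffAt IP (IB.prod 𝓘(ℝ, F)) ∞ (fun p => TotalSpace.mk' F (b p) (s p)) p₀) :
    ContMDiffAt IP 𝓘(ℝ, ℝ) ∞ (fun p => fr.coeff i (b p) (s p)) p₀ :=
  (fr.contMDiff_coeff i).contMDiffAt.comp p₀ hs

/-- A family of linear maps is smooth if its values on a frame are. -/
theorem BundleFrame.smoothAlong_hom {ι : Type*} [Fintype ι] (fr : BundleFrame IB F W ι)
    [FiniteDimensional ℝ F] [∀ x, IsTopologicalAddGroup (W' x)] [∀ x, ContinuousSMul ℝ (W' x)]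
    [ContMDiffVectorBundle ∞ F W IB]
    {Φ : ∀ p, W (b p) →L[ℝ] W' (b p)} (hb : ContMDiff IP IB ∞ b)
    (h : ∀ i, SmoothAlong IP IB F' b fun p => Φ p (fr.sec i (b p))) :
    SmoothAlong (W := fun x => W x →L[ℝ] W' x) IP IB (F →L[ℝ] F') b Φ := by
  intro p₀
  refine (contMDiffAt_hom_bundle _).2 ⟨hb p₀, ?_⟩
  set e := trivializationAt F W (b p₀) with he
  set e' := trivializationAt F' W' (b p₀) with he'
  let B := Module.finBasis ℝ F
  set T : P → F →L[ℝ] F' := fun p =>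
    ContinuousLinearMap.inCoordinates F W F' W' (b p₀) (b p) (b p₀) (b p) (Φ p) with hT
  change ContMDiffAt IP 𝓘(ℝ, F →L[ℝ] F') ∞ T p₀
  have key : ∀ k, ContMDiffAt IP 𝓘(ℝ, F') ∞ (fun p => T p (B k)) p₀ := by
    intro k
    have h1 : ContMDiffAt IP (IB.prod 𝓘(ℝ, F)) ∞
        (fun p => TotalSpace.mk' F (b p) (e.symm (b p) (B k))) p₀ := by
      have hm : b p₀ ∈ e.baseSet := FiberBundle.mem_baseSet_trivializationAt' _
      have hs : TotalSpace.mk' F (b p₀) (e.symm (b p₀) (B k)) ∈ e.source := e.mem_source.2 hm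
      refine (Bundle.Trivialization.contMDiffAt_iff (e := e)
        (f := fun p => TotalSpace.mk' F (b p) (e.symm (b p) (B k))) hs).2 ⟨hb p₀, (contMDiffAt_const (c := B k)).congr_of_eventuallyEq ?_⟩
      filter_upwards [eventually_mem_baseSet (F := F) (W := W) (hb p₀).continuousAt] with p hp
      rw [e.apply_mk_symm hp]
    have h2 : ContMDiffAt IP (IB.prod 𝓘(ℝ, F')) ∞
        (fun p => TotalSpace.mk' F' (b p) (Φ p (e.symm (b p) (B k)))) p₀ := by
      have h3 : ∀ p, Φ p (e.symm (b p) (B k)) =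
          ∑ i, fr.coeff i (b p) (e.symm (b p) (B k)) • Φ p (fr.sec i (b p)) := fun p => by
        conv_lhs => rw [← fr.sum_coeff (b p) (e.symm (b p) (B k))]
        rw [map_sum]
        simp only [map_smul]
      simp only [h3]
      exact contMDiffAt_along_sum (hb p₀) fun i _ =>
        contMDiffAt_along_smul (fr.contMDiffAt_coeff i h1) (h i p₀)
    refine (contMDiffAt_totalSpace.1 h2).2.congr_of_eventuallyEq ?_
    filter_upwards [eventually_mem_baseSet (F := F) (W := W) (hb p₀).continuousAt,
      eventually_mem_baseSet (F := F') (W := W') (hb p₀).continuousAt] with p hp hp'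
    rw [hT]
    simp only
    rw [ContinuousLinearMap.inCoordinates_eq hp hp']
    rfl
  have hsum : T = fun p => ∑ k, ContinuousLinearMap.smulRightL ℝ F F' (LinearMap.toContinuousLinearMap
      (B.coord k)) (T p (B k)) := by
    funext p
    ext v
    calc T p v = T p (∑ k, B.repr v k • B k) := by rw [B.sum_repr]
      _ = _ := by
        rw [map_sum, sum_apply]
        simp
  rw [hsum]
  refine contMDiffAt_finsetSum fun k _ => ?_
  exact (ContinuousLinearMap.contDiff (n := ∞) (ContinuousLinearMap.smulRightL ℝ F F'
    (LinearMap.toContinuousLinearMap (B.coord k)))).contMDiff.contMDiffAt.comp p₀ (key k)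

/-- Vector bundles over compact manifolds have global frames. -/
theorem exists_bundleFrame [CompactSpace N] [T2Space N] [FiniteDimensional ℝ EB]
    [IsManifold IB ∞ N] [FiniteDimensional ℝ F] [ContMDiffVectorBundle ∞ F W IB] :
    ∃ (ι : Type) (_ : Fintype ι), Nonempty (BundleFrame IB F W ι) := by
  have hex : ∀ c : N, ∃ f : SmoothBumpFunction IB c,
      tsupport f ⊆ (trivializationAt F W c).baseSet := fun c => by
    obtain ⟨f, -, hf⟩ := (SmoothBumpFunction.nhds_basis_tsupport (I := IB) c).mem_iff.1
      ((trivializationAt F W c).open_baseSet.mem_nhds (FiberBundle.mem_baseSet_trivializationAt' c))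
    exact ⟨f, hf⟩
  choose ρ hρ using hex
  obtain ⟨t, ht⟩ := CompactSpace.elim_nhds_subcover (fun c => {y | ρ c y ≠ 0}) fun c =>
    (isOpen_ne_fun (ρ c).continuous continuous_const).mem_nhds
      (by simp)
  let m := t.card
  let e : Fin m → N := fun a => (t.equivFin.symm a).1
  let q : N → ℝ := fun x => ∑ a, ρ (e a) x ^ 2
  have hq : ∀ x, q x ≠ 0 := fun x => by
    obtain ⟨c, hc, hx⟩ : ∃ c ∈ t, ρ c x ≠ 0 := by
      have : x ∈ ⋃ c ∈ t, {y | ρ c y ≠ 0} := by rw [ht]; trivial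
      simpa using this
    refine (Finset.sum_pos' (fun a _ => sq_nonneg _) ⟨t.equivFin ⟨c, hc⟩, Finset.mem_univ _, ?_⟩).ne'
    have hc' : ∀ c', c' = c → ρ c' x ≠ 0 := by
      rintro _ rfl
      exact hx
    exact sq_pos_of_ne_zero (hc' _ (by simp [e]))
  have hqs : ContMDiff IB 𝓘(ℝ, ℝ) ∞ q :=
    contMDiff_finsetSum fun a _ => (ρ (e a)).contMDiff.pow 2
  let B := Module.finBasis ℝ F
  let T : ∀ a, Trivialization F (TotalSpace.proj : TotalSpace F W → N) := fun a =>
    trivializationAt F W (e a)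
  refine ⟨Fin m × Fin (Module.finrank ℝ F), inferInstance, ⟨{
    sec := fun i => ⟨fun x => ρ (e i.1) x • (T i.1).localFrame B i.2 x, ?_⟩
    coeff := fun i x => (ρ (e i.1) x / q x) • ((LinearMap.toContinuousLinearMap (B.coord i.2)) ∘L
      (T i.1).continuousLinearMapAt ℝ x)
    contMDiff_coeff := ?_
    sum_coeff := ?_ }⟩⟩
  · exact ContMDiffOn.smul_section_of_tsupport (ρ (e i.1)).contMDiff.contMDiffOn
      (T i.1).open_baseSet (hρ _) ((T i.1).contMDiffOn_localFrame_baseSet (I := IB) ∞ B i.2)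
  · rintro ⟨a, k⟩
    have hproj : ContMDiff (IB.prod 𝓘(ℝ, F)) IB ∞ (TotalSpace.proj : TotalSpace F W → N) :=
      contMDiff_proj W
    have h1 : ContMDiff (IB.prod 𝓘(ℝ, F)) 𝓘(ℝ, ℝ) ∞
        fun v : TotalSpace F W => ρ (e a) v.1 / q v.1 := by
      have h2 : ContMDiff IB 𝓘(ℝ, ℝ) ∞ fun x => ρ (e a) x / q x :=
        (ρ (e a)).contMDiff.div₀ hqs hq
      exact h2.comp hproj
    refine contMDiff_of_contMDiffOn_union_of_isOpen (s := (T a).source)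
      (t := TotalSpace.proj ⁻¹' (tsupport (ρ (e a)))ᶜ) ?_ ?_ ?_ (T a).open_source
      ((isOpen_compl_iff.2 (isClosed_tsupport _)).preimage hproj.continuous)
    · have h2 : ContMDiffOn (IB.prod 𝓘(ℝ, F)) 𝓘(ℝ, ℝ) ∞
          (fun v : TotalSpace F W => B.coord k (T a v).2) (T a).source := by
        have h3 : ContMDiffOn (IB.prod 𝓘(ℝ, F)) 𝓘(ℝ, F) ∞
            (fun v : TotalSpace F W => (T a v).2) (T a).source :=
          contMDiff_snd.comp_contMDiffOn (T a).contMDiffOn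
        exact (LinearMap.toContinuousLinearMap (B.coord k)).contDiff.contMDiff.comp_contMDiffOn h3
      refine (h1.contMDiffOn.mul h2).congr fun v hv => ?_
      have hv' : v.1 ∈ (T a).baseSet := (T a).mem_source.1 hv
      simp [Bundle.Trivialization.coe_linearMapAt_of_mem _ hv']
    · refine (contMDiffOn_const (c := (0 : ℝ))).congr fun v hv => ?_
      have : ρ (e a) v.1 = 0 := image_eq_zero_of_notMem_tsupport hv
      simp [this]
    · refine Set.eq_univ_of_forall fun v => ?_
      by_cases hv : v.1 ∈ tsupport (ρ (e a))
      · exact Or.inl ((T a).mem_source.2 (hρ _ hv))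
      · exact Or.inr hv
  · intro x v
    rw [Fintype.sum_prod_type]
    have key : ∀ a, ∑ k, ((ρ (e a) x / q x) • ((LinearMap.toContinuousLinearMap (B.coord k)) ∘L
        (T a).continuousLinearMapAt ℝ x)) v •
        (ρ (e a) x • (T a).localFrame B k x) = (ρ (e a) x ^ 2 / q x) • v := by
      intro a
      by_cases hx : ρ (e a) x = 0
      · simp [hx]
      have hx' : x ∈ (T a).baseSet := hρ _ (subset_tsupport _ hx)
      have h1 : ∀ k, (T a).localFrame B k x = ((T a).linearEquivAt ℝ x hx').symm (B k) := fun k => by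
        rw [(T a).localFrame_apply_of_mem_baseSet B hx']
        rfl
      have h2 : ∑ k, B.coord k ((T a).linearMapAt ℝ x v) • (T a).localFrame B k x = v := by
        simp only [h1, ← map_smul]
        rw [← map_sum]
        simp only [Module.Basis.coord_apply, B.sum_repr]
        rw [LinearEquiv.symm_apply_eq]
        exact congrFun (Bundle.Trivialization.coe_linearMapAt_of_mem _ hx') v
      calc _ = ∑ k, (ρ (e a) x ^ 2 / q x) •
            (B.coord k ((T a).linearMapAt ℝ x v) • (T a).localFrame B k x) :=
            Finset.sum_congr rfl fun k _ => by
              simp only [smul_apply, ContinuousLinearMap.comp_apply, smul_smul, smul_eq_mul,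
                LinearMap.coe_toContinuousLinearMap',
                Bundle.Trivialization.continuousLinearMapAt_apply]
              congr 1
              ring
        _ = _ := by rw [← Finset.smul_sum, h2]
    have h3 : ∑ a, ρ (e a) x ^ 2 / q x = 1 := by
      rw [← Finset.sum_div]
      exact div_self (hq x)
    calc _ = ∑ a, (ρ (e a) x ^ 2 / q x) • v := Finset.sum_congr rfl fun a _ => key a
      _ = v := by rw [← Finset.sum_smul, h3, one_smul]

end Along

/-! ### Instances

Copies of inferred instances, found without a search. -/

section Shortcuts

variable {M : Type*} [TopologicalSpace M] [ChartedSpace R3 M] [IsManifold (𝓡 3) ∞ M]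
  (x : M) (q : M × Circle)

local notation "𝖳" => TangentSpace (𝓡 3)

instance : TopologicalSpace (TotalSpace R3 fun x : M => 𝖳 x) := inferInstance
instance : FiberBundle R3 fun x : M => 𝖳 x := inferInstance
instance : VectorBundle ℝ R3 fun x : M => 𝖳 x := inferInstance
instance : NormedAddCommGroup (R3 →L[ℝ] ℝ) := inferInstance
instance : NormedSpace ℝ (R3 →L[ℝ] ℝ) := inferInstance
instance : TopologicalSpace (𝖳 x →L[ℝ] ℝ) := inferInstance
instance : AddCommGroup (𝖳 x →L[ℝ] ℝ) := inferInstance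
instance : AddCommMonoid (𝖳 x →L[ℝ] ℝ) := inferInstance
instance : Module ℝ (𝖳 x →L[ℝ] ℝ) := inferInstance
instance : IsTopologicalAddGroup (𝖳 x →L[ℝ] ℝ) := inferInstance
instance : ContinuousSMul ℝ (𝖳 x →L[ℝ] ℝ) := inferInstance
instance : TopologicalSpace (TotalSpace (R3 →L[ℝ] ℝ) fun x : M => 𝖳 x →L[ℝ] ℝ) := inferInstance
instance : FiberBundle (R3 →L[ℝ] ℝ) fun x : M => 𝖳 x →L[ℝ] ℝ := inferInstance
instance : VectorBundle ℝ (R3 →L[ℝ] ℝ) fun x : M => 𝖳 x →L[ℝ] ℝ := inferInstance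
instance : NormedAddCommGroup (R3 →L[ℝ] R3) := inferInstance
instance : NormedSpace ℝ (R3 →L[ℝ] R3) := inferInstance
instance : TopologicalSpace (𝖳 x →L[ℝ] 𝖳 x) := inferInstance
instance : AddCommGroup (𝖳 x →L[ℝ] 𝖳 x) := inferInstance
instance : AddCommMonoid (𝖳 x →L[ℝ] 𝖳 x) := inferInstance
instance : Module ℝ (𝖳 x →L[ℝ] 𝖳 x) := inferInstance
instance : TopologicalSpace (TotalSpace (R3 →L[ℝ] R3) fun x : M => 𝖳 x →L[ℝ] 𝖳 x) := inferInstance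
instance : FiberBundle (R3 →L[ℝ] R3) fun x : M => 𝖳 x →L[ℝ] 𝖳 x := inferInstance
instance : VectorBundle ℝ (R3 →L[ℝ] R3) fun x : M => 𝖳 x →L[ℝ] 𝖳 x := inferInstance
instance : NormedAddCommGroup (R3 →L[ℝ] R3 →L[ℝ] ℝ) := inferInstance
instance : NormedSpace ℝ (R3 →L[ℝ] R3 →L[ℝ] ℝ) := inferInstance
instance : TopologicalSpace (𝖳 x →L[ℝ] 𝖳 x →L[ℝ] ℝ) := inferInstance
instance : AddCommGroup (𝖳 x →L[ℝ] 𝖳 x →L[ℝ] ℝ) := inferInstance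
instance : AddCommMonoid (𝖳 x →L[ℝ] 𝖳 x →L[ℝ] ℝ) := inferInstance
instance : Module ℝ (𝖳 x →L[ℝ] 𝖳 x →L[ℝ] ℝ) := inferInstance
instance : TopologicalSpace (TotalSpace (R3 →L[ℝ] R3 →L[ℝ] ℝ) fun x : M => 𝖳 x →L[ℝ] 𝖳 x →L[ℝ] ℝ) :=
  inferInstance
instance : FiberBundle (R3 →L[ℝ] R3 →L[ℝ] ℝ) fun x : M => 𝖳 x →L[ℝ] 𝖳 x →L[ℝ] ℝ := inferInstance
instance : VectorBundle ℝ (R3 →L[ℝ] R3 →L[ℝ] ℝ) fun x : M => 𝖳 x →L[ℝ] 𝖳 x →L[ℝ] ℝ := inferInstance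
instance : TopologicalSpace (TotalSpace EX fun q : M × Circle => TX M q) := inferInstance
instance : FiberBundle EX fun q : M × Circle => TX M q := inferInstance
instance : VectorBundle ℝ EX fun q : M × Circle => TX M q := inferInstance
instance : NormedAddCommGroup (EX →L[ℝ] ℝ) := inferInstance
instance : NormedSpace ℝ (EX →L[ℝ] ℝ) := inferInstance
instance : TopologicalSpace (TX M q →L[ℝ] ℝ) := inferInstance
instance : AddCommGroup (TX M q →L[ℝ] ℝ) := inferInstance
instance : AddCommMonoid (TX M q →L[ℝ] ℝ) := inferInstance
instance : Module ℝ (TX M q →L[ℝ] ℝ) := inferInstance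
instance : IsTopologicalAddGroup (TX M q →L[ℝ] ℝ) := inferInstance
instance : ContinuousSMul ℝ (TX M q →L[ℝ] ℝ) := inferInstance
instance : TopologicalSpace (TotalSpace (EX →L[ℝ] ℝ) fun q : M × Circle => TX M q →L[ℝ] ℝ) :=
  inferInstance
instance : FiberBundle (EX →L[ℝ] ℝ) fun q : M × Circle => TX M q →L[ℝ] ℝ := inferInstance
instance : VectorBundle ℝ (EX →L[ℝ] ℝ) fun q : M × Circle => TX M q →L[ℝ] ℝ := inferInstance
instance : NormedAddCommGroup (EX →L[ℝ] EX) := inferInstance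
instance : NormedSpace ℝ (EX →L[ℝ] EX) := inferInstance
instance : TopologicalSpace (TX M q →L[ℝ] TX M q) := inferInstance
instance : AddCommGroup (TX M q →L[ℝ] TX M q) := inferInstance
instance : AddCommMonoid (TX M q →L[ℝ] TX M q) := inferInstance
instance : Module ℝ (TX M q →L[ℝ] TX M q) := inferInstance
instance : TopologicalSpace (TotalSpace (EX →L[ℝ] EX) fun q : M × Circle => TX M q →L[ℝ] TX M q) :=
  inferInstance
instance : FiberBundle (EX →L[ℝ] EX) fun q : M × Circle => TX M q →L[ℝ] TX M q := inferInstance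
instance : VectorBundle ℝ (EX →L[ℝ] EX) fun q : M × Circle => TX M q →L[ℝ] TX M q := inferInstance
instance : NormedAddCommGroup (EX →L[ℝ] EX →L[ℝ] ℝ) := inferInstance
instance : NormedSpace ℝ (EX →L[ℝ] EX →L[ℝ] ℝ) := inferInstance
instance : TopologicalSpace (TX M q →L[ℝ] TX M q →L[ℝ] ℝ) := inferInstance
instance : AddCommGroup (TX M q →L[ℝ] TX M q →L[ℝ] ℝ) := inferInstance
instance : AddCommMonoid (TX M q →L[ℝ] TX M q →L[ℝ] ℝ) := inferInstance
instance : Module ℝ (TX M q →L[ℝ] TX M q →L[ℝ] ℝ) := inferInstance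
instance : TopologicalSpace (TotalSpace (EX →L[ℝ] EX →L[ℝ] ℝ) fun q : M × Circle => TX M q →L[ℝ] TX M q →L[ℝ] ℝ) :=
  inferInstance
instance : FiberBundle (EX →L[ℝ] EX →L[ℝ] ℝ) fun q : M × Circle => TX M q →L[ℝ] TX M q →L[ℝ] ℝ :=
  inferInstance
instance : VectorBundle ℝ (EX →L[ℝ] EX →L[ℝ] ℝ) fun q : M × Circle => TX M q →L[ℝ] TX M q →L[ℝ] ℝ :=
  inferInstance

end Shortcuts

section Bilinear

variable {EP : Type*} [NormedAddCommGroup EP] [NormedSpace ℝ EP] {HP : Type*} [TopologicalSpace HP]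
  {IP : ModelWithCorners ℝ EP HP} {P : Type*} [TopologicalSpace P] [ChartedSpace HP P]
  {EB : Type*} [NormedAddCommGroup EB] [NormedSpace ℝ EB] {HB : Type*} [TopologicalSpace HB]
  {IB : ModelWithCorners ℝ EB HB} {N : Type*} [TopologicalSpace N] [ChartedSpace HB N]
  {F : Type*} [NormedAddCommGroup F] [NormedSpace ℝ F] [FiniteDimensional ℝ F]
  {W : N → Type*} [TopologicalSpace (TotalSpace F W)] [∀ x, TopologicalSpace (W x)]
  [FiberBundle F W] [∀ x, AddCommGroup (W x)] [∀ x, Module ℝ (W x)] [VectorBundle ℝ F W]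
  [ContMDiffVectorBundle ∞ F W IB]
  {b : P → N} {ι : Type*} [Fintype ι]

/-- A family of linear forms is smooth if its values on a frame are. -/
lemma BundleFrame.smoothAlong_form (fr : BundleFrame IB F W ι) {Φ : ∀ p, W (b p) →L[ℝ] ℝ}
    (hb : ContMDiff IP IB ∞ b)
    (h : ∀ i, ContMDiff IP 𝓘(ℝ, ℝ) ∞ fun p => Φ p (fr.sec i (b p))) :
    SmoothAlong (W := fun x => W x →L[ℝ] ℝ) IP IB (F →L[ℝ] ℝ) b Φ :=
  fr.smoothAlong_hom (W' := Bundle.Trivial N ℝ) hb fun i => smoothAlong_trivial_iff.2 ⟨hb, h i⟩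

/-- A family of bilinear forms is smooth if its values on a frame are. -/
lemma BundleFrame.smoothAlong_bilin (fr : BundleFrame IB F W ι)
    {Φ : ∀ p, W (b p) →L[ℝ] W (b p) →L[ℝ] ℝ} (hb : ContMDiff IP IB ∞ b)
    (h : ∀ i j, ContMDiff IP 𝓘(ℝ, ℝ) ∞ fun p => Φ p (fr.sec i (b p)) (fr.sec j (b p))) :
    SmoothAlong (W := fun x => W x →L[ℝ] W x →L[ℝ] ℝ) IP IB (F →L[ℝ] F →L[ℝ] ℝ) b Φ :=
  fr.smoothAlong_hom (W' := fun x => W x →L[ℝ] ℝ) hb fun i => fr.smoothAlong_form hb fun j => h i j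

lemma SmoothAlong.bilin_apply {Φ : ∀ p, W (b p) →L[ℝ] W (b p) →L[ℝ] ℝ} {s t : ∀ p, W (b p)}
    (hΦ : SmoothAlong (W := fun x => W x →L[ℝ] W x →L[ℝ] ℝ) IP IB (F →L[ℝ] F →L[ℝ] ℝ) b Φ)
    (hs : SmoothAlong IP IB F b s) (ht : SmoothAlong IP IB F b t) :
    ContMDiff IP 𝓘(ℝ, ℝ) ∞ fun p => Φ p (s p) (t p) :=
  SmoothAlong.clm_apply_real (SmoothAlong.clm_apply (W' := fun x => W x →L[ℝ] ℝ) hΦ hs) ht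

lemma BundleFrame.contMDiff_coeff_along (fr : BundleFrame IB F W ι) (i : ι) {s : ∀ p, W (b p)}
    (hs : SmoothAlong IP IB F b s) : ContMDiff IP 𝓘(ℝ, ℝ) ∞ fun p => fr.coeff i (b p) (s p) :=
  fun p => fr.contMDiffAt_coeff i (hs p)

variable (fr : BundleFrame IB F W ι)

/-- The coefficients of a frame as sections of the dual bundle. -/
def BundleFrame.coSec (i : ι) : Cₛ^∞⟮IB; F →L[ℝ] ℝ, fun x => W x →L[ℝ] ℝ⟯ :=
  ⟨fun x => fr.coeff i x, fr.smoothAlong_form (IP := IB) (b := id) contMDiff_id fun j =>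
    fr.contMDiff_coeff_along i (smoothAlong_section (fr.sec j) contMDiff_id)⟩

/-- A linear form from its values on the frame. -/
lemma BundleFrame.form_eq_sum {x : N} (α : W x →L[ℝ] ℝ) (v : W x) :
    α v = ∑ i, α (fr.sec i x) * fr.coeff i x v := by
  conv_lhs => rw [← fr.sum_coeff x v]
  simp [mul_comm]

lemma BundleFrame.bilin_eq_sum {x : N} (β : W x →L[ℝ] W x →L[ℝ] ℝ) (u v : W x) :
    β u v = ∑ i, ∑ j, β (fr.sec i x) (fr.sec j x) * (fr.coeff i x u * fr.coeff j x v) := by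
  conv_lhs => rw [← fr.sum_coeff x u, map_sum, sum_apply]
  refine Finset.sum_congr rfl fun i _ => ?_
  rw [map_smul, smul_apply, fr.form_eq_sum (β (fr.sec i x)) v, smul_eq_mul, Finset.mul_sum]
  refine Finset.sum_congr rfl fun j _ => ?_
  ring

end Bilinear

section OnM

variable {M : Type*} [TopologicalSpace M] [ChartedSpace R3 M] [IsManifold (𝓡 3) ∞ M]

variable (M) in
/-- Smooth vector fields. -/
abbrev VecField : Type _ := Cₛ^∞⟮𝓡 3; R3, fun x : M => TangentSpace (𝓡 3) x⟯

variable (M) in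
/-- Smooth symmetric bilinear forms. -/
def SymBilin : Submodule ℝ (Bilin M) where
  carrier := {β | ∀ x u v, β x u v = β x v u}
  zero_mem' _ _ _ := rfl
  add_mem' {a b} ha hb x u v := by
    change a x u v + b x u v = a x v u + b x v u
    rw [ha, hb]
  smul_mem' c a ha x u v := by
    change c * a x u v = c * a x v u
    rw [ha]

section Generic

variable {F : Type*} [NormedAddCommGroup F] [NormedSpace ℝ F]
  {W : M → Type*} [TopologicalSpace (TotalSpace F W)] [∀ x, TopologicalSpace (W x)]
  [FiberBundle F W] [∀ x, AddCommGroup (W x)] [∀ x, Module ℝ (W x)] [VectorBundle ℝ F W]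
  [ContMDiffVectorBundle ∞ F W (𝓡 3)]

/-- Multiplication of a section by functions. -/
def smulSection (σ : Cₛ^∞⟮𝓡 3; F, W⟯) : SmoothFn M →ₗ[ℝ] Cₛ^∞⟮𝓡 3; F, W⟯ where
  toFun f := ⟨fun x => f x • σ x, (smoothAlong_section σ contMDiff_id).smul f.contMDiff⟩
  map_add' f g := ContMDiffSection.ext fun x => add_smul (f x) (g x) (σ x)
  map_smul' r f := ContMDiffSection.ext fun x => smul_assoc r (f x) (σ x)

lemma dSmooth_smulSection (σ : Cₛ^∞⟮𝓡 3; F, W⟯) : DSmooth (smulSection σ) := fun _ _ hp =>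
  isPlot_section_iff.2 ((smoothAlong_section σ contMDiff_snd).smul (isPlot_smoothFn_iff.1 hp))

/-- Evaluation of linear forms on a section. -/
def evalSection (σ : Cₛ^∞⟮𝓡 3; F, W⟯) :
    Cₛ^∞⟮𝓡 3; F →L[ℝ] ℝ, fun x => W x →L[ℝ] ℝ⟯ →ₗ[ℝ] SmoothFn M where
  toFun α := ⟨fun x => α x (σ x), SmoothAlong.clm_apply_real
    (smoothAlong_section α contMDiff_id) (smoothAlong_section σ contMDiff_id)⟩
  map_add' _ _ := rfl
  map_smul' _ _ := rfl

lemma dSmooth_evalSection [FiniteDimensional ℝ F] (σ : Cₛ^∞⟮𝓡 3; F, W⟯) :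
    DSmooth (evalSection σ) := fun _ _ hp =>
  isPlot_smoothFn_iff.2 (SmoothAlong.clm_apply_real (isPlot_section_iff.1 hp)
    (smoothAlong_section σ contMDiff_snd))

/-- Evaluation of bilinear forms on two sections. -/
def evalSection₂ [FiniteDimensional ℝ F] (σ τ : Cₛ^∞⟮𝓡 3; F, W⟯) :
    Cₛ^∞⟮𝓡 3; F →L[ℝ] F →L[ℝ] ℝ, fun x => W x →L[ℝ] W x →L[ℝ] ℝ⟯ →ₗ[ℝ] SmoothFn M where
  toFun β := ⟨fun x => β x (σ x) (τ x), SmoothAlong.bilin_apply (W := W)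
    (smoothAlong_section β contMDiff_id) (smoothAlong_section σ contMDiff_id)
    (smoothAlong_section τ contMDiff_id)⟩
  map_add' _ _ := rfl
  map_smul' _ _ := rfl

lemma dSmooth_evalSection₂ [FiniteDimensional ℝ F] (σ τ : Cₛ^∞⟮𝓡 3; F, W⟯) :
    DSmooth (evalSection₂ σ τ) := fun _ _ hp =>
  isPlot_smoothFn_iff.2 (SmoothAlong.bilin_apply (W := W) (isPlot_section_iff.1 hp)
    (smoothAlong_section σ contMDiff_snd) (smoothAlong_section τ contMDiff_snd))

end Generic

variable {ι : Type} [Fintype ι]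

variable (M ι) in
/-- A frame of the tangent bundle of `M`. -/
abbrev TFrame : Type _ := BundleFrame (𝓡 3) R3 (fun x : M => TangentSpace (𝓡 3) x) ι

variable (fr : TFrame M ι)

/-- The tensor product of two coefficient forms. -/
def TFrame.tens (i j : ι) : Bilin M :=
  ⟨fun x => (fr.coeff i x).smulRight (fr.coeff j x),
    fr.smoothAlong_bilin (IP := 𝓡 3) (b := id) contMDiff_id fun k l => by
      have h1 := fr.contMDiff_coeff_along i (smoothAlong_section (fr.sec k) (contMDiff_id (I := 𝓡 3)))
      have h2 := fr.contMDiff_coeff_along j (smoothAlong_section (fr.sec l) (contMDiff_id (I := 𝓡 3)))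
      exact (h1.mul h2).congr fun x => rfl⟩

/-- The exterior product of two coefficient forms. -/
def TFrame.alt (i j : ι) : Form2 M :=
  ⟨(1 / 2 : ℝ) • (TFrame.tens fr i j - TFrame.tens fr j i), fun x u => by
    change (1 / 2 : ℝ) * (fr.coeff i x u * fr.coeff j x u - fr.coeff j x u * fr.coeff i x u) = 0
    ring⟩

lemma TFrame.alt_apply (i j : ι) (x : M) (u v : TangentSpace (𝓡 3) x) :
    (TFrame.alt fr i j).1 x u v =
      1 / 2 * (fr.coeff i x u * fr.coeff j x v - fr.coeff j x u * fr.coeff i x v) := rfl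

/-- The symmetric product of two coefficient forms. -/
def TFrame.sym (i j : ι) : SymBilin M :=
  ⟨(1 / 2 : ℝ) • (TFrame.tens fr i j + TFrame.tens fr j i), fun x u v => by
    change (1 / 2 : ℝ) * (fr.coeff i x u * fr.coeff j x v + fr.coeff j x u * fr.coeff i x v) =
      (1 / 2 : ℝ) * (fr.coeff i x v * fr.coeff j x u + fr.coeff j x v * fr.coeff i x u)
    ring⟩

/-- Multiplication by functions preserves a submodule of sections given by pointwise conditions. -/
def smulSub {S : Submodule ℝ (Bilin M)} (σ : S)
    (h : ∀ f : SmoothFn M, smulSection σ.1 f ∈ S) : SmoothFn M →ₗ[ℝ] S :=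
  (smulSection σ.1).codRestrict S h

lemma dSmooth_smulSub {S : Submodule ℝ (Bilin M)} (σ : S)
    (h : ∀ f : SmoothFn M, smulSection σ.1 f ∈ S) : DSmooth (smulSub σ h) := fun n p hp =>
  isPlot_subtype_iff.2 (dSmooth_smulSection σ.1 n p hp)

lemma smulSection_mem_form2 (σ : Form2 M) (f : SmoothFn M) : smulSection σ.1 f ∈ Form2 M :=
  fun x u => by
    change f x * σ.1 x u u = 0
    rw [σ.2, mul_zero]

lemma smulSection_mem_symBilin (σ : SymBilin M) (f : SmoothFn M) :
    smulSection σ.1 f ∈ SymBilin M := fun x u v => by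
  change f x * σ.1 x u v = f x * σ.1 x v u
  rw [σ.2]

lemma Form2.swap (β : Form2 M) (x : M) (u v : TangentSpace (𝓡 3) x) :
    β.1 x u v = -β.1 x v u := by
  have h := β.2 x (u + v)
  simp only [map_add, add_apply] at h
  have h1 := β.2 x u
  have h2 := β.2 x v
  rw [h1, h2] at h
  linarith

lemma bilin_ext {α β : Bilin M} (h : ∀ x u v, α x u v = β x u v) : α = β :=
  ContMDiffSection.ext fun x => ContinuousLinearMap.ext fun u => ContinuousLinearMap.ext fun v =>
    h x u v

lemma sum_section_apply {F : Type*} [NormedAddCommGroup F] [NormedSpace ℝ F]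
    {W : M → Type*} [TopologicalSpace (TotalSpace F W)] [∀ x, TopologicalSpace (W x)]
    [FiberBundle F W] [∀ x, AddCommGroup (W x)] [∀ x, Module ℝ (W x)] [VectorBundle ℝ F W]
    {κ : Type*} (A : Finset κ) (s : κ → Cₛ^∞⟮𝓡 3; F, W⟯) (x : M) :
    (∑ i ∈ A, s i) x = ∑ i ∈ A, s i x := by
  classical
  induction A using Finset.induction_on with
  | empty => rfl
  | insert i A hi ih =>
    rw [Finset.sum_insert hi, Finset.sum_insert hi, ← ih]
    rfl

variable [T2Space M] [CompactSpace M]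

lemma exists_tFrame : ∃ (ι : Type) (_ : Fintype ι), Nonempty (TFrame M ι) := exists_bundleFrame

lemma smoothSummand_vecField : SmoothSummand (VecField M) (Rapid ℕ) := by
  obtain ⟨ι, _, ⟨fr⟩⟩ := exists_tFrame (M := M)
  refine smoothSummand_of_smoothFn (M := M) (J := fun i => smulSection (fr.sec i))
    (R := fun i => { toFun := fun X => ⟨fun x => fr.coeff i x (X x), fr.contMDiff_coeff_along i
                       (smoothAlong_section X contMDiff_id)⟩
                     map_add' := fun X Y => ContMDiffMap.ext fun x => map_add (fr.coeff i x) _ _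
                     map_smul' := fun r X => ContMDiffMap.ext fun x =>
                       map_smul (fr.coeff i x) r _ })
    (fun i => dSmooth_smulSection _) (fun i n p hp => isPlot_smoothFn_iff.2
      (fr.contMDiff_coeff_along i (isPlot_section_iff.1 hp))) fun X => ContMDiffSection.ext fun x => ?_
  rw [sum_section_apply]
  exact fr.sum_coeff x (X x)

lemma smoothSummand_form1 : SmoothSummand (Form1 M) (Rapid ℕ) := by
  obtain ⟨ι, _, ⟨fr⟩⟩ := exists_tFrame (M := M)
  refine smoothSummand_of_smoothFn (M := M) (J := fun i => smulSection (fr.coSec i))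
    (R := fun i => evalSection (fr.sec i)) (fun i => dSmooth_smulSection _)
    (fun i => dSmooth_evalSection _) fun α => ContMDiffSection.ext fun x =>
      ContinuousLinearMap.ext fun v => ?_
  rw [sum_section_apply, sum_apply]
  exact (fr.form_eq_sum (α x) v).symm

lemma smoothSummand_form2 : SmoothSummand (Form2 M) (Rapid ℕ) := by
  obtain ⟨ι, _, ⟨fr⟩⟩ := exists_tFrame (M := M)
  refine smoothSummand_of_smoothFn (M := M) (ι := ι × ι)
    (J := fun i => smulSub (TFrame.alt fr i.1 i.2) (smulSection_mem_form2 _))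
    (R := fun i => evalSection₂ (fr.sec i.1) (fr.sec i.2) ∘ₗ (Form2 M).subtype)
    (fun i => dSmooth_smulSub _ _)
    (fun i n p hp => dSmooth_evalSection₂ _ _ n _ (isPlot_subtype_iff.1 hp))
    fun β => Subtype.ext (bilin_ext fun x u v => ?_)
  rw [Submodule.coe_sum, sum_section_apply, sum_apply, sum_apply]
  change ∑ i : ι × ι, β.1 x (fr.sec i.1 x) (fr.sec i.2 x) * (1 / 2 * (fr.coeff i.1 x u *
    fr.coeff i.2 x v - fr.coeff i.2 x u * fr.coeff i.1 x v)) = β.1 x u v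
  rw [Fintype.sum_prod_type]
  have h1 := fr.bilin_eq_sum (β.1 x) u v
  have h2 := fr.bilin_eq_sum (β.1 x) v u
  rw [Form2.swap β x v u] at h2
  have h3 : β.1 x u v = 1 / 2 * (β.1 x u v - -β.1 x u v) := by ring
  rw [h3]
  conv_rhs => rw [h2, h1]
  rw [← Finset.sum_sub_distrib, Finset.mul_sum]
  refine Finset.sum_congr rfl fun i _ => ?_
  rw [← Finset.sum_sub_distrib, Finset.mul_sum]
  refine Finset.sum_congr rfl fun j _ => ?_
  simp only
  ring

lemma smoothSummand_symBilin : SmoothSummand (SymBilin M) (Rapid ℕ) := by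
  obtain ⟨ι, _, ⟨fr⟩⟩ := exists_tFrame (M := M)
  refine smoothSummand_of_smoothFn (M := M) (ι := ι × ι)
    (J := fun i => smulSub (TFrame.sym fr i.1 i.2) (smulSection_mem_symBilin _))
    (R := fun i => evalSection₂ (fr.sec i.1) (fr.sec i.2) ∘ₗ (SymBilin M).subtype)
    (fun i => dSmooth_smulSub _ _)
    (fun i n p hp => dSmooth_evalSection₂ _ _ n _ (isPlot_subtype_iff.1 hp))
    fun β => Subtype.ext (bilin_ext fun x u v => ?_)
  rw [Submodule.coe_sum, sum_section_apply, sum_apply, sum_apply]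
  change ∑ i : ι × ι, β.1 x (fr.sec i.1 x) (fr.sec i.2 x) * (1 / 2 * (fr.coeff i.1 x u *
    fr.coeff i.2 x v + fr.coeff i.2 x u * fr.coeff i.1 x v)) = β.1 x u v
  rw [Fintype.sum_prod_type]
  have h1 := fr.bilin_eq_sum (β.1 x) u v
  have h2 := fr.bilin_eq_sum (β.1 x) v u
  rw [β.2 x v u] at h2
  have h3 : β.1 x u v = 1 / 2 * (β.1 x u v + β.1 x u v) := by ring
  rw [h3]
  conv_rhs =>
    congr
    · skip
    · congr
      · rw [h1]
      · rw [h2]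
  rw [← Finset.sum_add_distrib, Finset.mul_sum]
  refine Finset.sum_congr rfl fun i _ => ?_
  rw [← Finset.sum_add_distrib, Finset.mul_sum]
  refine Finset.sum_congr rfl fun j _ => ?_
  simp only
  ring

lemma SmoothSummand.prod {A B : Type*} [AddCommGroup A] [Module ℝ A] [DiffeologicalSpace A]
    [AddCommGroup B] [Module ℝ B] [DiffeologicalSpace B] (hA : SmoothSummand A (Rapid ℕ))
    (hB : SmoothSummand B (Rapid ℕ)) : SmoothSummand (A × B) (Rapid ℕ) := by
  obtain ⟨a, b, ha, hb, hab⟩ := hA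
  obtain ⟨c, d, hc, hd, hcd⟩ := hB
  obtain ⟨e, he, he'⟩ := linearlyDiffeomorphic_rapid_sum (I := ℕ) (J := ℕ) |>.symm.trans
    linearlyDiffeomorphic_rapid_nat_sum
  refine ⟨e.toLinearMap ∘ₗ a.prodMap c, b.prodMap d ∘ₗ e.symm.toLinearMap,
    fun n p hp => he n _ ⟨ha n _ hp.1, hc n _ hp.2⟩,
    fun n p hp => ⟨hb n _ (he' n _ hp).1, hd n _ (he' n _ hp).2⟩, fun x => ?_⟩
  simp [hab, hcd]

lemma exists_coeff_sec_ne_zero (fr : TFrame M ι) (x : M) :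
    ∃ i j, fr.coeff i x (fr.sec j x) ≠ 0 := by
  by_contra! h
  have h0 : ∀ v : TangentSpace (𝓡 3) x, v = 0 := fun v => by
    have h1 : ∀ i, fr.coeff i x v = 0 := fun i => by
      rw [fr.form_eq_sum (fr.coeff i x) v]
      exact Finset.sum_eq_zero fun j _ => by rw [h, zero_mul]
    rw [← fr.sum_coeff x v]
    exact Finset.sum_eq_zero fun i _ => by rw [h1, zero_smul]
  have h1 : (EuclideanSpace.single 0 1 : R3) = 0 := h0 (EuclideanSpace.single 0 1 : R3)
  simpa using congrArg (fun v : R3 => v 0) h1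

lemma smoothSummand_rapid_form1 [Nonempty M] : SmoothSummand (Rapid ℕ) (Form1 M) := by
  obtain ⟨ι, _, ⟨fr⟩⟩ := exists_tFrame (M := M)
  let x₀ : M := Classical.arbitrary M
  obtain ⟨i, j, hij⟩ := exists_coeff_sec_ne_zero fr x₀
  refine smoothSummand_rapid_of_smoothFn (dSmooth_smulSection (fr.coSec i))
    (dSmooth_evalSection (fr.sec j)) (ζ := fun x => fr.coeff i x (fr.sec j x))
    (fr.contMDiff_coeff_along i (smoothAlong_section (fr.sec j) contMDiff_id)) (fun f x => ?_) hij
  exact mul_comm _ _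

lemma exists_alt_sec_ne_zero (fr : TFrame M ι) (x : M) :
    ∃ i j k l, (TFrame.alt fr i j).1 x (fr.sec k x) (fr.sec l x) ≠ 0 := by
  by_contra! h
  have h0 : ∀ i j (u v : TangentSpace (𝓡 3) x),
      fr.coeff i x u * fr.coeff j x v = fr.coeff j x u * fr.coeff i x v := fun i j u v => by
    have h1 : (TFrame.alt fr i j).1 x u v = 0 := by
      rw [fr.bilin_eq_sum]
      exact Finset.sum_eq_zero fun k _ => Finset.sum_eq_zero fun l _ => by rw [h, zero_mul]
    rw [TFrame.alt_apply] at h1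
    linarith
  let u : TangentSpace (𝓡 3) x := (EuclideanSpace.single 0 1 : R3)
  let v : TangentSpace (𝓡 3) x := (EuclideanSpace.single 1 1 : R3)
  have h2 : ∀ j, fr.coeff j x v • u = fr.coeff j x u • v := fun j => by
    conv_lhs => rw [← fr.sum_coeff x u, Finset.smul_sum]
    conv_rhs => rw [← fr.sum_coeff x v, Finset.smul_sum]
    refine Finset.sum_congr rfl fun i _ => ?_
    rw [smul_smul, smul_smul, mul_comm, h0 i j u v]
  have h3 : ∀ j, fr.coeff j x v = 0 := fun j => by
    have h4 : fr.coeff j x v • (EuclideanSpace.single 0 1 : R3) =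
      fr.coeff j x u • (EuclideanSpace.single 1 1 : R3) := h2 j
    simpa using congrArg (fun w : R3 => w 0) h4
  have h5 : (EuclideanSpace.single 1 1 : R3) = 0 := by
    have : v = 0 := by
      rw [← fr.sum_coeff x v]
      exact Finset.sum_eq_zero fun i _ => by rw [h3, zero_smul]
    exact this
  simpa using congrArg (fun w : R3 => w 1) h5

lemma smoothSummand_rapid_form2 [Nonempty M] : SmoothSummand (Rapid ℕ) (Form2 M) := by
  obtain ⟨ι, _, ⟨fr⟩⟩ := exists_tFrame (M := M)
  let x₀ : M := Classical.arbitrary M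
  obtain ⟨i, j, k, l, hij⟩ := exists_alt_sec_ne_zero fr x₀
  refine smoothSummand_rapid_of_smoothFn (X := Form2 M)
    (J := smulSub (TFrame.alt fr i j) (smulSection_mem_form2 _))
    (R := evalSection₂ (fr.sec k) (fr.sec l) ∘ₗ (Form2 M).subtype) (dSmooth_smulSub _ _)
    (fun n p hp => dSmooth_evalSection₂ _ _ n _ (isPlot_subtype_iff.1 hp))
    (ζ := fun x => (TFrame.alt fr i j).1 x (fr.sec k x) (fr.sec l x))
    (evalSection₂ (fr.sec k) (fr.sec l) (TFrame.alt fr i j).1).contMDiff (fun f x => ?_) hij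
  exact mul_comm _ _

/-- The coordinates of invariant triples and the last two summands of the model. -/
theorem linearlyDiffeomorphic_coordinates :
    LinearlyDiffeomorphic (SymBilin M × Form1 M × VecField M) (Form2 M × Form1 M) := by
  rcases isEmpty_or_nonempty M with hM | hM
  · have h1 : ∀ (F : Type) [NormedAddCommGroup F] [NormedSpace ℝ F] (W : M → Type)
        [TopologicalSpace (TotalSpace F W)] [∀ x, TopologicalSpace (W x)] [FiberBundle F W]
        [∀ x, AddCommGroup (W x)] [∀ x, Module ℝ (W x)],
        Subsingleton Cₛ^∞⟮𝓡 3; F, W⟯ := fun F _ _ W _ _ _ _ _ =>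
      ⟨fun s t => ContMDiffSection.ext fun x => hM.elim x⟩
    have i1 : Subsingleton (Form1 M) := h1 _ _
    have i2 : Subsingleton (VecField M) := h1 _ _
    have i3 : Subsingleton (Bilin M) := h1 _ _
    refine ⟨⟨⟨⟨fun _ => 0, fun _ _ => Subsingleton.elim _ _⟩, fun _ _ => Subsingleton.elim _ _⟩,
      fun _ => 0, fun _ => Subsingleton.elim _ _, fun _ => Subsingleton.elim _ _⟩,
      fun n p hp => isPlot_const, fun n p hp => isPlot_const⟩
  · have h1 : LinearlyDiffeomorphic (Form1 M) (Rapid ℕ) :=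
      linearlyDiffeomorphic_rapid_nat smoothSummand_form1 smoothSummand_rapid_form1
    have h2 : LinearlyDiffeomorphic (Form2 M) (Rapid ℕ) :=
      linearlyDiffeomorphic_rapid_nat smoothSummand_form2 smoothSummand_rapid_form2
    have h3 : SmoothSummand (Form1 M) (SymBilin M × Form1 M × VecField M) :=
      ⟨LinearMap.inr ℝ _ _ ∘ₗ LinearMap.inl ℝ _ _, LinearMap.fst ℝ _ _ ∘ₗ LinearMap.snd ℝ _ _,
        fun n p hp => ⟨isPlot_const, hp, isPlot_const⟩, fun n p hp => hp.2.1, fun x => rfl⟩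
    have h4 : LinearlyDiffeomorphic (SymBilin M × Form1 M × VecField M) (Rapid ℕ) :=
      linearlyDiffeomorphic_rapid_nat
        (smoothSummand_symBilin.prod (smoothSummand_form1.prod smoothSummand_vecField))
        (smoothSummand_rapid_form1.trans h3)
    exact h4.trans ((linearlyDiffeomorphic_rapid_sum (I := ℕ) (J := ℕ) |>.symm.trans
      linearlyDiffeomorphic_rapid_nat_sum).symm.trans (h2.prodMap h1).symm)

end OnM

/-! ### The duality of 1-forms and 2-forms -/

section Pairing

variable {M : Type*} [TopologicalSpace M] [ChartedSpace R3 M] [IsManifold (𝓡 3) ∞ M]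
  {ι : Type} [Fintype ι]

/-- The coefficients of the exterior product in a frame. -/
def TFrame.wedgeCoeff (fr : TFrame M ι) (a b c : ι) (x : M) (u v w : TangentSpace (𝓡 3) x) : ℝ :=
  fr.coeff a x u * (fr.coeff b x v * fr.coeff c x w) -
    fr.coeff a x v * (fr.coeff b x u * fr.coeff c x w) +
    fr.coeff a x w * (fr.coeff b x u * fr.coeff c x v)

lemma TFrame.wedge_eq_sum (fr : TFrame M ι) (α : Form1 M) (β : Form2 M) (x : M)
    (u v w : TangentSpace (𝓡 3) x) : wedge α β x u v w = ∑ a, ∑ b, ∑ c,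
      α x (fr.sec a x) * β.1 x (fr.sec b x) (fr.sec c x) * TFrame.wedgeCoeff fr a b c x u v w := by
  have h : ∀ u v w : TangentSpace (𝓡 3) x, α x u * β.1 x v w = ∑ a, ∑ b, ∑ c,
      α x (fr.sec a x) * β.1 x (fr.sec b x) (fr.sec c x) *
        (fr.coeff a x u * (fr.coeff b x v * fr.coeff c x w)) := fun u v w => by
    rw [fr.form_eq_sum (α x) u, fr.bilin_eq_sum (β.1 x) v w, Finset.sum_mul]
    refine Finset.sum_congr rfl fun a _ => ?_
    rw [Finset.mul_sum]
    refine Finset.sum_congr rfl fun b _ => ?_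
    rw [Finset.mul_sum]
    exact Finset.sum_congr rfl fun c _ => by ring
  unfold wedge
  rw [h u v w, h v u w, h w u v]
  simp only [← Finset.sum_sub_distrib, ← Finset.sum_add_distrib]
  refine Finset.sum_congr rfl fun a _ => Finset.sum_congr rfl fun b _ =>
    Finset.sum_congr rfl fun c _ => ?_
  unfold TFrame.wedgeCoeff
  ring

/-- The coordinate vector fields of a chart. -/
def coordVec (i : M) (j : Fin 3) (y : R3) : TangentSpace (𝓡 3) ((chartAt R3 i).symm y) :=
  mfderiv (𝓡 3) (𝓡 3) (chartAt R3 i).symm y (EuclideanSpace.single j (1 : ℝ))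

lemma contMDiffOn_coordVec (i : M) (j : Fin 3) :
    ContMDiffOn (𝓡 3) ((𝓡 3).prod 𝓘(ℝ, R3)) ∞
      (fun y => TotalSpace.mk' R3 (E := fun x : M => TangentSpace (𝓡 3) x)
        ((chartAt R3 i).symm y) (coordVec i j y)) (chartAt R3 i).target := by
  have h1 : ContMDiffOn (𝓡 3) (𝓡 3) ∞ (chartAt R3 i).symm (chartAt R3 i).target :=
    contMDiffOn_chart_symm
  have h2 := h1.contMDiffOn_tangentMapWithin (m := ∞) (by exact_mod_cast le_rfl)
    (chartAt R3 i).open_target.uniqueMDiffOn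
  have h3 : ContMDiff (𝓡 3) (𝓡 3).tangent ∞
      (fun y : R3 => (⟨y, EuclideanSpace.single j 1⟩ : TangentBundle (𝓡 3) R3)) := by
    intro y
    exact contMDiffAt_totalSpace.2 ⟨contMDiffAt_id, by
      simpa using contMDiffAt_const⟩
  refine (h2.comp h3.contMDiffOn (fun y hy => hy)).congr fun y hy => ?_
  simp only [Function.comp, tangentMapWithin]
  rw [mfderivWithin_of_mem_nhds ((chartAt R3 i).open_target.mem_nhds hy)]
  rfl

variable [T2Space M] [CompactSpace M]

variable (ρ : SmoothPartitionOfUnity M (𝓡 3) M)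

/-- The density of `ρᵢ α ∧ β` in the chart at `i`. -/
def chartDensity (i : M) (α : Form1 M) (β : Form2 M) (y : R3) : ℝ :=
  ρ i ((chartAt R3 i).symm y) *
    wedge α β ((chartAt R3 i).symm y) (coordVec i 0 y) (coordVec i 1 y) (coordVec i 2 y)

variable {ρ}

lemma exists_contDiff_chartDensity (hρ : ρ.IsSubordinate fun i => (chartAt R3 i).source) (i : M)
    {n : ℕ} {α : 𝔼 n → Form1 M} {β : 𝔼 n → Form2 M}
    (hα : IsPlot α) (hβ : IsPlot β) :
    ∃ G : 𝔼 n × R3 → ℝ, ContDiff ℝ ∞ G ∧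
      (∀ u, ∀ y ∈ (chartAt R3 i).target, G (u, y) = chartDensity ρ i (α u) (β u) y) ∧
      ∀ u, ∀ y ∉ chartAt R3 i '' tsupport (ρ i), G (u, y) = 0 := by
  classical
  obtain ⟨ι, _, ⟨fr⟩⟩ := exists_tFrame (M := M)
  set e := chartAt R3 i with he
  have hKt : e '' tsupport (ρ i) ⊆ e.target := by
    rintro _ ⟨x, hx, rfl⟩
    exact e.map_source (hρ i hx)
  have hK : IsCompact (e '' tsupport (ρ i)) :=
    (isClosed_tsupport _).isCompact.image_of_continuousOn (e.continuousOn.mono (hρ i))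
  have hz : ∀ u, ∀ y ∈ e.target, y ∉ e '' tsupport (ρ i) → chartDensity ρ i (α u) (β u) y = 0 := by
    intro u y hy hyK
    have h0 : e.symm y ∉ tsupport (ρ i) := fun h => hyK ⟨_, h, e.right_inv hy⟩
    unfold chartDensity
    rw [image_eq_zero_of_notMem_tsupport h0, zero_mul]
  have hsm : ContMDiffOn (𝓘(ℝ, 𝔼 n).prod (𝓡 3)) 𝓘(ℝ, ℝ) ∞
      (fun z : 𝔼 n × R3 => chartDensity ρ i (α z.1) (β z.1) z.2)
      (Set.univ ×ˢ e.target) := by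
    have hs : ContMDiffOn (𝓘(ℝ, 𝔼 n).prod (𝓡 3)) (𝓡 3) ∞
        (fun z : 𝔼 n × R3 => e.symm z.2) (Set.univ ×ˢ e.target) :=
      (contMDiffOn_chart_symm (I := 𝓡 3) (x := i)).comp contMDiff_snd.contMDiffOn fun z hz => hz.2
    have hs2 : ContMDiffOn (𝓘(ℝ, 𝔼 n).prod (𝓡 3))
        (𝓘(ℝ, 𝔼 n).prod (𝓡 3)) ∞
        (fun z : 𝔼 n × R3 => (z.1, e.symm z.2)) (Set.univ ×ˢ e.target) :=
      contMDiff_fst.contMDiffOn.prodMk hs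
    have hc : ∀ a j, ContMDiffOn (𝓘(ℝ, 𝔼 n).prod (𝓡 3)) 𝓘(ℝ, ℝ) ∞
        (fun z : 𝔼 n × R3 => fr.coeff a (e.symm z.2) (coordVec i j z.2))
        (Set.univ ×ˢ e.target) := fun a j =>
      ((fr.contMDiff_coeff a).comp_contMDiffOn (contMDiffOn_coordVec i j)).comp
        contMDiff_snd.contMDiffOn fun z hz => hz.2
    have hA : ∀ a, ContMDiffOn (𝓘(ℝ, 𝔼 n).prod (𝓡 3)) 𝓘(ℝ, ℝ) ∞
        (fun z : 𝔼 n × R3 => α z.1 (e.symm z.2) (fr.sec a (e.symm z.2)))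
        (Set.univ ×ˢ e.target) := fun a =>
      (isPlot_smoothFn_iff.1 (dSmooth_evalSection (fr.sec a) n α hα)).comp_contMDiffOn hs2
    have hB : ∀ a b, ContMDiffOn (𝓘(ℝ, 𝔼 n).prod (𝓡 3)) 𝓘(ℝ, ℝ) ∞
        (fun z : 𝔼 n × R3 =>
          (β z.1).1 (e.symm z.2) (fr.sec a (e.symm z.2)) (fr.sec b (e.symm z.2)))
        (Set.univ ×ˢ e.target) := fun a b =>
      (isPlot_smoothFn_iff.1 (dSmooth_evalSection₂ (fr.sec a) (fr.sec b) n _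
        (isPlot_subtype_iff.1 hβ))).comp_contMDiffOn hs2
    unfold chartDensity
    simp only [TFrame.wedge_eq_sum fr]
    refine ((ρ i).contMDiff.comp_contMDiffOn hs).mul ?_
    refine contMDiffOn_finsetSum fun a _ => contMDiffOn_finsetSum fun b _ =>
      contMDiffOn_finsetSum fun c _ => ((hA a).mul (hB b c)).mul ?_
    exact (((hc a 0).mul ((hc b 1).mul (hc c 2))).sub ((hc a 1).mul ((hc b 0).mul (hc c 2)))).add
      ((hc a 2).mul ((hc b 0).mul (hc c 1)))
  rw [← modelWithCornersSelf_prod, chartedSpaceSelf_prod, contMDiffOn_iff_contDiffOn] at hsm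
  refine ⟨fun z => if z.2 ∈ e.target then chartDensity ρ i (α z.1) (β z.1) z.2 else 0, ?_,
    fun u y hy => if_pos hy, fun u y hy => ?_⟩
  · rw [contDiff_iff_contDiffAt]
    rintro ⟨u, y⟩
    by_cases hy : y ∈ e.target
    · have ho : IsOpen ((Set.univ : Set (𝔼 n)) ×ˢ e.target) :=
        isOpen_univ.prod e.open_target
      refine (hsm.contDiffAt (ho.mem_nhds ⟨trivial, hy⟩)).congr_of_eventuallyEq ?_
      filter_upwards [ho.mem_nhds (show (u, y) ∈ _ from ⟨trivial, hy⟩)] with z hz'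
      exact if_pos hz'.2
    · have ho : IsOpen ((Set.univ : Set (𝔼 n)) ×ˢ (e '' tsupport (ρ i))ᶜ) :=
        isOpen_univ.prod hK.isClosed.isOpen_compl
      refine (contDiffAt_const (c := (0 : ℝ))).congr_of_eventuallyEq ?_
      filter_upwards [ho.mem_nhds (show (u, y) ∈ _ from ⟨trivial, fun h => hy (hKt h)⟩)] with z hz'
      split_ifs with h
      · exact hz _ _ h hz'.2
      · rfl
  · simp only
    split_ifs with h
    · exact hz _ _ h hy
    · rfl

/-- The integral of a chart density. -/
def chartPairing (ρ : SmoothPartitionOfUnity M (𝓡 3) M) (i : M) (α : Form1 M) (β : Form2 M) : ℝ :=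
  ∫ y in (chartAt R3 i).target, chartDensity ρ i α β y

lemma isCompact_image_tsupport (hρ : ρ.IsSubordinate fun i => (chartAt R3 i).source) (i : M) :
    IsCompact (chartAt R3 i '' tsupport (ρ i)) :=
  (isClosed_tsupport _).isCompact.image_of_continuousOn
    ((chartAt R3 i).continuousOn.mono (hρ i))

lemma integrableOn_chartDensity (hρ : ρ.IsSubordinate fun i => (chartAt R3 i).source) (i : M)
    (α : Form1 M) (β : Form2 M) :
    IntegrableOn (chartDensity ρ i α β) (chartAt R3 i).target := by
  obtain ⟨G, hG, hG1, hG2⟩ := exists_contDiff_chartDensity hρ i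
    (isPlot_const (n := 0) (x := α)) (isPlot_const (n := 0) (x := β))
  have h1 : Continuous fun y => G (0, y) := hG.continuous.comp (by fun_prop)
  have h2 : Integrable fun y => G (0, y) := h1.integrable_of_hasCompactSupport
    (HasCompactSupport.intro (isCompact_image_tsupport hρ i) (hG2 0))
  exact h2.integrableOn.congr_fun (fun y hy => hG1 0 y hy) (chartAt R3 i).open_target.measurableSet

lemma contDiff_chartPairing (hρ : ρ.IsSubordinate fun i => (chartAt R3 i).source) (i : M)
    {n : ℕ} {α : 𝔼 n → Form1 M} {β : 𝔼 n → Form2 M}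
    (hα : IsPlot α) (hβ : IsPlot β) :
    ContDiff ℝ ∞ fun u => chartPairing ρ i (α u) (β u) := by
  obtain ⟨G, hG, hG1, hG2⟩ := exists_contDiff_chartDensity hρ i hα hβ
  have h1 := contDiff_infty_integral_param (μ := volume) hG (isCompact_image_tsupport hρ i)
    (g := fun _ => 1) aestronglyMeasurable_const (fun y => by simp)
  have hKt : chartAt R3 i '' tsupport (ρ i) ⊆ (chartAt R3 i).target := by
    rintro _ ⟨x, hx, rfl⟩
    exact (chartAt R3 i).map_source (hρ i hx)
  refine (congrArg (ContDiff ℝ ∞) (funext fun u => ?_)).mp h1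
  unfold chartPairing
  rw [setIntegral_congr_fun (chartAt R3 i).open_target.measurableSet
    (fun y hy => (hG1 u y hy).symm)]
  simp only [one_smul]
  exact (setIntegral_eq_of_subset_of_forall_sdiff_eq_zero
    (chartAt R3 i).open_target.measurableSet hKt fun y hy => hG2 u y hy.2).symm

lemma finite_partition_support (ρ : SmoothPartitionOfUnity M (𝓡 3) M) :
    {i : M | ∃ x, ρ i x ≠ 0}.Finite := by
  have h := ρ.locallyFinite.finite_nonempty_of_compact
  refine h.subset ?_
  rintro i ⟨x, hx⟩
  exact ⟨x, hx⟩

lemma pairing_eq_sum : ∃ (ρ : SmoothPartitionOfUnity M (𝓡 3) M) (A : Finset M),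
    ρ.IsSubordinate (fun i => (chartAt R3 i).source) ∧ ∀ (α : Form1 M) (β : Form2 M),
      pairing α β = ∑ i ∈ A, chartPairing ρ i α β := by
  refine ⟨(SmoothPartitionOfUnity.exists_isSubordinate_chartAt_source (𝓡 3) M).choose,
    (finite_partition_support
      (SmoothPartitionOfUnity.exists_isSubordinate_chartAt_source (𝓡 3) M).choose).toFinset,
    (SmoothPartitionOfUnity.exists_isSubordinate_chartAt_source (𝓡 3) M).choose_spec,
    fun α β => ?_⟩
  unfold pairing integral3
  refine finsum_eq_sum_of_support_subset _ fun i hi => ?_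
  rw [Set.Finite.coe_toFinset]
  by_contra hc
  simp only [Set.mem_ofPred_eq, not_exists, not_not] at hc
  refine hi ?_
  simp only [hc, zero_mul]
  simp

/-- The pairing is smooth on smooth families. -/
lemma contDiff_pairing {n : ℕ} {α : 𝔼 n → Form1 M}
    {β : 𝔼 n → Form2 M} (hα : IsPlot α) (hβ : IsPlot β) :
    ContDiff ℝ ∞ fun u => pairing (α u) (β u) := by
  obtain ⟨ρ, A, hρ, h⟩ := pairing_eq_sum (M := M)
  simp only [h]
  exact ContDiff.sum fun i _ => contDiff_chartPairing hρ i hα hβ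

lemma pairing_add_left (α α' : Form1 M) (β : Form2 M) :
    pairing (α + α') β = pairing α β + pairing α' β := by
  obtain ⟨ρ, A, hρ, h⟩ := pairing_eq_sum (M := M)
  rw [h, h, h, ← Finset.sum_add_distrib]
  refine Finset.sum_congr rfl fun i _ => ?_
  unfold chartPairing
  rw [← integral_add (integrableOn_chartDensity hρ i α β) (integrableOn_chartDensity hρ i α' β)]
  refine integral_congr_ae (Filter.Eventually.of_forall fun y => ?_)
  have h1 : ∀ x u, (α + α') x u = α x u + α' x u := fun x u => rfl
  simp only [chartDensity, wedge, h1]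
  ring

lemma pairing_smul_left (r : ℝ) (α : Form1 M) (β : Form2 M) :
    pairing (r • α) β = r * pairing α β := by
  obtain ⟨ρ, A, hρ, h⟩ := pairing_eq_sum (M := M)
  rw [h, h, Finset.mul_sum]
  refine Finset.sum_congr rfl fun i _ => ?_
  unfold chartPairing
  rw [← integral_const_mul]
  refine integral_congr_ae (Filter.Eventually.of_forall fun y => ?_)
  have h1 : ∀ x u, (r • α) x u = r * α x u := fun x u => rfl
  simp only [chartDensity, wedge, h1]
  ring

lemma pairing_add_right (α : Form1 M) (β β' : Form2 M) :
    pairing α (β + β') = pairing α β + pairing α β' := by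
  obtain ⟨ρ, A, hρ, h⟩ := pairing_eq_sum (M := M)
  rw [h, h, h, ← Finset.sum_add_distrib]
  refine Finset.sum_congr rfl fun i _ => ?_
  unfold chartPairing
  rw [← integral_add (integrableOn_chartDensity hρ i α β) (integrableOn_chartDensity hρ i α β')]
  refine integral_congr_ae (Filter.Eventually.of_forall fun y => ?_)
  have h1 : ∀ x u v, (β + β').1 x u v = β.1 x u v + β'.1 x u v := fun x u v => rfl
  simp only [chartDensity, wedge, h1]
  ring

lemma pairing_smul_right (r : ℝ) (α : Form1 M) (β : Form2 M) :
    pairing α (r • β) = r * pairing α β := by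
  obtain ⟨ρ, A, hρ, h⟩ := pairing_eq_sum (M := M)
  rw [h, h, Finset.mul_sum]
  refine Finset.sum_congr rfl fun i _ => ?_
  unfold chartPairing
  rw [← integral_const_mul]
  refine integral_congr_ae (Filter.Eventually.of_forall fun y => ?_)
  have h1 : ∀ x u v, (r • β).1 x u v = r * β.1 x u v := fun x u v => rfl
  simp only [chartDensity, wedge, h1]
  ring

variable (M) in
/-- The pairing as a bilinear map. -/
def pairingL : Form1 M →ₗ[ℝ] Form2 M →ₗ[ℝ] ℝ :=
  LinearMap.mk₂ ℝ pairing pairing_add_left pairing_smul_left pairing_add_right pairing_smul_right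

end Pairing

/-! ### Smooth families and their derivatives -/

section Families

variable {E : Type} [NormedAddCommGroup E] [NormedSpace ℝ E]
  {E' : Type} [NormedAddCommGroup E'] [NormedSpace ℝ E']
  {A X : Type*} [DiffeologicalSpace A] [DiffeologicalSpace X]

/-- A family over a normed space is smooth if its smooth reparametrisations are plots. -/
def SmoothFamily (p : E → X) : Prop :=
  ∀ (n : ℕ) (f : 𝔼 n → E), ContDiff ℝ ∞ f → IsPlot fun u => p (f u)

lemma SmoothFamily.comp {p : E → X} (hp : SmoothFamily p) {f : E' → E} (hf : ContDiff ℝ ∞ f) :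
    SmoothFamily fun u => p (f u) := fun n g hg => hp n _ (hf.comp hg)

lemma smoothFamily_const (x : X) : SmoothFamily fun _ : E => x := fun _ _ _ => isPlot_const

lemma smoothFamily_iff_isPlot {n : ℕ} {p : 𝔼 n → X} :
    SmoothFamily p ↔ IsPlot p :=
  ⟨fun h => h n id contDiff_id, fun h _ _ hf => isPlot_reparam h hf⟩

lemma SmoothFamily.dSmooth_comp {p : E → A} (hp : SmoothFamily p) {f : A → X} (hf : DSmooth f) :
    SmoothFamily fun u => f (p u) := fun n g hg => hf n _ (hp n g hg)

lemma SmoothFamily.dSmoothOn_comp {p : E → A} (hp : SmoothFamily p) {f : A → X} {T : Set A}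
    (hf : DSmoothOn f T) (h : ∀ u, p u ∈ T) : SmoothFamily fun u => f (p u) := fun n g hg =>
  hf n _ (hp n g hg) fun _ => h _

lemma SmoothFamily.contDiff [FiniteDimensional ℝ E] {p : E → ℝ} (hp : SmoothFamily p) :
    ContDiff ℝ ∞ p := by
  have h := (hp _ _ (toEuclidean (E := E)).symm.contDiff).contDiff.comp
    (toEuclidean (E := E)).contDiff
  have h2 : p = (fun u => p ((toEuclidean (E := E)).symm u)) ∘ toEuclidean (E := E) := by
    funext u
    simp
  rw [h2]
  exact h

lemma isPlot_of_locally {n : ℕ} {p : 𝔼 n → X}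
    (h : ∀ u₀, ∃ q : 𝔼 n → X, IsPlot q ∧ p =ᶠ[𝓝 u₀] q) : IsPlot p := by
  refine DiffeologicalSpace.locality fun u₀ => ?_
  obtain ⟨q, hq, hpq⟩ := h u₀
  obtain ⟨U, hU, hUo, hu⟩ := eventually_nhds_iff.1 hpq
  refine ⟨U, hUo, hu, fun {m f} hfU hf => ?_⟩
  have : p ∘ f = q ∘ f := funext fun x => hU _ (hfU x)
  rw [this]
  exact isPlot_reparam hq hf

lemma SmoothFamily.isOpen_preimage [FiniteDimensional ℝ E] {p : E → X} (hp : SmoothFamily p)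
    {T : Set X} (hT : IsOpen[dTopology] T) : IsOpen (p ⁻¹' T) := by
  have h := isOpen_iff_preimages_plots.1 hT _ _
    (hp _ _ (toEuclidean (E := E)).symm.contDiff)
  have h2 := h.preimage (toEuclidean (E := E)).continuous
  convert h2 using 1
  ext u
  simp

lemma SmoothFamily.exists_localization [FiniteDimensional ℝ E] {p : E → A} (hp : SmoothFamily p)
    {T : Set A} (hT : IsOpen[dTopology] T) {u₀ : E} (hu : p u₀ ∈ T) :
    ∃ ψ : E → E, ContDiff ℝ ∞ ψ ∧ (∀ u, p (ψ u) ∈ T) ∧ ψ =ᶠ[𝓝 u₀] id := by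
  exact exists_contDiff_eventuallyEq_id ((hp.isOpen_preimage hT).mem_nhds hu)

lemma SmoothFamily.contDiffAt [FiniteDimensional ℝ E] {p : E → A} (hp : SmoothFamily p)
    {T : Set A} (hT : IsOpen[dTopology] T) {u₀ : E} (hu : p u₀ ∈ T) {f : A → ℝ}
    (hf : DSmoothOn f T) : ContDiffAt ℝ ∞ (fun u => f (p u)) u₀ := by
  obtain ⟨ψ, hψ, hψT, hψ0⟩ := hp.exists_localization hT hu
  refine (((hp.comp hψ).dSmoothOn_comp hf hψT).contDiff.contDiffAt (x := u₀)).congr_of_eventuallyEq ?_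
  filter_upwards [hψ0] with u hu
  rw [hu]
  rfl

/-- Smoothness is local. -/
lemma dSmooth_of_locally {f : A → X}
    (h : ∀ a, ∃ T : Set A, IsOpen[dTopology] T ∧ a ∈ T ∧ DSmoothOn f T) : DSmooth f := by
  intro n p hp
  refine isPlot_of_locally fun u₀ => ?_
  obtain ⟨T, hT, ha, hf⟩ := h (p u₀)
  obtain ⟨ψ, hψ, hψT, hψ0⟩ := (smoothFamily_iff_isPlot.2 hp).exists_localization hT ha
  refine ⟨_, hf n (fun u => p (ψ u)) (isPlot_reparam hp hψ) hψT, ?_⟩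
  filter_upwards [hψ0] with u hu
  simp [hu]

variable [AddCommGroup X] [Module ℝ X]

lemma SmoothFamily.add [DiffeologicalModule X] {p q : E → X} (hp : SmoothFamily p)
    (hq : SmoothFamily q) : SmoothFamily fun u => p u + q u := fun n f hf =>
  isPlot_add (hp n f hf) (hq n f hf)

lemma SmoothFamily.smul [DiffeologicalModule X] {p : E → X} (hp : SmoothFamily p) {r : E → ℝ}
    (hr : ContDiff ℝ ∞ r) : SmoothFamily fun u => r u • p u := fun n f hf =>
  isPlot_smul (hr.comp hf) (hp n f hf)

variable (X) in
/-- A space in which smooth families have difference quotients, and values are determined by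
limits. -/
class HadamardModule : Prop where
  exists_quotient : ∀ {E : Type} [NormedAddCommGroup E] [NormedSpace ℝ E] [FiniteDimensional ℝ E]
    {p : E × ℝ → X}, SmoothFamily p → ∃ q : E × ℝ → X, SmoothFamily q ∧
      ∀ u s, p (u, s) = p (u, 0) + s • q (u, s)
  eq_zero : ∀ {q : ℝ → X}, SmoothFamily q → (∀ᶠ s in 𝓝[≠] (0 : ℝ), q s = 0) → q 0 = 0

lemma HadamardModule.of_summand {Y : Type*} [AddCommGroup Y] [Module ℝ Y] [DiffeologicalSpace Y]
    [HadamardModule Y] (h : SmoothSummand X Y) : HadamardModule X := by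
  obtain ⟨a, b, ha, hb, hab⟩ := h
  refine ⟨fun {E} _ _ _ p hp => ?_, fun {q} hq h0 => ?_⟩
  · obtain ⟨q, hq, hpq⟩ := HadamardModule.exists_quotient (hp.dSmooth_comp ha)
    refine ⟨_, hq.dSmooth_comp hb, fun u s => ?_⟩
    have := congrArg b (hpq u s)
    simpa [hab] using this
  · have := HadamardModule.eq_zero (hq.dSmooth_comp ha) (by
      filter_upwards [h0] with s hs
      rw [hs, map_zero])
    rw [← hab (q 0), this, map_zero]

end Families

section RealHadamard

variable {G : Type} [NormedAddCommGroup G] [NormedSpace ℝ G] [FiniteDimensional ℝ G]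

/-- The difference quotient of a function of one variable. -/
def hadamardQuotient (f : ℝ → ℝ) (s : ℝ) : ℝ := ∫ r in Set.Icc (0 : ℝ) 1, deriv f (r * s)

lemma hadamardQuotient_spec {f : ℝ → ℝ} (hf : ContDiff ℝ ∞ f) (s : ℝ) :
    f s = f 0 + s * hadamardQuotient f s := by
  unfold hadamardQuotient
  rw [integral_Icc_eq_integral_Ioc, ← intervalIntegral.integral_of_le zero_le_one,
    ← intervalIntegral.integral_const_mul]
  have hd : ∀ r : ℝ, HasDerivAt (fun r => f (r * s)) (s * deriv f (r * s)) r := fun r => by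
    have h1 := ((hf.differentiable (by simp)) (r * s)).hasDerivAt
    exact (h1.comp r ((hasDerivAt_id r).mul_const s)).congr_deriv (by ring)
  have hc : Continuous fun r => s * deriv f (r * s) :=
    continuous_const.mul ((hf.continuous_deriv (by simp)).comp (by fun_prop))
  rw [intervalIntegral.integral_eq_sub_of_hasDerivAt (fun r _ => hd r) (hc.intervalIntegrable _ _)]
  simp

lemma contDiff_hadamardQuotient {f : G × ℝ → ℝ} (hf : ContDiff ℝ ∞ f) :
    ContDiff ℝ ∞ fun z : G × ℝ => hadamardQuotient (fun t => f (z.1, t)) z.2 := by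
  have h1 : ContDiff ℝ ∞ fun z : G × ℝ => fderiv ℝ f z (0, 1) :=
    contDiff_fderiv_apply_const hf _
  have h2 : ∀ (g : G) (t : ℝ), deriv (fun t => f (g, t)) t = fderiv ℝ f (g, t) (0, 1) := by
    intro g t
    have h3 := ((hf.differentiable (by simp)) (g, t)).hasFDerivAt
    have h4 : HasDerivAt (fun t : ℝ => (g, t)) ((0 : G), (1 : ℝ)) t :=
      (hasDerivAt_const t g).prodMk (hasDerivAt_id t)
    exact (h3.comp_hasDerivAt t h4).deriv
  have h5 : ContDiff ℝ ∞ fun w : (G × ℝ) × ℝ => fderiv ℝ f (w.1.1, w.2 * w.1.2) (0, 1) :=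
    h1.comp (f := fun w : (G × ℝ) × ℝ => (w.1.1, w.2 * w.1.2)) (by fun_prop)
  have h6 := contDiff_infty_integral_param (μ := volume) h5 (isCompact_Icc (a := (0 : ℝ)) (b := 1))
    (g := fun _ => 1) aestronglyMeasurable_const (fun y => by simp)
  unfold hadamardQuotient
  simp only [h2]
  simpa using h6

end RealHadamard

section SmoothFnHadamard

variable {M : Type*} [TopologicalSpace M] [ChartedSpace R3 M] [IsManifold (𝓡 3) ∞ M] [T2Space M]

lemma SmoothFamily.smoothFn_comp {E : Type} [NormedAddCommGroup E] [NormedSpace ℝ E]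
    [FiniteDimensional ℝ E] {p : E → SmoothFn M} (hp : SmoothFamily p)
    {V : Type} [NormedAddCommGroup V] [NormedSpace ℝ V] {Γ : V → M}
    (hΓ : ContMDiff 𝓘(ℝ, V) (𝓡 3) ∞ Γ) :
    ContDiff ℝ ∞ fun z : E × V => p z.1 (Γ z.2) := by
  have h1 := isPlot_smoothFn_comp (hp _ _ (toEuclidean (E := E)).symm.contDiff) hΓ
  have h2 := h1.comp (f := fun z : E × V => (toEuclidean (E := E) z.1, z.2))
    (((toEuclidean (E := E)).contDiff.comp contDiff_fst).prodMk contDiff_snd)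
  simpa [Function.comp_def] using h2

instance : HadamardModule (SmoothFn M) where
  exists_quotient {E} _ _ _ p hp := by
    have key : ContMDiff (𝓘(ℝ, E × ℝ).prod (𝓡 3)) 𝓘(ℝ, ℝ) ∞ fun z : (E × ℝ) × M =>
        hadamardQuotient (fun t => p (z.1.1, t) z.2) z.1.2 := by
      rintro ⟨w₀, x₀⟩
      obtain ⟨Γ, Θ, b, β, hΓ, hΘ, -, hβ, -, -, -, h4, h5⟩ := exists_patch x₀ Filter.univ_mem
      have h6 : ContDiff ℝ ∞ fun z : (E × R3) × ℝ => p (z.1.1, z.2) (Γ z.1.2) :=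
        (hp.smoothFn_comp hΓ).comp (f := fun z : (E × R3) × ℝ => ((z.1.1, z.2), z.1.2))
          (by fun_prop)
      have h7 := (contDiff_hadamardQuotient h6).comp
        (f := fun z : (E × ℝ) × R3 => ((z.1.1, z.2), z.1.2)) (by fun_prop)
      have h8 := contMDiff_comp_prodMk h7 hΘ
      refine (h8 (w₀, x₀)).congr_of_eventuallyEq ?_
      have h9 : ∀ᶠ z : (E × ℝ) × M in 𝓝 (w₀, x₀), β z.2 ≠ 0 :=
        ((hβ.continuous.comp continuous_snd).continuousAt).eventually_ne (by simp [h5])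
      filter_upwards [h9] with z hz
      simp only [Function.comp]
      rw [(h4 z.2 hz).1]
    refine ⟨fun w => ⟨fun x => hadamardQuotient (fun t => p (w.1, t) x) w.2,
      contMDiff_slice key w⟩, fun n f hf => isPlot_smoothFn_iff.2 ?_, fun u s =>
        ContMDiffMap.ext fun x => ?_⟩
    · have h1 : ContMDiff (𝓘(ℝ, 𝔼 n).prod (𝓡 3)) (𝓘(ℝ, E × ℝ).prod (𝓡 3)) ∞
          fun z : 𝔼 n × M => (f z.1, z.2) :=
        (hf.contMDiff.comp contMDiff_fst).prodMk contMDiff_snd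
      exact (key.comp h1).congr fun z => rfl
    · have h1 : ContDiff ℝ ∞ fun t => p (u, t) x :=
        (hp.smoothFn_comp (V := ℝ) (Γ := fun _ => x) contMDiff_const).comp
          (f := fun t : ℝ => ((u, t), (0 : ℝ))) (by fun_prop)
      exact hadamardQuotient_spec h1 s
  eq_zero {q} hq h := ContMDiffMap.ext fun x => by
    have h1 : ContDiff ℝ ∞ fun t => q t x :=
      (hq.smoothFn_comp (V := ℝ) (Γ := fun _ => x) contMDiff_const).comp
        (f := fun t : ℝ => (t, (0 : ℝ))) (by fun_prop)
    have h2 : Filter.Tendsto (fun t => q t x) (𝓝[≠] 0) (𝓝 (q 0 x)) :=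
      h1.continuous.continuousAt.tendsto.mono_left nhdsWithin_le_nhds
    have h3 : Filter.Tendsto (fun t => q t x) (𝓝[≠] 0) (𝓝 0) := by
      refine tendsto_const_nhds.congr' ?_
      filter_upwards [h] with t ht
      rw [ht]
      rfl
    exact tendsto_nhds_unique h2 h3

variable [CompactSpace M]

lemma hadamardModule_of_summand {X : Type*} [AddCommGroup X] [Module ℝ X] [DiffeologicalSpace X]
    (hs : IsEmpty M → Subsingleton X) (h : SmoothSummand X (Rapid ℕ)) : HadamardModule X := by
  rcases isEmpty_or_nonempty M with hM | hM
  · have := hs hM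
    exact ⟨fun {E} _ _ _ p hp => ⟨fun _ => 0, smoothFamily_const _, fun _ _ =>
      Subsingleton.elim _ _⟩, fun _ _ => Subsingleton.elim _ _⟩
  · have h1 : SmoothSummand (Rapid ℕ) (SmoothFn M) :=
      smoothSummand_rapid_of_smoothFn (M := M) (X := SmoothFn M) (J := LinearMap.id)
        (R := LinearMap.id) (x₀ := Classical.arbitrary M) dSmooth_id dSmooth_id
        (ζ := fun _ => 1) contMDiff_const (fun f x => (one_mul _).symm) one_ne_zero
    exact HadamardModule.of_summand (h.trans h1)

instance : HadamardModule (Form1 M) :=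
  hadamardModule_of_summand (M := M) (fun hM => ⟨fun s t => ContMDiffSection.ext fun x => hM.elim x⟩)
    smoothSummand_form1

instance : HadamardModule (Form2 M) :=
  hadamardModule_of_summand (M := M)
    (fun hM => ⟨fun s t => Subtype.ext (ContMDiffSection.ext fun x => hM.elim x)⟩)
    smoothSummand_form2

end SmoothFnHadamard

/-! ### Directional derivatives on open sets of a model space -/

section Directional

variable {E : Type} [NormedAddCommGroup E] [NormedSpace ℝ E] [FiniteDimensional ℝ E]
  {A X : Type*} [AddCommGroup A] [Module ℝ A] [DiffeologicalSpace A] [DiffeologicalModule A]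
  [AddCommGroup X] [Module ℝ X] [DiffeologicalSpace X] [DiffeologicalModule X] [HadamardModule X]
  {T : Set A} {f : A → X}

/-- The map `f` has at `x` the derivative `d` in the direction `v`. -/
def HasDirectional (f : A → X) (x v : A) (d : X) : Prop :=
  ∃ q : ℝ → X, SmoothFamily q ∧ q 0 = d ∧ ∀ᶠ s in 𝓝 (0 : ℝ), f (x + s • v) = f x + s • q s

lemma HasDirectional.unique {x v : A} {d d' : X} (h : HasDirectional f x v d)
    (h' : HasDirectional f x v d') : d = d' := by
  obtain ⟨q, hq, rfl, h1⟩ := h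
  obtain ⟨q', hq', rfl, h1'⟩ := h'
  have h2 : SmoothFamily fun s => q s + (-1 : ℝ) • q' s := hq.add (hq'.smul contDiff_const)
  have h3 := HadamardModule.eq_zero h2 (by
    filter_upwards [h1.filter_mono nhdsWithin_le_nhds, h1'.filter_mono nhdsWithin_le_nhds,
      self_mem_nhdsWithin] with s hs hs' hs0
    have h4 : s • q s = s • q' s := by
      rw [hs] at hs'
      exact add_left_cancel hs'
    have h5 : q s = q' s := by
      have := congrArg (fun w => s⁻¹ • w) h4
      simpa [smul_smul, inv_mul_cancel₀ hs0] using this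
    rw [h5]
    simp)
  simpa [add_neg_eq_zero] using h3

/-- The derivative of `f` at `x` in the direction `v`. -/
def directional (f : A → X) (x v : A) : X := by
  classical
  exact if h : ∃ d, HasDirectional f x v d then h.choose else 0

lemma HasDirectional.directional_eq {x v : A} {d : X} (h : HasDirectional f x v d) :
    directional f x v = d := by
  have h1 : ∃ d, HasDirectional f x v d := ⟨d, h⟩
  unfold directional
  rw [dif_pos h1]
  exact h1.choose_spec.unique h

lemma exists_family_hasDirectional (hT : IsOpen[dTopology] T) (hf : DSmoothOn f T) {x v : E → A}
    (hx : SmoothFamily x) (hv : SmoothFamily v) {u₀ : E} (hu : x u₀ ∈ T) :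
    ∃ d : E → X, SmoothFamily d ∧ ∀ᶠ u in 𝓝 u₀, HasDirectional f (x u) (v u) (d u) := by
  have hp : SmoothFamily fun w : E × ℝ => x w.1 + w.2 • v w.1 :=
    (hx.comp contDiff_fst).add ((hv.comp contDiff_fst).smul contDiff_snd)
  obtain ⟨ψ, hψ, hψT, hψ0⟩ := hp.exists_localization hT (u₀ := (u₀, 0)) (by simpa using hu)
  have hP := (hp.comp hψ).dSmoothOn_comp hf hψT
  obtain ⟨q, hq, hPq⟩ := HadamardModule.exists_quotient hP
  refine ⟨fun u => q (u, 0), hq.comp (contDiff_id.prodMk contDiff_const), ?_⟩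
  have h1 : ∀ᶠ u in 𝓝 u₀, ∀ᶠ s in 𝓝 (0 : ℝ), ψ (u, s) = (u, s) := by
    have h2 : ∀ᶠ w in 𝓝 u₀ ×ˢ 𝓝 (0 : ℝ), ψ w = w := by
      rw [← nhds_prod_eq]
      exact hψ0
    exact h2.curry
  filter_upwards [h1] with u hu1
  refine ⟨fun s => q (u, s), hq.comp (contDiff_const.prodMk contDiff_id), rfl, ?_⟩
  have h0 := hu1.self_of_nhds
  filter_upwards [hu1] with s hs
  have h3 := hPq u s
  simp only [hs, h0, zero_smul, add_zero] at h3
  exact h3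

lemma hasDirectional_directional (hT : IsOpen[dTopology] T) (hf : DSmoothOn f T) {x : A}
    (hx : x ∈ T) (v : A) : HasDirectional f x v (directional f x v) := by
  obtain ⟨d, -, h⟩ := exists_family_hasDirectional (E := ℝ) hT hf (smoothFamily_const x)
    (smoothFamily_const v) (u₀ := 0) hx
  have h1 := h.self_of_nhds
  rwa [h1.directional_eq]

lemma dSmoothOn_directional (hT : IsOpen[dTopology] T) (hf : DSmoothOn f T) {V : A → A}
    (hV : DSmoothOn V T) : DSmoothOn (fun x => directional f x (V x)) T := by
  intro n p hp hpT
  have hp' := smoothFamily_iff_isPlot.2 hp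
  refine isPlot_of_locally fun u₀ => ?_
  obtain ⟨d, hd, h⟩ := exists_family_hasDirectional hT hf hp' (hp'.dSmoothOn_comp hV hpT) (hpT u₀)
  refine ⟨d, smoothFamily_iff_isPlot.1 hd, ?_⟩
  filter_upwards [h] with u hu
  exact hu.directional_eq

lemma hasDerivAt_of_quotient {φ h : ℝ → ℝ} {c : ℝ} (hh : ContinuousAt h 0)
    (hφ : ∀ᶠ s in 𝓝 (0 : ℝ), φ s = c + s * h s) : HasDerivAt φ (h 0) 0 := by
  have h0 : φ 0 = c := by simpa using hφ.self_of_nhds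
  rw [hasDerivAt_iff_tendsto_slope]
  refine (hh.tendsto.mono_left nhdsWithin_le_nhds).congr' ?_
  filter_upwards [hφ.filter_mono nhdsWithin_le_nhds, self_mem_nhdsWithin] with s hs hs0
  have hs0' : s ≠ 0 := hs0
  rw [slope_def_field, hs, h0]
  field_simp
  ring

lemma HasDirectional.hasDerivAt {x v : A} {d : X} (h : HasDirectional f x v d) {ℓ : X →ₗ[ℝ] ℝ}
    (hℓ : DSmooth ℓ) : HasDerivAt (fun s : ℝ => ℓ (f (x + s • v))) (ℓ d) 0 := by
  obtain ⟨q, hq, rfl, h1⟩ := h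
  refine hasDerivAt_of_quotient (h := fun s => ℓ (q s)) (c := ℓ (f x))
    (hq.dSmooth_comp hℓ).contDiff.continuous.continuousAt ?_
  filter_upwards [h1] with s hs
  rw [hs, map_add, map_smul, smul_eq_mul]

end Directional

section TwoVariables

/-- The mixed partial derivatives of a smooth function of two variables agree. -/
lemma mixed_partials_eq {Φ : ℝ × ℝ → ℝ} (hΦ : ContDiffAt ℝ ∞ Φ 0) {h k : ℝ → ℝ} {a b : ℝ}
    (hh : ∀ᶠ s in 𝓝 (0 : ℝ), HasDerivAt (fun t => Φ (s, t)) (h s) 0)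
    (hk : ∀ᶠ t in 𝓝 (0 : ℝ), HasDerivAt (fun s => Φ (s, t)) (k t) 0)
    (ha : HasDerivAt h a 0) (hb : HasDerivAt k b 0) : a = b := by
  have h1 : ∀ᶠ z in 𝓝 (0 : ℝ × ℝ), DifferentiableAt ℝ Φ z := by
    have := (hΦ.of_le (m := 1) (by exact_mod_cast le_top)).eventually (by simp)
    filter_upwards [this] with z hz
    exact hz.differentiableAt (by simp)
  have h2 : DifferentiableAt ℝ (fderiv ℝ Φ) 0 :=
    (hΦ.fderiv_right (m := ∞) le_rfl).differentiableAt (by simp)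
  have hl : ∀ s : ℝ, HasDerivAt (fun s : ℝ => (s, (0 : ℝ))) (1, 0) s := fun s =>
    (hasDerivAt_id s).prodMk (hasDerivAt_const s 0)
  have hr : ∀ t : ℝ, HasDerivAt (fun t : ℝ => ((0 : ℝ), t)) (0, 1) t := fun t =>
    (hasDerivAt_const t 0).prodMk (hasDerivAt_id t)
  have c1 : ContinuousAt (fun s : ℝ => (s, (0 : ℝ))) 0 := (hl 0).continuousAt
  have c2 : ContinuousAt (fun t : ℝ => ((0 : ℝ), t)) 0 := (hr 0).continuousAt
  have e1 : h =ᶠ[𝓝 0] fun s => fderiv ℝ Φ (s, 0) (0, 1) := by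
    filter_upwards [hh, c1.eventually h1] with s hs hs1
    have h3 := hs1.hasFDerivAt.comp_hasDerivAt (f := fun t : ℝ => (s, t)) (0 : ℝ)
      ((hasDerivAt_const (0 : ℝ) s).prodMk (hasDerivAt_id (0 : ℝ)))
    exact hs.unique h3
  have e2 : k =ᶠ[𝓝 0] fun t => fderiv ℝ Φ (0, t) (1, 0) := by
    filter_upwards [hk, c2.eventually h1] with s hs hs1
    have h3 := hs1.hasFDerivAt.comp_hasDerivAt (f := fun t : ℝ => (t, s)) (0 : ℝ)
      ((hasDerivAt_id (0 : ℝ)).prodMk (hasDerivAt_const (0 : ℝ) s))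
    exact hs.unique h3
  have d1 : HasDerivAt h (fderiv ℝ (fderiv ℝ Φ) 0 (1, 0) (0, 1)) 0 := by
    have h3 := h2.hasFDerivAt.comp_hasDerivAt (f := fun s : ℝ => (s, (0 : ℝ))) (0 : ℝ) (hl 0)
    have h4 := (h3.clm_apply (hasDerivAt_const (0 : ℝ) ((0 : ℝ), (1 : ℝ))))
    exact (h4.congr_of_eventuallyEq e1).congr_deriv (by simp)
  have d2 : HasDerivAt k (fderiv ℝ (fderiv ℝ Φ) 0 (0, 1) (1, 0)) 0 := by
    have h3 := h2.hasFDerivAt.comp_hasDerivAt (f := fun t : ℝ => ((0 : ℝ), t)) (0 : ℝ) (hr 0)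
    have h4 := (h3.clm_apply (hasDerivAt_const (0 : ℝ) ((1 : ℝ), (0 : ℝ))))
    exact (h4.congr_of_eventuallyEq e2).congr_deriv (by simp)
  rw [ha.unique d1, hb.unique d2]
  have h5 : minSmoothness ℝ 2 ≤ ∞ := by
    rw [minSmoothness_of_isRCLikeNormedField]
    exact WithTop.coe_le_coe.2 (le_top : (2 : ℕ∞) ≤ ⊤)
  exact hΦ.isSymmSndFDerivAt h5 _ _

/-- The derivative along the diagonal is the sum of the partial derivatives. -/
lemma hasDerivAt_diag {Φ : ℝ × ℝ → ℝ} (hΦ : DifferentiableAt ℝ Φ 0) {a b : ℝ}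
    (ha : HasDerivAt (fun s => Φ (s, 0)) a 0) (hb : HasDerivAt (fun t => Φ (0, t)) b 0) :
    HasDerivAt (fun s => Φ (s, s)) (a + b) 0 := by
  have h0 : HasFDerivAt Φ (fderiv ℝ Φ 0) ((0 : ℝ), (0 : ℝ)) := hΦ.hasFDerivAt
  have h1 := h0.comp_hasDerivAt (f := fun s : ℝ => (s, (0 : ℝ))) (0 : ℝ)
    ((hasDerivAt_id (0 : ℝ)).prodMk (hasDerivAt_const (0 : ℝ) (0 : ℝ)))
  have h2 := h0.comp_hasDerivAt (f := fun s : ℝ => ((0 : ℝ), s)) (0 : ℝ)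
    ((hasDerivAt_const (0 : ℝ) (0 : ℝ)).prodMk (hasDerivAt_id (0 : ℝ)))
  have h3 := h0.comp_hasDerivAt (f := fun s : ℝ => (s, s)) (0 : ℝ)
    ((hasDerivAt_id (0 : ℝ)).prodMk (hasDerivAt_id (0 : ℝ)))
  rw [ha.unique h1, hb.unique h2, ← map_add]
  exact h3.congr_deriv (by simp)

end TwoVariables

/-! ### The bracket on open sets of the model space -/

section ModelBracket

variable {V₁ V₂ V₃ : Type*} [AddCommGroup V₁] [Module ℝ V₁] [DiffeologicalSpace V₁]
  [DiffeologicalModule V₁] [HadamardModule V₁] [AddCommGroup V₂] [Module ℝ V₂]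
  [DiffeologicalSpace V₂] [DiffeologicalModule V₂] [HadamardModule V₂] [AddCommGroup V₃]
  [Module ℝ V₃] [DiffeologicalSpace V₃] [DiffeologicalModule V₃]

/-- A bilinear form that is smooth on smooth families. -/
def SmoothPairing (B : V₁ →ₗ[ℝ] V₂ →ₗ[ℝ] ℝ) : Prop :=
  ∀ {n : ℕ} {p : 𝔼 n → V₁} {q : 𝔼 n → V₂},
    IsPlot p → IsPlot q → ContDiff ℝ ∞ fun u => B (p u) (q u)

/-- `f₁` and `f₂` represent the first two partial differentials of `f` on `T`. -/
structure LocalComponents (B : V₁ →ₗ[ℝ] V₂ →ₗ[ℝ] ℝ) (T : Set (V₁ × V₂ × V₃))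
    (f : V₁ × V₂ × V₃ → ℝ) (f₁ : V₁ × V₂ × V₃ → V₂) (f₂ : V₁ × V₂ × V₃ → V₁) : Prop where
  smooth : DSmoothOn f T
  smooth₁ : DSmoothOn f₁ T
  smooth₂ : DSmoothOn f₂ T
  deriv₁ : ∀ x ∈ T, ∀ v : V₁, HasDerivAt (fun s : ℝ => f (x + s • (v, 0, 0))) (B v (f₁ x)) 0
  deriv₂ : ∀ x ∈ T, ∀ w : V₂, HasDerivAt (fun s : ℝ => f (x + s • (0, w, 0))) (B (f₂ x) w) 0

variable {B : V₁ →ₗ[ℝ] V₂ →ₗ[ℝ] ℝ} {T : Set (V₁ × V₂ × V₃)}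
  {f g h : V₁ × V₂ × V₃ → ℝ} {f₁ g₁ h₁ : V₁ × V₂ × V₃ → V₂} {f₂ g₂ h₂ : V₁ × V₂ × V₃ → V₁}

lemma SmoothPairing.dSmooth_left (hB : SmoothPairing B) (w : V₂) : DSmooth (B.flip w) :=
  fun _ _ hp => (hB hp isPlot_const).isPlot

lemma SmoothPairing.dSmooth_right (hB : SmoothPairing B) (v : V₁) : DSmooth (B v) :=
  fun _ _ hp => (hB isPlot_const hp).isPlot

lemma SmoothPairing.contDiff {E : Type} [NormedAddCommGroup E] [NormedSpace ℝ E]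
    [FiniteDimensional ℝ E] (hB : SmoothPairing B) {p : E → V₁} {q : E → V₂}
    (hp : SmoothFamily p) (hq : SmoothFamily q) : ContDiff ℝ ∞ fun u => B (p u) (q u) :=
  SmoothFamily.contDiff fun n φ hφ => (hB (hp n φ hφ) (hq n φ hφ)).isPlot

lemma smoothFamily_plane (x V W : V₁ × V₂ × V₃) :
    SmoothFamily fun z : ℝ × ℝ => x + z.1 • V + z.2 • W :=
  ((smoothFamily_const x).add ((smoothFamily_const V).smul contDiff_fst)).add
    ((smoothFamily_const W).smul contDiff_snd)

lemma LocalComponents.contDiffAt (hT : IsOpen[dTopology] T) (hf : LocalComponents B T f f₁ f₂)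
    {x : V₁ × V₂ × V₃} (hx : x ∈ T) (V W : V₁ × V₂ × V₃) :
    ContDiffAt ℝ ∞ (fun z : ℝ × ℝ => f (x + z.1 • V + z.2 • W)) 0 :=
  (smoothFamily_plane x V W).contDiffAt hT (by simpa using hx) hf.smooth

/-- The derivative in a direction of the first two summands. -/
lemma LocalComponents.hasDerivAt (hT : IsOpen[dTopology] T) (hf : LocalComponents B T f f₁ f₂)
    {x : V₁ × V₂ × V₃} (hx : x ∈ T) (v : V₁) (w : V₂) :
    HasDerivAt (fun s : ℝ => f (x + s • (v, w, 0))) (B v (f₁ x) + B (f₂ x) w) 0 := by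
  have h1 := hasDerivAt_diag ((hf.contDiffAt hT hx (v, 0, 0) (0, w, 0)).differentiableAt (by simp))
    (a := B v (f₁ x)) (b := B (f₂ x) w) (by simpa using hf.deriv₁ x hx v)
    (by simpa using hf.deriv₂ x hx w)
  refine h1.congr_of_eventuallyEq (Filter.Eventually.of_forall fun s => ?_)
  simp only [add_assoc, ← smul_add, Prod.mk_add_mk, add_zero, zero_add]

lemma eventually_mem_line (hT : IsOpen[dTopology] T) {x : V₁ × V₂ × V₃} (hx : x ∈ T)
    (V : V₁ × V₂ × V₃) : ∀ᶠ s in 𝓝 (0 : ℝ), x + s • V ∈ T := by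
  have h1 : SmoothFamily fun s : ℝ => x + s • V :=
    (smoothFamily_const x).add ((smoothFamily_const V).smul contDiff_id)
  exact (h1.isOpen_preimage hT).mem_nhds (by simpa using hx)

/-- The second derivative of a function with components. -/
def secondDeriv (B : V₁ →ₗ[ℝ] V₂ →ₗ[ℝ] ℝ) (f₁ : V₁ × V₂ × V₃ → V₂) (f₂ : V₁ × V₂ × V₃ → V₁)
    (x : V₁ × V₂ × V₃) (V W : V₁ × V₂) : ℝ :=
  B W.1 (directional f₁ x (V.1, V.2, 0)) + B (directional f₂ x (V.1, V.2, 0)) W.2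

lemma LocalComponents.hasDerivAt_secondDeriv (hB : SmoothPairing B) (hT : IsOpen[dTopology] T)
    (hf : LocalComponents B T f f₁ f₂) {x : V₁ × V₂ × V₃} (hx : x ∈ T) (V W : V₁ × V₂) :
    HasDerivAt (fun s : ℝ => B W.1 (f₁ (x + s • (V.1, V.2, 0))) +
      B (f₂ (x + s • (V.1, V.2, 0))) W.2) (secondDeriv B f₁ f₂ x V W) 0 :=
  ((hasDirectional_directional hT hf.smooth₁ hx (V.1, V.2, 0)).hasDerivAt
    (hB.dSmooth_right W.1)).add
  ((hasDirectional_directional hT hf.smooth₂ hx (V.1, V.2, 0)).hasDerivAt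
    (hB.dSmooth_left W.2))

lemma LocalComponents.secondDeriv_comm (hB : SmoothPairing B) (hT : IsOpen[dTopology] T)
    (hf : LocalComponents B T f f₁ f₂) {x : V₁ × V₂ × V₃} (hx : x ∈ T) (V W : V₁ × V₂) :
    secondDeriv B f₁ f₂ x V W = secondDeriv B f₁ f₂ x W V := by
  refine mixed_partials_eq (hf.contDiffAt hT hx (V.1, V.2, 0) (W.1, W.2, 0)) ?_ ?_
    (hf.hasDerivAt_secondDeriv hB hT hx V W) (hf.hasDerivAt_secondDeriv hB hT hx W V)
  · filter_upwards [eventually_mem_line hT hx (V.1, V.2, 0)] with s hs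
    exact hf.hasDerivAt hT hs W.1 W.2
  · filter_upwards [eventually_mem_line hT hx (W.1, W.2, 0)] with s hs
    refine (hf.hasDerivAt hT hs V.1 V.2).congr_of_eventuallyEq
      (Filter.Eventually.of_forall fun t => ?_)
    simp only [add_right_comm]

/-- The bracket of two functions with components. -/
def modelBracket (B : V₁ →ₗ[ℝ] V₂ →ₗ[ℝ] ℝ) (f₁ : V₁ × V₂ × V₃ → V₂) (f₂ : V₁ × V₂ × V₃ → V₁)
    (g₁ : V₁ × V₂ × V₃ → V₂) (g₂ : V₁ × V₂ × V₃ → V₁) (x : V₁ × V₂ × V₃) : ℝ :=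
  B (g₂ x) (f₁ x) - B (f₂ x) (g₁ x)

lemma hasDerivAt_pairing (hB : SmoothPairing B) {x V : V₁ × V₂ × V₃} {a : V₁ × V₂ × V₃ → V₁}
    {c : V₁ × V₂ × V₃ → V₂} {a' : V₁} {c' : V₂} (ha : HasDirectional a x V a')
    (hc : HasDirectional c x V c') :
    HasDerivAt (fun s : ℝ => B (a (x + s • V)) (c (x + s • V))) (B a' (c x) + B (a x) c') 0 := by
  obtain ⟨q, hq, rfl, h1⟩ := ha
  obtain ⟨r, hr, rfl, h2⟩ := hc
  have h3 : ContDiff ℝ ∞ fun s : ℝ => B (q s) (c x) + B (a x) (r s) + s * B (q s) (r s) :=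
    ((hB.contDiff hq (smoothFamily_const _)).add (hB.contDiff (smoothFamily_const _) hr)).add
      (contDiff_id.mul (hB.contDiff hq hr))
  have h4 := hasDerivAt_of_quotient (φ := fun s : ℝ => B (a (x + s • V)) (c (x + s • V)))
    (c := B (a x) (c x)) h3.continuous.continuousAt (by
      filter_upwards [h1, h2] with s hs hs'
      rw [hs, hs']
      simp only [map_add, map_smul, LinearMap.add_apply, LinearMap.smul_apply, smul_eq_mul]
      ring)
  simpa using h4

/-- The derivative of a bracket. -/
lemma hasDerivAt_modelBracket (hB : SmoothPairing B) (hT : IsOpen[dTopology] T)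
    (hf : LocalComponents B T f f₁ f₂) (hg : LocalComponents B T g g₁ g₂)
    {x : V₁ × V₂ × V₃} (hx : x ∈ T) (V : V₁ × V₂) :
    HasDerivAt (fun s : ℝ => modelBracket B f₁ f₂ g₁ g₂ (x + s • (V.1, V.2, 0)))
      (secondDeriv B f₁ f₂ x V (g₂ x, -g₁ x) - secondDeriv B g₁ g₂ x V (f₂ x, -f₁ x)) 0 := by
  have a1 := hasDirectional_directional hT hf.smooth₁ hx (V.1, V.2, 0)
  have a2 := hasDirectional_directional hT hf.smooth₂ hx (V.1, V.2, 0)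
  have b1 := hasDirectional_directional hT hg.smooth₁ hx (V.1, V.2, 0)
  have b2 := hasDirectional_directional hT hg.smooth₂ hx (V.1, V.2, 0)
  refine ((hasDerivAt_pairing hB b2 a1).sub (hasDerivAt_pairing hB a2 b1)).congr_deriv ?_
  simp only [secondDeriv, map_neg]
  ring

/-- A bracket has components. -/
lemma localComponents_modelBracket (hB : SmoothPairing B) (hT : IsOpen[dTopology] T)
    (hf : LocalComponents B T f f₁ f₂) (hg : LocalComponents B T g g₁ g₂) :
    LocalComponents B T (modelBracket B f₁ f₂ g₁ g₂)
      (fun x => directional f₁ x (g₂ x, -g₁ x, 0) - directional g₁ x (f₂ x, -f₁ x, 0))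
      (fun x => directional f₂ x (g₂ x, -g₁ x, 0) - directional g₂ x (f₂ x, -f₁ x, 0)) := by
  have hXf : DSmoothOn (fun x => (f₂ x, -f₁ x, (0 : V₃))) T := fun n p hp hpT =>
    ⟨hf.smooth₂ n p hp hpT, isPlot_neg (hf.smooth₁ n p hp hpT), isPlot_const⟩
  have hXg : DSmoothOn (fun x => (g₂ x, -g₁ x, (0 : V₃))) T := fun n p hp hpT =>
    ⟨hg.smooth₂ n p hp hpT, isPlot_neg (hg.smooth₁ n p hp hpT), isPlot_const⟩
  refine ⟨fun n p hp hpT => ?_, fun n p hp hpT => ?_, fun n p hp hpT => ?_, fun x hx v => ?_,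
    fun x hx w => ?_⟩
  · exact ((hB (hg.smooth₂ n p hp hpT) (hf.smooth₁ n p hp hpT)).sub
      (hB (hf.smooth₂ n p hp hpT) (hg.smooth₁ n p hp hpT))).isPlot
  · exact isPlot_sub (dSmoothOn_directional hT hf.smooth₁ hXg n p hp hpT)
      (dSmoothOn_directional hT hg.smooth₁ hXf n p hp hpT)
  · exact isPlot_sub (dSmoothOn_directional hT hf.smooth₂ hXg n p hp hpT)
      (dSmoothOn_directional hT hg.smooth₂ hXf n p hp hpT)
  · refine (hasDerivAt_modelBracket hB hT hf hg hx (v, 0)).congr_deriv ?_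
    rw [hf.secondDeriv_comm hB hT hx, hg.secondDeriv_comm hB hT hx]
    simp [secondDeriv]
  · refine (hasDerivAt_modelBracket hB hT hf hg hx (0, w)).congr_deriv ?_
    rw [hf.secondDeriv_comm hB hT hx, hg.secondDeriv_comm hB hT hx]
    simp [secondDeriv]

/-- The iterated bracket, with any components of the inner one. -/
lemma modelBracket_modelBracket (hB : SmoothPairing B) (hT : IsOpen[dTopology] T)
    (hf : LocalComponents B T f f₁ f₂) (hg : LocalComponents B T g g₁ g₂)
    {k : V₁ × V₂ × V₃ → ℝ} {k₁ : V₁ × V₂ × V₃ → V₂} {k₂ : V₁ × V₂ × V₃ → V₁}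
    (hk : LocalComponents B T k k₁ k₂)
    (hkT : ∀ x ∈ T, k x = modelBracket B f₁ f₂ g₁ g₂ x) {x : V₁ × V₂ × V₃} (hx : x ∈ T) :
    modelBracket B k₁ k₂ h₁ h₂ x = secondDeriv B f₁ f₂ x (h₂ x, -h₁ x) (g₂ x, -g₁ x) -
      secondDeriv B g₁ g₂ x (h₂ x, -h₁ x) (f₂ x, -f₁ x) := by
  have h3 := hk.hasDerivAt hT hx (h₂ x) (-h₁ x)
  have h4 := hasDerivAt_modelBracket hB hT hf hg hx (h₂ x, -h₁ x)
  have h5 := h3.congr_of_eventuallyEq (f₁ := fun s : ℝ =>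
    modelBracket B f₁ f₂ g₁ g₂ (x + s • (h₂ x, -h₁ x, 0))) (by
      filter_upwards [eventually_mem_line hT hx (h₂ x, -h₁ x, 0)] with s hs
      exact (hkT _ hs).symm)
  rw [← h5.unique h4]
  simp [modelBracket, sub_eq_add_neg]

end ModelBracket

/-! ### The Poisson bracket of an atlas -/

section Atlas

variable {V₁ V₂ V₃ : Type*} [AddCommGroup V₁] [Module ℝ V₁] [DiffeologicalSpace V₁]
  [DiffeologicalModule V₁] [HadamardModule V₁] [AddCommGroup V₂] [Module ℝ V₂]
  [DiffeologicalSpace V₂] [DiffeologicalModule V₂] [HadamardModule V₂] [AddCommGroup V₃]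
  [Module ℝ V₃] [DiffeologicalSpace V₃] [DiffeologicalModule V₃] {Y : Type*} [DiffeologicalSpace Y]

/-- An atlas whose charts are the restrictions of a globally defined map. -/
structure IsGlobalAtlas (B : V₁ →ₗ[ℝ] V₂ →ₗ[ℝ] ℝ) (𝔸 : Set (PartialEquiv Y (V₁ × V₂ × V₃)))
    (D : Y → V₁ × V₂ × V₃) : Prop where
  smoothPairing : SmoothPairing B
  isChart : ∀ φ ∈ 𝔸, IsChart φ
  cover : ∀ y, ∃ φ ∈ 𝔸, y ∈ φ.source
  smooth : DSmooth D
  eq : ∀ φ ∈ 𝔸, ∀ y ∈ φ.source, φ y = D y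

/-- The derivative of `F` in the direction `v`, in a chart. -/
def HasChartDeriv (φ : PartialEquiv Y (V₁ × V₂ × V₃)) (F : Y → ℝ) (y : Y)
    (v : V₁ × V₂ × V₃) (d : ℝ) : Prop :=
  HasDerivAt (fun s : ℝ => F (φ.symm (φ y + s • v))) d 0

/-- The elements `α` and `β` represent the first two partial differentials of `F` at `y`. -/
def HasChartComponents (B : V₁ →ₗ[ℝ] V₂ →ₗ[ℝ] ℝ) (φ : PartialEquiv Y (V₁ × V₂ × V₃))
    (F : Y → ℝ) (y : Y) (α : V₂) (β : V₁) : Prop :=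
  (∀ v : V₁, HasChartDeriv φ F y (v, 0, 0) (B v α)) ∧
  ∀ w : V₂, HasChartDeriv φ F y (0, w, 0) (B β w)

/-- Smooth functions whose first two partial differentials are smoothly represented. -/
def IsChartRegular (B : V₁ →ₗ[ℝ] V₂ →ₗ[ℝ] ℝ) (𝔸 : Set (PartialEquiv Y (V₁ × V₂ × V₃)))
    (F : Y → ℝ) : Prop :=
  DSmooth F ∧ ∀ φ ∈ 𝔸, ∃ (F₁ : Y → V₂) (F₂ : Y → V₁),
    DSmoothOn F₁ φ.source ∧ DSmoothOn F₂ φ.source ∧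
      ∀ y ∈ φ.source, HasChartComponents B φ F y (F₁ y) (F₂ y)

/-- Near each point, `F` depends on the third component only. -/
def IsChartFunctionOfThird (𝔸 : Set (PartialEquiv Y (V₁ × V₂ × V₃))) (F : Y → ℝ) : Prop :=
  ∀ y, ∃ φ ∈ 𝔸, ∃ W : Set Y, IsOpen[dTopology] W ∧ y ∈ W ∧ W ⊆ φ.source ∧
    ∀ z ∈ W, ∀ z' ∈ W, (φ z).2.2 = (φ z').2.2 → F z = F z'

variable {B : V₁ →ₗ[ℝ] V₂ →ₗ[ℝ] ℝ} {𝔸 : Set (PartialEquiv Y (V₁ × V₂ × V₃))} {D : Y → V₁ × V₂ × V₃}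
  {φ φ' : PartialEquiv Y (V₁ × V₂ × V₃)} {F G H : Y → ℝ} {y : Y}

lemma IsChart.eventually_symm_mem (hφ : IsChart φ) {W : Set (Y)}
    (hW : IsOpen[dTopology] W) (hy : y ∈ φ.source) (hyW : y ∈ W) (v : V₁ × V₂ × V₃) :
    ∀ᶠ s in 𝓝 (0 : ℝ), φ y + s • v ∈ φ.target ∧ φ.symm (φ y + s • v) ∈ W := by
  have h1 : SmoothFamily fun s : ℝ => φ y + s • v :=
    (smoothFamily_const _).add ((smoothFamily_const v).smul contDiff_id)
  obtain ⟨ψ, hψ, hψT, hψ0⟩ := h1.exists_localization hφ.open_target (u₀ := 0)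
    (by simpa using φ.map_source hy)
  have h2 := (h1.comp hψ).dSmoothOn_comp hφ.smooth_symm hψT
  have h3 := (h2.isOpen_preimage hW).mem_nhds (x := (0 : ℝ)) (by
    simp only [Set.mem_preimage, hψ0.self_of_nhds]
    simpa [φ.left_inv hy] using hyW)
  filter_upwards [h3, hψ0, eventually_mem_line hφ.open_target (φ.map_source hy) v] with s hs hs' hs''
  refine ⟨hs'', ?_⟩
  simpa [hs'] using hs

lemma IsGlobalAtlas.hasDirDeriv_of (h : IsGlobalAtlas B 𝔸 D) (hφ : φ ∈ 𝔸) (hφ' : φ' ∈ 𝔸)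
    (hy : y ∈ φ.source) (hy' : y ∈ φ'.source) {v : V₁ × V₂ × V₃} {d : ℝ}
    (hd : HasChartDeriv φ F y v d) : HasChartDeriv φ' F y v d := by
  refine HasDerivAt.congr_of_eventuallyEq hd ?_
  filter_upwards [(h.isChart φ hφ).eventually_symm_mem
    (h.isChart φ' hφ').open_source hy hy' v] with s hs
  have h1 : φ.symm (φ y + s • v) ∈ φ.source := φ.map_target hs.1
  have h2 : φ' (φ.symm (φ y + s • v)) = φ y + s • v := by
    rw [h.eq φ' hφ' _ hs.2, ← h.eq φ hφ _ h1, φ.right_inv hs.1]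
  rw [h.eq φ' hφ' y hy', ← h.eq φ hφ y hy, ← h2, φ'.left_inv hs.2, h2]

lemma IsGlobalAtlas.hasComponents_of (h : IsGlobalAtlas B 𝔸 D) (hφ : φ ∈ 𝔸) (hφ' : φ' ∈ 𝔸)
    (hy : y ∈ φ.source) (hy' : y ∈ φ'.source) {α : V₂} {β : V₁}
    (hd : HasChartComponents B φ F y α β) : HasChartComponents B φ' F y α β :=
  ⟨fun v => h.hasDirDeriv_of hφ hφ' hy hy' (hd.1 v), fun w => h.hasDirDeriv_of hφ hφ' hy hy' (hd.2 w)⟩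

/-- The components of a regular function in a chart. -/
lemma localComponents_of_hasComponents (hφ : IsChart φ) (hF : DSmooth F)
    {F₁ : Y → V₂} {F₂ : Y → V₁} (h1 : DSmoothOn F₁ φ.source)
    (h2 : DSmoothOn F₂ φ.source) (h : ∀ y ∈ φ.source, HasChartComponents B φ F y (F₁ y) (F₂ y)) :
    LocalComponents B φ.target (fun x => F (φ.symm x)) (fun x => F₁ (φ.symm x))
      (fun x => F₂ (φ.symm x)) := by
  have hs : ∀ (n : ℕ) (p : 𝔼 n → V₁ × V₂ × V₃), IsPlot p →
      (∀ u, p u ∈ φ.target) → IsPlot fun u => φ.symm (p u) := hφ.smooth_symm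
  refine ⟨fun n p hp hpT => hF n _ (hs n p hp hpT),
    fun n p hp hpT => h1 n _ (hs n p hp hpT) fun u => φ.map_target (hpT u),
    fun n p hp hpT => h2 n _ (hs n p hp hpT) fun u => φ.map_target (hpT u),
    fun x hx v => ?_, fun x hx w => ?_⟩
  · have h3 := (h _ (φ.map_target hx)).1 v
    unfold HasChartDeriv at h3
    rwa [φ.right_inv hx] at h3
  · have h3 := (h _ (φ.map_target hx)).2 w
    unfold HasChartDeriv at h3
    rwa [φ.right_inv hx] at h3

lemma IsChartRegular.exists_localComponents (h : IsGlobalAtlas B 𝔸 D)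
    (hF : IsChartRegular B 𝔸 F) (hφ : φ ∈ 𝔸) : ∃ f₁ f₂, LocalComponents B φ.target
      (fun x => F (φ.symm x)) f₁ f₂ ∧ ∀ y ∈ φ.source, HasChartComponents B φ F y (f₁ (φ y)) (f₂ (φ y)) := by
  obtain ⟨F₁, F₂, h1, h2, h3⟩ := hF.2 φ hφ
  refine ⟨_, _, localComponents_of_hasComponents (h.isChart φ hφ) hF.1 h1 h2 h3, fun y hy => ?_⟩
  rw [φ.left_inv hy]
  exact h3 y hy

lemma LocalComponents.hasComponents {f₁ : V₁ × V₂ × V₃ → V₂} {f₂ : V₁ × V₂ × V₃ → V₁}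
    (h : LocalComponents B φ.target (fun x => F (φ.symm x)) f₁ f₂)
    (hy : y ∈ φ.source) : HasChartComponents B φ F y (f₁ (φ y)) (f₂ (φ y)) :=
  ⟨fun v => h.deriv₁ _ (φ.map_source hy) v, fun w => h.deriv₂ _ (φ.map_source hy) w⟩

lemma isRegularFunction_of_localComponents (h : IsGlobalAtlas B 𝔸 D) (hF : DSmooth F)
    (hc : ∀ φ ∈ 𝔸, ∃ f₁ f₂, LocalComponents B φ.target (fun x => F (φ.symm x)) f₁ f₂) :
    IsChartRegular B 𝔸 F := by
  refine ⟨hF, fun φ hφ => ?_⟩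
  obtain ⟨f₁, f₂, hf⟩ := hc φ hφ
  have hs := (h.isChart φ hφ).smooth
  exact ⟨fun y => f₁ (φ y), fun y => f₂ (φ y),
    fun n p hp hpT => hf.smooth₁ n _ (hs n p hp hpT) fun u => φ.map_source (hpT u),
    fun n p hp hpT => hf.smooth₂ n _ (hs n p hp hpT) fun u => φ.map_source (hpT u),
    fun y hy => hf.hasComponents hy⟩

lemma LocalComponents.congr {T : Set (V₁ × V₂ × V₃)} (hT : IsOpen[dTopology] T)
    {f g : V₁ × V₂ × V₃ → ℝ} {f₁ : V₁ × V₂ × V₃ → V₂} {f₂ : V₁ × V₂ × V₃ → V₁}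
    (h : LocalComponents B T f f₁ f₂) (hfg : ∀ x ∈ T, g x = f x) :
    LocalComponents B T g f₁ f₂ := by
  refine ⟨fun n p hp hpT => ?_, h.smooth₁, h.smooth₂, fun x hx v => ?_, fun x hx w => ?_⟩
  · have h1 : (fun u => g (p u)) = fun u => f (p u) := funext fun u => hfg _ (hpT u)
    rw [h1]
    exact h.smooth n p hp hpT
  · refine (h.deriv₁ x hx v).congr_of_eventuallyEq ?_
    filter_upwards [eventually_mem_line hT hx (v, 0, 0)] with s hs using hfg _ hs
  · refine (h.deriv₂ x hx w).congr_of_eventuallyEq ?_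
    filter_upwards [eventually_mem_line hT hx (0, w, 0)] with s hs using hfg _ hs

section Algebra

variable {α α' : V₂} {β β' : V₁}

lemma HasChartComponents.add (hF : HasChartComponents B φ F y α β)
    (hG : HasChartComponents B φ G y α' β') :
    HasChartComponents B φ (F + G) y (α + α') (β + β') :=
  ⟨fun v => ((hF.1 v).add (hG.1 v)).congr_deriv (map_add (B v) _ _).symm,
    fun w => ((hF.2 w).add (hG.2 w)).congr_deriv (B.map_add₂ _ _ w).symm⟩

lemma HasChartComponents.smul (c : ℝ) (hF : HasChartComponents B φ F y α β) :
    HasChartComponents B φ (c • F) y (c • α) (c • β) :=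
  ⟨fun v => ((hF.1 v).const_mul c).congr_deriv ((B v).map_smul _ _).symm,
    fun w => ((hF.2 w).const_mul c).congr_deriv (B.map_smul₂ _ _ w).symm⟩

lemma HasChartComponents.mul (hy : y ∈ φ.source) (hF : HasChartComponents B φ F y α β)
    (hG : HasChartComponents B φ G y α' β') :
    HasChartComponents B φ (F * G) y (G y • α + F y • α') (G y • β + F y • β') := by
  have h0 : ∀ v : V₁ × V₂ × V₃, φ.symm (φ y + (0 : ℝ) • v) = y := fun v => by
    rw [zero_smul, add_zero, φ.left_inv hy]
  refine ⟨fun v => ((hF.1 v).mul (hG.1 v)).congr_deriv ?_,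
    fun w => ((hF.2 w).mul (hG.2 w)).congr_deriv ?_⟩
  · simp only [h0, map_add, map_smul, smul_eq_mul]
    ring
  · simp only [h0, map_add, map_smul, LinearMap.add_apply, LinearMap.smul_apply, smul_eq_mul]
    ring

lemma hasComponents_const (c : ℝ) : HasChartComponents B φ (fun _ => c) y (0 : V₂) (0 : V₁) :=
  ⟨fun v => (hasDerivAt_const (0 : ℝ) c).congr_deriv ((B v).map_zero).symm,
    fun w => (hasDerivAt_const (0 : ℝ) c).congr_deriv (B.map_zero₂ w).symm⟩

lemma IsChartRegular.add (hF : IsChartRegular B 𝔸 F) (hG : IsChartRegular B 𝔸 G) :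
    IsChartRegular B 𝔸 (F + G) := by
  refine ⟨fun n p hp => ((hF.1 n p hp).contDiff.add (hG.1 n p hp).contDiff).isPlot, fun φ hφ => ?_⟩
  obtain ⟨F₁, F₂, h1, h2, h3⟩ := hF.2 φ hφ
  obtain ⟨G₁, G₂, k1, k2, k3⟩ := hG.2 φ hφ
  exact ⟨fun y => F₁ y + G₁ y, fun y => F₂ y + G₂ y,
    fun n p hp hpT => isPlot_add (h1 n p hp hpT) (k1 n p hp hpT),
    fun n p hp hpT => isPlot_add (h2 n p hp hpT) (k2 n p hp hpT),
    fun y hy => (h3 y hy).add (k3 y hy)⟩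

lemma IsChartRegular.mul (hF : IsChartRegular B 𝔸 F) (hG : IsChartRegular B 𝔸 G) :
    IsChartRegular B 𝔸 (F * G) := by
  refine ⟨fun n p hp => ((hF.1 n p hp).contDiff.mul (hG.1 n p hp).contDiff).isPlot, fun φ hφ => ?_⟩
  obtain ⟨F₁, F₂, h1, h2, h3⟩ := hF.2 φ hφ
  obtain ⟨G₁, G₂, k1, k2, k3⟩ := hG.2 φ hφ
  exact ⟨fun y => G y • F₁ y + F y • G₁ y, fun y => G y • F₂ y + F y • G₂ y,
    fun n p hp hpT => isPlot_add (isPlot_smul (hG.1 n p hp).contDiff (h1 n p hp hpT))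
      (isPlot_smul (hF.1 n p hp).contDiff (k1 n p hp hpT)),
    fun n p hp hpT => isPlot_add (isPlot_smul (hG.1 n p hp).contDiff (h2 n p hp hpT))
      (isPlot_smul (hF.1 n p hp).contDiff (k2 n p hp hpT)),
    fun y hy => (h3 y hy).mul hy (k3 y hy)⟩

lemma isRegularFunction_const (c : ℝ) : IsChartRegular B 𝔸 fun _ => c :=
  ⟨dSmooth_const, fun _ _ => ⟨fun _ => 0, fun _ => 0, fun _ _ _ _ => isPlot_const,
    fun _ _ _ _ => isPlot_const, fun _ _ => hasComponents_const c⟩⟩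

variable (B 𝔸) in
/-- The algebra of regular functions. -/
def regularSubalgebra : Subalgebra ℝ (Y → ℝ) where
  carrier := {F | IsChartRegular B 𝔸 F}
  mul_mem' := IsChartRegular.mul
  add_mem' := IsChartRegular.add
  algebraMap_mem' c := isRegularFunction_const c

end Algebra

/-! ### The bracket -/

variable (B 𝔸 F G) in
/-- The bracket of two functions, by means of a chart. -/
def atlasBracket (y : Y) : ℝ := by
  classical
  exact if h : ∃ d : ℝ, ∃ φ ∈ 𝔸, y ∈ φ.source ∧ ∃ (F₁ G₁ : V₂) (F₂ G₂ : V₁),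
    HasChartComponents B φ F y F₁ F₂ ∧ HasChartComponents B φ G y G₁ G₂ ∧
      d = B G₂ F₁ - B F₂ G₁ then h.choose else 0

lemma IsGlobalAtlas.bracket_eq (h : IsGlobalAtlas B 𝔸 D) (hφ : φ ∈ 𝔸) (hy : y ∈ φ.source)
    {F₁ G₁ : V₂} {F₂ G₂ : V₁} (hF : HasChartComponents B φ F y F₁ F₂)
    (hG : HasChartComponents B φ G y G₁ G₂) :
    atlasBracket B 𝔸 F G y = B G₂ F₁ - B F₂ G₁ := by
  have hex : ∃ d : ℝ, ∃ φ ∈ 𝔸, y ∈ φ.source ∧ ∃ (F₁ G₁ : V₂) (F₂ G₂ : V₁),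
    HasChartComponents B φ F y F₁ F₂ ∧ HasChartComponents B φ G y G₁ G₂ ∧
      d = B G₂ F₁ - B F₂ G₁ := ⟨_, φ, hφ, hy, F₁, G₁, F₂, G₂, hF, hG, rfl⟩
  unfold atlasBracket
  rw [dif_pos hex]
  obtain ⟨φ', hφ', hy', F₁', G₁', F₂', G₂', hF', hG', hd⟩ := hex.choose_spec
  rw [hd]
  have hF'' := h.hasComponents_of hφ' hφ hy' hy hF'
  have hG'' := h.hasComponents_of hφ' hφ hy' hy hG'
  rw [(hF''.1 G₂').unique (hF.1 G₂'), (hF''.2 G₁').unique (hF.2 G₁'),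
    (hG''.2 F₁).unique (hG.2 F₁), (hG''.1 F₂).unique (hG.1 F₂)]

lemma IsGlobalAtlas.bracket_eq_modelBracket (h : IsGlobalAtlas B 𝔸 D) (hφ : φ ∈ 𝔸)
    (hy : y ∈ φ.source) {f₁ g₁ : V₁ × V₂ × V₃ → V₂} {f₂ g₂ : V₁ × V₂ × V₃ → V₁}
    (hF : LocalComponents B φ.target (fun x => F (φ.symm x)) f₁ f₂)
    (hG : LocalComponents B φ.target (fun x => G (φ.symm x)) g₁ g₂) :
    atlasBracket B 𝔸 F G y = modelBracket B f₁ f₂ g₁ g₂ (φ y) :=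
  h.bracket_eq hφ hy (hF.hasComponents hy) (hG.hasComponents hy)

lemma IsGlobalAtlas.localComponents_bracket (h : IsGlobalAtlas B 𝔸 D) (hφ : φ ∈ 𝔸)
    {f₁ g₁ : V₁ × V₂ × V₃ → V₂} {f₂ g₂ : V₁ × V₂ × V₃ → V₁}
    (hF : LocalComponents B φ.target (fun x => F (φ.symm x)) f₁ f₂)
    (hG : LocalComponents B φ.target (fun x => G (φ.symm x)) g₁ g₂) :
    ∃ k₁ k₂, LocalComponents B φ.target
      (fun x => atlasBracket B 𝔸 F G (φ.symm x)) k₁ k₂ := by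
  have hT := (h.isChart φ hφ).open_target
  refine ⟨_, _, (localComponents_modelBracket h.smoothPairing hT hF hG).congr hT fun x hx => ?_⟩
  rw [h.bracket_eq_modelBracket hφ (φ.map_target hx) hF hG, φ.right_inv hx]

lemma IsGlobalAtlas.isRegularFunction_bracket (h : IsGlobalAtlas B 𝔸 D)
    (hF : IsChartRegular B 𝔸 F) (hG : IsChartRegular B 𝔸 G) :
    IsChartRegular B 𝔸 (atlasBracket B 𝔸 F G) := by
  refine isRegularFunction_of_localComponents h ?_ fun φ hφ => ?_
  · refine dSmooth_of_locally fun y => ?_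
    obtain ⟨φ, hφ, hy⟩ := h.cover y
    have hc := h.isChart φ hφ
    obtain ⟨f₁, f₂, hf, -⟩ := hF.exists_localComponents h hφ
    obtain ⟨g₁, g₂, hg, -⟩ := hG.exists_localComponents h hφ
    refine ⟨φ.source, hc.open_source, hy, fun n p hp hpT => ?_⟩
    have h1 := (localComponents_modelBracket h.smoothPairing hc.open_target hf hg).smooth n _
      (hc.smooth n p hp hpT) fun u => φ.map_source (hpT u)
    have h2 : (fun u => atlasBracket B 𝔸 F G (p u)) =
        fun u => modelBracket B f₁ f₂ g₁ g₂ (φ (p u)) :=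
      funext fun u => h.bracket_eq_modelBracket hφ (hpT u) hf hg
    rw [h2]
    exact h1
  · obtain ⟨f₁, f₂, hf, -⟩ := hF.exists_localComponents h hφ
    obtain ⟨g₁, g₂, hg, -⟩ := hG.exists_localComponents h hφ
    exact h.localComponents_bracket hφ hf hg

lemma IsChartRegular.exists_components (hF : IsChartRegular B 𝔸 F) (hφ : φ ∈ 𝔸)
    (hy : y ∈ φ.source) : ∃ (α : V₂) (β : V₁), HasChartComponents B φ F y α β := by
  obtain ⟨F₁, F₂, -, -, h⟩ := hF.2 φ hφ
  exact ⟨_, _, h y hy⟩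

lemma IsGlobalAtlas.bracket_skew (h : IsGlobalAtlas B 𝔸 D) (hF : IsChartRegular B 𝔸 F)
    (hG : IsChartRegular B 𝔸 G) (y : Y) :
    atlasBracket B 𝔸 F G y = -atlasBracket B 𝔸 G F y := by
  obtain ⟨φ, hφ, hy⟩ := h.cover y
  obtain ⟨_, _, hf⟩ := hF.exists_components hφ hy
  obtain ⟨_, _, hg⟩ := hG.exists_components hφ hy
  rw [h.bracket_eq hφ hy hf hg, h.bracket_eq hφ hy hg hf]
  ring

lemma IsGlobalAtlas.bracket_add_left (h : IsGlobalAtlas B 𝔸 D) (hF : IsChartRegular B 𝔸 F)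
    (hG : IsChartRegular B 𝔸 G) (hH : IsChartRegular B 𝔸 H) (y : Y) :
    atlasBracket B 𝔸 (F + G) H y = atlasBracket B 𝔸 F H y + atlasBracket B 𝔸 G H y := by
  obtain ⟨φ, hφ, hy⟩ := h.cover y
  obtain ⟨_, _, hf⟩ := hF.exists_components hφ hy
  obtain ⟨_, _, hg⟩ := hG.exists_components hφ hy
  obtain ⟨_, _, hh⟩ := hH.exists_components hφ hy
  rw [h.bracket_eq hφ hy (hf.add hg) hh, h.bracket_eq hφ hy hf hh, h.bracket_eq hφ hy hg hh]
  simp only [map_add, map_smul, LinearMap.add_apply, LinearMap.smul_apply, smul_eq_mul]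
  ring

lemma IsGlobalAtlas.bracket_smul_left (h : IsGlobalAtlas B 𝔸 D) (c : ℝ)
    (hF : IsChartRegular B 𝔸 F) (hG : IsChartRegular B 𝔸 G) (y : Y) :
    atlasBracket B 𝔸 (c • F) G y = c * atlasBracket B 𝔸 F G y := by
  obtain ⟨φ, hφ, hy⟩ := h.cover y
  obtain ⟨_, _, hf⟩ := hF.exists_components hφ hy
  obtain ⟨_, _, hg⟩ := hG.exists_components hφ hy
  rw [h.bracket_eq hφ hy (hf.smul c) hg, h.bracket_eq hφ hy hf hg]
  simp only [map_add, map_smul, LinearMap.add_apply, LinearMap.smul_apply, smul_eq_mul]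
  ring

lemma IsGlobalAtlas.bracket_leibniz (h : IsGlobalAtlas B 𝔸 D) (hF : IsChartRegular B 𝔸 F)
    (hG : IsChartRegular B 𝔸 G) (hH : IsChartRegular B 𝔸 H) (y : Y) :
    atlasBracket B 𝔸 F (G * H) y = atlasBracket B 𝔸 F G y * H y + G y * atlasBracket B 𝔸 F H y := by
  obtain ⟨φ, hφ, hy⟩ := h.cover y
  obtain ⟨_, _, hf⟩ := hF.exists_components hφ hy
  obtain ⟨_, _, hg⟩ := hG.exists_components hφ hy
  obtain ⟨_, _, hh⟩ := hH.exists_components hφ hy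
  rw [h.bracket_eq hφ hy hf (hg.mul hy hh), h.bracket_eq hφ hy hf hg, h.bracket_eq hφ hy hf hh]
  simp only [map_add, map_smul, LinearMap.add_apply, LinearMap.smul_apply, smul_eq_mul]
  ring

lemma IsGlobalAtlas.bracket_jacobi (h : IsGlobalAtlas B 𝔸 D) (hF : IsChartRegular B 𝔸 F)
    (hG : IsChartRegular B 𝔸 G) (hH : IsChartRegular B 𝔸 H) (y : Y) :
    atlasBracket B 𝔸 F (atlasBracket B 𝔸 G H) y + atlasBracket B 𝔸 G (atlasBracket B 𝔸 H F) y +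
      atlasBracket B 𝔸 H (atlasBracket B 𝔸 F G) y = 0 := by
  obtain ⟨φ, hφ, hy⟩ := h.cover y
  obtain ⟨f₁, f₂, hf, -⟩ := hF.exists_localComponents h hφ
  obtain ⟨g₁, g₂, hg, -⟩ := hG.exists_localComponents h hφ
  obtain ⟨h₁, h₂, hh, -⟩ := hH.exists_localComponents h hφ
  have hT := (h.isChart φ hφ).open_target
  have hx : φ y ∈ φ.target := φ.map_source hy
  have key : ∀ {A A' C : Y → ℝ} {a₁ b₁ c₁ : V₁ × V₂ × V₃ → V₂}
      {a₂ b₂ c₂ : V₁ × V₂ × V₃ → V₁},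
      LocalComponents B φ.target (fun x => A (φ.symm x)) a₁ a₂ →
      LocalComponents B φ.target (fun x => A' (φ.symm x)) b₁ b₂ →
      LocalComponents B φ.target (fun x => C (φ.symm x)) c₁ c₂ →
      atlasBracket B 𝔸 (atlasBracket B 𝔸 A A') C y =
        secondDeriv B a₁ a₂ (φ y) (c₂ (φ y), -c₁ (φ y)) (b₂ (φ y), -b₁ (φ y)) -
        secondDeriv B b₁ b₂ (φ y) (c₂ (φ y), -c₁ (φ y)) (a₂ (φ y), -a₁ (φ y)) := by
    intro A A' C a₁ b₁ c₁ a₂ b₂ c₂ hA hB hC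
    obtain ⟨k₁, k₂, hk⟩ := h.localComponents_bracket hφ hA hB
    rw [h.bracket_eq_modelBracket hφ hy hk hC]
    refine modelBracket_modelBracket h.smoothPairing hT hA hB hk (fun x hx => ?_) hx
    rw [h.bracket_eq_modelBracket hφ (φ.map_target hx) hA hB, φ.right_inv hx]
  rw [h.bracket_skew hF (h.isRegularFunction_bracket hG hH),
    h.bracket_skew hG (h.isRegularFunction_bracket hH hF),
    h.bracket_skew hH (h.isRegularFunction_bracket hF hG), key hg hh hf, key hh hf hg, key hf hg hh,
    hf.secondDeriv_comm h.smoothPairing hT hx,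
    hg.secondDeriv_comm h.smoothPairing hT hx,
    hh.secondDeriv_comm h.smoothPairing hT hx]
  ring

/-- The Poisson bracket on the regular functions. -/
def IsGlobalAtlas.poissonBracket (h : IsGlobalAtlas B 𝔸 D) : PoissonBracket
    (regularSubalgebra B 𝔸) where
  bracket := LinearMap.mk₂ ℝ (fun F G => ⟨atlasBracket B 𝔸 F.1 G.1, h.isRegularFunction_bracket F.2 G.2⟩)
    (fun F G H => Subtype.ext (funext fun y => h.bracket_add_left F.2 G.2 H.2 y))
    (fun c F G => Subtype.ext (funext fun y => h.bracket_smul_left c F.2 G.2 y))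
    (fun F G H => Subtype.ext (funext fun y => by
      change atlasBracket B 𝔸 F.1 (G.1 + H.1) y = atlasBracket B 𝔸 F.1 G.1 y + atlasBracket B 𝔸 F.1 H.1 y
      rw [h.bracket_skew F.2 (G.2.add H.2), h.bracket_add_left G.2 H.2 F.2,
        h.bracket_skew F.2 G.2, h.bracket_skew F.2 H.2]
      ring))
    (fun c F G => Subtype.ext (funext fun y => by
      change atlasBracket B 𝔸 F.1 (c • G.1) y = c * atlasBracket B 𝔸 F.1 G.1 y
      rw [h.bracket_skew F.2 ((regularSubalgebra B 𝔸).smul_mem G.2 c), h.bracket_smul_left c G.2 F.2,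
        h.bracket_skew F.2 G.2]
      ring))
  skew F G := Subtype.ext (funext fun y => h.bracket_skew F.2 G.2 y)
  leibniz F G H := Subtype.ext (funext fun y => h.bracket_leibniz F.2 G.2 H.2 y)
  jacobi F G H := Subtype.ext (funext fun y => h.bracket_jacobi F.2 G.2 H.2 y)

/-- Every linear form is the differential of a regular function. -/
lemma IsGlobalAtlas.exists_function (h : IsGlobalAtlas B 𝔸 D) (α : V₂) (β : V₁)
    (γ : V₃ →ₗ[ℝ] ℝ) (hγ : DSmooth γ) : ∃ F ∈ regularSubalgebra B 𝔸, ∀ φ ∈ 𝔸, ∀ y ∈ φ.source,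
      ∀ (u : V₁) (v : V₂) (w : V₃),
        HasChartDeriv φ F y (u, v, w) (B u α + B β v + γ w) := by
  let ℓ : V₁ × V₂ × V₃ → ℝ := fun x => B x.1 α + B β x.2.1 + γ x.2.2
  have hℓ : ∀ φ ∈ 𝔸, ∀ y ∈ φ.source, ∀ v : V₁ × V₂ × V₃,
      HasChartDeriv φ (fun y => ℓ (D y)) y v (ℓ v) := by
    intro φ hφ y hy v
    have h1 : HasDerivAt (fun s : ℝ => ℓ (φ y) + s * ℓ v) (ℓ v) 0 := by
      simpa using ((hasDerivAt_id (0 : ℝ)).mul_const (ℓ v)).const_add (ℓ (φ y))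
    refine h1.congr_of_eventuallyEq ?_
    filter_upwards [eventually_mem_line (h.isChart φ hφ).open_target
      (φ.map_source hy) v] with s hs
    rw [← h.eq φ hφ _ (φ.map_target hs), φ.right_inv hs]
    change B ((φ y).1 + s • v.1) α + B β ((φ y).2.1 + s • v.2.1) +
      γ ((φ y).2.2 + s • v.2.2) = _
    simp only [map_add, map_smul, LinearMap.add_apply, LinearMap.smul_apply, smul_eq_mul, ℓ]
    ring
  have hz : ∀ w : V₂, B 0 w = 0 := fun w => B.map_zero₂ w
  have hz' : ∀ v : V₁, B v 0 = 0 := fun v => (B v).map_zero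
  refine ⟨fun y => ℓ (D y), ⟨fun n p hp => ?_, fun φ hφ => ⟨fun _ => α, fun _ => β,
    fun _ _ _ _ => isPlot_const, fun _ _ _ _ => isPlot_const, fun y hy => ⟨fun v => ?_, fun w => ?_⟩⟩⟩,
    fun φ hφ y hy u v w => hℓ φ hφ y hy (u, v, w)⟩
  · have h1 := h.smooth n p hp
    exact (((h.smoothPairing h1.1 isPlot_const).add (h.smoothPairing isPlot_const h1.2.1)).add
      (hγ n _ h1.2.2).contDiff).isPlot
  · simpa [ℓ, hz, hz'] using hℓ φ hφ y hy (v, 0, 0)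
  · simpa [ℓ, hz, hz'] using hℓ φ hφ y hy (0, w, 0)

/-- Functions of the third component commute with all regular functions. -/
lemma IsGlobalAtlas.bracket_eq_zero (h : IsGlobalAtlas B 𝔸 D) (hF : IsChartRegular B 𝔸 F)
    (hG : IsChartRegular B 𝔸 G) (hd : IsChartFunctionOfThird 𝔸 F) (y : Y) :
    atlasBracket B 𝔸 F G y = 0 := by
  obtain ⟨φ, hφ, W, hW, hyW, hWφ, hc⟩ := hd y
  have hy := hWφ hyW
  have h0 : ∀ v : V₁ × V₂ × V₃, v.2.2 = 0 → HasChartDeriv φ F y v 0 := by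
    intro v hv
    refine (hasDerivAt_const (0 : ℝ) (F y)).congr_of_eventuallyEq ?_
    filter_upwards [(h.isChart φ hφ).eventually_symm_mem hW hy hyW v] with s hs
    refine hc _ hs.2 _ hyW ?_
    rw [φ.right_inv hs.1]
    change (φ y).2.2 + s • v.2.2 = _
    rw [hv, smul_zero, add_zero]
  obtain ⟨α, β, hf⟩ := hF.exists_components hφ hy
  obtain ⟨α', β', hg⟩ := hG.exists_components hφ hy
  rw [h.bracket_eq hφ hy hf hg, (hf.1 β').unique (h0 _ rfl), (hf.2 α').unique (h0 _ rfl), sub_self]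

/-- The set of points that are joined to `x₀` by a segment in the first two directions. -/
lemma isOpen_segment_set (hφ : IsChart φ) (x₀ : V₁ × V₂ × V₃) :
    IsOpen[dTopology] {z | z ∈ φ.source ∧ ∀ r ∈ Set.Icc (0 : ℝ) 1,
      φ z + r • (x₀.1 - (φ z).1, x₀.2.1 - (φ z).2.1, (0 : V₃)) ∈ φ.target} := by
  rw [isOpen_iff_preimages_plots]
  intro n p hp
  rw [isOpen_iff_mem_nhds]
  rintro u₀ ⟨hu₀, hr⟩
  have hp' := smoothFamily_iff_isPlot.2 hp
  obtain ⟨ψ, hψ, hψT, hψ0⟩ := hp'.exists_localization hφ.open_source hu₀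
  have h1 : SmoothFamily fun u => φ (p (ψ u)) := (hp'.comp hψ).dSmoothOn_comp hφ.smooth hψT
  have h2 : SmoothFamily fun w : 𝔼 n × ℝ =>
      φ (p (ψ w.1)) + w.2 • (x₀.1 - (φ (p (ψ w.1))).1, x₀.2.1 - (φ (p (ψ w.1))).2.1,
        (0 : V₃)) := by
    refine (h1.comp contDiff_fst).add (SmoothFamily.smul ?_ contDiff_snd)
    intro m f hf
    have h3 := h1.comp contDiff_fst m f hf
    exact ⟨isPlot_sub isPlot_const h3.1, isPlot_sub isPlot_const h3.2.1, isPlot_const⟩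
  have h3 := h2.isOpen_preimage hφ.open_target
  have h4 : ∀ᶠ u in 𝓝 u₀, ∀ r ∈ Set.Icc (0 : ℝ) 1, (u, r) ∈ (fun w :
      𝔼 n × ℝ => φ (p (ψ w.1)) + w.2 • (x₀.1 - (φ (p (ψ w.1))).1,
        x₀.2.1 - (φ (p (ψ w.1))).2.1, (0 : V₃))) ⁻¹' φ.target := by
    refine isCompact_Icc.eventually_forall_of_forall_eventually fun r hr' => ?_
    refine h3.mem_nhds ?_
    have h5 : ψ u₀ = u₀ := hψ0.self_of_nhds
    simp only [Set.mem_preimage, h5]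
    exact hr r hr'
  filter_upwards [h4, hψ0, (hp'.isOpen_preimage hφ.open_source).mem_nhds hu₀] with u hu hu' hu''
  refine ⟨hu'', fun r hr' => ?_⟩
  have h5 := hu r hr'
  have h6 : ψ u = u := hu'
  simpa only [Set.mem_preimage, h6] using h5

/-- Functions that commute with all regular functions depend on the third component only. -/
lemma IsGlobalAtlas.dependsOnThird (h : IsGlobalAtlas B 𝔸 D) (hF : IsChartRegular B 𝔸 F)
    (h0 : ∀ G, IsChartRegular B 𝔸 G → ∀ y, atlasBracket B 𝔸 F G y = 0) : IsChartFunctionOfThird 𝔸 F := by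
  intro y
  obtain ⟨φ, hφ, hy⟩ := h.cover y
  have hc := h.isChart φ hφ
  obtain ⟨f₁, f₂, hf, -⟩ := hF.exists_localComponents h hφ
  have hz : ∀ w : V₂, B 0 w = 0 := fun w => B.map_zero₂ w
  have hz' : ∀ v : V₁, B v 0 = 0 := fun v => (B v).map_zero
  have hzero : ∀ x ∈ φ.target, ∀ (v : V₁) (w : V₂),
      HasDerivAt (fun s : ℝ => F (φ.symm (x + s • (v, w, 0)))) 0 0 := by
    intro x hx v w
    obtain ⟨G, hG, hd⟩ := h.exists_function (-w) v 0 dSmooth_const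
    have hy' := φ.map_target hx
    have hg : HasChartComponents B φ G (φ.symm x) (-w) v :=
      ⟨fun a => by simpa [hz, hz'] using hd φ hφ _ hy' a 0 0,
        fun b => by simpa [hz, hz'] using hd φ hφ _ hy' 0 b 0⟩
    have h1 := h0 G hG (φ.symm x)
    rw [h.bracket_eq hφ hy' (hf.hasComponents hy') hg, φ.right_inv hx] at h1
    refine (hf.hasDerivAt hc.open_target hx v w).congr_deriv ?_
    rw [← h1, map_neg]
    ring
  refine ⟨φ, hφ, _, isOpen_segment_set hc (φ y), ⟨hy, fun r _ => ?_⟩, fun z hz => hz.1, ?_⟩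
  · simp only [sub_self, Prod.mk_zero_zero, smul_zero, add_zero]
    exact φ.map_source hy
  have key : ∀ z ∈ {z | z ∈ φ.source ∧ ∀ r ∈ Set.Icc (0 : ℝ) 1,
      φ z + r • ((φ y).1 - (φ z).1, (φ y).2.1 - (φ z).2.1, (0 : V₃)) ∈ φ.target},
      F z = F (φ.symm ((φ y).1, (φ y).2.1, (φ z).2.2)) := by
    rintro z ⟨hz1, hz2⟩
    set V : V₁ × V₂ × V₃ := ((φ y).1 - (φ z).1, (φ y).2.1 - (φ z).2.1, 0) with hV
    have hder : ∀ r ∈ Set.Icc (0 : ℝ) 1,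
        HasDerivAt (fun r : ℝ => F (φ.symm (φ z + r • V))) 0 r := by
      intro r hr
      have h1 := hzero _ (hz2 r hr) ((φ y).1 - (φ z).1) ((φ y).2.1 - (φ z).2.1)
      have h2 : HasDerivAt (fun t : ℝ => F (φ.symm (φ z + r • V + (t - r) • V))) 0 r := by
        have h3 : HasDerivAt (fun t : ℝ => t - r) 1 r := (hasDerivAt_id r).sub_const r
        have h4 : HasDerivAt (fun s : ℝ => F (φ.symm (φ z + r • V + s • V))) 0 (r - r) := by
          rw [sub_self]
          exact h1
        simpa [Function.comp_def] using HasDerivAt.comp (h := fun t : ℝ => t - r) r h4 h3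
      refine h2.congr_of_eventuallyEq (Filter.Eventually.of_forall fun t => ?_)
      simp only [add_assoc, ← add_smul, add_sub_cancel]
    have hconst := constant_of_has_deriv_right_zero (f := fun r : ℝ => F (φ.symm (φ z + r • V)))
      (a := 0) (b := 1) (fun r hr => (hder r hr).continuousAt.continuousWithinAt)
      (fun r hr => (hder r ⟨hr.1, hr.2.le⟩).hasDerivWithinAt) 1 ⟨zero_le_one, le_rfl⟩
    have h5 : φ z + (1 : ℝ) • V = ((φ y).1, (φ y).2.1, (φ z).2.2) := by
      rw [one_smul, hV]
      refine Prod.ext ?_ (Prod.ext ?_ ?_)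
      · exact add_sub_cancel _ _
      · exact add_sub_cancel _ _
      · exact add_zero _
    simp only [h5, zero_smul, add_zero, φ.left_inv hz1] at hconst
    exact hconst.symm
  intro z hz z' hz' hzz
  rw [key z hz, key z' hz', hzz]

end Atlas

section Poisson

variable {M : Type*} [TopologicalSpace M] [ChartedSpace R3 M] [IsManifold (𝓡 3) ∞ M] [T2Space M]
  [CompactSpace M] {L : M → Type*} [TopologicalSpace (TotalSpace ℂ L)]
  [∀ x, NormedAddCommGroup (L x)] [∀ x, InnerProductSpace ℂ (L x)] [FiberBundle ℂ L]
  [VectorBundle ℝ ℂ L] [ContMDiffVectorBundle ∞ ℂ L (𝓡 3)] {K : CechH2 (M × Circle)}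

lemma smoothPairing_pairingL : SmoothPairing (pairingL M) := fun hp hq => contDiff_pairing hp hq

/-- A constant atlas given by a global map defines a Poisson structure. -/
theorem exists_poisson {𝔸 : Set (PartialEquiv (SpaceY L K) (ModelY M))} {D : SpaceY L K → ModelY M}
    (h : IsGlobalAtlas (pairingL M) 𝔸 D) :
    ∃ 𝒞 : Subalgebra ℝ (SpaceY L K → ℝ), (∀ F, F ∈ 𝒞 ↔ IsRegularFunction 𝔸 F) ∧
        (∀ φ ∈ 𝔸, ∀ y ∈ φ.source, ∀ (α : Form2 M) (β : Form1 M) (γ : Form2 M), ∃ F ∈ 𝒞,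
          ∀ (u : Form1 M) (v : Form2 M) (w : Form1 M),
            HasDirDeriv φ F y (u, v, w) (pairing u α + pairing β v + pairing w γ)) ∧
        ∃ P : PoissonBracket 𝒞,
          (∀ φ ∈ 𝔸, ∀ y ∈ φ.source, ∀ (F G : 𝒞) (F₁ G₁ : Form2 M) (F₂ G₂ : Form1 M),
            HasComponents φ F.1 y F₁ F₂ → HasComponents φ G.1 y G₁ G₂ →
              (P.bracket F G).1 y = pairing G₂ F₁ - pairing F₂ G₁) ∧
          ∀ F : 𝒞, (∀ G : 𝒞, P.bracket F G = 0) ↔ DependsOnThird 𝔸 F.1 := by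
  refine ⟨regularSubalgebra (pairingL M) 𝔸, fun F => Iff.rfl, fun φ hφ y hy α β γ => ?_,
    h.poissonBracket, fun φ hφ y hy F G F₁ G₁ F₂ G₂ hF hG => h.bracket_eq hφ hy hF hG,
    fun F => ⟨fun hF => ?_, fun hF G => Subtype.ext (funext fun y => h.bracket_eq_zero F.2 G.2 hF y)⟩⟩
  · obtain ⟨F, hF, hd⟩ := h.exists_function α β ((pairingL M).flip γ)
      (SmoothPairing.dSmooth_left h.smoothPairing γ)
    exact ⟨F, hF, hd φ hφ y hy⟩
  · exact h.dependsOnThird F.2 fun G hG y => congrFun (congrArg Subtype.val (hF ⟨G, hG⟩)) y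

end Poisson

/-! ### Coordinates on the space of connections -/

section ConnectionCoordinates

variable {M : Type*} [TopologicalSpace M] [ChartedSpace R3 M] [IsManifold (𝓡 3) ∞ M]
  {L : M → Type*} [TopologicalSpace (TotalSpace ℂ L)] [∀ x, NormedAddCommGroup (L x)]
  [∀ x, InnerProductSpace ℂ (L x)] [FiberBundle ℂ L] [VectorBundle ℂ ℂ L] [VectorBundle ℝ ℂ L]
  [ContMDiffVectorBundle ∞ ℂ L (𝓡 3)]
  {EP : Type*} [NormedAddCommGroup EP] [NormedSpace ℝ EP] {HP : Type*} [TopologicalSpace HP]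
  {IP : ModelWithCorners ℝ EP HP} {P : Type*} [TopologicalSpace P] [ChartedSpace HP P] {b : P → M}

lemma SmoothAlong.smul_complex {f : P → ℂ} {s : ∀ p, L (b p)} (hs : SmoothAlong IP (𝓡 3) ℂ b s)
    (hf : ContMDiff IP 𝓘(ℝ, ℂ) ∞ f) : SmoothAlong IP (𝓡 3) ℂ b fun p => f p • s p := by
  intro p₀
  have h1 := contMDiffAt_totalSpace.1 (hs p₀)
  have hm : ContDiff ℝ ∞ fun z : ℂ × ℂ => z.1 * z.2 := contDiff_mul
  refine contMDiffAt_totalSpace.2 ⟨h1.1, (hm.contMDiff.contMDiffAt.comp p₀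
    ((hf p₀).prodMk_space h1.2)).congr_of_eventuallyEq ?_⟩
  filter_upwards [eventually_mem_baseSet (F := ℂ) (W := L) h1.1.continuousAt] with p hp
  exact ((trivializationAt ℂ L (b p₀)).linear ℂ hp).map_smul _ _

/-- The product of a section with a smooth complex function. -/
def smulComplexSection (f : M → ℂ) (hf : ContMDiff (𝓡 3) 𝓘(ℝ, ℂ) ∞ f) (σ : Cₛ^∞⟮𝓡 3; ℂ, L⟯) :
    Cₛ^∞⟮𝓡 3; ℂ, L⟯ :=
  ⟨fun x => f x • σ x, (smoothAlong_section σ contMDiff_id).smul_complex hf⟩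

variable (L) in
lemma finrank_fiber (x : M) : Module.finrank ℂ (L x) = 1 := by
  rw [((trivializationAt ℂ L x).linearEquivAt ℂ x
    (FiberBundle.mem_baseSet_trivializationAt' x)).finrank_eq, Module.finrank_self]

lemma exists_eq_smul {x : M} {s : L x} (hs : s ≠ 0) (t : L x) : ∃ c : ℂ, t = c • s := by
  obtain ⟨c, hc⟩ := (finrank_eq_one_iff_of_nonzero' s hs).1 (finrank_fiber L x) t
  exact ⟨c, hc.symm⟩

lemma norm_sq_smul_eq {x : M} (s t : L x) : (inner ℂ s s : ℂ) • t = (inner ℂ s t : ℂ) • s := by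
  by_cases hs : s = 0
  · simp [hs]
  · obtain ⟨c, rfl⟩ := exists_eq_smul hs t
    rw [inner_smul_right, smul_smul, mul_comm]

variable [T2Space M] [CompactSpace M]

variable (L) in
/-- The hermitian connection `a + i α`. -/
lemma exists_translate (a : HermitianConnection L) (α : Form1 M) :
    ∃ a' : HermitianConnection L, IsTranslate a α a' := by
  obtain ⟨ι, _, ⟨fr⟩⟩ := exists_tFrame (M := M)
  let T : Cₛ^∞⟮𝓡 3; ℂ, L⟯ → Cₛ^∞⟮𝓡 3; R3 →L[ℝ] ℂ, fun x : M => TangentSpace (𝓡 3) x →L[ℝ] L x⟯ :=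
    fun σ => ⟨fun x => (α x).smulRight (Complex.I • σ x),
      fr.smoothAlong_hom (b := id) (IP := 𝓡 3) contMDiff_id fun i =>
        ((smoothAlong_section σ contMDiff_id).smul_complex contMDiff_const).smul
          (evalSection (fr.sec i) α).contMDiff⟩
  have hT : ∀ σ x v, T σ x v = (Complex.I * (α x v : ℂ)) • σ x := fun σ x v => by
    change (α x v) • (Complex.I • σ x) = _
    rw [mul_comm, ← smul_smul, Complex.coe_smul]
  have hcov : ∀ σ x v, (a.cov σ + T σ) x v = a.cov σ x v + (Complex.I * (α x v : ℂ)) • σ x :=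
    fun σ x v => by
      rw [← hT]
      rfl
  refine ⟨⟨fun σ => a.cov σ + T σ, fun σ τ => ?_, fun f σ τ hf h x v => ?_, fun σ τ x v => ?_⟩, hcov⟩
  · refine ContMDiffSection.ext fun x => ContinuousLinearMap.ext fun v => ?_
    rw [hcov, a.add]
    change a.cov σ x v + a.cov τ x v + (Complex.I * (α x v : ℂ)) • (σ x + τ x) =
      (a.cov σ + T σ) x v + (a.cov τ + T τ) x v
    rw [hcov, hcov, smul_add]
    abel
  · rw [hcov, hcov, a.leibniz f σ τ hf h, h, smul_add, smul_smul, smul_smul, mul_comm (f x)]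
    abel
  · rw [hcov, hcov, a.hermitian, inner_add_left, inner_add_right, inner_smul_left, inner_smul_right]
    simp only [map_mul, Complex.conj_I, Complex.conj_ofReal]
    ring

/-- The difference of two connections is linear over functions. -/
lemma HermitianConnection.sub_smul (a a₀ : HermitianConnection L) {f : M → ℂ}
    (hf : ContMDiff (𝓡 3) 𝓘(ℝ, ℂ) ∞ f) {σ τ : Cₛ^∞⟮𝓡 3; ℂ, L⟯} (h : ∀ x, τ x = f x • σ x)
    (x : M) (v : TangentSpace (𝓡 3) x) :
    a.cov τ x v - a₀.cov τ x v = f x • (a.cov σ x v - a₀.cov σ x v) := by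
  rw [a.leibniz f σ τ hf h, a₀.leibniz f σ τ hf h, smul_sub]
  abel

variable [IsSmoothHermitian L]

lemma HermitianConnection.sub_eq (a a₀ : HermitianConnection L) {s : Cₛ^∞⟮𝓡 3; ℂ, L⟯} {x : M}
    (hs : s x ≠ 0) (v : TangentSpace (𝓡 3) x) :
    ∃ r : ℝ, ∀ σ : Cₛ^∞⟮𝓡 3; ℂ, L⟯, a.cov σ x v - a₀.cov σ x v = (Complex.I * (r : ℂ)) • σ x := by
  obtain ⟨μ, hμ⟩ := exists_eq_smul hs (a.cov s x v - a₀.cov s x v)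
  have h1 : ∀ σ : Cₛ^∞⟮𝓡 3; ℂ, L⟯, a.cov σ x v - a₀.cov σ x v = μ • σ x := by
    intro σ
    have hf := IsSmoothHermitian.contMDiff_inner s s
    have hg := IsSmoothHermitian.contMDiff_inner s σ
    have h2 := a.sub_smul a₀ hf (σ := σ) (τ := smulComplexSection _ hf σ) (fun x => rfl) x v
    have h3 := a.sub_smul a₀ hg (σ := s) (τ := smulComplexSection _ hf σ)
      (fun x => norm_sq_smul_eq (s x) (σ x)) x v
    rw [h2, hμ, smul_smul, mul_comm, ← smul_smul, ← norm_sq_smul_eq, smul_smul, mul_comm,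
      ← smul_smul] at h3
    exact smul_right_injective _ (inner_self_ne_zero.2 hs) h3
  have h4 : μ.re = 0 := by
    have h5 := a.hermitian s s x v
    rw [a₀.hermitian s s x v] at h5
    have h6 : inner ℂ (μ • s x) (s x) + inner ℂ (s x) (μ • s x) = (0 : ℂ) := by
      rw [← h1 s, inner_sub_left, inner_sub_right]
      linear_combination -h5
    rw [inner_smul_left, inner_smul_right, ← add_mul] at h6
    have h7 := (mul_eq_zero.1 h6).resolve_right (inner_self_ne_zero.2 hs)
    have h8 := congrArg Complex.re h7
    simp at h8
    linarith
  refine ⟨μ.im, fun σ => ?_⟩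
  rw [h1 σ]
  congr 1
  apply Complex.ext <;> simp [h4]

variable (L) in
lemma exists_sec_ne_zero {ι : Type} [Fintype ι] (fr : BundleFrame (𝓡 3) ℂ L ι) (x : M) :
    ∃ i, fr.sec i x ≠ 0 := by
  by_contra! h
  have h0 : ∀ v : L x, v = 0 := fun v => by
    rw [← fr.sum_coeff x v]
    exact Finset.sum_eq_zero fun i _ => by rw [h, smul_zero]
  have h1 := finrank_fiber L x
  have : Subsingleton (L x) := ⟨fun v w => by rw [h0 v, h0 w]⟩
  rw [Module.finrank_zero_of_subsingleton] at h1
  exact zero_ne_one h1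

/-- The hermitian metric is smooth on smooth families. -/
lemma contMDiff_inner_along {ι : Type} [Fintype ι] (fr : BundleFrame (𝓡 3) ℂ L ι)
    (σ : Cₛ^∞⟮𝓡 3; ℂ, L⟯) {s : ∀ p, L (b p)} (hs : SmoothAlong IP (𝓡 3) ℂ b s) :
    ContMDiff IP 𝓘(ℝ, ℂ) ∞ fun p => (inner ℂ (σ (b p)) (s p) : ℂ) := by
  have h1 : ∀ p, (inner ℂ (σ (b p)) (s p) : ℂ) =
      ∑ k, fr.coeff k (b p) (s p) • (inner ℂ (σ (b p)) (fr.sec k (b p)) : ℂ) := fun p => by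
    conv_lhs => rw [← fr.sum_coeff (b p) (s p), inner_sum]
    exact Finset.sum_congr rfl fun k _ => by rw [inner_smul_right_eq_smul]
  simp only [h1]
  exact contMDiff_finsetSum fun k _ => (fr.contMDiff_coeff_along k hs).smul
    ((IsSmoothHermitian.contMDiff_inner σ (fr.sec k)).comp hs.base)

/-- The affine coordinate of a connection. -/
lemma exists_connection_difference (a₀ : HermitianConnection L) :
    ∃ c : HermitianConnection L → Form1 M, DSmooth c ∧ ∀ a, IsTranslate a₀ (c a) a := by
  obtain ⟨ι, _, ⟨fr⟩⟩ := exists_bundleFrame (IB := 𝓡 3) (F := ℂ) (W := L)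
  obtain ⟨κ, _, ⟨tf⟩⟩ := exists_tFrame (M := M)
  let N : M → ℝ := fun x => ∑ j, (inner ℂ (fr.sec j x) (fr.sec j x) : ℂ).re
  have hN : ∀ x, N x ≠ 0 := fun x => by
    obtain ⟨i, hi⟩ := exists_sec_ne_zero L fr x
    refine (Finset.sum_pos' (fun j _ => inner_self_nonneg (𝕜 := ℂ)) ⟨i, Finset.mem_univ _, ?_⟩).ne'
    exact re_inner_self_pos.2 hi
  have hNs : ContMDiff (𝓡 3) 𝓘(ℝ, ℝ) ∞ N := contMDiff_finsetSum fun j _ =>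
    Complex.reCLM.contDiff.contMDiff.comp (IsSmoothHermitian.contMDiff_inner (fr.sec j) (fr.sec j))
  let C : HermitianConnection L → ∀ x : M, TangentSpace (𝓡 3) x →L[ℝ] ℝ := fun a x =>
    (N x)⁻¹ • ∑ j, Complex.imCLM ∘L ((innerSL ℂ (fr.sec j x)).restrictScalars ℝ) ∘L
      (a.cov (fr.sec j) x - a₀.cov (fr.sec j) x)
  have hC : ∀ a x v, C a x v = (N x)⁻¹ * ∑ j,
      (inner ℂ (fr.sec j x) (a.cov (fr.sec j) x v - a₀.cov (fr.sec j) x v) : ℂ).im := fun a x v => by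
    simp only [C, smul_apply, sum_apply, smul_eq_mul]
    rfl
  have hsm : ∀ {n : ℕ} {p : 𝔼 n → HermitianConnection L}, IsPlot p →
      SmoothAlong (W := fun x : M => TangentSpace (𝓡 3) x →L[ℝ] ℝ)
        (𝓘(ℝ, 𝔼 n).prod (𝓡 3)) (𝓡 3) (R3 →L[ℝ] ℝ)
        (fun z : 𝔼 n × M => z.2) fun z => C (p z.1) z.2 := by
    intro n p hp
    refine tf.smoothAlong_form contMDiff_snd fun i => ?_
    simp only [hC]
    refine ((hNs.comp contMDiff_snd).inv₀ fun z => hN _).mul (contMDiff_finsetSum fun j _ =>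
      Complex.imCLM.contDiff.contMDiff.comp (contMDiff_inner_along fr _ (SmoothAlong.sub ?_ ?_)))
    · exact SmoothAlong.clm_apply (isPlot_section_iff.1 (hp (fr.sec j)))
        (smoothAlong_section (tf.sec i) contMDiff_snd)
    · exact SmoothAlong.clm_apply (smoothAlong_section (a₀.cov (fr.sec j)) contMDiff_snd)
        (smoothAlong_section (tf.sec i) contMDiff_snd)
  refine ⟨fun a => ⟨C a, ?_⟩, fun n p hp => isPlot_section_iff.2 (hsm hp), fun a σ x v => ?_⟩
  · have h1 := (hsm (p := fun _ : EuclideanSpace ℝ (Fin 0) => a) isPlot_const).comp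
      (f := fun x : M => ((0 : EuclideanSpace ℝ (Fin 0)), x))
      (contMDiff_const.prodMk contMDiff_id)
    exact h1
  · obtain ⟨i, hi⟩ := exists_sec_ne_zero L fr x
    obtain ⟨r, hr⟩ := a.sub_eq a₀ hi v
    have h1 : C a x v = r := by
      rw [hC]
      have h2 : ∀ j, (inner ℂ (fr.sec j x) (a.cov (fr.sec j) x v - a₀.cov (fr.sec j) x v) : ℂ).im =
          (inner ℂ (fr.sec j x) (fr.sec j x) : ℂ).re * r := fun j => by
        rw [hr, inner_smul_right, Complex.mul_im]
        have h3 : (inner ℂ (fr.sec j x) (fr.sec j x) : ℂ).im = 0 := inner_self_im (𝕜 := ℂ) _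
        rw [h3]
        simp [mul_comm]
      simp only [h2, ← Finset.sum_mul]
      rw [← mul_assoc, inv_mul_cancel₀ (hN x), one_mul]
    change _ = _ + (Complex.I * ((C a x v : ℝ) : ℂ)) • σ x
    rw [h1, ← hr σ]
    abel

lemma IsTranslate.eq {a a₁ a₂ : HermitianConnection L} {α : Form1 M} (h₁ : IsTranslate a α a₁)
    (h₂ : IsTranslate a α a₂) : a₁ = a₂ :=
  HermitianConnection.ext <| funext fun σ => ContMDiffSection.ext fun x =>
    ContinuousLinearMap.ext fun v => by rw [h₁, h₂]

/-- The space of connections is an affine space over the 1-forms. -/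
theorem exists_connection_coordinate (a₀ : HermitianConnection L) :
    ∃ e : HermitianConnection L ≃ Form1 M, DSmooth e ∧ DSmooth e.symm ∧
      ∀ a a', IsTranslate a (e a' - e a) a' := by
  obtain ⟨c, hc, h⟩ := exists_connection_difference a₀
  choose t ht using exists_translate L a₀
  obtain ⟨ι, _, ⟨fr⟩⟩ := exists_bundleFrame (IB := 𝓡 3) (F := ℂ) (W := L)
  have htr : ∀ a a', IsTranslate a (c a' - c a) a' := fun a a' σ x v => by
    change _ = _ + (Complex.I * ((c a' x v - c a x v : ℝ) : ℂ)) • σ x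
    rw [h a, h a']
    push_cast
    rw [mul_sub, sub_smul]
    abel
  refine ⟨⟨c, t, fun a => (ht _).eq (h a), fun α => ContMDiffSection.ext fun x =>
    ContinuousLinearMap.ext fun v => ?_⟩, hc, fun n p hp σ => ?_, htr⟩
  · obtain ⟨i, hi⟩ := exists_sec_ne_zero L fr x
    have h1 := (h (t α) (fr.sec i) x v).symm.trans (ht α (fr.sec i) x v)
    have h2 := smul_left_injective ℂ hi (add_left_cancel h1)
    exact_mod_cast mul_left_cancel₀ Complex.I_ne_zero h2
  · obtain ⟨κ, _, ⟨tf⟩⟩ := exists_tFrame (M := M)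
    refine isPlot_section_iff.2 (tf.smoothAlong_hom contMDiff_snd fun i => ?_)
    have h1 : ∀ z : 𝔼 n × M, (t (p z.1)).cov σ z.2 (tf.sec i z.2) =
        a₀.cov σ z.2 (tf.sec i z.2) + (p z.1 z.2 (tf.sec i z.2)) • (Complex.I • σ z.2) := fun z => by
      rw [ht, mul_comm, ← smul_smul, Complex.coe_smul]
    refine SmoothAlong.congr (SmoothAlong.add (SmoothAlong.clm_apply
      (smoothAlong_section (a₀.cov σ) contMDiff_snd) (smoothAlong_section (tf.sec i) contMDiff_snd))
      (SmoothAlong.smul ((smoothAlong_section σ contMDiff_snd).smul_complex contMDiff_const)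
        (SmoothAlong.clm_apply_real (isPlot_section_iff.1 hp)
          (smoothAlong_section (tf.sec i) contMDiff_snd)))) h1

end ConnectionCoordinates

/-! ### Smooth families on `M` and on `M × S¹` -/

section Families

variable {M : Type*} [TopologicalSpace M] [ChartedSpace R3 M] [IsManifold (𝓡 3) ∞ M]
  {EP : Type*} [NormedAddCommGroup EP] [NormedSpace ℝ EP] {HP : Type*} [TopologicalSpace HP]
  (IP : ModelWithCorners ℝ EP HP) {P : Type*} [TopologicalSpace P] [ChartedSpace HP P]

/-- Smooth families of tangent vectors of `M`. -/
abbrev SmoothVec (f : P → M) (s : ∀ p, TangentSpace (𝓡 3) (f p)) : Prop :=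
  SmoothAlong (W := fun x : M => TangentSpace (𝓡 3) x) IP (𝓡 3) R3 f s

/-- Smooth families of linear forms on `M`. -/
abbrev SmoothForm (f : P → M) (s : ∀ p, TangentSpace (𝓡 3) (f p) →L[ℝ] ℝ) : Prop :=
  SmoothAlong (W := fun x : M => TangentSpace (𝓡 3) x →L[ℝ] ℝ) IP (𝓡 3) (R3 →L[ℝ] ℝ) f s

/-- Smooth families of endomorphisms on `M`. -/
abbrev SmoothEnd (f : P → M)
    (s : ∀ p, TangentSpace (𝓡 3) (f p) →L[ℝ] TangentSpace (𝓡 3) (f p)) : Prop :=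
  SmoothAlong (W := fun x : M => TangentSpace (𝓡 3) x →L[ℝ] TangentSpace (𝓡 3) x) IP (𝓡 3)
    (R3 →L[ℝ] R3) f s

/-- Smooth families of bilinear forms on `M`. -/
abbrev SmoothBilin (f : P → M)
    (s : ∀ p, TangentSpace (𝓡 3) (f p) →L[ℝ] TangentSpace (𝓡 3) (f p) →L[ℝ] ℝ) : Prop :=
  SmoothAlong (W := fun x : M => TangentSpace (𝓡 3) x →L[ℝ] TangentSpace (𝓡 3) x →L[ℝ] ℝ) IP (𝓡 3)
    (R3 →L[ℝ] R3 →L[ℝ] ℝ) f s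

/-- Smooth families of tangent vectors of `M × S¹`. -/
abbrev SmoothVecX (f : P → M × Circle) (s : ∀ p, TX M (f p)) : Prop :=
  SmoothAlong (W := fun q : M × Circle => TX M q) IP IX EX f s

/-- Smooth families of endomorphisms on `M × S¹`. -/
abbrev SmoothEndX (f : P → M × Circle) (s : ∀ p, TX M (f p) →L[ℝ] TX M (f p)) : Prop :=
  SmoothAlong (W := fun q : M × Circle => TX M q →L[ℝ] TX M q) IP IX (EX →L[ℝ] EX) f s

/-- Smooth families of bilinear forms on `M × S¹`. -/
abbrev SmoothBilinX (f : P → M × Circle) (s : ∀ p, TX M (f p) →L[ℝ] TX M (f p) →L[ℝ] ℝ) : Prop :=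
  SmoothAlong (W := fun q : M × Circle => TX M q →L[ℝ] TX M q →L[ℝ] ℝ) IP IX
    (EX →L[ℝ] EX →L[ℝ] ℝ) f s

end Families

/-! ### The tangent bundle of `M × S¹` -/

section CircleField

/-- The rotation field on the circle. -/
def circleField (z : Circle) : TangentSpace (𝓡 1) z :=
  mfderiv (𝓡 1) (𝓡 1) (fun w : Circle => z * w) 1 (EuclideanSpace.single 0 (1 : ℝ))

lemma contMDiff_circle_mul : ContMDiff ((𝓡 1).prod (𝓡 1)) (𝓡 1) ∞
    fun p : Circle × Circle => p.1 * p.2 :=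
  (contMDiff_mul (𝓡 1) ω).of_le le_top

lemma mdifferentiableAt_circle_mul_left (c z : Circle) :
    MDifferentiableAt (𝓡 1) (𝓡 1) (fun w : Circle => c * w) z :=
  ((contMDiff_mul_left (I := 𝓡 1) (n := ω) (a := c)).mdifferentiable (by simp)) z

lemma mfderiv_mul_circleField (c z : Circle) :
    mfderiv (𝓡 1) (𝓡 1) (fun w : Circle => c * w) z (circleField z) = circleField (c * z) := by
  have h1 : (fun w : Circle => c * z * w) = (fun w => c * w) ∘ fun w => z * w := by
    funext w
    simp [mul_assoc]
  have h3 : mfderiv (𝓡 1) (𝓡 1) (fun w : Circle => c * z * w) 1 =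
      (mfderiv (𝓡 1) (𝓡 1) (fun w : Circle => c * w) (z * 1)).comp
        (mfderiv (𝓡 1) (𝓡 1) (fun w : Circle => z * w) 1) := by
    rw [h1]
    exact mfderiv_comp (1 : Circle) (mdifferentiableAt_circle_mul_left c (z * 1))
      (mdifferentiableAt_circle_mul_left z 1)
  have h4 : mfderiv (𝓡 1) (𝓡 1) (fun w : Circle => c * w) z =
    mfderiv (𝓡 1) (𝓡 1) (fun w : Circle => c * w) (z * 1) := by rw [mul_one]
  unfold circleField
  rw [h3]
  exact congrArg (fun T : EuclideanSpace ℝ (Fin 1) →L[ℝ] EuclideanSpace ℝ (Fin 1) =>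
    T (mfderiv (𝓡 1) (𝓡 1) (fun w : Circle => z * w) 1 (EuclideanSpace.single 0 (1 : ℝ)))) h4

lemma circleField_one : circleField 1 = (EuclideanSpace.single (0 : Fin 1) (1 : ℝ) : EuclideanSpace ℝ (Fin 1)) := by
  have h1 : (fun w : Circle => 1 * w) = id := by
    funext w
    simp
  unfold circleField
  rw [h1, mfderiv_id]
  rfl

lemma circleField_ne_zero (z : Circle) : circleField z ≠ 0 := by
  intro h
  have h1 := mfderiv_mul_circleField z⁻¹ z
  rw [h, map_zero] at h1
  have h2 : ∀ w : Circle, w = 1 → circleField w = (0 : EuclideanSpace ℝ (Fin 1)) → False := by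
    rintro _ rfl h3
    have h4 : (EuclideanSpace.single (0 : Fin 1) (1 : ℝ) : EuclideanSpace ℝ (Fin 1)) = 0 :=
      circleField_one.symm.trans h3
    simpa using congrArg (fun v : EuclideanSpace ℝ (Fin 1) => v 0) h4
  exact h2 (z⁻¹ * z) (inv_mul_cancel z) h1.symm

lemma circleField_apply_ne_zero (z : Circle) :
    (show EuclideanSpace ℝ (Fin 1) from circleField z) 0 ≠ 0 := fun h =>
  circleField_ne_zero z (PiLp.ext fun i => by
    rw [Subsingleton.elim i 0]
    exact h)

end CircleField

section ProductTangent

variable {M : Type*} [TopologicalSpace M] [ChartedSpace R3 M]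

/-- The projection to the tangent spaces of `M`. -/
def txFst (q : M × Circle) : TX M q →L[ℝ] TangentSpace (𝓡 3) q.1 :=
  ContinuousLinearMap.fst ℝ R3 (EuclideanSpace ℝ (Fin 1))

/-- The inclusion of the tangent spaces of `M`. -/
def txLift (q : M × Circle) : TangentSpace (𝓡 3) q.1 →L[ℝ] TX M q :=
  ContinuousLinearMap.inl ℝ R3 (EuclideanSpace ℝ (Fin 1))

/-- The rotation field. -/
def vert (q : M × Circle) : TX M q := ((0 : R3), circleField q.2)

/-- The 1-form `dθ`. -/
def dTheta (q : M × Circle) : TX M q →L[ℝ] ℝ :=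
  ((show EuclideanSpace ℝ (Fin 1) from circleField q.2) 0)⁻¹ •
    (EuclideanSpace.proj (𝕜 := ℝ) (0 : Fin 1) ∘L
      ContinuousLinearMap.snd ℝ R3 (EuclideanSpace ℝ (Fin 1)))

lemma txFst_lift (q : M × Circle) (w : TangentSpace (𝓡 3) q.1) : txFst q (txLift q w) = w := rfl

lemma txFst_vert (q : M × Circle) : txFst q (vert q) = 0 := rfl

lemma dTheta_lift (q : M × Circle) (w : TangentSpace (𝓡 3) q.1) : dTheta q (txLift q w) = 0 := by
  change _ * (0 : ℝ) = 0
  simp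

lemma dTheta_vert (q : M × Circle) : dTheta q (vert q) = 1 :=
  inv_mul_cancel₀ (circleField_apply_ne_zero q.2)

lemma dTheta_smul_circleField (q : M × Circle) (v : TX M q) :
    dTheta q v • circleField q.2 = (show R3 × EuclideanSpace ℝ (Fin 1) from v).2 := by
  refine PiLp.ext fun i => ?_
  rw [Subsingleton.elim i 0]
  have h := circleField_apply_ne_zero q.2
  change ((show EuclideanSpace ℝ (Fin 1) from circleField q.2) 0)⁻¹ *
    (show R3 × EuclideanSpace ℝ (Fin 1) from v).2 0 *
      (show EuclideanSpace ℝ (Fin 1) from circleField q.2) 0 = _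
  rw [mul_right_comm, inv_mul_cancel₀ h, one_mul]

lemma tx_decomp (q : M × Circle) (v : TX M q) :
    v = txLift q (txFst q v) + dTheta q v • vert q := by
  refine Prod.ext ?_ ?_
  · change _ = (show R3 from txFst q v) + dTheta q v • (0 : R3)
    rw [smul_zero, add_zero]
    rfl
  · change _ = (0 : EuclideanSpace ℝ (Fin 1)) + dTheta q v • (show EuclideanSpace ℝ (Fin 1) from circleField q.2)
    rw [zero_add]
    exact (dTheta_smul_circleField q v).symm

variable [IsManifold (𝓡 3) ∞ M]

lemma mfderiv_rotate (c : Circle) (q : M × Circle) (v : TX M q) :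
    mfderiv IX IX (rotate c) q v =
      txLift (rotate c q) (txFst q v) + dTheta q v • vert (rotate c q) := by
  have h0 : (rotate c : M × Circle → M × Circle) = Prod.map id (fun w => c * w) := rfl
  have h1 : mfderiv IX IX (rotate c) q = (mfderiv (𝓡 3) (𝓡 3) (id : M → M) q.1).prodMap
      (mfderiv (𝓡 1) (𝓡 1) (fun w => c * w) q.2) := by
    rw [h0]
    exact mfderiv_prodMap mdifferentiableAt_id (mdifferentiableAt_circle_mul_left c q.2)
  rw [h1, mfderiv_id]
  refine Prod.ext ?_ ?_
  · change _ = (show R3 from txFst q v) + dTheta q v • (0 : R3)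
    rw [smul_zero, add_zero]
    rfl
  · change _ = (0 : EuclideanSpace ℝ (Fin 1)) +
      dTheta q v • (show EuclideanSpace ℝ (Fin 1) from circleField (c * q.2))
    rw [zero_add, ← mfderiv_mul_circleField]
    refine Eq.trans ?_ (map_smul (mfderiv (𝓡 1) (𝓡 1) (fun w : Circle => c * w) q.2)
      (dTheta q v) (circleField q.2))
    rw [dTheta_smul_circleField]
    rfl

lemma txFst_mfderiv_rotate (c : Circle) (q : M × Circle) (v : TX M q) :
    txFst (rotate c q) (mfderiv IX IX (rotate c) q v) = txFst q v := by
  rw [mfderiv_rotate, map_add, map_smul, txFst_vert, smul_zero, add_zero]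
  exact txFst_lift (rotate c q) _

lemma dTheta_mfderiv_rotate (c : Circle) (q : M × Circle) (v : TX M q) :
    dTheta (rotate c q) (mfderiv IX IX (rotate c) q v) = dTheta q v := by
  rw [mfderiv_rotate, map_add, map_smul, dTheta_vert, smul_eq_mul, mul_one]
  refine (congrArg (· + _) (dTheta_lift (rotate c q) _)).trans (zero_add _)

/-! ### Smoothness -/

variable {EP : Type*} [NormedAddCommGroup EP] [NormedSpace ℝ EP] {HP : Type*} [TopologicalSpace HP]
  {IP : ModelWithCorners ℝ EP HP} {P : Type*} [TopologicalSpace P] [ChartedSpace HP P]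
  {b : P → M × Circle}

lemma SmoothAlong.tx_prod {s : ∀ p, TangentSpace (𝓡 3) (b p).1}
    {r : ∀ p, TangentSpace (𝓡 1) (b p).2}
    (hs : SmoothVec IP (fun p => (b p).1) s)
    (hr : SmoothAlong (W := fun x : Circle => TangentSpace (𝓡 1) x) IP (𝓡 1)
      (EuclideanSpace ℝ (Fin 1)) (fun p => (b p).2) r) :
    SmoothVecX IP b
      fun p => (show TX M (b p) from (s p, r p)) := by
  have : IsManifold (𝓡 3) 1 M := .of_le (n := ∞) (by exact_mod_cast le_top)
  have h1 := (contMDiff_equivTangentBundleProd_symm (n := ∞) (I := 𝓡 3) (M := M) (I' := 𝓡 1)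
    (M' := Circle)).comp (ContMDiff.prodMk hs hr)
  exact h1

lemma SmoothAlong.tx_fst {v : ∀ p, TX M (b p)}
    (hv : SmoothVecX IP b v) :
    SmoothVec IP (fun p => (b p).1)
      fun p => txFst (b p) (v p) := by
  have : IsManifold (𝓡 3) 1 M := .of_le (n := ∞) (by exact_mod_cast le_top)
  have h1 := (contMDiff_equivTangentBundleProd (n := ∞) (I := 𝓡 3) (M := M) (I' := 𝓡 1)
    (M' := Circle)).comp hv
  exact contMDiff_fst.comp h1

lemma SmoothAlong.tx_snd {v : ∀ p, TX M (b p)}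
    (hv : SmoothVecX IP b v) :
    SmoothAlong (W := fun x : Circle => TangentSpace (𝓡 1) x) IP (𝓡 1) (EuclideanSpace ℝ (Fin 1))
      (fun p => (b p).2) fun p => (show R3 × EuclideanSpace ℝ (Fin 1) from v p).2 := by
  have : IsManifold (𝓡 3) 1 M := .of_le (n := ∞) (by exact_mod_cast le_top)
  have h1 := (contMDiff_equivTangentBundleProd (n := ∞) (I := 𝓡 3) (M := M) (I' := 𝓡 1)
    (M' := Circle)).comp hv
  exact contMDiff_snd.comp h1

lemma smoothAlong_circleField {b : P → Circle} (hb : ContMDiff IP (𝓡 1) ∞ b) :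
    SmoothAlong (W := fun x : Circle => TangentSpace (𝓡 1) x) IP (𝓡 1) (EuclideanSpace ℝ (Fin 1))
      b fun p => circleField (b p) := by
  have h0 : ContMDiff (𝓡 1) ((𝓡 1).prod 𝓘(ℝ, EuclideanSpace ℝ (Fin 1))) ∞
      fun z : Circle => (⟨z, circleField z⟩ : TangentBundle (𝓡 1) Circle) := by
    have h1 : ContMDiff (𝓡 1) ((𝓡 1).prod 𝓘(ℝ, EuclideanSpace ℝ (Fin 1))) ∞
        fun z : Circle => (⟨z, 0⟩ : TangentBundle (𝓡 1) Circle) :=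
      contMDiff_zeroSection ℝ (fun x : Circle => TangentSpace (𝓡 1) x)
    have h2 : ContMDiff (𝓡 1) ((𝓡 1).prod 𝓘(ℝ, EuclideanSpace ℝ (Fin 1))) ∞
        fun _ : Circle => (⟨1, (EuclideanSpace.single 0 (1 : ℝ) : EuclideanSpace ℝ (Fin 1))⟩ :
          TangentBundle (𝓡 1) Circle) := contMDiff_const
    have h3 := (contMDiff_circle_mul.contMDiff_tangentMap (m := ∞) le_rfl).comp
      ((contMDiff_equivTangentBundleProd_symm (n := ∞) (I := 𝓡 1) (M := Circle) (I' := 𝓡 1)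
        (M' := Circle)).comp (h1.prodMk h2))
    refine h3.congr fun z => ?_
    have h4 : mfderiv ((𝓡 1).prod (𝓡 1)) (𝓡 1) (fun p : Circle × Circle => p.1 * p.2) (z, 1)
        ((0 : EuclideanSpace ℝ (Fin 1)), (EuclideanSpace.single (0 : Fin 1) (1 : ℝ) :
          EuclideanSpace ℝ (Fin 1))) = circleField z := by
      refine (mfderiv_prod_eq_add_apply
        ((contMDiff_circle_mul.mdifferentiable (by simp)) (z, 1))).trans ?_
      refine (congrArg (· + _) (map_zero _)).trans ?_
      exact zero_add _
    change (⟨z, circleField z⟩ : TangentBundle (𝓡 1) Circle) = ⟨z * 1, _⟩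
    rw [mul_one]
    exact congrArg _ h4.symm
  exact h0.comp hb

lemma smoothAlong_vert (hb : ContMDiff IP IX ∞ b) :
    SmoothVecX IP b fun p => vert (b p) :=
  SmoothAlong.tx_prod (SmoothAlong.zero (contMDiff_fst.comp hb))
    (smoothAlong_circleField (contMDiff_snd.comp hb))

lemma smoothAlong_lift (hb : ContMDiff IP IX ∞ b) {s : ∀ p, TangentSpace (𝓡 3) (b p).1}
    (hs : SmoothVec IP (fun p => (b p).1) s) :
    SmoothVecX IP b fun p => txLift (b p) (s p) :=
  SmoothAlong.tx_prod hs (SmoothAlong.zero (contMDiff_snd.comp hb))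

lemma SmoothAlong.contMDiff_dTheta {v : ∀ p, TX M (b p)}
    (hv : SmoothVecX IP b v) :
    ContMDiff IP 𝓘(ℝ, ℝ) ∞ fun p => dTheta (b p) (v p) := by
  have hb : ContMDiff IP (𝓡 1) ∞ fun p => (b p).2 := contMDiff_snd.comp hv.base
  obtain ⟨ι, _, ⟨fr⟩⟩ := exists_bundleFrame (IB := 𝓡 1) (F := ℝ) (W := Bundle.Trivial Circle ℝ)
  let Φ : ∀ p, Bundle.Trivial Circle ℝ (b p).2 →L[ℝ] TangentSpace (𝓡 1) (b p).2 := fun p =>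
    ContinuousLinearMap.smulRight (ContinuousLinearMap.id ℝ ℝ) (circleField (b p).2)
  have hΦ : SmoothAlong (W := fun z : Circle => Bundle.Trivial Circle ℝ z →L[ℝ]
      TangentSpace (𝓡 1) z) IP (𝓡 1) (ℝ →L[ℝ] EuclideanSpace ℝ (Fin 1)) (fun p => (b p).2) Φ :=
    fr.smoothAlong_hom (W' := fun z : Circle => TangentSpace (𝓡 1) z) hb fun i =>
      (smoothAlong_circleField hb).smul
        (smoothAlong_trivial_iff.1 (smoothAlong_section (fr.sec i) hb)).2
  refine (smoothAlong_trivial_iff.1 (SmoothAlong.solve (W := Bundle.Trivial Circle ℝ) hΦ hv.tx_snd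
    (fun p => dTheta_smul_circleField (b p) (v p)) fun p => ⟨fun r s h => ?_, fun w => ?_⟩)).2
  · exact smul_left_injective ℝ (circleField_ne_zero (b p).2) h
  · exact ⟨dTheta (b p) (show TX M (b p) from ((0 : R3), w)), dTheta_smul_circleField (b p) _⟩

end ProductTangent

/-! ### Skew endomorphisms of a Euclidean 3-space -/

section LinearAlgebra

variable {V : Type*} [AddCommGroup V] [Module ℝ V] [TopologicalSpace V]

/-- An inner product on a real vector space. -/
structure IsInner (h : V →L[ℝ] V →L[ℝ] ℝ) : Prop where
  symm : ∀ u v, h u v = h v u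
  pos : ∀ u, u ≠ 0 → 0 < h u u

namespace IsInner

variable {h : V →L[ℝ] V →L[ℝ] ℝ}

lemma eq_zero (hh : IsInner h) {u : V} (hu : h u u = 0) : u = 0 := by
  by_contra h0
  exact (hh.pos u h0).ne' hu

lemma nonneg (hh : IsInner h) (u : V) : 0 ≤ h u u := by
  by_cases h0 : u = 0
  · simp [h0]
  · exact (hh.pos u h0).le

lemma eq_of_forall (hh : IsInner h) {u v : V} (huv : ∀ w, h u w = h v w) : u = v := by
  have h1 : h (u - v) (u - v) = 0 := by
    rw [h.map_sub, sub_apply, huv, sub_self]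
  exact sub_eq_zero.1 (hh.eq_zero h1)

/-- A vector orthogonal to three orthogonal vectors of a 3-space vanishes. -/
lemma eq_zero_of_orthogonal (hh : IsInner h) (hV : Module.finrank ℝ V = 3) {a b c w : V}
    (ha : a ≠ 0) (hb : b ≠ 0)
    (hc : c ≠ 0) (hab : h a b = 0) (hac : h a c = 0) (hbc : h b c = 0) (hwa : h w a = 0)
    (hwb : h w b = 0) (hwc : h w c = 0) : w = 0 := by
  by_contra hw
  have : FiniteDimensional ℝ V := .of_finrank_pos (by omega)
  have hli : LinearIndependent ℝ ![a, b, c, w] := by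
    rw [Fintype.linearIndependent_iff]
    intro g hg
    rw [Fin.sum_univ_four] at hg
    have hg' : ∀ u, g 0 * h u a + g 1 * h u b + g 2 * h u c + g 3 * h u w = 0 := fun u => by
      simpa using congrArg (h u) hg
    have e0 := hg' a
    have e1 := hg' b
    have e2 := hg' c
    have e3 := hg' w
    rw [hab, hac, hh.symm a w, hwa] at e0
    rw [hh.symm b a, hab, hbc, hh.symm b w, hwb] at e1
    rw [hh.symm c a, hac, hh.symm c b, hbc, hh.symm c w, hwc] at e2
    rw [hwa, hwb, hwc] at e3
    have p0 := (hh.pos a ha).ne'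
    have p1 := (hh.pos b hb).ne'
    have p2 := (hh.pos c hc).ne'
    have p3 := (hh.pos w hw).ne'
    simp only [mul_zero, add_zero, zero_add, mul_eq_zero, p0, p1, p2, p3, or_false] at e0 e1 e2 e3
    intro i
    fin_cases i <;> assumption
  have := hli.fintype_card_le_finrank
  simp [hV] at this

/-- A plane with a rotation, spanned by `e` and `A e`. -/
lemma exists_plane (hh : IsInner h) (hV : Module.finrank ℝ V = 3) {A : V →L[ℝ] V}
    (hA : ∀ u, h (A u) u = 0) {Y : V}
    (hY : Y ≠ 0) (hAY : A Y = 0) (hA0 : A ≠ 0) :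
    ∃ e, 0 < h e e ∧ 0 < h (A e) (A e) ∧
      (∀ v, ∃ a b : ℝ, v = (h v Y / h Y Y) • Y + a • e + b • A e) ∧
      ∀ K : V →L[ℝ] V, (∀ u, h (K u) u = 0) → K Y = 0 →
        K e = (h (K e) (A e) / h (A e) (A e)) • A e ∧
          K (A e) = -(h (K e) (A e) / h e e) • e := by
  have hskew : ∀ K : V →L[ℝ] V, (∀ u, h (K u) u = 0) → ∀ u v, h (K u) v = - h (K v) u := by
    intro K hK u v
    have h1 := hK (u + v)
    simp only [map_add, add_apply, hK] at h1
    linarith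
  obtain ⟨u, hu⟩ : ∃ u, A u ≠ 0 := by
    by_contra! h0
    exact hA0 (ContinuousLinearMap.ext h0)
  have hp := (hh.pos Y hY).ne'
  set e := u - (h u Y / h Y Y) • Y with he
  have hAe : A e = A u := by simp [he, hAY]
  have heY : h e Y = 0 := by
    simp [he, hp]
  have hAe0 : A e ≠ 0 := hAe ▸ hu
  have he0 : e ≠ 0 := fun h0 => hAe0 (by rw [h0, map_zero])
  have hKY : ∀ K : V →L[ℝ] V, (∀ u, h (K u) u = 0) → K Y = 0 → ∀ u, h (K u) Y = 0 := by
    intro K hK h0 u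
    rw [hskew K hK, h0]
    simp
  have hAeY := hKY A hA hAY e
  have hYe : h Y e = 0 := by rw [hh.symm, heY]
  have hYAe : h Y (A e) = 0 := by rw [hh.symm, hAeY]
  have heAe : h e (A e) = 0 := by rw [hh.symm, hA]
  have pe := hh.pos e he0
  have pA := hh.pos _ hAe0
  have key : ∀ w, h w Y = 0 → h w e = 0 → h w (A e) = 0 → w = 0 := fun w h1 h2 h3 =>
    hh.eq_zero_of_orthogonal hV hY he0 hAe0 hYe hYAe heAe h1 h2 h3
  refine ⟨e, pe, pA, fun v => ⟨h v e / h e e, h v (A e) / h (A e) (A e), ?_⟩, fun K hK h0 => ⟨?_, ?_⟩⟩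
  · rw [← sub_eq_zero]
    refine key _ ?_ ?_ ?_ <;> simp [hp, pe.ne', pA.ne', hAeY, hYe, hYAe, heAe, heY, hA]
  · rw [← sub_eq_zero]
    refine key _ ?_ ?_ ?_ <;> simp [pA.ne', hAeY, hA, hKY K hK h0, hK]
  · rw [← sub_eq_zero]
    refine key _ ?_ ?_ ?_
    · simp [hKY K hK h0, heY]
    · rw [h.map_sub, sub_apply, hskew K hK]
      simp [pe.ne']
    · simp [hK, heAe]

/-- The square of a skew endomorphism with kernel `Y`. -/
lemma exists_sq_eq (hh : IsInner h) (hV : Module.finrank ℝ V = 3) {A : V →L[ℝ] V}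
    (hA : ∀ u, h (A u) u = 0) {Y : V}
    (hY : Y ≠ 0) (hAY : A Y = 0) (hA0 : A ≠ 0) :
    ∃ k : ℝ, 0 < k ∧ ∀ v, A (A v) = k • ((h v Y / h Y Y) • Y - v) := by
  obtain ⟨e, pe, pA, hspan, hK⟩ := hh.exists_plane hV hA hY hAY hA0
  have h2 := (hK A hA hAY).2
  refine ⟨h (A e) (A e) / h e e, by positivity, fun v => ?_⟩
  obtain ⟨a, b, hv⟩ := hspan v
  set s := h v Y / h Y Y
  have h3 : s • Y - v = -(a • e + b • A e) := by
    rw [hv]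
    abel
  rw [h3]
  conv_lhs => rw [hv]
  simp only [map_add, map_smul, hAY, h2, smul_zero, zero_add]
  module

/-- Skew endomorphisms with kernel `Y` are proportional. -/
lemma exists_eq_smul (hh : IsInner h) (hV : Module.finrank ℝ V = 3) {A : V →L[ℝ] V}
    (hA : ∀ u, h (A u) u = 0) {Y : V}
    (hY : Y ≠ 0) (hAY : A Y = 0) (hA0 : A ≠ 0) {K : V →L[ℝ] V} (hK : ∀ u, h (K u) u = 0)
    (hKY : K Y = 0) : ∃ c : ℝ, ∀ v, K v = c • A v := by
  obtain ⟨e, pe, pA, hspan, hK'⟩ := hh.exists_plane hV hA hY hAY hA0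
  have h1 := (hK' A hA hAY).2
  obtain ⟨h2, h3⟩ := hK' K hK hKY
  refine ⟨h (K e) (A e) / h (A e) (A e), fun v => ?_⟩
  obtain ⟨a, b, hv⟩ := hspan v
  set s := h v Y / h Y Y
  set m := h (K e) (A e)
  rw [hv]
  simp only [map_add, map_smul, hAY, hKY, h1, h2, h3, smul_zero, zero_add, smul_add, smul_smul]
  congr 2
  · ring
  · field_simp

end IsInner

end LinearAlgebra

/-! ### Hermitian structures on a 3-space plus a line -/

section Hermitian

variable {T V : Type*} [AddCommGroup T] [Module ℝ T] [TopologicalSpace T] [IsTopologicalAddGroup T]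
  [ContinuousSMul ℝ T] [AddCommGroup V] [Module ℝ V] [TopologicalSpace V] [IsTopologicalAddGroup V]
  [ContinuousSMul ℝ V]

variable (T V) in
/-- A splitting `T = V ⊕ ℝ`. -/
structure LineSplitting where
  /-- The projection to `V`. -/
  fst : T →L[ℝ] V
  /-- The inclusion of `V`. -/
  lift : V →L[ℝ] T
  /-- The coordinate on the line. -/
  theta : T →L[ℝ] ℝ
  /-- The generator of the line. -/
  vert : T
  fst_lift : ∀ w, fst (lift w) = w
  fst_vert : fst vert = 0
  theta_lift : ∀ w, theta (lift w) = 0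
  theta_vert : theta vert = 1
  decomp : ∀ v, v = lift (fst v) + theta v • vert

/-- Rotation by a right angle about the axis `Y`. -/
structure IsRotation (h : V →L[ℝ] V →L[ℝ] ℝ) (Y : V) (K : V →L[ℝ] V) : Prop where
  skew : ∀ u, h (K u) u = 0
  apply_axis : K Y = 0
  sq : ∀ u, K (K u) = (h u Y / h Y Y) • Y - u

lemma IsRotation.skew' {h : V →L[ℝ] V →L[ℝ] ℝ} {Y : V} {K : V →L[ℝ] V} (hK : IsRotation h Y K)
    (u v : V) : h (K u) v = - h (K v) u := by
  have h1 := hK.skew (u + v)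
  simp only [map_add, add_apply, hK.skew] at h1
  linarith

namespace LineSplitting

variable (S : LineSplitting T V)

/-- The connection form. -/
def tau (η : V →L[ℝ] ℝ) : T →L[ℝ] ℝ := S.theta + η ∘L S.fst

/-- The metric with horizontal part `h`, connection form `η` and fibres of length `|Y|`. -/
def metricOf (h : V →L[ℝ] V →L[ℝ] ℝ) (η : V →L[ℝ] ℝ) (Y : V) : T →L[ℝ] T →L[ℝ] ℝ :=
  ContinuousLinearMap.precomp ℝ S.fst ∘L h ∘L S.fst + h Y Y • (S.tau η).smulRight (S.tau η)

/-- The horizontal part of the complex structure. -/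
def jFst (η : V →L[ℝ] ℝ) (Y : V) (K : V →L[ℝ] V) : T →L[ℝ] V :=
  (S.tau η).smulRight Y + K ∘L S.fst

/-- The complex structure taking the fibre direction to the lift of `Y`. -/
def jOf (h : V →L[ℝ] V →L[ℝ] ℝ) (η : V →L[ℝ] ℝ) (Y : V) (K : V →L[ℝ] V) : T →L[ℝ] T :=
  S.lift ∘L S.jFst η Y K +
    (-((h Y Y)⁻¹ • (h Y ∘L S.fst)) - η ∘L S.jFst η Y K).smulRight S.vert

variable {S} {h : V →L[ℝ] V →L[ℝ] ℝ} {η : V →L[ℝ] ℝ} {Y : V} {K : V →L[ℝ] V}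

lemma tau_apply (v : T) : S.tau η v = S.theta v + η (S.fst v) := rfl

lemma metricOf_apply (v w : T) :
    S.metricOf h η Y v w = h (S.fst v) (S.fst w) + h Y Y * (S.tau η v * S.tau η w) := rfl

lemma fst_jOf (v : T) : S.fst (S.jOf h η Y K v) = S.tau η v • Y + K (S.fst v) := by
  simp [jOf, S.fst_lift, S.fst_vert, jFst]

lemma tau_jOf (v : T) : S.tau η (S.jOf h η Y K v) = -((h Y Y)⁻¹ * h Y (S.fst v)) := by
  rw [tau_apply, fst_jOf]
  simp [jOf, S.theta_lift, S.theta_vert, jFst]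

lemma ext_tau {v w : T} (h1 : S.fst v = S.fst w) (h2 : S.tau η v = S.tau η w) : v = w := by
  rw [tau_apply, tau_apply, h1, add_left_inj] at h2
  rw [S.decomp v, S.decomp w, h1, h2]

lemma isInner_metricOf (hh : IsInner h) (hY : Y ≠ 0) : IsInner (S.metricOf h η Y) where
  symm u v := by
    rw [metricOf_apply, metricOf_apply, hh.symm, mul_comm (S.tau η u)]
  pos u hu := by
    have hp := hh.pos Y hY
    rw [metricOf_apply]
    by_cases h0 : S.fst u = 0
    · have h1 : S.tau η u ≠ 0 := fun h2 => hu (S.ext_tau (η := η) (by rw [h0, map_zero]) (by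
        rw [h2, map_zero]))
      rw [h0]
      simp only [map_zero, zero_add]
      exact mul_pos hp (mul_self_pos.2 h1)
    · have := hh.pos _ h0
      have := mul_self_nonneg (S.tau η u)
      positivity

lemma jOf_jOf (hh : IsInner h) (hY : Y ≠ 0) (hK : IsRotation h Y K) (v : T) :
    S.jOf h η Y K (S.jOf h η Y K v) = -v := by
  have hp := (hh.pos Y hY).ne'
  refine S.ext_tau (η := η) ?_ ?_
  · rw [fst_jOf, tau_jOf, fst_jOf, map_add, map_smul, hK.apply_axis, hK.sq, map_neg,
      hh.symm (S.fst v) Y]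
    module
  · have h1 : h Y (K (S.fst v)) = 0 := by
      rw [hh.symm, hK.skew', hK.apply_axis]
      simp
    rw [tau_jOf, fst_jOf, map_neg]
    simp [h1]
    field_simp

lemma metricOf_jOf (hh : IsInner h) (hY : Y ≠ 0) (hK : IsRotation h Y K) (v w : T) :
    S.metricOf h η Y (S.jOf h η Y K v) (S.jOf h η Y K w) = S.metricOf h η Y v w := by
  have hp := (hh.pos Y hY).ne'
  have h0 : ∀ u, h (K u) Y = 0 := fun u => by
    rw [hK.skew', hK.apply_axis]
    simp
  have h1 : ∀ u, h Y (K u) = 0 := fun u => by rw [hh.symm, h0]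
  have h2 : ∀ u u', h (K u) (K u') = h u u' - h u Y * h u' Y / h Y Y := fun u u' => by
    rw [hK.skew', hK.sq]
    simp only [map_sub, map_smul, sub_apply, smul_apply, smul_eq_mul]
    rw [hh.symm u' u, hh.symm Y u]
    ring
  simp only [metricOf_apply, tau_jOf, fst_jOf, map_add, add_apply, map_smul, smul_apply, h0, h1, h2,
    smul_eq_mul, hh.symm _ Y]
  field_simp
  ring

variable (S) (g : T →L[ℝ] T →L[ℝ] ℝ) (J : T →L[ℝ] T)

/-- The connection form of a metric. -/
def etaOf : V →L[ℝ] ℝ := (g S.vert S.vert)⁻¹ • (g S.vert ∘L S.lift)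

/-- The horizontal part of a metric. -/
def horOf : V →L[ℝ] V →L[ℝ] ℝ :=
  ContinuousLinearMap.precomp ℝ S.lift ∘L g ∘L S.lift -
    g S.vert S.vert • (S.etaOf g).smulRight (S.etaOf g)

/-- The axis of a complex structure. -/
def axisOf : V := S.fst (J S.vert)

/-- The horizontal part of a complex structure. -/
def rotOf : V →L[ℝ] V := S.fst ∘L J ∘L (S.lift - (S.etaOf g).smulRight S.vert)

variable {S g J}

lemma horOf_apply (u v : V) : S.horOf g u v =
    g (S.lift u) (S.lift v) - g S.vert S.vert * (S.etaOf g u * S.etaOf g v) := rfl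

lemma etaOf_apply (u : V) : S.etaOf g u = (g S.vert S.vert)⁻¹ * g S.vert (S.lift u) := rfl

lemma rotOf_apply (u : V) : S.rotOf g J u = S.fst (J (S.lift u - S.etaOf g u • S.vert)) := rfl

/-- Reconstruction of the data from the metric and the complex structure. -/
lemma etaOf_metricOf (hh : IsInner h) (hY : Y ≠ 0) : S.etaOf (S.metricOf h η Y) = η := by
  have hp := (hh.pos Y hY).ne'
  ext u
  rw [etaOf_apply, metricOf_apply, metricOf_apply]
  simp [tau_apply, S.fst_vert, S.theta_vert, S.fst_lift, S.theta_lift, hp]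

lemma horOf_metricOf (hh : IsInner h) (hY : Y ≠ 0) : S.horOf (S.metricOf h η Y) = h := by
  ext u v
  rw [horOf_apply, etaOf_metricOf hh hY, metricOf_apply, metricOf_apply]
  simp [tau_apply, S.fst_vert, S.theta_vert, S.fst_lift, S.theta_lift]

lemma axisOf_jOf : S.axisOf (S.jOf h η Y K) = Y := by
  rw [axisOf, fst_jOf]
  simp [tau_apply, S.fst_vert, S.theta_vert]

lemma rotOf_jOf (hh : IsInner h) (hY : Y ≠ 0) :
    S.rotOf (S.metricOf h η Y) (S.jOf h η Y K) = K := by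
  ext u
  rw [rotOf_apply, etaOf_metricOf hh hY, fst_jOf]
  simp [tau_apply, S.fst_vert, S.theta_vert, S.fst_lift, S.theta_lift]

lemma vert_ne_zero : S.vert ≠ 0 := fun h0 => by
  have := S.theta_vert
  rw [h0, map_zero] at this
  exact zero_ne_one this

section Extract

lemma metric_eq (hg : IsInner g) (v w : T) : g v w = S.horOf g (S.fst v) (S.fst w) +
    g S.vert S.vert * (S.tau (S.etaOf g) v * S.tau (S.etaOf g) w) := by
  have hp := (hg.pos _ S.vert_ne_zero).ne'
  conv_lhs => rw [S.decomp v, S.decomp w]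
  simp only [horOf_apply, tau_apply, etaOf_apply, map_add, map_smul, add_apply, smul_apply,
    smul_eq_mul]
  rw [hg.symm (S.lift (S.fst v)) S.vert]
  field_simp
  ring

lemma isInner_horOf (hg : IsInner g) : IsInner (S.horOf g) where
  symm u v := by
    rw [horOf_apply, horOf_apply, hg.symm, mul_comm (S.etaOf g u)]
  pos u hu := by
    have h1 := S.metric_eq hg (S.lift u - S.etaOf g u • S.vert) (S.lift u - S.etaOf g u • S.vert)
    have h2 : S.tau (S.etaOf g) (S.lift u - S.etaOf g u • S.vert) = 0 := by
      simp [tau_apply, S.fst_vert, S.theta_vert, S.fst_lift, S.theta_lift]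
    have h3 : S.fst (S.lift u - S.etaOf g u • S.vert) = u := by
      simp [S.fst_vert, S.fst_lift]
    rw [h2, h3, mul_zero, mul_zero, add_zero] at h1
    rw [← h1]
    refine hg.pos _ fun h4 => hu ?_
    rw [← h3, h4, map_zero]

lemma skew_of_compatible (hg : IsInner g) (hJ : ∀ v, J (J v) = -v)
    (hc : ∀ v w, g (J v) (J w) = g v w) (v w : T) : g (J v) w = - g (J w) v := by
  have h1 := hc v (J w)
  rw [hJ, map_neg, hg.symm v] at h1
  linarith

lemma tau_vert (η : V →L[ℝ] ℝ) : S.tau η S.vert = 1 := by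
  simp [tau_apply, S.fst_vert, S.theta_vert]

lemma tau_eq (hg : IsInner g) (v : T) :
    S.tau (S.etaOf g) v = (g S.vert S.vert)⁻¹ * g S.vert v := by
  have hp := (hg.pos _ S.vert_ne_zero).ne'
  rw [S.metric_eq hg S.vert v, S.fst_vert, tau_vert]
  simp [hp]

lemma tau_J_vert (hg : IsInner g) (hJ : ∀ v, J (J v) = -v) (hc : ∀ v w, g (J v) (J w) = g v w) :
    S.tau (S.etaOf g) (J S.vert) = 0 := by
  have h1 := skew_of_compatible hg hJ hc S.vert S.vert
  rw [tau_eq hg, hg.symm S.vert (J S.vert)]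
  have : g (J S.vert) S.vert = 0 := by linarith
  rw [this, mul_zero]

lemma horOf_axisOf (hg : IsInner g) (hJ : ∀ v, J (J v) = -v)
    (hc : ∀ v w, g (J v) (J w) = g v w) (v : T) :
    S.horOf g (S.axisOf J) (S.fst v) = g (J S.vert) v := by
  rw [S.metric_eq hg (J S.vert) v, tau_J_vert hg hJ hc, axisOf]
  simp

lemma horOf_axisOf_self (hg : IsInner g) (hJ : ∀ v, J (J v) = -v)
    (hc : ∀ v w, g (J v) (J w) = g v w) :
    S.horOf g (S.axisOf J) (S.axisOf J) = g S.vert S.vert := by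
  conv_lhs => enter [2]; rw [axisOf]
  rw [horOf_axisOf hg hJ hc, hc]

lemma axisOf_ne_zero (hg : IsInner g) (hJ : ∀ v, J (J v) = -v)
    (hc : ∀ v w, g (J v) (J w) = g v w) : S.axisOf J ≠ 0 := fun h0 => by
  have h1 := horOf_axisOf_self (S := S) hg hJ hc
  rw [h0, map_zero] at h1
  exact (hg.pos _ S.vert_ne_zero).ne h1

lemma metricOf_horOf (hg : IsInner g) (hJ : ∀ v, J (J v) = -v)
    (hc : ∀ v w, g (J v) (J w) = g v w) :
    S.metricOf (S.horOf g) (S.etaOf g) (S.axisOf J) = g := by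
  ext v w
  rw [metricOf_apply, horOf_axisOf_self hg hJ hc, ← S.metric_eq hg]

lemma fst_J (v : T) :
    S.fst (J v) = S.tau (S.etaOf g) v • S.axisOf J + S.rotOf g J (S.fst v) := by
  have h1 : v = S.tau (S.etaOf g) v • S.vert +
      (S.lift (S.fst v) - S.etaOf g (S.fst v) • S.vert) := by
    conv_lhs => rw [S.decomp v]
    rw [tau_apply]
    module
  conv_lhs => rw [h1, map_add, map_add, map_smul, map_smul]
  rfl

lemma tau_J (hg : IsInner g) (hJ : ∀ v, J (J v) = -v)
    (hc : ∀ v w, g (J v) (J w) = g v w) (v : T) :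
    S.tau (S.etaOf g) (J v) =
      -((S.horOf g (S.axisOf J) (S.axisOf J))⁻¹ * S.horOf g (S.axisOf J) (S.fst v)) := by
  rw [horOf_axisOf_self hg hJ hc, horOf_axisOf hg hJ hc, tau_eq hg,
    hg.symm S.vert (J v), skew_of_compatible hg hJ hc]
  ring

lemma jOf_rotOf (hg : IsInner g) (hJ : ∀ v, J (J v) = -v)
    (hc : ∀ v w, g (J v) (J w) = g v w) :
    S.jOf (S.horOf g) (S.etaOf g) (S.axisOf J) (S.rotOf g J) = J := by
  ext v
  refine S.ext_tau (η := S.etaOf g) ?_ ?_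
  · rw [fst_jOf, fst_J (g := g)]
  · rw [tau_jOf, tau_J hg hJ hc]

lemma isRotation_rotOf (hg : IsInner g) (hJ : ∀ v, J (J v) = -v)
    (hc : ∀ v w, g (J v) (J w) = g v w) :
    IsRotation (S.horOf g) (S.axisOf J) (S.rotOf g J) := by
  have hi := S.isInner_horOf hg
  have hp := (hi.pos _ (axisOf_ne_zero (S := S) hg hJ hc)).ne'
  have hhor : ∀ u, ∃ v, S.fst v = u ∧ S.tau (S.etaOf g) v = 0 := fun u =>
    ⟨S.lift u - S.etaOf g u • S.vert, by simp [S.fst_vert, S.fst_lift],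
      by simp [tau_apply, S.fst_vert, S.theta_vert, S.fst_lift, S.theta_lift]⟩
  have hrot : ∀ v, S.tau (S.etaOf g) v = 0 → S.rotOf g J (S.fst v) = S.fst (J v) := fun v hv => by
    rw [fst_J (g := g) v, hv, zero_smul, zero_add]
  refine ⟨fun u => ?_, ?_, fun u => ?_⟩
  · obtain ⟨v, rfl, hv⟩ := hhor u
    rw [hrot v hv]
    have h1 := S.metric_eq hg (J v) v
    rw [hv, mul_zero, mul_zero, add_zero] at h1
    rw [← h1]
    have := skew_of_compatible hg hJ hc v v
    linarith
  · rw [axisOf, hrot _ (tau_J_vert hg hJ hc), hJ, map_neg, S.fst_vert, neg_zero]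
  · obtain ⟨v, rfl, hv⟩ := hhor u
    have h1 := fst_J (S := S) (g := g) (J := J) (J v)
    rw [hJ, tau_J hg hJ hc, ← hrot v hv, map_neg] at h1
    rw [← sub_eq_zero, hi.symm _ (S.axisOf J)]
    rw [← sub_eq_zero] at h1
    rw [← neg_eq_zero, ← h1]
    module

end Extract

end LineSplitting

end Hermitian

/-! ### The rotation with a given axis -/

section Rotation

variable {V : Type*} [AddCommGroup V] [Module ℝ V] [TopologicalSpace V] [IsTopologicalAddGroup V]
  [ContinuousSMul ℝ V] {ι : Type*} [Fintype ι]

/-- The vectors `X i` with coefficients `ξ i` span. -/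
def SpansWith (X : ι → V) (ξ : ι → V →L[ℝ] ℝ) : Prop := ∀ v, ∑ i, ξ i v • X i = v

lemma SpansWith.bilin_ext {X : ι → V} {ξ : ι → V →L[ℝ] ℝ} (hX : SpansWith X ξ)
    {b c : V →L[ℝ] V →L[ℝ] ℝ} (h : ∀ i j, b (X i) (X j) = c (X i) (X j)) : b = c := by
  ext u v
  rw [← hX u, ← hX v]
  simp only [map_sum, map_smul, sum_apply, smul_apply, h]

lemma IsInner.bijective [FiniteDimensional ℝ V] [T2Space V] {h : V →L[ℝ] V →L[ℝ] ℝ}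
    (hh : IsInner h) : Function.Bijective h := by
  have h1 : Function.Injective h := fun u v huv => hh.eq_of_forall fun w => by rw [huv]
  refine ⟨h1, ?_⟩
  have e : Module.finrank ℝ V = Module.finrank ℝ (V →L[ℝ] ℝ) := by
    rw [← (LinearMap.toContinuousLinearMap (𝕜 := ℝ) (E := V) (F' := ℝ)).finrank_eq]
    exact Subspace.dual_finrank_eq.symm
  have : FiniteDimensional ℝ (V →L[ℝ] ℝ) :=
    (LinearMap.toContinuousLinearMap (𝕜 := ℝ) (E := V) (F' := ℝ)).finiteDimensional
  exact (LinearMap.injective_iff_surjective_of_finrank_eq_finrank (f := (h : V →ₗ[ℝ] V →L[ℝ] ℝ))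
    e).1 h1

open Classical in
/-- The endomorphism `A` with `h (A u) v = b u v`. -/
def sharp (h b : V →L[ℝ] V →L[ℝ] ℝ) : V →L[ℝ] V :=
  if H : ∃ A : V →L[ℝ] V, ∀ u, h (A u) = b u then H.choose else 0

lemma IsInner.apply_sharp [FiniteDimensional ℝ V] [T2Space V] {h : V →L[ℝ] V →L[ℝ] ℝ}
    (hh : IsInner h) (b : V →L[ℝ] V →L[ℝ] ℝ) (u : V) : h (sharp h b u) = b u := by
  have H : ∃ A : V →L[ℝ] V, ∀ u, h (A u) = b u := by
    let e := LinearEquiv.ofBijective (h : V →ₗ[ℝ] V →L[ℝ] ℝ) hh.bijective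
    refine ⟨LinearMap.toContinuousLinearMap (e.symm.toLinearMap ∘ₗ (b : V →ₗ[ℝ] V →L[ℝ] ℝ)),
      fun u => ?_⟩
    exact e.apply_symm_apply (b u)
  rw [sharp, dif_pos H]
  exact H.choose_spec u

/-- The 2-form `ι_Y (l ∧ β)`. -/
def axisForm (l : V →L[ℝ] ℝ) (β : V →L[ℝ] V →L[ℝ] ℝ) (Y : V) : V →L[ℝ] V →L[ℝ] ℝ :=
  l Y • β - l.smulRight (β Y) + (β Y).smulRight l

lemma axisForm_apply (l : V →L[ℝ] ℝ) (β : V →L[ℝ] V →L[ℝ] ℝ) (Y u v : V) :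
    axisForm l β Y u v = l Y * β u v - l u * β Y v + β Y u * l v := rfl

/-- The square of the rotation speed of a skew endomorphism `A` with kernel `Y`. -/
def speedSq (X : ι → V) (h : V →L[ℝ] V →L[ℝ] ℝ) (Y : V) (A : V →L[ℝ] V) : ℝ :=
  (∑ j, h (A (X j)) (A (X j))) / ∑ j, (h (X j) (X j) - h (X j) Y * h (X j) Y / h Y Y)

/-- The rotation about `Y`, oriented by the 2-form `b`. -/
def axisRotation (X : ι → V) (h : V →L[ℝ] V →L[ℝ] ℝ) (Y : V) (b : V →L[ℝ] V →L[ℝ] ℝ) : V →L[ℝ] V :=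
  (√(speedSq X h Y (sharp h b)))⁻¹ • sharp h b

/-- The pairing of two bilinear forms. -/
def formPairing (X : ι → V) (b c : V →L[ℝ] V →L[ℝ] ℝ) : ℝ :=
  ∑ i, ∑ j, b (X i) (X j) * c (X i) (X j)

lemma formPairing_self_pos {X : ι → V} {ξ : ι → V →L[ℝ] ℝ} (hX : SpansWith X ξ)
    {b : V →L[ℝ] V →L[ℝ] ℝ} (hb : b ≠ 0) : 0 < formPairing X b b := by
  have h0 : ∀ i, 0 ≤ ∑ j, b (X i) (X j) * b (X i) (X j) := fun i =>
    Finset.sum_nonneg fun j _ => mul_self_nonneg _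
  refine lt_of_le_of_ne (Finset.sum_nonneg fun i _ => h0 i) fun h1 => hb ?_
  refine hX.bilin_ext fun i j => ?_
  have h2 := (Finset.sum_eq_zero_iff_of_nonneg fun i _ => h0 i).1 h1.symm i (Finset.mem_univ i)
  have h3 := (Finset.sum_eq_zero_iff_of_nonneg fun j _ => mul_self_nonneg _).1 h2 j
    (Finset.mem_univ j)
  exact mul_self_eq_zero.1 h3

lemma ne_zero_of_formPairing_pos {X : ι → V} {b c : V →L[ℝ] V →L[ℝ] ℝ}
    (h : 0 < formPairing X b c) : b ≠ 0 := by
  rintro rfl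
  simp [formPairing] at h

/-- The 2-form of an endomorphism. -/
def lower (h : V →L[ℝ] V →L[ℝ] ℝ) (K : V →L[ℝ] V) : V →L[ℝ] V →L[ℝ] ℝ := h ∘L K

lemma lower_apply (h : V →L[ℝ] V →L[ℝ] ℝ) (K : V →L[ℝ] V) (u v : V) : lower h K u v = h (K u) v :=
  rfl

variable [T2Space V] {X : ι → V} {ξ : ι → V →L[ℝ] ℝ} {h b : V →L[ℝ] V →L[ℝ] ℝ} {Y : V}

lemma sharp_properties (hV : Module.finrank ℝ V = 3) (hX : SpansWith X ξ) (hh : IsInner h)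
    (hY : Y ≠ 0) (hb : ∀ u, b u u = 0) (hbY : b Y = 0) (hb0 : b ≠ 0) :
    (∀ u, h (sharp h b u) u = 0) ∧ sharp h b Y = 0 ∧ sharp h b ≠ 0 ∧
      0 < speedSq X h Y (sharp h b) ∧
      0 < ∑ j, (h (X j) (X j) - h (X j) Y * h (X j) Y / h Y Y) ∧
      ∀ v, sharp h b (sharp h b v) = speedSq X h Y (sharp h b) • ((h v Y / h Y Y) • Y - v) := by
  have : FiniteDimensional ℝ V := .of_finrank_pos (by omega)
  have hA := hh.apply_sharp b
  set A := sharp h b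
  have h1 : ∀ u, h (A u) u = 0 := fun u => by rw [hA, hb]
  have h2 : A Y = 0 := hh.eq_of_forall fun w => by rw [hA, hbY]; simp
  have h3 : A ≠ 0 := fun h0 => hb0 (by
    ext u v
    rw [← hA, h0]
    simp)
  obtain ⟨k, hk, hk'⟩ := hh.exists_sq_eq hV h1 hY h2 h3
  have hskew : ∀ u v, h (A u) v = - h (A v) u := fun u v => by
    have h4 := h1 (u + v)
    simp only [map_add, add_apply, h1] at h4
    linarith
  have h4 : ∀ u, h (A u) (A u) = k * (h u u - h u Y * h u Y / h Y Y) := fun u => by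
    rw [hskew, hk']
    simp only [map_smul, map_sub, smul_apply, sub_apply, smul_eq_mul, hh.symm Y u]
    ring
  set D := ∑ j, (h (X j) (X j) - h (X j) Y * h (X j) Y / h Y Y) with hD
  have h5 : ∑ j, h (A (X j)) (A (X j)) = k * D := by
    rw [hD, Finset.mul_sum]
    exact Finset.sum_congr rfl fun j _ => h4 _
  have h6 : 0 < ∑ j, h (A (X j)) (A (X j)) := by
    refine lt_of_le_of_ne (Finset.sum_nonneg fun i _ => hh.nonneg _) fun h7 => h3 ?_
    have h8 := (Finset.sum_eq_zero_iff_of_nonneg fun i _ => hh.nonneg _).1 h7.symm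
    refine ContinuousLinearMap.ext fun v => ?_
    have h9 : A v = ∑ i, ξ i v • A (X i) := by
      conv_lhs => rw [← hX v]
      simp only [map_sum, map_smul]
    rw [h9]
    refine Finset.sum_eq_zero fun i hi => ?_
    rw [hh.eq_zero (h8 i hi), smul_zero]
  have h7 : 0 < D := by
    rw [h5] at h6
    exact pos_of_mul_pos_right h6 hk.le
  have h8 : speedSq X h Y A = k := by
    rw [speedSq, h5, mul_div_assoc, div_self h7.ne', mul_one]
  exact ⟨h1, h2, h3, h8 ▸ hk, h7, h8 ▸ hk'⟩

lemma isRotation_axisRotation (hV : Module.finrank ℝ V = 3) (hX : SpansWith X ξ) (hh : IsInner h)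
    (hY : Y ≠ 0) (hb : ∀ u, b u u = 0) (hbY : b Y = 0) (hb0 : b ≠ 0) :
    IsRotation h Y (axisRotation X h Y b) := by
  obtain ⟨h1, h2, -, h4, -, h5⟩ := sharp_properties hV hX hh hY hb hbY hb0
  refine ⟨fun u => by simp [axisRotation, h1], by simp [axisRotation, h2], fun u => ?_⟩
  simp only [axisRotation, smul_apply, map_smul, h5, smul_smul]
  rw [← mul_assoc, ← mul_inv, Real.mul_self_sqrt h4.le, inv_mul_cancel₀ h4.ne', one_smul]

lemma formPairing_axisRotation_pos (hV : Module.finrank ℝ V = 3) (hX : SpansWith X ξ)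
    (hh : IsInner h)
    (hY : Y ≠ 0) (hb : ∀ u, b u u = 0) (hbY : b Y = 0) (hb0 : b ≠ 0) :
    0 < formPairing X b (lower h (axisRotation X h Y b)) := by
  have : FiniteDimensional ℝ V := .of_finrank_pos (by omega)
  obtain ⟨-, -, -, h4, -, -⟩ := sharp_properties hV hX hh hY hb hbY hb0
  have h1 : formPairing X b (lower h (axisRotation X h Y b)) =
      (√(speedSq X h Y (sharp h b)))⁻¹ * formPairing X b b := by
    simp only [formPairing, Finset.mul_sum, lower_apply, axisRotation, smul_apply, map_smul,
      hh.apply_sharp, smul_eq_mul]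
    exact Finset.sum_congr rfl fun i _ => Finset.sum_congr rfl fun j _ => by ring
  rw [h1]
  exact mul_pos (inv_pos.2 (Real.sqrt_pos.2 h4)) (formPairing_self_pos hX hb0)

lemma IsRotation.eq_axisRotation (hV : Module.finrank ℝ V = 3) (hX : SpansWith X ξ) (hh : IsInner h)
    (hY : Y ≠ 0) (hb : ∀ u, b u u = 0) (hbY : b Y = 0) {K : V →L[ℝ] V} (hK : IsRotation h Y K)
    (hpos : 0 < formPairing X b (lower h K)) : axisRotation X h Y b = K := by
  have : FiniteDimensional ℝ V := .of_finrank_pos (by omega)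
  have hb0 := ne_zero_of_formPairing_pos hpos
  obtain ⟨h1, h2, h3, h4, -, h5⟩ := sharp_properties hV hX hh hY hb hbY hb0
  obtain ⟨c, hc⟩ := hh.exists_eq_smul hV h1 hY h2 h3 hK.skew hK.apply_axis
  have h6 : formPairing X b (lower h K) = c * formPairing X b b := by
    simp only [formPairing, Finset.mul_sum, lower_apply, hc, map_smul, smul_apply, hh.apply_sharp,
      smul_eq_mul]
    exact Finset.sum_congr rfl fun i _ => Finset.sum_congr rfl fun j _ => by ring
  rw [h6] at hpos
  have hc0 : 0 < c := pos_of_mul_pos_left hpos (formPairing_self_pos hX hb0).le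
  obtain ⟨v, hv⟩ : ∃ v, sharp h b v ≠ 0 := by
    by_contra! h0
    exact h3 (ContinuousLinearMap.ext h0)
  have h7 : (h v Y / h Y Y) • Y - v ≠ 0 := fun h0 => hv (by
    rw [sub_eq_zero] at h0
    rw [← h0, map_smul, h2, smul_zero])
  have h8 := hK.sq v
  rw [hc, hc, map_smul, h5, smul_smul, smul_smul] at h8
  have h9 : c * c * speedSq X h Y (sharp h b) = 1 := by
    refine smul_left_injective ℝ h7 ?_
    simpa only [one_smul] using h8
  have h10 : (√(speedSq X h Y (sharp h b)))⁻¹ = c := by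
    rw [inv_eq_iff_eq_inv, Real.sqrt_eq_iff_mul_self_eq h4.le (by positivity)]
    field_simp
    nlinarith
  ext v
  rw [axisRotation, h10, hc]
  rfl

lemma IsRotation.ne_zero (hV : Module.finrank ℝ V = 3) {K : V →L[ℝ] V} (hK : IsRotation h Y K) :
    K ≠ 0 := by
  rintro rfl
  have h1 : ∀ v : V, (h v Y / h Y Y) • Y = v := fun v => by
    have := hK.sq v
    simp only [zero_apply] at this
    exact sub_eq_zero.1 this.symm
  have := finrank_le_one Y fun v => ⟨_, h1 v⟩
  omega

/-- The rotation of a metric is positive with respect to its own 3-form. -/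
lemma IsRotation.formPairing_pos (hV : Module.finrank ℝ V = 3) (hX : SpansWith X ξ) (hh : IsInner h)
    (hY : Y ≠ 0) {K : V →L[ℝ] V} (hK : IsRotation h Y K) :
    0 < formPairing X (axisForm (h Y) (lower h K) Y) (lower h K) := by
  have h1 : axisForm (h Y) (lower h K) Y = h Y Y • lower h K := by
    ext u v
    rw [axisForm_apply]
    simp [lower_apply, hK.apply_axis]
  have h2 : lower h K ≠ 0 := fun h0 => hK.ne_zero hV (by
    ext u
    refine hh.eq_of_forall fun w => ?_
    rw [← lower_apply, h0]
    simp)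
  have h3 : formPairing X (axisForm (h Y) (lower h K) Y) (lower h K) =
      h Y Y * formPairing X (lower h K) (lower h K) := by
    simp only [h1, formPairing, Finset.mul_sum, smul_apply, smul_eq_mul, mul_assoc]
  rw [h3]
  exact mul_pos (hh.pos Y hY) (formPairing_self_pos hX h2)

end Rotation

section SmoothRotation

variable {EP : Type*} [NormedAddCommGroup EP] [NormedSpace ℝ EP] {HP : Type*} [TopologicalSpace HP]
  {IP : ModelWithCorners ℝ EP HP} {P : Type*} [TopologicalSpace P] [ChartedSpace HP P]
  {EB : Type*} [NormedAddCommGroup EB] [NormedSpace ℝ EB] {HB : Type*} [TopologicalSpace HB]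
  {IB : ModelWithCorners ℝ EB HB} {N : Type*} [TopologicalSpace N] [ChartedSpace HB N]
  {F : Type*} [NormedAddCommGroup F] [NormedSpace ℝ F] [FiniteDimensional ℝ F]
  {W : N → Type*} [TopologicalSpace (TotalSpace F W)] [∀ x, TopologicalSpace (W x)]
  [FiberBundle F W] [∀ x, AddCommGroup (W x)] [∀ x, Module ℝ (W x)] [VectorBundle ℝ F W]
  [ContMDiffVectorBundle ∞ F W IB] [∀ x, IsTopologicalAddGroup (W x)]
  [∀ x, ContinuousSMul ℝ (W x)] [∀ x, T2Space (W x)]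
  {f : P → N} {ι : Type*} [Fintype ι]

lemma contMDiff_div {u v : P → ℝ} (hu : ContMDiff IP 𝓘(ℝ, ℝ) ∞ u) (hv : ContMDiff IP 𝓘(ℝ, ℝ) ∞ v)
    (h0 : ∀ p, v p ≠ 0) : ContMDiff IP 𝓘(ℝ, ℝ) ∞ fun p => u p / v p := hu.div₀ hv h0

lemma contMDiff_inv_sqrt {u : P → ℝ} (hu : ContMDiff IP 𝓘(ℝ, ℝ) ∞ u) (h0 : ∀ p, 0 < u p) :
    ContMDiff IP 𝓘(ℝ, ℝ) ∞ fun p => (√(u p))⁻¹ := by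
  intro p
  have h1 : ContDiffAt ℝ ∞ (fun r => (√r)⁻¹) (u p) :=
    (Real.contDiffAt_sqrt (h0 p).ne').inv (Real.sqrt_pos.2 (h0 p)).ne'
  exact h1.contMDiffAt.comp p (hu p)

lemma BundleFrame.spansWith (fr : BundleFrame IB F W ι) (x : N) :
    SpansWith (fun i => fr.sec i x) (fun i => fr.coeff i x) := fr.sum_coeff x

/-- The rotations about a smooth family of axes form a smooth family. -/
lemma BundleFrame.smoothAlong_axisRotation (fr : BundleFrame IB F W ι)
    (hW : ∀ x, Module.finrank ℝ (W x) = 3)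
    {h b : ∀ p, W (f p) →L[ℝ] W (f p) →L[ℝ] ℝ} {Y : ∀ p, W (f p)}
    (sh : SmoothAlong (W := fun x => W x →L[ℝ] W x →L[ℝ] ℝ) IP IB (F →L[ℝ] F →L[ℝ] ℝ) f h)
    (sb : SmoothAlong (W := fun x => W x →L[ℝ] W x →L[ℝ] ℝ) IP IB (F →L[ℝ] F →L[ℝ] ℝ) f b)
    (sY : SmoothAlong IP IB F f Y)
    (hh : ∀ p, IsInner (h p)) (hY : ∀ p, Y p ≠ 0) (hb : ∀ p u, b p u u = 0)
    (hbY : ∀ p, b p (Y p) = 0) (hb0 : ∀ p, b p ≠ 0) :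
    SmoothAlong (W := fun x => W x →L[ℝ] W x) IP IB (F →L[ℝ] F) f fun p =>
      axisRotation (fun i => fr.sec i (f p)) (h p) (Y p) (b p) := by
  have hf := sY.base
  have hfin : ∀ x, FiniteDimensional ℝ (W x) := fun x => .of_finrank_pos (by rw [hW]; omega)
  have sX : ∀ i, SmoothAlong IP IB F f fun p => fr.sec i (f p) := fun i =>
    smoothAlong_section (fr.sec i) hf
  have sA : SmoothAlong (W := fun x => W x →L[ℝ] W x) IP IB (F →L[ℝ] F) f fun p =>
      sharp (h p) (b p) := fr.smoothAlong_hom hf fun i =>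
    SmoothAlong.solve (W' := fun x => W x →L[ℝ] ℝ) sh
      (SmoothAlong.clm_apply (W' := fun x => W x →L[ℝ] ℝ) sb (sX i))
      (fun p => (hh p).apply_sharp (b p) _) fun p => (hh p).bijective
  have hprop := fun p => sharp_properties (hW (f p)) (fr.spansWith (f p)) (hh p) (hY p) (hb p)
    (hbY p) (hb0 p)
  have sAX := fun i => SmoothAlong.clm_apply (W' := W) sA (sX i)
  have hYY := sh.bilin_apply sY sY
  have hk : ContMDiff IP 𝓘(ℝ, ℝ) ∞ fun p =>
      speedSq (fun i => fr.sec i (f p)) (h p) (Y p) (sharp (h p) (b p)) := by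
    refine contMDiff_div (contMDiff_finsetSum fun i _ => sh.bilin_apply (sAX i) (sAX i))
      (contMDiff_finsetSum fun i _ => (sh.bilin_apply (sX i) (sX i)).sub (contMDiff_div
        ((sh.bilin_apply (sX i) sY).mul (sh.bilin_apply (sX i) sY)) hYY fun p =>
          ((hh p).pos _ (hY p)).ne')) fun p => (hprop p).2.2.2.2.1.ne'
  exact sA.smul (contMDiff_inv_sqrt hk fun p => (hprop p).2.2.2.1)

/-- The forms `ι_Y (l ∧ β)` of smooth families form a smooth family. -/
lemma BundleFrame.smoothAlong_axisForm (fr : BundleFrame IB F W ι)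
    {l : ∀ p, W (f p) →L[ℝ] ℝ} {β : ∀ p, W (f p) →L[ℝ] W (f p) →L[ℝ] ℝ} {Y : ∀ p, W (f p)}
    (sl : SmoothAlong (W := fun x => W x →L[ℝ] ℝ) IP IB (F →L[ℝ] ℝ) f l)
    (sβ : SmoothAlong (W := fun x => W x →L[ℝ] W x →L[ℝ] ℝ) IP IB (F →L[ℝ] F →L[ℝ] ℝ) f β)
    (sY : SmoothAlong IP IB F f Y) :
    SmoothAlong (W := fun x => W x →L[ℝ] W x →L[ℝ] ℝ) IP IB (F →L[ℝ] F →L[ℝ] ℝ) f fun p =>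
      axisForm (l p) (β p) (Y p) := by
  have hf := sY.base
  have sX : ∀ i, SmoothAlong IP IB F f fun p => fr.sec i (f p) := fun i =>
    smoothAlong_section (fr.sec i) hf
  refine fr.smoothAlong_bilin hf fun i j => ?_
  exact (((sl.clm_apply_real sY).mul (sβ.bilin_apply (sX i) (sX j))).sub
    ((sl.clm_apply_real (sX i)).mul (sβ.bilin_apply sY (sX j)))).add
      ((sβ.bilin_apply sY (sX i)).mul (sl.clm_apply_real (sX j)))

lemma BundleFrame.contMDiff_formPairing (fr : BundleFrame IB F W ι)
    {b c : ∀ p, W (f p) →L[ℝ] W (f p) →L[ℝ] ℝ}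
    (sb : SmoothAlong (W := fun x => W x →L[ℝ] W x →L[ℝ] ℝ) IP IB (F →L[ℝ] F →L[ℝ] ℝ) f b)
    (sc : SmoothAlong (W := fun x => W x →L[ℝ] W x →L[ℝ] ℝ) IP IB (F →L[ℝ] F →L[ℝ] ℝ) f c) :
    ContMDiff IP 𝓘(ℝ, ℝ) ∞ fun p => formPairing (fun i => fr.sec i (f p)) (b p) (c p) := by
  have hf := sb.base
  have sX : ∀ i, SmoothAlong IP IB F f fun p => fr.sec i (f p) := fun i =>
    smoothAlong_section (fr.sec i) hf
  exact contMDiff_finsetSum fun i _ => contMDiff_finsetSum fun j _ =>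
    (sb.bilin_apply (sX i) (sX j)).mul (sc.bilin_apply (sX i) (sX j))

end SmoothRotation

section SmoothTriple

variable {M : Type*} [TopologicalSpace M] [ChartedSpace R3 M] [IsManifold (𝓡 3) ∞ M]

instance (x : M) : T2Space (TangentSpace (𝓡 3) x) := inferInstanceAs (T2Space R3)

lemma finrank_tangentSpace (x : M) : Module.finrank ℝ (TangentSpace (𝓡 3) x) = 3 :=
  finrank_euclideanSpace_fin (𝕜 := ℝ) (n := 3)

/-- The splitting of the tangent spaces of `M × S¹`. -/
def txSplit (q : M × Circle) : LineSplitting (TX M q) (TangentSpace (𝓡 3) q.1) where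
  fst := txFst q
  lift := txLift q
  theta := dTheta q
  vert := vert q
  fst_lift := txFst_lift q
  fst_vert := txFst_vert q
  theta_lift := dTheta_lift q
  theta_vert := dTheta_vert q
  decomp := tx_decomp q

variable {EP : Type*} [NormedAddCommGroup EP] [NormedSpace ℝ EP] {HP : Type*} [TopologicalSpace HP]
  {IP : ModelWithCorners ℝ EP HP} {P : Type*} [TopologicalSpace P] [ChartedSpace HP P]
  {f : P → M × Circle} {ι : Type*} [Fintype ι]
  {h : ∀ p, TangentSpace (𝓡 3) (f p).1 →L[ℝ] TangentSpace (𝓡 3) (f p).1 →L[ℝ] ℝ}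
  {η : ∀ p, TangentSpace (𝓡 3) (f p).1 →L[ℝ] ℝ} {Y : ∀ p, TangentSpace (𝓡 3) (f p).1}
  {K : ∀ p, TangentSpace (𝓡 3) (f p).1 →L[ℝ] TangentSpace (𝓡 3) (f p).1}

lemma contMDiff_tau (sη : SmoothForm IP (fun p => (f p).1) η) {v : ∀ p, TX M (f p)}
    (hv : SmoothVecX IP f v) :
    ContMDiff IP 𝓘(ℝ, ℝ) ∞ fun p => (txSplit (f p)).tau (η p) (v p) :=
  hv.contMDiff_dTheta.add (sη.clm_apply_real hv.tx_fst)

variable [T2Space M] [CompactSpace M]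

lemma smoothAlong_metricOf
    (sh : SmoothBilin IP (fun p => (f p).1) h)
    (sη : SmoothForm IP (fun p => (f p).1) η)
    (sY : SmoothVec IP (fun p => (f p).1) Y)
    (hf : ContMDiff IP IX ∞ f) :
    SmoothBilinX IP f fun p => (txSplit (f p)).metricOf (h p) (η p) (Y p) := by
  obtain ⟨κ, _, ⟨fr⟩⟩ := exists_bundleFrame (IB := IX) (F := EX) (W := fun q : M × Circle => TX M q)
  have sX : ∀ i, SmoothVecX IP f fun p =>
    fr.sec i (f p) := fun i => smoothAlong_section (fr.sec i) hf
  refine fr.smoothAlong_bilin hf fun i j => ?_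
  exact (sh.bilin_apply (sX i).tx_fst (sX j).tx_fst).add ((sh.bilin_apply sY sY).mul
    ((contMDiff_tau sη (sX i)).mul (contMDiff_tau sη (sX j))))

lemma smoothAlong_jOf
    (sh : SmoothBilin IP (fun p => (f p).1) h)
    (sη : SmoothForm IP (fun p => (f p).1) η)
    (sY : SmoothVec IP (fun p => (f p).1) Y)
    (sK : SmoothEnd IP (fun p => (f p).1) K)
    (hf : ContMDiff IP IX ∞ f) (hp : ∀ p, h p (Y p) (Y p) ≠ 0) :
    SmoothEndX IP f fun p => (txSplit (f p)).jOf (h p) (η p) (Y p) (K p) := by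
  obtain ⟨κ, _, ⟨fr⟩⟩ := exists_bundleFrame (IB := IX) (F := EX) (W := fun q : M × Circle => TX M q)
  have sX : ∀ i, SmoothVecX IP f fun p =>
    fr.sec i (f p) := fun i => smoothAlong_section (fr.sec i) hf
  refine fr.smoothAlong_hom (W' := fun q : M × Circle => TX M q) hf fun i => ?_
  have s1 := (sY.smul (contMDiff_tau sη (sX i))).add (SmoothAlong.clm_apply
    (W' := fun x : M => TangentSpace (𝓡 3) x) sK (sX i).tx_fst)
  have s2 := (sh.bilin_apply sY (sX i).tx_fst)
  have s3 := ((sh.bilin_apply sY sY).inv₀ hp).mul s2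
  refine ((smoothAlong_lift hf s1).add ((smoothAlong_vert hf).smul
    (s3.neg.sub (sη.clm_apply_real s1)))).congr fun p => rfl

end SmoothTriple

/-! ### Triples and their coordinates -/

section BoundedUnitBall

lemma IsInner.isVonNBounded {E : Type*} [NormedAddCommGroup E] [NormedSpace ℝ E]
    [FiniteDimensional ℝ E] {g : E →L[ℝ] E →L[ℝ] ℝ} (hg : IsInner g) :
    Bornology.IsVonNBounded ℝ {v : E | g v v < 1} := by
  rw [NormedSpace.isVonNBounded_iff]
  have hc : Continuous fun v => g v v := by fun_prop
  have hs : IsCompact (Metric.sphere (0 : E) 1) := isCompact_sphere 0 1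
  have hpos : ∃ c : ℝ, 0 < c ∧ ∀ v ∈ Metric.sphere (0 : E) 1, c ≤ g v v := by
    rcases (Metric.sphere (0 : E) 1).eq_empty_or_nonempty with h0 | h0
    · exact ⟨1, one_pos, fun v hv => by simp [h0] at hv⟩
    · obtain ⟨v, hv, hm⟩ := hs.exists_isMinOn h0 hc.continuousOn
      exact ⟨g v v, hg.pos v (ne_zero_of_mem_unit_sphere ⟨v, hv⟩), fun w hw => hm hw⟩
  obtain ⟨c, hc0, hcv⟩ := hpos
  refine (Metric.isBounded_closedBall (x := (0 : E)) (r := √c⁻¹)).subset fun v hv => ?_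
  rw [mem_closedBall_zero_iff]
  by_cases h0 : v = 0
  · rw [h0, norm_zero]
    positivity
  · have hn : 0 < ‖v‖ := norm_pos_iff.2 h0
    have h1 := hcv (‖v‖⁻¹ • v) (by simp [norm_smul, hn.ne'])
    simp only [map_smul, smul_apply, smul_eq_mul] at h1
    have h2 : g v v < 1 := hv
    refine Real.le_sqrt_of_sq_le ?_
    rw [← mul_assoc, ← mul_inv, ← sq, inv_mul_eq_div, le_div_iff₀ (by positivity)] at h1
    rw [← one_div, le_div_iff₀ hc0]
    linarith

end BoundedUnitBall

section Coordinates

variable {M : Type*} [TopologicalSpace M] [ChartedSpace R3 M] [IsManifold (𝓡 3) ∞ M]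

lemma HermitianTriple.ext_of {t t' : HermitianTriple M}
    (hg : ∀ q, t.g.inner q = t'.g.inner q) (hJ : ∀ q, t.J q = t'.J q) : t = t' := by
  obtain ⟨⟨g, _, _, _, _⟩, J, om, _, _, h1⟩ := t
  obtain ⟨⟨g', _, _, _, _⟩, J', om', _, _, h1'⟩ := t'
  obtain rfl : g = g' := funext hg
  obtain rfl : J = J' := ContMDiffSection.ext hJ
  obtain rfl : om = om' := ContMDiffSection.ext fun q => by
    ext v w
    rw [h1, h1']
  rfl

lemma HermitianTriple.isInner (t : HermitianTriple M) (q : M × Circle) : IsInner (t.g.inner q) :=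
  ⟨t.g.symm q, t.g.pos q⟩

variable (M) in
/-- The coordinates of invariant triples: a symmetric bilinear form, a connection form and a
vector field on `M`. -/
abbrev CoordSpace : Type _ := SymBilin M × Form1 M × VecField M

/-- The conditions for the coordinates of a triple whose orientation is that of `l ∧ β`. -/
def Admissible (l : Form1 M) (β : Form2 M) (d : CoordSpace M) : Prop :=
  ∀ x, IsInner (d.1.1 x) ∧ axisForm (l x) (β.1 x) (d.2.2 x) ≠ 0

variable {ι : Type} [Fintype ι] (fr : TFrame M ι) {l : Form1 M} {β : Form2 M} {d : CoordSpace M}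

lemma Admissible.axis_ne_zero (hd : Admissible l β d) (x : M) : d.2.2 x ≠ 0 := fun h0 =>
  (hd x).2 (by
    ext u v
    rw [axisForm_apply, h0]
    simp)

lemma axisForm_self (l : Form1 M) (β : Form2 M) (x : M) (Y u : TangentSpace (𝓡 3) x) :
    axisForm (l x) (β.1 x) Y u u = 0 := by
  rw [axisForm_apply, β.2 x u]
  ring

lemma axisForm_axis (l : Form1 M) (β : Form2 M) (x : M) (Y : TangentSpace (𝓡 3) x) :
    axisForm (l x) (β.1 x) Y Y = 0 := by
  ext u
  rw [axisForm_apply, β.2 x Y]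
  simp

variable (l β d) in
/-- The rotation about the axis of `d`. -/
def rotAt (x : M) : TangentSpace (𝓡 3) x →L[ℝ] TangentSpace (𝓡 3) x :=
  axisRotation (fun i => fr.sec i x) (d.1.1 x) (d.2.2 x) (axisForm (l x) (β.1 x) (d.2.2 x))

lemma Admissible.isRotation (hd : Admissible l β d) (x : M) :
    IsRotation (d.1.1 x) (d.2.2 x) (rotAt fr l β d x) :=
  isRotation_axisRotation (finrank_tangentSpace x) (fr.spansWith x) (hd x).1 (hd.axis_ne_zero x)
    (axisForm_self l β x _) (axisForm_axis l β x _) (hd x).2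

section Families

variable {EP : Type*} [NormedAddCommGroup EP] [NormedSpace ℝ EP] {HP : Type*} [TopologicalSpace HP]
  {IP : ModelWithCorners ℝ EP HP} {P : Type*} [TopologicalSpace P] [ChartedSpace HP P]
  {f : P → M × Circle} {d : P → CoordSpace M}

variable [T2Space M] [CompactSpace M]

lemma Admissible.smoothAlong_j
    (sh : SmoothBilin IP (fun p => (f p).1) fun p => (d p).1.1 (f p).1)
    (sη : SmoothForm IP (fun p => (f p).1) fun p => (d p).2.1 (f p).1)
    (sY : SmoothVec IP (fun p => (f p).1)
      fun p => (d p).2.2 (f p).1)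
    (hf : ContMDiff IP IX ∞ f) (hd : ∀ p, Admissible l β (d p)) :
    SmoothEndX IP f fun p => (txSplit (f p)).jOf ((d p).1.1 (f p).1)
        ((d p).2.1 (f p).1) ((d p).2.2 (f p).1) (rotAt fr l β (d p) (f p).1) := by
  have hf1 : ContMDiff IP (𝓡 3) ∞ fun p => (f p).1 := contMDiff_fst.comp hf
  have sb := fr.smoothAlong_axisForm (smoothAlong_section l hf1) (smoothAlong_section β.1 hf1) sY
  refine smoothAlong_jOf sh sη sY (fr.smoothAlong_axisRotation finrank_tangentSpace sh
    sb sY (fun p => (hd p _).1) (fun p => (hd p).axis_ne_zero _) (fun p => axisForm_self l β _ _)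
    (fun p => axisForm_axis l β _ _) fun p => (hd p _).2) hf fun p =>
      ((hd p _).1.pos _ ((hd p).axis_ne_zero _)).ne'

lemma smoothAlong_om {g : ∀ p, TX M (f p) →L[ℝ] TX M (f p) →L[ℝ] ℝ}
    {J : ∀ p, TX M (f p) →L[ℝ] TX M (f p)}
    (sg : SmoothBilinX IP f g)
    (sJ : SmoothEndX IP f J) :
    SmoothBilinX IP f fun p => lower (g p) (J p) := by
  obtain ⟨κ, _, ⟨fx⟩⟩ := exists_bundleFrame (IB := IX) (F := EX) (W := fun q : M × Circle => TX M q)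
  have sX : ∀ i, SmoothVecX IP f fun p =>
    fx.sec i (f p) := fun i => smoothAlong_section (fx.sec i) sg.base
  exact fx.smoothAlong_bilin sg.base fun i j => sg.bilin_apply
    (SmoothAlong.clm_apply (W' := fun q : M × Circle => TX M q) sJ (sX i)) (sX j)

end Families

variable [T2Space M] [CompactSpace M]

/-- The triple with given coordinates. -/
def tripleOf (hd : Admissible l β d) : HermitianTriple M :=
  have sh := smoothAlong_section (IP := IX) d.1.1 (b := fun q : M × Circle => q.1) contMDiff_fst
  have sη := smoothAlong_section (IP := IX) d.2.1 (b := fun q : M × Circle => q.1) contMDiff_fst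
  have sY := smoothAlong_section (IP := IX) d.2.2 (b := fun q : M × Circle => q.1) contMDiff_fst
  have sg := smoothAlong_metricOf (f := id) sh sη sY contMDiff_id
  have sJ := Admissible.smoothAlong_j fr (f := id) (d := fun _ => d) sh sη sY contMDiff_id
    fun _ => hd
  { g := { inner := fun q => (txSplit q).metricOf (d.1.1 q.1) (d.2.1 q.1) (d.2.2 q.1)
           symm := fun q => (LineSplitting.isInner_metricOf (hd q.1).1 (hd.axis_ne_zero q.1)).symm
           pos := fun q => (LineSplitting.isInner_metricOf (hd q.1).1 (hd.axis_ne_zero q.1)).pos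
           isVonNBounded := fun q => IsInner.isVonNBounded (E := EX)
             (LineSplitting.isInner_metricOf (hd q.1).1 (hd.axis_ne_zero q.1))
           contMDiff := sg }
    J := ⟨fun q => (txSplit q).jOf (d.1.1 q.1) (d.2.1 q.1) (d.2.2 q.1) (rotAt fr l β d q.1), sJ⟩
    om := ⟨fun q => lower ((txSplit q).metricOf (d.1.1 q.1) (d.2.1 q.1) (d.2.2 q.1))
      ((txSplit q).jOf (d.1.1 q.1) (d.2.1 q.1) (d.2.2 q.1) (rotAt fr l β d q.1)),
      smoothAlong_om sg sJ⟩
    J_sq := fun q v => LineSplitting.jOf_jOf (hd q.1).1 (hd.axis_ne_zero q.1) (hd.isRotation fr q.1) v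
    compatible := fun q v w =>
      LineSplitting.metricOf_jOf (hd q.1).1 (hd.axis_ne_zero q.1) (hd.isRotation fr q.1) v w
    om_eq := fun _ _ _ => rfl }

end Coordinates

section Extraction

variable {M : Type*} [TopologicalSpace M] [ChartedSpace R3 M] [IsManifold (𝓡 3) ∞ M]

section Invariance

variable (c : Circle) (q : M × Circle)
  (h : ∀ x : M, TangentSpace (𝓡 3) x →L[ℝ] TangentSpace (𝓡 3) x →L[ℝ] ℝ)
  (η : ∀ x : M, TangentSpace (𝓡 3) x →L[ℝ] ℝ) (Y : ∀ x : M, TangentSpace (𝓡 3) x)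
  (K : ∀ x : M, TangentSpace (𝓡 3) x →L[ℝ] TangentSpace (𝓡 3) x)

lemma tau_mfderiv_rotate (v : TX M q) :
    (txSplit (rotate c q)).tau (η (rotate c q).1) (mfderiv IX IX (rotate c) q v) =
      (txSplit q).tau (η q.1) v :=
  congrArg₂ (· + ·) (dTheta_mfderiv_rotate c q v) (congrArg (η q.1) (txFst_mfderiv_rotate c q v))

lemma metricOf_mfderiv_rotate (v w : TX M q) :
    (txSplit (rotate c q)).metricOf (h (rotate c q).1) (η (rotate c q).1) (Y (rotate c q).1)
        (mfderiv IX IX (rotate c) q v) (mfderiv IX IX (rotate c) q w) =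
      (txSplit q).metricOf (h q.1) (η q.1) (Y q.1) v w :=
  congrArg₂ (· + ·) (congrArg₂ (fun a b => h q.1 a b) (txFst_mfderiv_rotate c q v)
    (txFst_mfderiv_rotate c q w)) (congrArg (h q.1 (Y q.1) (Y q.1) * ·) (congrArg₂ (· * ·)
      (tau_mfderiv_rotate c q η v) (tau_mfderiv_rotate c q η w)))

lemma jOf_mfderiv_rotate (v : TX M q) :
    (txSplit (rotate c q)).jOf (h (rotate c q).1) (η (rotate c q).1) (Y (rotate c q).1)
        (K (rotate c q).1) (mfderiv IX IX (rotate c) q v) =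
      mfderiv IX IX (rotate c) q ((txSplit q).jOf (h q.1) (η q.1) (Y q.1) (K q.1) v) := by
  refine LineSplitting.ext_tau (S := txSplit (rotate c q)) (η := η (rotate c q).1) ?_ ?_
  · rw [LineSplitting.fst_jOf, tau_mfderiv_rotate]
    refine Eq.trans ?_ (txFst_mfderiv_rotate c q _).symm
    refine Eq.trans ?_ (LineSplitting.fst_jOf (S := txSplit q) v).symm
    exact congrArg (fun a => (txSplit q).tau (η q.1) v • Y q.1 + K q.1 a)
      (txFst_mfderiv_rotate c q v)
  · rw [LineSplitting.tau_jOf, tau_mfderiv_rotate, LineSplitting.tau_jOf]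
    exact congrArg (fun a => -((h q.1 (Y q.1) (Y q.1))⁻¹ * h q.1 (Y q.1) a))
      (txFst_mfderiv_rotate c q v)

end Invariance

section Families

variable {EP : Type*} [NormedAddCommGroup EP] [NormedSpace ℝ EP] {HP : Type*} [TopologicalSpace HP]
  {IP : ModelWithCorners ℝ EP HP} {P : Type*} [TopologicalSpace P] [ChartedSpace HP P]
  {f : P → M × Circle} {g : ∀ p, TX M (f p) →L[ℝ] TX M (f p) →L[ℝ] ℝ}
  {J : ∀ p, TX M (f p) →L[ℝ] TX M (f p)}

lemma smoothAlong_axisOf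
    (sJ : SmoothEndX IP f J) :
    SmoothVec IP (fun p => (f p).1)
      fun p => (txSplit (f p)).axisOf (J p) :=
  (SmoothAlong.clm_apply (W' := fun q : M × Circle => TX M q) sJ (smoothAlong_vert sJ.base)).tx_fst

lemma contMDiff_etaOf
    (sg : SmoothBilinX IP f g) (hg : ∀ p, IsInner (g p)) {u : ∀ p, TangentSpace (𝓡 3) (f p).1}
    (su : SmoothVec IP (fun p => (f p).1) u) :
    ContMDiff IP 𝓘(ℝ, ℝ) ∞ fun p => (txSplit (f p)).etaOf (g p) (u p) :=
  have sv := smoothAlong_vert sg.base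
  ((sg.bilin_apply sv sv).inv₀ fun p => ((hg p).pos _ (txSplit (f p)).vert_ne_zero).ne').mul
    (sg.bilin_apply sv (smoothAlong_lift sg.base su))

lemma contMDiff_horOf
    (sg : SmoothBilinX IP f g) (hg : ∀ p, IsInner (g p)) {u v : ∀ p, TangentSpace (𝓡 3) (f p).1}
    (su : SmoothVec IP (fun p => (f p).1) u)
    (sv : SmoothVec IP (fun p => (f p).1) v) :
    ContMDiff IP 𝓘(ℝ, ℝ) ∞ fun p => (txSplit (f p)).horOf (g p) (u p) (v p) :=
  have se := smoothAlong_vert sg.base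
  (sg.bilin_apply (smoothAlong_lift sg.base su) (smoothAlong_lift sg.base sv)).sub
    ((sg.bilin_apply se se).mul ((contMDiff_etaOf sg hg su).mul (contMDiff_etaOf sg hg sv)))

variable {ι : Type} [Fintype ι]

lemma TFrame.smoothAlong_etaOf (fr : TFrame M ι)
    (sg : SmoothBilinX IP f g) (hg : ∀ p, IsInner (g p)) :
    SmoothForm IP
      (fun p => (f p).1) fun p => (txSplit (f p)).etaOf (g p) :=
  have hf : ContMDiff IP (𝓡 3) ∞ fun p => (f p).1 := contMDiff_fst.comp sg.base
  fr.smoothAlong_form hf fun i => contMDiff_etaOf sg hg (smoothAlong_section (fr.sec i) hf)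

lemma TFrame.smoothAlong_horOf (fr : TFrame M ι)
    (sg : SmoothBilinX IP f g) (hg : ∀ p, IsInner (g p)) :
    SmoothBilin IP (fun p => (f p).1) fun p => (txSplit (f p)).horOf (g p) :=
  have hf : ContMDiff IP (𝓡 3) ∞ fun p => (f p).1 := contMDiff_fst.comp sg.base
  fr.smoothAlong_bilin hf fun i j => contMDiff_horOf sg hg (smoothAlong_section (fr.sec i) hf)
    (smoothAlong_section (fr.sec j) hf)

lemma TFrame.smoothAlong_lower_rotOf (fr : TFrame M ι)
    (sg : SmoothBilinX IP f g) (hg : ∀ p, IsInner (g p))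
    (sJ : SmoothEndX IP f J) :
    SmoothBilin IP (fun p => (f p).1) fun p =>
        lower ((txSplit (f p)).horOf (g p)) ((txSplit (f p)).rotOf (g p) (J p)) := by
  have hf : ContMDiff IP (𝓡 3) ∞ fun p => (f p).1 := contMDiff_fst.comp sg.base
  refine fr.smoothAlong_bilin hf fun i j => ?_
  have si := smoothAlong_section (fr.sec i) hf
  exact contMDiff_horOf sg hg (SmoothAlong.clm_apply (W' := fun q : M × Circle => TX M q) sJ
    ((smoothAlong_lift sg.base si).sub ((smoothAlong_vert sg.base).smul
      (contMDiff_etaOf sg hg si)))).tx_fst (smoothAlong_section (fr.sec j) hf)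

end Families

end Extraction

section TripleCoordinates

variable {M : Type*} [TopologicalSpace M] [ChartedSpace R3 M] [IsManifold (𝓡 3) ∞ M]

namespace HermitianTriple

variable (t : HermitianTriple M)

/-- The 2-form of a triple on the horizontal vectors. -/
def rotForm (q : M × Circle) :
    TangentSpace (𝓡 3) q.1 →L[ℝ] TangentSpace (𝓡 3) q.1 →L[ℝ] ℝ :=
  lower ((txSplit q).horOf (t.g.inner q)) ((txSplit q).rotOf (t.g.inner q) (t.J q))

lemma isRotation (q : M × Circle) : IsRotation ((txSplit q).horOf (t.g.inner q))
    ((txSplit q).axisOf (t.J q)) ((txSplit q).rotOf (t.g.inner q) (t.J q)) :=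
  LineSplitting.isRotation_rotOf (t.isInner q) (t.J_sq q) (t.compatible q)

lemma axis_ne_zero (q : M × Circle) : (txSplit q).axisOf (t.J q) ≠ 0 :=
  LineSplitting.axisOf_ne_zero (t.isInner q) (t.J_sq q) (t.compatible q)

section Invariant

variable {t} (c : Circle) (x : M) (z : Circle)

lemma _root_.mfderiv_rotate_lift (w : TangentSpace (𝓡 3) x) :
    mfderiv IX IX (rotate c) (x, z) (txLift (x, z) w) = txLift (x, c * z) w := by
  refine (mfderiv_rotate c (x, z) _).trans ?_
  rw [dTheta_lift, zero_smul, add_zero]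
  rfl

lemma _root_.mfderiv_rotate_vert :
    mfderiv IX IX (rotate c) ((x, z) : M × Circle) (vert (x, z)) = vert (x, c * z) := by
  refine (mfderiv_rotate c (x, z) _).trans ?_
  rw [dTheta_vert, one_smul, txFst_vert]
  exact (congrArg (· + _) (map_zero (txLift (rotate c (x, z))))).trans (zero_add _)

lemma IsInvariant.etaOf_eq (ht : t.IsInvariant) : (txSplit (x, c * z)).etaOf
    (t.g.inner (x, c * z)) =
    (txSplit (x, z)).etaOf (t.g.inner (x, z)) := by
  ext u
  have h1 := (ht c (x, z) (vert (x, z)) (vert (x, z))).1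
  have h2 := (ht c (x, z) (vert (x, z)) (txLift (x, z) u)).1
  rw [mfderiv_rotate_vert] at h1 h2
  rw [mfderiv_rotate_lift] at h2
  exact congrArg₂ (fun a b : ℝ => a⁻¹ * b) h1 h2

lemma IsInvariant.horOf_eq (ht : t.IsInvariant) : (txSplit (x, c * z)).horOf
    (t.g.inner (x, c * z)) =
    (txSplit (x, z)).horOf (t.g.inner (x, z)) := by
  ext u v
  have h1 := (ht c (x, z) (vert (x, z)) (vert (x, z))).1
  have h2 := (ht c (x, z) (txLift (x, z) u) (txLift (x, z) v)).1
  rw [mfderiv_rotate_vert] at h1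
  rw [mfderiv_rotate_lift, mfderiv_rotate_lift] at h2
  rw [LineSplitting.horOf_apply, LineSplitting.horOf_apply, ht.etaOf_eq]
  exact congrArg₂ (fun a b : ℝ => a - b * _) h2 h1

lemma IsInvariant.fst_J (ht : t.IsInvariant) (v : TX M (x, z)) :
    txFst (x, c * z) (t.J (x, c * z) (mfderiv IX IX (rotate c) (x, z) v)) =
      txFst (x, z) (t.J (x, z) v) := by
  have h1 := (ht c (x, z) v v).2.1
  exact (congrArg (txFst (x, c * z)) h1).trans (txFst_mfderiv_rotate c (x, z) _)

lemma IsInvariant.axisOf_eq (ht : t.IsInvariant) : (txSplit (x, c * z)).axisOf (t.J (x, c * z)) =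
    (txSplit (x, z)).axisOf (t.J (x, z)) := by
  have h1 := ht.fst_J c x z (vert (x, z))
  rwa [mfderiv_rotate_vert] at h1

lemma IsInvariant.rotOf_eq (ht : t.IsInvariant) :
    (txSplit (x, c * z)).rotOf (t.g.inner (x, c * z)) (t.J (x, c * z)) =
      (txSplit (x, z)).rotOf (t.g.inner (x, z)) (t.J (x, z)) := by
  ext1 u
  have h1 := ht.fst_J c x z
    (txLift (x, z) u - (txSplit (x, z)).etaOf (t.g.inner (x, z)) u • vert (x, z))
  rw [map_sub, map_smul, mfderiv_rotate_vert, mfderiv_rotate_lift] at h1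
  rw [LineSplitting.rotOf_apply, ht.etaOf_eq]
  exact h1

end Invariant

variable [T2Space M] [CompactSpace M]

lemma smoothAlong_coords {EP : Type*} [NormedAddCommGroup EP] [NormedSpace ℝ EP] {HP : Type*}
    [TopologicalSpace HP] {IP : ModelWithCorners ℝ EP HP} {P : Type*} [TopologicalSpace P]
    [ChartedSpace HP P] {f : P → M × Circle} {t : P → HermitianTriple M}
    (sg : SmoothBilinX IP f fun p => (t p).g.inner (f p)) (sJ : SmoothEndX IP f fun p => (t p).J (f p)) :
    SmoothBilin IP (fun p => (f p).1) (fun p => (txSplit (f p)).horOf ((t p).g.inner (f p))) ∧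
    SmoothForm IP (fun p => (f p).1) (fun p => (txSplit (f p)).etaOf ((t p).g.inner (f p))) ∧
    SmoothVec IP (fun p => (f p).1) (fun p => (txSplit (f p)).axisOf ((t p).J (f p))) ∧
    SmoothBilin IP (fun p => (f p).1) (fun p => (t p).rotForm (f p)) := by
  obtain ⟨ι, _, ⟨fr⟩⟩ := exists_tFrame (M := M)
  have hg : ∀ p, IsInner ((t p).g.inner (f p)) := fun p => (t p).isInner _
  exact ⟨fr.smoothAlong_horOf sg hg, fr.smoothAlong_etaOf sg hg, smoothAlong_axisOf sJ,
    fr.smoothAlong_lower_rotOf sg hg sJ⟩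

lemma contMDiff_slice : ContMDiff (𝓡 3) IX ∞ fun x : M => ((x, 1) : M × Circle) :=
  contMDiff_id.prodMk contMDiff_const

lemma smoothAlong_slice :
    SmoothBilin (𝓡 3) (fun x : M => x) (fun x => (txSplit (x, 1)).horOf (t.g.inner (x, 1))) ∧
    SmoothForm (𝓡 3) (fun x : M => x) (fun x => (txSplit (x, 1)).etaOf (t.g.inner (x, 1))) ∧
    SmoothVec (𝓡 3) (fun x : M => x) (fun x => (txSplit (x, 1)).axisOf (t.J (x, 1))) ∧
    SmoothBilin (𝓡 3) (fun x : M => x) (fun x => t.rotForm (x, 1)) :=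
  smoothAlong_coords (f := fun x : M => (x, 1)) (t := fun _ => t)
    (smoothAlong_section t.metric contMDiff_slice) (smoothAlong_section t.J contMDiff_slice)

/-- The coordinates of a triple. -/
def coords : CoordSpace M :=
  (⟨⟨fun x => (txSplit (x, 1)).horOf (t.g.inner (x, 1)), t.smoothAlong_slice.1⟩,
      fun x => (LineSplitting.isInner_horOf (t.isInner (x, 1))).symm⟩,
    ⟨fun x => (txSplit (x, 1)).etaOf (t.g.inner (x, 1)), t.smoothAlong_slice.2.1⟩,
    ⟨fun x => (txSplit (x, 1)).axisOf (t.J (x, 1)), t.smoothAlong_slice.2.2.1⟩)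

/-- The 2-form of a triple on `M`. -/
def form2 : Form2 M :=
  ⟨⟨fun x => t.rotForm (x, 1), t.smoothAlong_slice.2.2.2⟩, fun x => (t.isRotation (x, 1)).skew⟩

/-- The dual 1-form of the axis. -/
def form1 : Form1 M :=
  ⟨fun x => (txSplit (x, 1)).horOf (t.g.inner (x, 1)) ((txSplit (x, 1)).axisOf (t.J (x, 1))),
    SmoothAlong.clm_apply (W := fun x : M => TangentSpace (𝓡 3) x)
      (W' := fun x : M => TangentSpace (𝓡 3) x →L[ℝ] ℝ) (b := fun x => x) t.smoothAlong_slice.1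
      t.smoothAlong_slice.2.2.1⟩

variable {ι : Type} [Fintype ι] (fr : TFrame M ι) (l : Form1 M) (β : Form2 M)

/-- The orientation of a triple is that of `l ∧ β`. -/
def OrientedBy : Prop := ∀ x, 0 < formPairing (fun i => fr.sec i x)
  (axisForm (l x) (β.1 x) ((txSplit (x, 1)).axisOf (t.J (x, 1)))) (t.rotForm (x, 1))

lemma orientedBy_self : t.OrientedBy fr t.form1 t.form2 := fun x =>
  (t.isRotation (x, 1)).formPairing_pos (finrank_tangentSpace x) (fr.spansWith x)
    (LineSplitting.isInner_horOf (t.isInner (x, 1))) (t.axis_ne_zero (x, 1))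

variable {t fr l β}

lemma OrientedBy.admissible (h : t.OrientedBy fr l β) : Admissible l β t.coords := fun x =>
  ⟨LineSplitting.isInner_horOf (t.isInner (x, 1)), ne_zero_of_formPairing_pos (h x)⟩

lemma OrientedBy.tripleOf_coords (h : t.OrientedBy fr l β) (ht : t.IsInvariant) :
    tripleOf fr h.admissible = t := by
  have hr : ∀ x, rotAt fr l β t.coords x =
      (txSplit (x, 1)).rotOf (t.g.inner (x, 1)) (t.J (x, 1)) := fun x =>
    (t.isRotation (x, 1)).eq_axisRotation (finrank_tangentSpace x) (fr.spansWith x)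
      (LineSplitting.isInner_horOf (t.isInner (x, 1))) (t.axis_ne_zero (x, 1))
      (axisForm_self l β x _) (axisForm_axis l β x _) (h x)
  refine ext_of (fun q => ?_) fun q => ?_ <;> obtain ⟨x, z⟩ := q <;>
    obtain ⟨z, rfl⟩ : ∃ c, z = c * 1 := ⟨z, (mul_one z).symm⟩
  · have h1 := LineSplitting.metricOf_horOf (S := txSplit (x, z * 1)) (t.isInner _) (t.J_sq _)
      (t.compatible _)
    rw [ht.horOf_eq, ht.etaOf_eq, ht.axisOf_eq] at h1
    exact h1
  · have h1 := LineSplitting.jOf_rotOf (S := txSplit (x, z * 1)) (t.isInner _) (t.J_sq _)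
      (t.compatible _)
    rw [ht.horOf_eq, ht.etaOf_eq, ht.axisOf_eq, ht.rotOf_eq, ← hr] at h1
    exact h1

end HermitianTriple

variable [T2Space M] [CompactSpace M] {ι : Type} [Fintype ι] (fr : TFrame M ι) {l : Form1 M}
  {β : Form2 M} {d : CoordSpace M} (hd : Admissible l β d)

lemma coords_tripleOf : (tripleOf fr hd).coords = d :=
  Prod.ext (Subtype.ext (ContMDiffSection.ext fun x =>
      LineSplitting.horOf_metricOf (hd x).1 (hd.axis_ne_zero x)))
    (Prod.ext (ContMDiffSection.ext fun x =>
      LineSplitting.etaOf_metricOf (hd x).1 (hd.axis_ne_zero x))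
      (ContMDiffSection.ext fun _ => LineSplitting.axisOf_jOf))

lemma orientedBy_tripleOf : (tripleOf fr hd).OrientedBy fr l β := fun x => by
  have h1 : (tripleOf fr hd).rotForm (x, 1) = lower (d.1.1 x) (rotAt fr l β d x) :=
    congrArg₂ lower (LineSplitting.horOf_metricOf (hd x).1 (hd.axis_ne_zero x))
      (LineSplitting.rotOf_jOf (hd x).1 (hd.axis_ne_zero x))
  have h2 : (txSplit (x, 1)).axisOf ((tripleOf fr hd).J (x, 1)) = d.2.2 x :=
    LineSplitting.axisOf_jOf
  rw [h1, h2]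
  exact formPairing_axisRotation_pos (finrank_tangentSpace x) (fr.spansWith x) (hd x).1
    (hd.axis_ne_zero x) (axisForm_self l β x _) (axisForm_axis l β x _) (hd x).2

lemma isInvariant_tripleOf : (tripleOf fr hd).IsInvariant := fun c q u v => by
  have h1 := fun u v => metricOf_mfderiv_rotate c q (fun x => d.1.1 x) (fun x => d.2.1 x)
    (fun x => d.2.2 x) u v
  have h2 := fun u => jOf_mfderiv_rotate c q (fun x => d.1.1 x) (fun x => d.2.1 x)
    (fun x => d.2.2 x) (rotAt fr l β d) u
  refine ⟨h1 u v, h2 u, ?_⟩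
  refine ((tripleOf fr hd).om_eq _ _ _).trans ?_
  refine Eq.trans ?_ ((tripleOf fr hd).om_eq _ _ _).symm
  refine Eq.trans ?_ (h1 _ _)
  exact congrArg (fun w => (tripleOf fr hd).g.inner (rotate c q) w _) (h2 u)

end TripleCoordinates

/-! ### Openness -/

section Compactness

variable {E N : Type*} [TopologicalSpace E] [TopologicalSpace N] [CompactSpace N]

lemma isOpen_forall_pos {F : E × N → ℝ} (hF : Continuous F) : IsOpen {u | ∀ x, 0 < F (u, x)} :=
  isOpen_iff_eventually.2 fun u hu =>
    (isCompact_univ.eventually_forall_of_forall_eventually (x₀ := u) (P := fun u x => 0 < F (u, x))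
      fun x _ => (isOpen_lt continuous_const hF).mem_nhds (hu x)).mono fun _ h x => h x trivial

variable {W : N → Type*} [∀ x, TopologicalSpace (W x)] [∀ x, AddCommGroup (W x)]
  [∀ x, Module ℝ (W x)] {ι : Type*} [Fintype ι]

/-- Positivity of a continuous family of bilinear forms over a compact base is an open condition. -/
lemma isOpen_posDef {X : ι → ∀ x, W x} {ξ : ι → ∀ x, W x →L[ℝ] ℝ}
    (hX : ∀ x v, ∑ i, ξ i x v • X i x = v) (hξ : ∀ i j, Continuous fun x => ξ i x (X j x))
    {Φ : E → ∀ x, W x →L[ℝ] W x →L[ℝ] ℝ}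
    (hΦ : ∀ i j, Continuous fun z : E × N => Φ z.1 z.2 (X i z.2) (X j z.2)) :
    IsOpen {u | ∀ x v, v ≠ 0 → 0 < Φ u x v v} := by
  let Q : E × N × Metric.sphere (0 : ι → ℝ) 1 → ℝ := fun z =>
    ∑ i, ∑ j, z.2.2.1 i * (z.2.2.1 j * Φ z.1 z.2.1 (X i z.2.1) (X j z.2.1)) +
      ∑ i, (z.2.2.1 i - ∑ j, z.2.2.1 j * ξ i z.2.1 (X j z.2.1)) ^ 2
  have hc : ∀ i, Continuous fun z : E × N × Metric.sphere (0 : ι → ℝ) 1 => z.2.2.1 i := fun i =>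
    (continuous_apply i).comp (continuous_subtype_val.comp (continuous_snd.comp continuous_snd))
  have hx : Continuous fun z : E × N × Metric.sphere (0 : ι → ℝ) 1 => z.2.1 :=
    continuous_fst.comp continuous_snd
  have hQ : Continuous Q :=
    (continuous_finsetSum _ fun i _ => continuous_finsetSum _ fun j _ =>
      (hc i).mul ((hc j).mul ((hΦ i j).comp (continuous_fst.prodMk hx)))).add
    (continuous_finsetSum _ fun i _ => ((hc i).sub (continuous_finsetSum _ fun j _ =>
      (hc j).mul ((hξ i j).comp hx))).pow 2)
  have hQe : ∀ (u : E) (x : N) (c : Metric.sphere (0 : ι → ℝ) 1), Q (u, x, c) =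
      Φ u x (∑ i, c.1 i • X i x) (∑ i, c.1 i • X i x) +
        ∑ i, (c.1 i - ξ i x (∑ j, c.1 j • X j x)) ^ 2 := fun u x c => by
    simp only [Q, map_sum, map_smul, sum_apply, smul_apply, smul_eq_mul, Finset.mul_sum]
    rw [Finset.sum_comm]
    simp only [mul_left_comm]
  convert isOpen_forall_pos hQ using 1
  ext u
  refine ⟨fun h z => ?_, fun h x v hv => ?_⟩
  · obtain ⟨x, c⟩ := z
    rw [hQe]
    by_cases h0 : ∑ i, c.1 i • X i x = 0
    · rw [h0]
      simp only [map_zero, sub_zero, zero_add]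
      refine lt_of_le_of_ne (Finset.sum_nonneg fun i _ => sq_nonneg _) fun h1 => ?_
      have h2 := (Finset.sum_eq_zero_iff_of_nonneg fun i _ => sq_nonneg _).1 h1.symm
      refine ne_zero_of_mem_unit_sphere c (funext fun i => ?_)
      exact pow_eq_zero_iff two_ne_zero |>.1 (h2 i (Finset.mem_univ i))
    · exact add_pos_of_pos_of_nonneg (h x _ h0) (Finset.sum_nonneg fun i _ => sq_nonneg _)
  · set c : ι → ℝ := fun i => ξ i x v with hcd
    have hcv : ∑ i, c i • X i x = v := hX x v
    have hc0 : c ≠ 0 := fun h0 => hv (by simp [← hcv, h0])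
    have hn : 0 < ‖c‖ := norm_pos_iff.2 hc0
    have h1 := h (x, ⟨‖c‖⁻¹ • c, by simp [norm_smul, hn.ne']⟩)
    have h2 : ∑ i, (‖c‖⁻¹ • c) i • X i x = ‖c‖⁻¹ • v := by
      rw [← hcv, Finset.smul_sum]
      simp only [Pi.smul_apply, smul_smul, smul_eq_mul]
    rw [hQe, h2] at h1
    simp only [map_smul, smul_apply, smul_eq_mul, Pi.smul_apply, hcd, sub_self, ne_eq,
      OfNat.ofNat_ne_zero, not_false_eq_true, zero_pow, Finset.sum_const_zero, add_zero] at h1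
    have h3 := pos_of_mul_pos_right h1 (by positivity)
    exact pos_of_mul_pos_right h3 (by positivity)

end Compactness

section Plots

variable {M : Type*} [TopologicalSpace M] [ChartedSpace R3 M] [IsManifold (𝓡 3) ∞ M]
  [T2Space M] [CompactSpace M] {ι : Type} [Fintype ι] (fr : TFrame M ι) {l : Form1 M} {β : Form2 M}
  {n : ℕ}

lemma smoothAlong_slice_of_isPlot {p : 𝔼 n → HermitianTriple M}
    (hp : IsPlot p) :
    SmoothBilin (𝓘(ℝ, 𝔼 n).prod (𝓡 3)) (fun z => z.2)
      (fun z : 𝔼 n × M => (p z.1).coords.1.1 z.2) ∧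
    SmoothForm (𝓘(ℝ, 𝔼 n).prod (𝓡 3)) (fun z => z.2)
      (fun z : 𝔼 n × M => (p z.1).coords.2.1 z.2) ∧
    SmoothVec (𝓘(ℝ, 𝔼 n).prod (𝓡 3)) (fun z => z.2)
      (fun z : 𝔼 n × M => (p z.1).coords.2.2 z.2) ∧
    SmoothBilin (𝓘(ℝ, 𝔼 n).prod (𝓡 3)) (fun z => z.2)
      (fun z : 𝔼 n × M => (p z.1).rotForm (z.2, 1)) := by
  have hf : ContMDiff (𝓘(ℝ, 𝔼 n).prod (𝓡 3))
      (𝓘(ℝ, 𝔼 n).prod IX) ∞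
      fun z : 𝔼 n × M => (z.1, (z.2, (1 : Circle))) :=
    contMDiff_fst.prodMk (contMDiff_snd.prodMk contMDiff_const)
  have hp' := hp ()
  exact HermitianTriple.smoothAlong_coords (t := fun z : 𝔼 n × M => p z.1)
    ((isPlot_section_iff.1 hp'.1).comp hf) ((isPlot_section_iff.1 hp'.2.1).comp hf)

lemma dSmooth_coords : DSmooth fun t : HermitianTriple M => t.coords :=
  fun _ _ hp => ⟨fun _ => isPlot_section_iff.2 (smoothAlong_slice_of_isPlot hp).1,
    isPlot_section_iff.2 (smoothAlong_slice_of_isPlot hp).2.1,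
    isPlot_section_iff.2 (smoothAlong_slice_of_isPlot hp).2.2.1⟩

lemma isOpen_orientedBy {p : 𝔼 n → HermitianTriple M} (hp : IsPlot p) :
    IsOpen {u | (p u).OrientedBy fr l β} := by
  obtain ⟨-, -, sY, sr⟩ := smoothAlong_slice_of_isPlot hp
  exact isOpen_forall_pos (fr.contMDiff_formPairing (fr.smoothAlong_axisForm
    (smoothAlong_section l contMDiff_snd) (smoothAlong_section β.1 contMDiff_snd) sY) sr).continuous

lemma isOpen_admissible {p : 𝔼 n → CoordSpace M} (hp : IsPlot p) :
    IsOpen {u | Admissible l β (p u)} := by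
  obtain ⟨ι, _, ⟨fr⟩⟩ := exists_tFrame (M := M)
  have sh := isPlot_section_iff.1 (hp.1 ())
  have sY := isPlot_section_iff.1 hp.2.2
  have sX := fun i => smoothAlong_section (fr.sec i)
    (contMDiff_snd (I := 𝓘(ℝ, 𝔼 n)) (J := 𝓡 3)
      (M := 𝔼 n) (N := M) (n := ∞))
  have sb := fr.smoothAlong_axisForm (smoothAlong_section l contMDiff_snd)
    (smoothAlong_section β.1 contMDiff_snd) sY
  convert (isOpen_posDef fr.sum_coeff (fun i j => (fr.contMDiff_coeff_along i
    (smoothAlong_section (fr.sec j) (contMDiff_id (I := 𝓡 3)))).continuous)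
    (Φ := fun u x => (p u).1.1 x) fun i j => (sh.bilin_apply (sX i) (sX j)).continuous).inter
    (isOpen_forall_pos (fr.contMDiff_formPairing sb sb).continuous) using 1
  ext u
  exact ⟨fun h => ⟨fun x => (h x).1.pos, fun x => formPairing_self_pos (fr.spansWith x) (h x).2⟩,
    fun h x => ⟨⟨(p u).1.2 x, h.1 x⟩, ne_zero_of_formPairing_pos (h.2 x)⟩⟩

lemma isPlot_tripleOf {p : 𝔼 n → CoordSpace M} (hp : IsPlot p)
    (hd : ∀ u, Admissible l β (p u)) : IsPlot fun u => tripleOf fr (hd u) := by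
  have hf : ContMDiff (𝓘(ℝ, 𝔼 n).prod IX)
      (𝓘(ℝ, 𝔼 n).prod (𝓡 3)) ∞
      fun z : 𝔼 n × (M × Circle) => (z.1, z.2.1) :=
    contMDiff_fst.prodMk (contMDiff_fst.comp contMDiff_snd)
  have sh := (isPlot_section_iff.1 (hp.1 ())).comp hf
  have sη := (isPlot_section_iff.1 hp.2.1).comp hf
  have sY := (isPlot_section_iff.1 hp.2.2).comp hf
  have sg := smoothAlong_metricOf (f := fun z : 𝔼 n × (M × Circle) => z.2) sh sη sY
    contMDiff_snd
  have sJ := Admissible.smoothAlong_j fr (f := fun z : 𝔼 n × (M × Circle) => z.2)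
    (d := fun z => p z.1) sh sη sY contMDiff_snd fun z => hd z.1
  exact fun _ => ⟨isPlot_section_iff.2 sg, isPlot_section_iff.2 sJ,
    isPlot_section_iff.2 (smoothAlong_om sg sJ)⟩

end Plots

section Pullback

variable {EB : Type*} [NormedAddCommGroup EB] [NormedSpace ℝ EB] {HB : Type*} [TopologicalSpace HB]
  {IB : ModelWithCorners ℝ EB HB} {N : Type*} [TopologicalSpace N] [ChartedSpace HB N]
  {F : Type*} [NormedAddCommGroup F] [NormedSpace ℝ F] [FiniteDimensional ℝ F]
  {W : N → Type*} [TopologicalSpace (TotalSpace F W)] [∀ x, TopologicalSpace (W x)]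
  [FiberBundle F W] [∀ x, AddCommGroup (W x)] [∀ x, Module ℝ (W x)] [VectorBundle ℝ F W]
  [ContMDiffVectorBundle ∞ F W IB] [∀ x, IsTopologicalAddGroup (W x)]
  [∀ x, ContinuousSMul ℝ (W x)] {ι : Type*} [Fintype ι]

lemma continuousOn_sum_smul {U : Set N} {f g : ι → N → ℝ} {A B : ι → ∀ x, W x}
    (hf : ∀ i, ContinuousOn (f i) U) (hg : ∀ i, ContinuousOn (g i) U)
    (hA : ∀ i, SmoothAlong IB IB F (fun x => x) (A i))
    (hB : ∀ i, SmoothAlong IB IB F (fun x => x) (B i)) :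
    ContinuousOn (fun x => TotalSpace.mk' F x (∑ i, (f i x • A i x + g i x • B i x))) U := by
  have h0 : (0 : WithTop ℕ∞) ≤ ∞ := zero_le
  exact contMDiffOn_zero_iff.1 (ContMDiffOn.sum_section fun i _ => ContMDiffOn.add_section
    (ContMDiffOn.smul_section (I := IB) (contMDiffOn_zero_iff.2 (hf i))
      ((hA i).of_le h0).contMDiffOn)
    (ContMDiffOn.smul_section (I := IB) (contMDiffOn_zero_iff.2 (hg i))
      ((hB i).of_le h0).contMDiffOn))

lemma BundleFrame.smoothAlong_rankOne (fr : BundleFrame IB F W ι) {a b : ∀ x, W x →L[ℝ] ℝ}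
    (ha : ∀ i, ContMDiff IB 𝓘(ℝ, ℝ) ∞ fun x => a x (fr.sec i x))
    (hb : ∀ i, ContMDiff IB 𝓘(ℝ, ℝ) ∞ fun x => b x (fr.sec i x)) (c : ℂ) :
    SmoothAlong (W := fun x => W x →L[ℝ] W x →L[ℝ] ℂ) IB IB (F →L[ℝ] F →L[ℝ] ℂ) (fun x => x)
      fun x => (a x).smulRight ((b x).smulRight c) :=
  fr.smoothAlong_hom (W' := fun x => W x →L[ℝ] ℂ) contMDiff_id fun i =>
    fr.smoothAlong_hom (W' := Bundle.Trivial N ℂ) contMDiff_id fun j => smoothAlong_trivial_iff.2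
      ⟨contMDiff_id, (ha i).smul ((hb j).smul contMDiff_const)⟩

lemma continuousOn_bilin_apply {U : Set N} {σ : ∀ x, W x →L[ℝ] W x →L[ℝ] ℂ}
    (hσ : ContinuousOn (fun x => TotalSpace.mk' (F →L[ℝ] F →L[ℝ] ℂ)
      (E := fun x => W x →L[ℝ] W x →L[ℝ] ℂ) x (σ x)) U) (X Y : Cₛ^∞⟮IB; F, W⟯) :
    ContinuousOn (fun x => σ x (X x) (Y x)) U :=
  (continuous_snd.comp (Bundle.Trivial.homeomorphProd N ℂ).continuous).comp_continuousOn
    (ContinuousOn.clm_bundle_apply₂ (F₁ := F) (F₂ := F) (F₃ := ℂ) (E₃ := Bundle.Trivial N ℂ) hσ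
      X.contMDiff.continuous.continuousOn Y.contMDiff.continuous.continuousOn)

lemma bilin_comp_eq_sum {V : Type*} [TopologicalSpace V] [AddCommGroup V] [Module ℝ V]
    [IsTopologicalAddGroup V] [ContinuousSMul ℝ V] {X : ι → V} {ξ : ι → V →L[ℝ] ℝ}
    (h : ∀ v, ∑ i, ξ i v • X i = v) {σ τ : V →L[ℝ] V →L[ℝ] ℂ} {ψ : V →L[ℝ] V}
    (hτ : ∀ v w, τ v w = σ (ψ v) (ψ w)) :
    τ = ∑ j : ι × ι, ((σ (X j.1) (X j.2)).re • (ξ j.1 ∘L ψ).smulRight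
      ((ξ j.2 ∘L ψ).smulRight (1 : ℂ)) + (σ (X j.1) (X j.2)).im • (ξ j.1 ∘L ψ).smulRight
      ((ξ j.2 ∘L ψ).smulRight Complex.I)) := by
  ext v w
  rw [hτ]
  conv_lhs => rw [← h (ψ v), ← h (ψ w)]
  simp only [map_sum, sum_apply, map_smul, smul_apply, add_apply, Finset.smul_sum,
    ContinuousLinearMap.smulRight_apply, ContinuousLinearMap.comp_apply]
  rw [Finset.sum_comm, Fintype.sum_prod_type]
  refine Finset.sum_congr rfl fun k _ => Finset.sum_congr rfl fun l _ => ?_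
  conv_lhs => rw [← Complex.re_add_im (σ (X k) (X l))]
  simp only [Complex.real_smul]
  ring

/-- Pullback of a continuous family of complex bilinear forms by smooth endomorphisms. -/
lemma BundleFrame.continuousOn_pullback (fr : BundleFrame IB F W ι) {U : Set N}
    {σ τ : ∀ x, W x →L[ℝ] W x →L[ℝ] ℂ} {ψ : ∀ x, W x →L[ℝ] W x}
    (hσ : ContinuousOn (fun x => TotalSpace.mk' (F →L[ℝ] F →L[ℝ] ℂ)
      (E := fun x => W x →L[ℝ] W x →L[ℝ] ℂ) x (σ x)) U)
    (hψ : SmoothAlong (W := fun x => W x →L[ℝ] W x) IB IB (F →L[ℝ] F) (fun x => x) ψ)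
    (hτ : ∀ x v w, τ x v w = σ x (ψ x v) (ψ x w)) :
    ContinuousOn (fun x => TotalSpace.mk' (F →L[ℝ] F →L[ℝ] ℂ)
      (E := fun x => W x →L[ℝ] W x →L[ℝ] ℂ) x (τ x)) U := by
  have hid : ContMDiff IB IB ∞ fun x : N => x := contMDiff_id
  have sX := fun i => smoothAlong_section (fr.sec i) hid
  have hf := fun k l => continuousOn_bilin_apply hσ (fr.sec k) (fr.sec l)
  have ha : ∀ k i, ContMDiff IB 𝓘(ℝ, ℝ) ∞ fun x => (fr.coeff k x ∘L ψ x) (fr.sec i x) := fun k i =>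
    fr.contMDiff_coeff_along k (SmoothAlong.clm_apply (W' := W) hψ (sX i))
  rw [funext fun x => bilin_comp_eq_sum (fr.sum_coeff x) (hτ x)]
  have h1 := fun j : ι × ι => fr.smoothAlong_rankOne (ha j.1) (ha j.2) 1
  have h2 := fun j : ι × ι => fr.smoothAlong_rankOne (ha j.1) (ha j.2) Complex.I
  have h3 : ∀ j : ι × ι, ContinuousOn (fun x => (σ x (fr.sec j.1 x) (fr.sec j.2 x)).re) U :=
    fun j => Complex.continuous_re.comp_continuousOn (hf j.1 j.2)
  have h4 : ∀ j : ι × ι, ContinuousOn (fun x => (σ x (fr.sec j.1 x) (fr.sec j.2 x)).im) U :=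
    fun j => Complex.continuous_im.comp_continuousOn (hf j.1 j.2)
  exact continuousOn_sum_smul (IB := IB) (F := F →L[ℝ] F →L[ℝ] ℂ)
    (W := fun x => W x →L[ℝ] W x →L[ℝ] ℂ) h3 h4 h1 h2

end Pullback

/-! ### The canonical class is locally constant -/

section CanonicalClass

variable {M : Type*} [TopologicalSpace M] [ChartedSpace R3 M] [IsManifold (𝓡 3) ∞ M]

/-- Up to a factor 2, the `J₀`-linear part of the identity, for the almost complex structure `J` on
the source. -/
def linkEnd (t₀ t : HermitianTriple M) (q : M × Circle) : TX M q →L[ℝ] TX M q :=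
  ContinuousLinearMap.id ℝ (TX M q) - t₀.J q ∘L t.J q

lemma linkEnd_apply (t₀ t : HermitianTriple M) (q : M × Circle) (v : TX M q) :
    linkEnd t₀ t q v = v - t₀.J q (t.J q v) := rfl

lemma linkEnd_J (t₀ t : HermitianTriple M) (q : M × Circle) (v : TX M q) :
    linkEnd t₀ t q (t.J q v) = t₀.J q (linkEnd t₀ t q v) := by
  rw [linkEnd_apply, linkEnd_apply, t.J_sq, map_neg, map_sub, t₀.J_sq, sub_neg_eq_add,
    sub_neg_eq_add, add_comm]

lemma surjective_linkEnd {t₀ t : HermitianTriple M} {q : M × Circle}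
    (h : ∀ v : TX M q, v ≠ 0 → 0 < t₀.g.inner q (linkEnd t₀ t q v) v) :
    Function.Surjective (linkEnd t₀ t q) := by
  have : FiniteDimensional ℝ (TX M q) := inferInstanceAs (FiniteDimensional ℝ EX)
  refine LinearMap.surjective_of_injective (f := (linkEnd t₀ t q).toLinearMap)
    ((injective_iff_map_eq_zero (linkEnd t₀ t q)).2 fun v hv => ?_)
  by_contra h0
  have h1 := h v h0
  rw [hv, map_zero] at h1
  exact lt_irrefl _ h1

variable [T2Space M] [CompactSpace M]

lemma HermitianTriple.HasCanonicalClass.of_linkEnd {t₀ t : HermitianTriple M}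
    {K : CechH2 (M × Circle)} (hK : t₀.HasCanonicalClass K)
    (h : ∀ q (v : TX M q), v ≠ 0 → 0 < t₀.g.inner q (linkEnd t₀ t q v) v) :
    t.HasCanonicalClass K := by
  obtain ⟨z, ⟨σ, f, hσ, hz, hf, hσf, hc⟩, rfl⟩ := hK
  obtain ⟨κ, _, ⟨fx⟩⟩ := exists_bundleFrame (IB := IX) (F := EX) (W := fun q : M × Circle => TX M q)
  have hid : ContMDiff IX IX ∞ fun q : M × Circle => q := contMDiff_id
  have sX := fun i => smoothAlong_section (fx.sec i) hid
  have sX' := fun i => (sX i).sub (SmoothAlong.clm_apply (W' := fun q : M × Circle => TX M q)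
    (smoothAlong_section t₀.J hid) (SmoothAlong.clm_apply (W' := fun q : M × Circle => TX M q)
      (smoothAlong_section t.J hid) (sX i)))
  have sψ : SmoothEndX IX (fun q => q) (linkEnd t₀ t) :=
    fx.smoothAlong_hom (W' := fun q : M × Circle => TX M q) hid sX'
  let τ : M × Circle → ∀ q : M × Circle, TX M q →L[ℝ] TX M q →L[ℝ] ℂ := fun i q =>
    ContinuousLinearMap.precomp ℂ (linkEnd t₀ t q) ∘L (σ i q ∘L linkEnd t₀ t q)
  refine ⟨z, ⟨τ, f, fun i => fx.continuousOn_pullback (hσ i) sψ fun _ _ _ => rfl,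
    fun i x hx => ⟨fun h0 => (hz i x hx).1 ?_, fun u => (hz i x hx).2.1 (linkEnd t₀ t x u), fun u v => ?_⟩, hf,
    fun i j x hx u v => hσf i j x hx (linkEnd t₀ t x u) (linkEnd t₀ t x v), hc⟩, rfl⟩
  · ext u v
    obtain ⟨u, rfl⟩ := surjective_linkEnd (h x) u
    obtain ⟨v, rfl⟩ := surjective_linkEnd (h x) v
    exact congrArg (fun φ : TX M x →L[ℝ] TX M x →L[ℝ] ℂ => φ u v) h0
  · change σ i x (linkEnd t₀ t x (t.J x u)) _ = _
    rw [linkEnd_J]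
    exact (hz i x hx).2.2 _ _

lemma isOpen_hasCanonicalClass {n : ℕ} {p : 𝔼 n → HermitianTriple M}
    (hp : IsPlot p) (K : CechH2 (M × Circle)) : IsOpen {u | (p u).HasCanonicalClass K} := by
  rw [isOpen_iff_mem_nhds]
  intro u₀ hK
  obtain ⟨κ, _, ⟨fx⟩⟩ := exists_bundleFrame (IB := IX) (F := EX) (W := fun q : M × Circle => TX M q)
  have hs : ContMDiff (𝓘(ℝ, 𝔼 n).prod IX) IX ∞
      fun z : 𝔼 n × (M × Circle) => z.2 := contMDiff_snd
  have sX := fun i => smoothAlong_section (fx.sec i) hs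
  have sJ := isPlot_section_iff.1 (hp ()).2.1
  have sψ := fun i => (sX i).sub (SmoothAlong.clm_apply (W' := fun q : M × Circle => TX M q)
    (smoothAlong_section (p u₀).J hs)
    (SmoothAlong.clm_apply (W' := fun q : M × Circle => TX M q) sJ (sX i)))
  have sg := smoothAlong_section (p u₀).metric hs
  have ho := isOpen_posDef fx.sum_coeff (fun i j => (fx.contMDiff_coeff_along i
    (smoothAlong_section (fx.sec j) (contMDiff_id (I := IX)))).continuous)
    (Φ := fun u q => (p u₀).g.inner q ∘L linkEnd (p u₀) (p u) q)
    fun i j => (sg.bilin_apply (sψ i) (sX j)).continuous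
  refine Filter.mem_of_superset (ho.mem_nhds fun q v hv => ?_) fun u hu => hK.of_linkEnd hu
  change 0 < (p u₀).g.inner q (linkEnd (p u₀) (p u₀) q v) v
  rw [linkEnd_apply, (p u₀).J_sq, sub_neg_eq_add, map_add, add_apply]
  exact add_pos ((p u₀).g.pos q v hv) ((p u₀).g.pos q v hv)

end CanonicalClass

/-! ### The atlas of `Y` -/

section Atlas

variable {M : Type*} [TopologicalSpace M] [ChartedSpace R3 M] [IsManifold (𝓡 3) ∞ M] [T2Space M]
  [CompactSpace M] {L : M → Type*} [TopologicalSpace (TotalSpace ℂ L)]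
  [∀ x, NormedAddCommGroup (L x)] [∀ x, InnerProductSpace ℂ (L x)] [FiberBundle ℂ L]
  [VectorBundle ℝ ℂ L] [ContMDiffVectorBundle ∞ ℂ L (𝓡 3)] {K : CechH2 (M × Circle)}
  {ι : Type} [Fintype ι] (fr : TFrame M ι) (e : HermitianConnection L ≃ Form1 M)
  (Ψ : CoordSpace M ≃ₗ[ℝ] Form2 M × Form1 M)

/-- The coordinates of a connection and a triple. -/
def coordY (y : SpaceY L K) : ModelY M := (e y.1, Ψ y.2.1.coords)

open Classical in
/-- The chart of `Y` around a triple, on the triples with the same orientation of the horizontal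
complement of the axis. -/
def chartY (t₀ : InvariantTriples K) : PartialEquiv (SpaceY L K) (ModelY M) where
  toFun := coordY e Ψ
  invFun m := (e.symm m.1, if h : ∃ hd : Admissible t₀.1.form1 t₀.1.form2 (Ψ.symm m.2),
    (tripleOf fr hd).HasCanonicalClass K then
      ⟨tripleOf fr h.1, isInvariant_tripleOf fr h.1, h.2⟩ else t₀)
  source := {y | y.2.1.OrientedBy fr t₀.1.form1 t₀.1.form2}
  target := {m | ∃ hd : Admissible t₀.1.form1 t₀.1.form2 (Ψ.symm m.2),
    (tripleOf fr hd).HasCanonicalClass K}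
  map_source' y hy := by
    have h : Ψ.symm (coordY e Ψ y).2 = y.2.1.coords := Ψ.symm_apply_apply _
    simp only [Set.mem_ofPred_eq, h]
    exact ⟨hy.admissible, by rw [hy.tripleOf_coords y.2.2.1]; exact y.2.2.2⟩
  map_target' m hm := by
    have hm' : ∃ hd : Admissible t₀.1.form1 t₀.1.form2 (Ψ.symm m.2),
      (tripleOf fr hd).HasCanonicalClass K := hm
    simp only [Set.mem_ofPred_eq]
    rw [dif_pos hm']
    exact orientedBy_tripleOf fr hm'.1
  left_inv' y hy := by
    have h : Ψ.symm (coordY e Ψ y).2 = y.2.1.coords := Ψ.symm_apply_apply _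
    have h1 := hy.tripleOf_coords y.2.2.1
    refine Prod.ext (e.symm_apply_apply _) (Subtype.ext ?_)
    simp only [h]
    rw [dif_pos ⟨hy.admissible, by rw [h1]; exact y.2.2.2⟩]
    exact h1
  right_inv' m hm := by
    have hm' : ∃ hd : Admissible t₀.1.form1 t₀.1.form2 (Ψ.symm m.2),
      (tripleOf fr hd).HasCanonicalClass K := hm
    refine Prod.ext (e.apply_symm_apply _) ?_
    simp only [coordY]
    rw [dif_pos hm', coords_tripleOf]
    exact Ψ.apply_symm_apply _

variable {e Ψ}

lemma chartY_symm_apply {t₀ : InvariantTriples K} {m : ModelY M}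
    (hm : m ∈ (chartY fr e Ψ t₀).target) : (chartY fr e Ψ t₀).symm m =
      (e.symm m.1, ⟨tripleOf fr hm.1, isInvariant_tripleOf fr hm.1, hm.2⟩) :=
  Prod.ext rfl (dif_pos hm)

lemma dSmooth_coordY (he : DSmooth e) (hΨ : DSmooth Ψ) :
    DSmooth (coordY e Ψ : SpaceY L K → ModelY M) := fun n _ hp =>
  ⟨he n _ hp.1, hΨ n _ (dSmooth_coords n _ (isPlot_subtype_iff.1 hp.2))⟩

lemma isOpen_target {n : ℕ} {q : 𝔼 n → CoordSpace M} (hq : IsPlot q)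
    (l : Form1 M) (β : Form2 M) (K : CechH2 (M × Circle)) :
    IsOpen {u | ∃ hd : Admissible l β (q u), (tripleOf fr hd).HasCanonicalClass K} := by
  rw [isOpen_iff_mem_nhds]
  rintro u₀ ⟨hd, hK⟩
  obtain ⟨ψ, hψ, hψT, hψ0⟩ := exists_contDiff_eventuallyEq_id ((isOpen_admissible hq).mem_nhds hd)
  have ho := isOpen_hasCanonicalClass (isPlot_tripleOf fr (isPlot_reparam hq hψ) hψT) K
  have h0 : u₀ ∈ {u | (tripleOf fr (hψT u)).HasCanonicalClass K} := by
    have h1 := hψT u₀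
    have h2 : ∀ v (hv : Admissible l β (q v)), v = u₀ → (tripleOf fr hv).HasCanonicalClass K := by
      rintro v hv rfl
      exact hK
    exact h2 _ _ hψ0.self_of_nhds
  filter_upwards [ho.mem_nhds h0, hψ0] with u hu hu'
  have h2 : ∀ v (hv : Admissible l β (q v)), v = u → (tripleOf fr hv).HasCanonicalClass K →
      ∃ hd : Admissible l β (q u), (tripleOf fr hd).HasCanonicalClass K := by
    rintro v hv rfl h
    exact ⟨hv, h⟩
  exact h2 _ _ hu' hu

lemma isChart_chartY (he : DSmooth e) (he' : DSmooth e.symm) (hΨ : DSmooth Ψ)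
    (hΨ' : DSmooth Ψ.symm) (t₀ : InvariantTriples K) : IsChart (chartY fr e Ψ t₀) where
  open_source := isOpen_iff_preimages_plots.2 fun n p hp =>
    isOpen_orientedBy fr (isPlot_subtype_iff.1 hp.2)
  open_target := isOpen_iff_preimages_plots.2 fun n p hp =>
    isOpen_target fr (hΨ' n _ hp.2) _ _ K
  smooth := fun n p hp _ => dSmooth_coordY he hΨ n p hp
  smooth_symm := fun n p hp h => by
    have h1 : (fun u => (chartY fr e Ψ t₀).symm (p u)) = fun u => (e.symm (p u).1,
        ⟨tripleOf fr (h u).1, isInvariant_tripleOf fr (h u).1, (h u).2⟩) :=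
      funext fun u => chartY_symm_apply fr (h u)
    rw [h1]
    exact ⟨he' n _ hp.1, isPlot_subtype_iff.2 (isPlot_tripleOf fr (hΨ' n _ hp.2) fun u => (h u).1)⟩

lemma isGlobalAtlas_range_chartY (he : DSmooth e) (he' : DSmooth e.symm) (hΨ : DSmooth Ψ)
    (hΨ' : DSmooth Ψ.symm) :
    IsGlobalAtlas (pairingL M) (Set.range (chartY fr e Ψ (K := K))) (coordY e Ψ) where
  smoothPairing := smoothPairing_pairingL
  isChart := Set.forall_mem_range.2 (isChart_chartY fr he he' hΨ hΨ')
  cover y := ⟨_, ⟨y.2, rfl⟩, y.2.1.orientedBy_self fr⟩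
  smooth := dSmooth_coordY he hΨ
  eq := Set.forall_mem_range.2 fun _ _ _ => rfl

lemma IsGlobalAtlas.isConstantAtlas {𝔸 : Set (PartialEquiv (SpaceY L K) (ModelY M))}
    (h : IsGlobalAtlas (pairingL M) 𝔸 (coordY e Ψ))
    (htr : ∀ a a', IsTranslate a (e a' - e a) a') : IsConstantAtlas 𝔸 where
  isChart := h.isChart
  isSplit φ hφ y hy y' hy' := by
    rw [h.eq φ hφ y hy, h.eq φ hφ y' hy']
    exact ⟨htr y.1 y'.1, fun hyy => congrArg (fun t : InvariantTriples K => Ψ t.1.coords) hyy⟩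
  cover := h.cover
  locally_translation φ hφ φ' hφ' y hy :=
    ⟨φ.source ∩ φ'.source, @IsOpen.inter _ dTopology _ _ (h.isChart φ hφ).open_source
      (h.isChart φ' hφ').open_source, hy, subset_rfl, fun z hz => by
      rw [h.eq φ hφ y hy.1, h.eq φ' hφ' y hy.2, h.eq φ hφ z hz.1, h.eq φ' hφ' z hz.2, sub_self,
        sub_self]⟩

end Atlas

end

theorem mainTheorem1 {M : Type*} [TopologicalSpace M] [ChartedSpace R3 M]
    [IsManifold (𝓡 3) ∞ M] [T2Space M] [CompactSpace M] [OrientedAtlas M]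
    (L : M → Type*) [TopologicalSpace (TotalSpace ℂ L)] [∀ x, NormedAddCommGroup (L x)]
    [∀ x, InnerProductSpace ℂ (L x)] [FiberBundle ℂ L] [VectorBundle ℂ ℂ L] [VectorBundle ℝ ℂ L]
    [ContMDiffVectorBundle ∞ ℂ L (𝓡 3)] [IsSmoothHermitian L]
    (K : CechH2 (M × Circle)) :
    ∃ 𝔸 : Set (PartialEquiv (SpaceY L K) (ModelY M)), IsConstantAtlas 𝔸 ∧
      ∃ 𝒞 : Subalgebra ℝ (SpaceY L K → ℝ), (∀ F, F ∈ 𝒞 ↔ IsRegularFunction 𝔸 F) ∧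
        -- the differentials of these functions at each point fill `V* ⊕ V ⊕ V*`
        (∀ φ ∈ 𝔸, ∀ y ∈ φ.source, ∀ (α : Form2 M) (β : Form1 M) (γ : Form2 M), ∃ F ∈ 𝒞,
          ∀ (u : Form1 M) (v : Form2 M) (w : Form1 M),
            HasDirDeriv φ F y (u, v, w) (pairing u α + pairing β v + pairing w γ)) ∧
        ∃ P : PoissonBracket 𝒞,
          -- `{F, G} = dF₁(dG₂) - dG₁(dF₂)`
          (∀ φ ∈ 𝔸, ∀ y ∈ φ.source, ∀ (F G : 𝒞) (F₁ G₁ : Form2 M) (F₂ G₂ : Form1 M),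
            HasComponents φ F.1 y F₁ F₂ → HasComponents φ G.1 y G₁ G₂ →
              (P.bracket F G).1 y = pairing G₂ F₁ - pairing F₂ G₁) ∧
          -- the center consists of the functions of the third component
          ∀ F : 𝒞, (∀ G : 𝒞, P.bracket F G = 0) ↔ DependsOnThird 𝔸 F.1 := by
  obtain ⟨ι, _, ⟨fr⟩⟩ := exists_tFrame (M := M)
  obtain ⟨Ψ, hΨ, hΨ'⟩ := linearlyDiffeomorphic_coordinates (M := M)
  obtain h | ⟨⟨a₀⟩⟩ := isEmpty_or_nonempty (HermitianConnection L)
  · have h0 : IsGlobalAtlas (pairingL M) (∅ : Set (PartialEquiv (SpaceY L K) (ModelY M)))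
        fun y => h.elim y.1 :=
      ⟨smoothPairing_pairingL, fun _ h => h.elim, fun y => h.elim y.1,
        fun n p _ => h.elim (p 0).1, fun _ h => h.elim⟩
    exact ⟨∅, ⟨fun _ h => h.elim, fun _ h => h.elim, fun y => h.elim y.1, fun _ h => h.elim⟩,
      exists_poisson h0⟩
  · obtain ⟨e, he, he', htr⟩ := exists_connection_coordinate a₀
    have h := isGlobalAtlas_range_chartY (K := K) fr he he' hΨ hΨ'
    exact ⟨_, h.isConstantAtlas htr, exists_poisson h⟩
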